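/- **Lemma 6.9 (revised).** *Target.* Let $Z$ be a smooth manifold and $\lambda:Z\to\mathbb C$ a smooth map with fibres $Z_\lambda$, whose central fibre is compact and is a union $Z_0=X\cup Y$ of two closed sets, with $V=X\cap Y$; $\lambda$ is a submersion off $V$. Around the points $q\in V$ there are local coordinates $(v,x,y)\in\mathbb R^{2n-2}\times\mathbb C\times\mathbb C$ centred at $q$, ranging over a ball of fixed radius and forming a smooth family with compact parameter space $\Theta$ (every $q \in V$ occurs as a centre), in which $\lambda=xy$, $X=\{y=0\}$, $Y=\{x=0\}$. Off $V$, points of $X$ and of $Y$ are identified with points of $Z_\lambda$ for small $\lambda$, smoothly and with the identity at $\lambda=0$; in the coordinates near $V$ these identifications are $(v,x)\mapsto(v,x,\lambda/x)$ and $(v,y)\mapsto(v,\lambda/y,y)$. (The fibration of a symplectic sum $X\#_VY$ is of this form, with $(v,x,y)$ coordinates of $L\oplus L^*$, $L=N_XV$.) Let $J$ be a smooth almost complex structure on $Z$ and $g$ a $J$-invariant Riemannian metric. Let $P$ be an almost complex manifold and $\nu$ a smooth section over $Z\times P$ of the complex antilinear maps $TP\to TZ$. Assume that $J$ preserves $\ker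 d\lambda$ and $TV$, and that $\nu$ takes values in $\ker d\lambda$, and in $TV$ along $V$. Let $\xi=\xi^V+\xi^N$ be a smooth splitting of $TZ$ near $V$ which along $V$ is a splitting $TZ=TV\oplus N$, and extend $\xi\mapsto\xi^N$ to a smooth endomorphism of $TZ$. *Domains.* Let $C_1\sqcup C_2$ be a compact surface with complex structures $j_b$ depending smoothly on $b$ in a manifold $N$, with points $p_k\in C_1$, $q_k\in C_2$ ($k=1,\dots,\ell$) that have disjoint $j_b$-holomorphic coordinate discs $|z_k|<2$, $|w_k|<2$, independent of $b$. Let $C_{b,0}$ be the nodal curve obtained by identifying $p_k$ with $q_k$, and for $\mu=(\mu_1,\dots,\mu_\ell)$ with all $\mu_k\ne0$ small let $C_{b,\mu}$ be the curve obtained by the plumbing $z_kw_k=\mu_k$. Let $\phi_{b,\mu}:C_{b,\mu}\to P$ be holomorphic maps, smooth in $b,\mu$ and the point (near the nodes: smooth in $(b,\mu,z_k,w_k)$). Put $\rho=(|z_k|^2+|w_k|^2)^{1/2}$ where this is at most $1$, and $\rho=1$ elsewhere; let $B_k(1)$ be the region $(|z_k|^2+|w_k|^2)^{1/2}\le1$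 near the $k$-th node. The curves carry Hermitian metrics, smooth in $b$ and independent of $\mu$ off the discs $|z_k|\le 1$, $|w_k|\le 1$, and equal to $\rho^{-2}(|dz_k|^2+|dw_k|^2)=|dz_k|^2/|z_k|^2=|dw_k|^2/|w_k|^2$ in the plumbing regions $|z_k|,|w_k|\le1$. *Maps.* Let $s=(s_1,\dots,s_\ell)$ with integers $s_k\ge1$ and $|s|=s_1s_2\cdots s_\ell$. Let $\mathcal M_s^V(X)\times_{\mathrm{ev}}\mathcal M_s^V(Y)$ be the space of pairs $(b,f)$ where $f:C_1\sqcup C_2\to Z_0$ is smooth with $f(C_1)\subset X$, $f(C_2)\subset Y$, $f^{-1}(V)=\{p_k,q_k\}$, $f(p_k)=f(q_k)$, with contact of order $s_k$ with $V$ at $p_k$ and $q_k$ (that is, $f^x=a_kz_k^{s_k}+O(|z_k|^{s_k+1})$ and $f^y=b_kw_k^{s_k}+O(|w_k|^{s_k+1})$ with $a_k,b_k\ne0$ in the above coordinates centred at $f(p_k)$), and $\bar\partial_Jf=\nu_f$. Here, for a map $F$ on $C_{b,\mu}$, $\bar\partial_{J_F}F=\frac12(dF+J_F\,dF\,j)$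 and $\nu_F=\nu(F,\phi_{b,\mu})\circ d\phi_{b,\mu}$. *Approximate maps.* Fix a smooth cutoff function $\beta:\mathbb R\to[0,1]$ with $\beta=1$ on $(-\infty,1]$ and $\beta=0$ on $[2,\infty)$. For such $(b,f)$, $\lambda\ne0$ small, coordinates centred at the points $f(p_k)$, taken from the above family, and $\mu$ with $a_kb_k\mu_k^{s_k}=\lambda$ for all $k$, the approximate map $F:C_{b,\mu}\to Z_\lambda$ is defined as follows. Where $(|z_k|^2+|w_k|^2)^{1/2}\le2|\mu_k|^{1/4}$ and $|w_k|\le|z_k|$, write $f=(h^v,\,a_kz_k^{s_k}(1+h^x),\,0)$ and put $$F=\big((1-\beta_k)h^v,\ a_kz_k^{s_k}(1+(1-\beta_k)h^x),\ b_kw_k^{s_k}(1+(1-\beta_k)h^x)^{-1}\big),\qquad \beta_k=\beta\big((|z_k|^2+|w_k|^2)^{1/2}/|\mu_k|^{1/4}\big);$$ where $|z_k|\le|w_k|$, exchange the roles of $(z,x,a)$ and $(w,y,b)$; elsewhere $F=f$ under the identification of $X\setminus V$ and $Y\setminus V$ with $Z_\lambda$. *Norms.* For $0<\delta<\frac16$,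 $1\le p<\infty$ and a 1-form $\eta$ on $C_{b,\mu}$ with values in $F^*TZ$, let $$\|\eta\|_{0,p,s}^p=\int_{C_{b,\mu}}\big(|\eta|^p+|\eta|^p\big)\rho^{-\delta p/2}+\sum_k\int_{C_{b,\mu}\cap B_k(1)}\big(|\rho^{1-s_k}\eta^N|^p+|\rho^{1-s_k}\eta^N|^p\big)\rho^{-\delta p/2}.$$ *Claim.* Let $\mathcal K$ be a compact subset of $\mathcal M_s^V(X)\times_{\mathrm{ev}}\mathcal M_s^V(Y)$ in the topology of smooth convergence. Then for every $\delta\in(0,\frac16)$ and $p\in[1,\infty)$ there are constants $c,\lambda_0>0$ such that $$\|\bar\partial_{J_F}F-\nu_F\|_{0,p,s}\ \le\ c\,|\lambda|^{\frac1{5|s|}}$$ for every approximate map $F$ constructed from some $(b,f)\in\mathcal K$ and some $\lambda$ with $0<|\lambda|\le\lambda_0$. -/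

import Mathlib

open Set Filter Topology MeasureTheory Asymptotics
open scoped Manifold ContDiff ENNReal

namespace SymplecticSum

noncomputable section

/-- `u` is a tangent vector at `z` of the submanifold `A` of `Z`: the velocity of a smooth curve
of `Z` that runs inside `A`. -/
def TangentTo {EZ : Type*} [NormedAddCommGroup EZ] [NormedSpace ℝ EZ]
    {Z : Type*} [TopologicalSpace Z] [ChartedSpace EZ Z]
    (A : Set Z) (z : Z) (u : TangentSpace 𝓘(ℝ, EZ) z) : Prop :=
  ∃ γ : ℝ → Z, ContMDiff 𝓘(ℝ, ℝ) 𝓘(ℝ, EZ) ∞ γ ∧ γ 0 = z ∧ (∀ t, γ t ∈ A) ∧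
    (mfderiv 𝓘(ℝ, ℝ) 𝓘(ℝ, EZ) γ 0 (1 : ℝ) : EZ) = u

/-- A tangent vector of the complex plane, as a complex number. -/
def toComplex {w : ℂ} (u : TangentSpace 𝓘(ℝ, ℂ) w) : ℂ := u

/-- The vector of `ℂ × ℂ` with `i`-th coordinate `x` and other coordinate `y`. -/
def pair (i : Fin 2) (x y : ℂ) : Fin 2 → ℂ := fun j => if j = i then x else y

section Target

variable (EZ : Type*) [NormedAddCommGroup EZ] [NormedSpace ℝ EZ]
  (Z : Type*) [TopologicalSpace Z] [ChartedSpace EZ Z]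
  (W : Type*) [NormedAddCommGroup W] [NormedSpace ℝ W]
  (EΘ : Type*) [NormedAddCommGroup EΘ] [NormedSpace ℝ EΘ]
  (Θ : Type*) [TopologicalSpace Θ] [ChartedSpace EΘ Θ]

/-- The fibration `lam : Z → ℂ` of a symplectic sum, with fibres `Z_λ = lam ⁻¹' {λ}` and
`Z_0 = X ∪_V Y`, where `X = comp 0`, `Y = comp 1`, `V = X ∩ Y`.

Near `V`, the space `Z` is a neighbourhood of the zero section of `L ⊕ L*` for a line bundle
`L → V`, and `lam (v, x, y) = x y`.  The coordinates `(v, x, y)` centred at the points of `V` are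
given as a smooth family `chart θ` indexed by a manifold `Θ` (for instance the bundle of pairs of a
frame of `T_q V` and a unit vector of `L_q`; the chart is then given by the exponential map of `V`
and by parallel transport).  The pair `(x, y)` is a function on `Fin 2`, so that
the two sides can be treated alike.

Away from `V`, the fibre `Z_λ` is identified with `X` and with `Y`: `lift i lambda` takes a point of
`comp i` off `V` to the corresponding point of `Z_λ`.  Near `V`, where `Z_λ` is a graph, this is
`(v, x) ↦ (v, x, λ / x)`, respectively `(v, y) ↦ (v, λ / y, y)`. -/
structure SumFibration where
  lam : Z → ℂ
  lam_smooth : ContMDiff 𝓘(ℝ, EZ) 𝓘(ℝ, ℂ) ∞ lam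
  comp : Fin 2 → Set Z
  comp_closed : ∀ i, IsClosed (comp i)
  central : lam ⁻¹' {0} = comp 0 ∪ comp 1
  central_compact : IsCompact (lam ⁻¹' {0})
  submersion : ∀ z, z ∉ comp 0 ∩ comp 1 →
    Function.Surjective (mfderiv 𝓘(ℝ, EZ) 𝓘(ℝ, ℂ) lam z)
  ε : ℝ
  ε_pos : 0 < ε
  chart : Θ → OpenPartialHomeomorph (W × (Fin 2 → ℂ)) Z
  chart_source : ∀ θ, (chart θ).source = Metric.ball 0 ε
  chart_smooth : ContMDiffOn (𝓘(ℝ, EΘ).prod 𝓘(ℝ, W × (Fin 2 → ℂ))) 𝓘(ℝ, EZ) ∞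
    (fun q : Θ × (W × (Fin 2 → ℂ)) => chart q.1 q.2) (univ ×ˢ Metric.ball 0 ε)
  chart_symm_smooth : ContMDiffOn (𝓘(ℝ, EΘ).prod 𝓘(ℝ, EZ)) 𝓘(ℝ, W × (Fin 2 → ℂ)) ∞
    (fun q : Θ × Z => (chart q.1).symm q.2) {q | q.2 ∈ (chart q.1).target}
  chart_centre : ∀ z, z ∈ comp 0 ∩ comp 1 ↔ ∃ θ, chart θ 0 = z
  chart_lam : ∀ θ, ∀ y ∈ Metric.ball 0 ε, lam (chart θ y) = y.2 0 * y.2 1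
  chart_comp : ∀ θ, ∀ y ∈ Metric.ball 0 ε, ∀ i,
    chart θ y ∈ comp i ↔ ∀ j, j ≠ i → y.2 j = 0
  lift : Fin 2 → ℂ → Z → Z
  dom : Fin 2 → Set (ℂ × Z)
  dom_open : ∀ i, IsOpen (dom i)
  dom_zero : ∀ i, ∀ z ∈ comp i \ (comp 0 ∩ comp 1), ((0 : ℂ), z) ∈ dom i
  lift_smooth : ∀ i, ContMDiffOn (𝓘(ℝ, ℂ).prod 𝓘(ℝ, EZ)) 𝓘(ℝ, EZ) ∞
    (fun q : ℂ × Z => lift i q.1 q.2) (dom i)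
  lift_zero : ∀ i, ∀ z ∈ comp i \ (comp 0 ∩ comp 1), lift i 0 z = z
  lam_lift : ∀ i lambda, ∀ z ∈ comp i, (lambda, z) ∈ dom i → lam (lift i lambda z) = lambda
  chart_lift : ∀ i θ v x lambda, x ≠ 0 → (v, pair i x 0) ∈ Metric.ball (0 : W × (Fin 2 → ℂ)) ε →
    (v, pair i x (lambda / x)) ∈ Metric.ball (0 : W × (Fin 2 → ℂ)) ε →
    (lambda, chart θ (v, pair i x 0)) ∈ dom i ∧
      lift i lambda (chart θ (v, pair i x 0)) = chart θ (v, pair i x (lambda / x))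

variable {EZ Z W EΘ Θ}

/-- The divisor `V = X ∩ Y`. -/
def SumFibration.V (T : SumFibration EZ Z W EΘ Θ) : Set Z := T.comp 0 ∩ T.comp 1

/-- A pair `(J, ν)` on the fibration, with a `J`-invariant Riemannian metric `g`:
`J` and `ν` are tangent to the fibres of `lam` and to `V`.  The perturbation `ν` is a
smooth section of the bundle of complex antilinear maps from `TP` to `TZ` over `Z × P`, where `P`
is an almost complex manifold to which all the domains are mapped (the universal curve, or a
projective space that contains it). -/
structure CompatiblePair (T : SumFibration EZ Z W EΘ Θ)
    (EP : Type*) [NormedAddCommGroup EP] [NormedSpace ℝ EP]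
    (P : Type*) [TopologicalSpace P] [ChartedSpace EP P]
    [IsManifold 𝓘(ℝ, EZ) 1 Z] [IsManifold 𝓘(ℝ, EP) 1 P] where
  J : ∀ z : Z, TangentSpace 𝓘(ℝ, EZ) z →L[ℝ] TangentSpace 𝓘(ℝ, EZ) z
  J_sq : ∀ z u, J z (J z u) = -u
  J_smooth : ContMDiff 𝓘(ℝ, EZ).tangent 𝓘(ℝ, EZ).tangent ∞
    (fun q : TangentBundle 𝓘(ℝ, EZ) Z => (⟨q.1, J q.1 q.2⟩ : TangentBundle 𝓘(ℝ, EZ) Z))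
  J_fibre : ∀ z u, mfderiv 𝓘(ℝ, EZ) 𝓘(ℝ, ℂ) T.lam z u = 0 →
    mfderiv 𝓘(ℝ, EZ) 𝓘(ℝ, ℂ) T.lam z (J z u) = 0
  J_divisor : ∀ z ∈ T.V, ∀ u, TangentTo T.V z u → TangentTo T.V z (J z u)
  g : ∀ z : Z, TangentSpace 𝓘(ℝ, EZ) z →L[ℝ] TangentSpace 𝓘(ℝ, EZ) z →L[ℝ] ℝ
  g_symm : ∀ z u u', g z u u' = g z u' u
  g_pos : ∀ z u, u ≠ 0 → 0 < g z u u
  g_smooth : ContMDiff 𝓘(ℝ, EZ).tangent 𝓘(ℝ, ℝ) ∞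
    (fun q : TangentBundle 𝓘(ℝ, EZ) Z => g q.1 q.2 q.2)
  g_hermitian : ∀ z u u', g z (J z u) (J z u') = g z u u'
  jP : ∀ q : P, TangentSpace 𝓘(ℝ, EP) q →L[ℝ] TangentSpace 𝓘(ℝ, EP) q
  jP_sq : ∀ q u, jP q (jP q u) = -u
  jP_smooth : ContMDiff 𝓘(ℝ, EP).tangent 𝓘(ℝ, EP).tangent ∞
    (fun q : TangentBundle 𝓘(ℝ, EP) P => (⟨q.1, jP q.1 q.2⟩ : TangentBundle 𝓘(ℝ, EP) P))
  ν : ∀ (z : Z) (q : P), TangentSpace 𝓘(ℝ, EP) q →L[ℝ] TangentSpace 𝓘(ℝ, EZ) z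
  ν_smooth : ContMDiff (𝓘(ℝ, EZ).prod 𝓘(ℝ, EP).tangent) 𝓘(ℝ, EZ).tangent ∞
    (fun r : Z × TangentBundle 𝓘(ℝ, EP) P =>
      (⟨r.1, ν r.1 r.2.1 r.2.2⟩ : TangentBundle 𝓘(ℝ, EZ) Z))
  ν_anti : ∀ z q u, ν z q (jP q u) = -(J z (ν z q u))
  ν_fibre : ∀ z q u, mfderiv 𝓘(ℝ, EZ) 𝓘(ℝ, ℂ) T.lam z (ν z q u) = 0
  ν_divisor : ∀ z ∈ T.V, ∀ q u, TangentTo T.V z (ν z q u)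

/-- A splitting of `TZ` near `V` that extends a splitting `TZ = TV ⊕ N` along `V`, given by its
projection `ξ ↦ ξ^N` onto the normal subbundle `N`.  Far from `V`, the field `proj` is an arbitrary
smooth extension. -/
structure NormalSplitting (T : SumFibration EZ Z W EΘ Θ) [IsManifold 𝓘(ℝ, EZ) 1 Z] where
  proj : ∀ z : Z, TangentSpace 𝓘(ℝ, EZ) z →L[ℝ] TangentSpace 𝓘(ℝ, EZ) z
  proj_smooth : ContMDiff 𝓘(ℝ, EZ).tangent 𝓘(ℝ, EZ).tangent ∞
    (fun q : TangentBundle 𝓘(ℝ, EZ) Z => (⟨q.1, proj q.1 q.2⟩ : TangentBundle 𝓘(ℝ, EZ) Z))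
  proj_idem : ∃ O : Set Z, IsOpen O ∧ T.V ⊆ O ∧ ∀ z ∈ O, ∀ u, proj z (proj z u) = proj z u
  proj_ker : ∀ z ∈ T.V, ∀ u, proj z u = 0 ↔ TangentTo T.V z u

end Target

section Domain

variable (S : Type*) [TopologicalSpace S] [ChartedSpace ℂ S] [IsManifold 𝓘(ℝ, ℂ) 1 S]

/-- A smooth family of curves `C_{b, μ}` obtained by plumbing.

`S = C_1 ⊔ C_2` is a compact surface (`C_1` is `side = 0`, and `C_2` is `side = 1`) with complex
structures `j b`, `b ∈ N`.  Around the points `p_k ∈ C_1` and `q_k ∈ C_2`, `k < ℓ`, there are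
disjoint holomorphic coordinate discs of radius `2` with coordinates `z_k = coord 0 k` and
`w_k = coord 1 k`.
The nodal curve `C_{b, 0}` is obtained by identifying `p_k` with `q_k`, and `C_{b, μ}` from the discs
with `|z_k|, |w_k| > |μ_k| / 2` by the identification `z_k w_k = μ_k`.

`φ b μ` is the holomorphic map of `C_{b, μ}` to `P`.  It is smooth in `(b, μ)` and in the point;
at the nodes this means that it is a smooth function `φnode` of `(b, μ, z_k, w_k)`.

`h b` is a Hermitian metric on the punctured surface; it is the cylindrical metric
`|dz|² / |z|²` on the punctured unit coordinate discs.  On `C_{b, μ}` this is the metric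
`ρ⁻² (|dz|² + |dw|²)`, where `ρ² = |z|² + |w|²`. -/
structure CurveFamily (EN : Type*) [NormedAddCommGroup EN] [NormedSpace ℝ EN]
    (N : Type*) [TopologicalSpace N] [ChartedSpace EN N]
    {EP : Type*} [NormedAddCommGroup EP] [NormedSpace ℝ EP]
    {P : Type*} [TopologicalSpace P] [ChartedSpace EP P]
    (jP : ∀ q : P, TangentSpace 𝓘(ℝ, EP) q →L[ℝ] TangentSpace 𝓘(ℝ, EP) q)
    (ℓ : ℕ) where
  side : S → Fin 2
  side_locConst : IsLocallyConstant side
  j : N → ∀ p : S, TangentSpace 𝓘(ℝ, ℂ) p →L[ℝ] TangentSpace 𝓘(ℝ, ℂ) p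
  j_sq : ∀ b p u, j b p (j b p u) = -u
  j_smooth : ContMDiff (𝓘(ℝ, EN).prod 𝓘(ℝ, ℂ).tangent) 𝓘(ℝ, ℂ).tangent ∞
    (fun r : N × TangentBundle 𝓘(ℝ, ℂ) S =>
      (⟨r.2.1, j r.1 r.2.1 r.2.2⟩ : TangentBundle 𝓘(ℝ, ℂ) S))
  coord : Fin 2 → Fin ℓ → OpenPartialHomeomorph S ℂ
  coord_smooth : ∀ i k, coord i k ∈ IsManifold.maximalAtlas 𝓘(ℝ, ℂ) ∞ S
  coord_target : ∀ i k, (coord i k).target = Metric.ball 0 2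
  coord_side : ∀ i k, ∀ p ∈ (coord i k).source, side p = i
  coord_disjoint : ∀ i k k', k ≠ k' → Disjoint (coord i k).source (coord i k').source
  coord_holo : ∀ i k b, ∀ p ∈ (coord i k).source, ∀ u,
    toComplex (mfderiv 𝓘(ℝ, ℂ) 𝓘(ℝ, ℂ) (coord i k) p (j b p u)) =
      Complex.I * toComplex (mfderiv 𝓘(ℝ, ℂ) 𝓘(ℝ, ℂ) (coord i k) p u)
  φ : N → (Fin ℓ → ℂ) → S → P
  φ_smooth : ContMDiffOn (𝓘(ℝ, EN).prod (𝓘(ℝ, Fin ℓ → ℂ).prod 𝓘(ℝ, ℂ))) 𝓘(ℝ, EP) ∞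
    (fun r : N × ((Fin ℓ → ℂ) × S) => φ r.1 r.2.1 r.2.2)
    {r | (∀ k, ‖r.2.1 k‖ < 1) ∧
      ∀ i k, r.2.2 ∉ (coord i k).symm '' Metric.closedBall 0 1}
  φnode : Fin ℓ → N → (Fin ℓ → ℂ) → ℂ → ℂ → P
  φnode_smooth : ∀ k, ContMDiffOn (𝓘(ℝ, EN).prod 𝓘(ℝ, (Fin ℓ → ℂ) × ℂ × ℂ)) 𝓘(ℝ, EP) ∞
    (fun r : N × ((Fin ℓ → ℂ) × ℂ × ℂ) => φnode k r.1 r.2.1 r.2.2.1 r.2.2.2)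
    {r | (∀ k, ‖r.2.1 k‖ < 1) ∧ ‖r.2.2.1‖ < 2 ∧ ‖r.2.2.2‖ < 2}
  φ_eq_left : ∀ k b μ, (∀ k, ‖μ k‖ < 1) → ∀ p ∈ (coord 0 k).source,
    (μ k = 0 ∨ ‖μ k‖ < 2 * ‖coord 0 k p‖) →
    φ b μ p = φnode k b μ (coord 0 k p) (μ k / coord 0 k p)
  φ_eq_right : ∀ k b μ, (∀ k, ‖μ k‖ < 1) → ∀ p ∈ (coord 1 k).source,
    (μ k = 0 ∨ ‖μ k‖ < 2 * ‖coord 1 k p‖) →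
    φ b μ p = φnode k b μ (μ k / coord 1 k p) (coord 1 k p)
  φ_holo : ∀ b μ, (∀ k, ‖μ k‖ < 1) → ∀ p,
    (∀ i k, p ∈ (coord i k).source → μ k = 0 ∨ ‖μ k‖ < 2 * ‖coord i k p‖) → ∀ u,
    mfderiv 𝓘(ℝ, ℂ) 𝓘(ℝ, EP) (φ b μ) p (j b p u) =
      jP (φ b μ p) (mfderiv 𝓘(ℝ, ℂ) 𝓘(ℝ, EP) (φ b μ) p u)
  h : N → ∀ p : S, TangentSpace 𝓘(ℝ, ℂ) p →L[ℝ] TangentSpace 𝓘(ℝ, ℂ) p →L[ℝ] ℝ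
  h_symm : ∀ b p u u', h b p u u' = h b p u' u
  h_pos : ∀ b p, (∀ i k, p ≠ (coord i k).symm 0) → ∀ u, u ≠ 0 → 0 < h b p u u
  h_smooth : ContMDiffOn (𝓘(ℝ, EN).prod 𝓘(ℝ, ℂ).tangent) 𝓘(ℝ, ℝ) ∞
    (fun r : N × TangentBundle 𝓘(ℝ, ℂ) S => h r.1 r.2.1 r.2.2 r.2.2)
    {r | ∀ i k, r.2.1 ≠ (coord i k).symm 0}
  h_hermitian : ∀ b p, (∀ i k, p ≠ (coord i k).symm 0) →
    ∀ u u', h b p (j b p u) (j b p u') = h b p u u'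
  h_cylindrical : ∀ i k b, ∀ p ∈ (coord i k).source, 0 < ‖coord i k p‖ → ‖coord i k p‖ ≤ 1 →
    ∀ u, h b p u u =
      (‖toComplex (mfderiv 𝓘(ℝ, ℂ) 𝓘(ℝ, ℂ) (coord i k) p u)‖ / ‖coord i k p‖) ^ 2

variable {S}

/-- `m` is the area measure of the Riemannian metric `h` on the surface `S`. -/
def IsAreaMeasure [MeasurableSpace S]
    (h : ∀ p : S, TangentSpace 𝓘(ℝ, ℂ) p →L[ℝ] TangentSpace 𝓘(ℝ, ℂ) p →L[ℝ] ℝ)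
    (m : Measure S) : Prop :=
  ∀ (x : S) (A : Set S), MeasurableSet A → A ⊆ (chartAt ℂ x).source →
    m A = ∫⁻ y in chartAt ℂ x '' A, ENNReal.ofReal (Real.sqrt (
      let p := (chartAt ℂ x).symm y
      let e₁ : TangentSpace 𝓘(ℝ, ℂ) p :=
        mfderiv 𝓘(ℝ, ℂ) 𝓘(ℝ, ℂ) (chartAt ℂ x).symm y (1 : ℂ)
      let e₂ : TangentSpace 𝓘(ℝ, ℂ) p :=
        mfderiv 𝓘(ℝ, ℂ) 𝓘(ℝ, ℂ) (chartAt ℂ x).symm y Complex.I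
      h p e₁ e₁ * h p e₂ e₂ - h p e₁ e₂ ^ 2))

namespace CurveFamily

variable {EN : Type*} [NormedAddCommGroup EN] [NormedSpace ℝ EN]
  {N : Type*} [TopologicalSpace N] [ChartedSpace EN N]
  {EP : Type*} [NormedAddCommGroup EP] [NormedSpace ℝ EP]
  {P : Type*} [TopologicalSpace P] [ChartedSpace EP P]
  {jP : ∀ q : P, TangentSpace 𝓘(ℝ, EP) q →L[ℝ] TangentSpace 𝓘(ℝ, EP) q}
  {ℓ : ℕ} (D : CurveFamily S EN N jP ℓ)

/-- The points `p_k` (for `i = 0`) and `q_k` (for `i = 1`) that form the `k`-th node. -/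
def pt (i : Fin 2) (k : Fin ℓ) : S := (D.coord i k).symm 0

/-- The curve `C_{b, μ}` for `μ` with nonzero entries, cut along the circles
`|z_k| = |w_k| = |μ_k| ^ (1/2)` into two halves, each of which is a graph over a part of `C_{b, 0}`.
In the half over `C_1` one has `w_k = μ_k / z_k`, in the half over `C_2` one has `z_k = μ_k / w_k`.
Up to the cutting circles, which have measure zero, the curve is a disjoint union of the halves. -/
def curve (μ : Fin ℓ → ℂ) : Set S :=
  {p | ∀ i k, p ∈ (D.coord i k).source → Real.sqrt ‖μ k‖ ≤ ‖D.coord i k p‖}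

/-- `(|z_k|² + |w_k|²) ^ (1/2)` at a point of `C_{b, μ}` in a coordinate disc of the `k`-th node. -/
def nodeRho (μ : Fin ℓ → ℂ) (i : Fin 2) (k : Fin ℓ) (p : S) : ℝ :=
  Real.sqrt (‖D.coord i k p‖ ^ 2 + ‖μ k / D.coord i k p‖ ^ 2)

open Classical in
/-- The function `ρ` on `C_{b, μ}`: it is `(|z_k|² + |w_k|²) ^ (1/2)` where this is at most `1`, and
`1` elsewhere.  At most one factor of the product differs from `1`. -/
def rho (μ : Fin ℓ → ℂ) (p : S) : ℝ :=
  ∏ i, ∏ k, if p ∈ (D.coord i k).source then min 1 (D.nodeRho μ i k p) else 1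

/-- The part `C_{b, μ} ∩ B_k(r)` of `C_{b, μ}` near the `k`-th node. -/
def nodeBall (μ : Fin ℓ → ℂ) (k : Fin ℓ) (r : ℝ) : Set S :=
  {p ∈ D.curve μ | ∃ i, p ∈ (D.coord i k).source ∧ D.nodeRho μ i k p ≤ r}

end CurveFamily

end Domain

section Maps

variable {EZ : Type*} [NormedAddCommGroup EZ] [NormedSpace ℝ EZ]
  {Z : Type*} [TopologicalSpace Z] [ChartedSpace EZ Z] [IsManifold 𝓘(ℝ, EZ) 1 Z]
  {W : Type*} [NormedAddCommGroup W] [NormedSpace ℝ W]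
  {EΘ : Type*} [NormedAddCommGroup EΘ] [NormedSpace ℝ EΘ]
  {Θ : Type*} [TopologicalSpace Θ] [ChartedSpace EΘ Θ]
  {EP : Type*} [NormedAddCommGroup EP] [NormedSpace ℝ EP]
  {P : Type*} [TopologicalSpace P] [ChartedSpace EP P] [IsManifold 𝓘(ℝ, EP) 1 P]
  {EN : Type*} [NormedAddCommGroup EN] [NormedSpace ℝ EN]
  {N : Type*} [TopologicalSpace N] [ChartedSpace EN N]
  {S : Type*} [TopologicalSpace S] [ChartedSpace ℂ S] [IsManifold 𝓘(ℝ, ℂ) 1 S]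
  {ℓ : ℕ}
  {T : SumFibration EZ Z W EΘ Θ} (A : CompatiblePair T EP P) (D : CurveFamily S EN N A.jP ℓ)

/-- The section `∂̄_J F - ν_F` for a map `F : C_{b, μ} → Z`, where
`∂̄_J F = (dF + J ∘ dF ∘ j) / 2` and `ν_F` is the pullback of `ν` by `(F, φ b μ)`. -/
def dbarSub (b : N) (μ : Fin ℓ → ℂ) (F : S → Z) (p : S) :
    TangentSpace 𝓘(ℝ, ℂ) p →L[ℝ] TangentSpace 𝓘(ℝ, EZ) (F p) :=
  (1 / 2 : ℝ) • (mfderiv 𝓘(ℝ, ℂ) 𝓘(ℝ, EZ) F p +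
      (A.J (F p)).comp ((mfderiv 𝓘(ℝ, ℂ) 𝓘(ℝ, EZ) F p).comp (D.j b p))) -
    (A.ν (F p) (D.φ b μ p)).comp (mfderiv 𝓘(ℝ, ℂ) 𝓘(ℝ, EP) (D.φ b μ) p)

/-- At the `i`-th of the two points over the `k`-th node, `f` is centred in the chart `θ` and its
normal coordinate is `a z ^ s + O(|z| ^ (s + 1))`, with `a ≠ 0`: contact of order `s` with `V`. -/
def HasContact (f : S → Z) (i : Fin 2) (k : Fin ℓ) (s : ℕ) (θ : Θ) (a : ℂ) : Prop :=
  T.chart θ 0 = f (D.pt i k) ∧ a ≠ 0 ∧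
    (fun z : ℂ => ((T.chart θ).symm (f ((D.coord i k).symm z))).2 i - a * z ^ s)
      =O[𝓝 0] (fun z : ℂ => ‖z‖ ^ (s + 1))

/-- The space `M_s^V(X) ×_ev M_s^V(Y)`, for domains in the given family: the pairs `(b, f)` where
`f` is a `(J, ν)`-holomorphic map from `C_{b, 0}` to `Z_0 = X ∪ Y` with
`f(C_1) ⊆ X`, `f(C_2) ⊆ Y`, which meets `V` exactly in the nodes `p_k = q_k` of `C_{b, 0}`, with
contact of order `s_k` at the `k`-th node from both sides. -/
def moduli (s : Fin ℓ → ℕ) : Set (N × (S → Z)) :=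
  {x | ContMDiff 𝓘(ℝ, ℂ) 𝓘(ℝ, EZ) ∞ x.2 ∧
    (∀ p, x.2 p ∈ T.comp (D.side p)) ∧
    (∀ p, x.2 p ∈ T.V ↔ ∃ i k, p = D.pt i k) ∧
    (∀ k, x.2 (D.pt 0 k) = x.2 (D.pt 1 k)) ∧
    (∀ i k, ∃ θ a, HasContact A D x.2 i k (s k) θ a) ∧
    ∀ p, dbarSub A D x.1 0 x.2 p = 0}

variable (EZ) in
/-- Convergence of `(b_n, f_n)` to `(b, f)`: `b_n → b`, and `f_n → f` with all derivatives,
uniformly near each point, in local coordinates of `S` and `Z`. -/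
def SmoothlyTendsto (u : ℕ → N × (S → Z)) (x : N × (S → Z)) : Prop :=
  Tendsto (fun n => (u n).1) atTop (𝓝 x.1) ∧
  ∀ p : S, ∃ B ∈ 𝓝 p, B ⊆ (chartAt ℂ p).source ∧
    MapsTo x.2 B (chartAt EZ (x.2 p)).source ∧
    (∀ᶠ n in atTop, MapsTo (u n).2 B (chartAt EZ (x.2 p)).source) ∧
    ∀ d : ℕ, TendstoUniformlyOn
      (fun n => iteratedFDeriv ℝ d
        (fun y => chartAt EZ (x.2 p) ((u n).2 ((chartAt ℂ p).symm y))))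
      (iteratedFDeriv ℝ d (fun y => chartAt EZ (x.2 p) (x.2 ((chartAt ℂ p).symm y))))
      atTop (chartAt ℂ p '' B)

variable (EZ) in
/-- Compactness of a set of pairs `(b, f)` in the topology of smooth convergence. -/
def IsSmoothlyCompact (K : Set (N × (S → Z))) : Prop :=
  ∀ u : ℕ → N × (S → Z), (∀ n, u n ∈ K) →
    ∃ x ∈ K, ∃ τ : ℕ → ℕ, StrictMono τ ∧ SmoothlyTendsto EZ (u ∘ τ) x

/-- A cutoff profile: a smooth function that is `1` on `(-∞, 1]` and `0` on `[2, ∞)`. -/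
structure IsCutoff (β : ℝ → ℝ) : Prop where
  smooth : ContDiff ℝ ∞ β
  one : ∀ r ≤ 1, β r = 1
  zero : ∀ r ≥ 2, β r = 0
  nonneg : ∀ r, 0 ≤ β r
  le_one : ∀ r, β r ≤ 1

/-- In the coordinates `(v, x, y)` of the chart `θ`, the map `f` on the disc around `p_k` is
`(h^v, a z ^ s (1 + h^x), 0)`.  This is the point
`((1-β) h^v, x, λ / x)` with `x = a z ^ s (1 + (1-β) h^x)`; on the disc around `q_k`, the roles of
`x` and `y` are exchanged.  If `a_k b_k μ_k ^ s = λ` and `z w = μ_k`, then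
`λ / x = b_k w ^ s (1 + (1-β) h^x)⁻¹`. -/
def neckValue (f : S → Z) (i : Fin 2) (k : Fin ℓ) (s : ℕ) (θ : Θ) (a lambda : ℂ) (t : ℝ) (p : S) :
    Z :=
  let z := D.coord i k p
  let y := (T.chart θ).symm (f p)
  let hx := y.2 i / (a * z ^ s) - 1
  let x := a * z ^ s * (1 + ((1 - t : ℝ) : ℂ) * hx)
  T.chart θ ((1 - t) • y.1, pair i x (lambda / x))

/-- `F : C_{b, μ} → Z_λ` is the approximate map made from `f`, from coordinates `θ k` centred at the
images of the nodes, in which `f` has the leading coefficients `a 0 k` (on `C_1`) and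
`a 1 k` (on `C_2`), and from the gluing parameters `μ`.
Where `ρ ≤ 2 |μ_k| ^ (1/4)` at the `k`-th node it is
interpolated by the cutoff function `β(ρ / |μ_k| ^ (1/4))`; elsewhere it is `f`, under the
identification of `Z_λ` with `X` and with `Y` off `V`. -/
structure IsApproxMap (s : Fin ℓ → ℕ) (β : ℝ → ℝ) (f : S → Z) (lambda : ℂ) (θ : Fin ℓ → Θ)
    (a : Fin 2 → Fin ℓ → ℂ) (μ : Fin ℓ → ℂ) (F : S → Z) : Prop where
  contact : ∀ i k, HasContact A D f i k (s k) (θ k) (a i k)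
  gluing : ∀ k, a 0 k * a 1 k * μ k ^ s k = lambda
  neck : ∀ i k, ∀ p ∈ (D.coord i k).source, D.nodeRho μ i k p ≤ 2 * ‖μ k‖ ^ (1 / 4 : ℝ) →
    F p = neckValue A D f i k (s k) (θ k) (a i k) lambda
      (β (D.nodeRho μ i k p / ‖μ k‖ ^ (1 / 4 : ℝ))) p
  outside : ∀ p, (∀ i k, p ∈ (D.coord i k).source →
      2 * ‖μ k‖ ^ (1 / 4 : ℝ) < D.nodeRho μ i k p) →
    F p = T.lift (D.side p) lambda (f p)

/-- The pointwise norm of a linear map from `T_p C` to `T_z Z` for the metrics `h b` and `g`. -/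
def ptNorm (b : N) (p : S) (z : Z)
    (η : TangentSpace 𝓘(ℝ, ℂ) p →L[ℝ] TangentSpace 𝓘(ℝ, EZ) z) : ℝ≥0∞ :=
  ⨆ u : TangentSpace 𝓘(ℝ, ℂ) p, ⨆ _ : D.h b p u u ≤ 1,
    ENNReal.ofReal (Real.sqrt (A.g z (η u) (η u)))

/-- The weighted norm `‖η‖_{0, q, s}` of a one-form `η` on `C_{b, μ}` with values in `F^* TZ`:
its `q`-th power is
`∫_{C_μ} (|η|^q + |η|^q) ρ^(-δq/2)
  + ∑_k ∫_{C_μ ∩ B_k(1)} (|ρ^(1-s_k) η^N|^q + |ρ^(1-s_k) η^N|^q) ρ^(-δq/2)`.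
For order `m = 0` the two terms `|∇^m η|^q` and `|η|^q` coincide. -/
def weightedNorm [MeasurableSpace S] (Nm : NormalSplitting T) (m : Measure S)
    (s : Fin ℓ → ℕ) (δ q : ℝ) (b : N) (μ : Fin ℓ → ℂ) (F : S → Z)
    (η : ∀ p : S, TangentSpace 𝓘(ℝ, ℂ) p →L[ℝ] TangentSpace 𝓘(ℝ, EZ) (F p)) : ℝ≥0∞ :=
  ((∫⁻ p in D.curve μ, (ptNorm A D b p (F p) (η p) ^ q + ptNorm A D b p (F p) (η p) ^ q) *
      ENNReal.ofReal (D.rho μ p ^ (-(δ * q / 2))) ∂m) +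
    ∑ k, ∫⁻ p in D.nodeBall μ k 1,
      ((ENNReal.ofReal (D.rho μ p ^ (1 - (s k : ℝ))) *
          ptNorm A D b p (F p) ((Nm.proj (F p)).comp (η p))) ^ q +
        (ENNReal.ofReal (D.rho μ p ^ (1 - (s k : ℝ))) *
          ptNorm A D b p (F p) ((Nm.proj (F p)).comp (η p))) ^ q) *
      ENNReal.ofReal (D.rho μ p ^ (-(δ * q / 2))) ∂m) ^ (1 / q)

end Maps

end

end SymplecticSum

namespace SymplecticSum

set_option linter.unusedSectionVars false

theorem two_le_infty : (2 : ℕ∞ω) ≤ (∞ : ℕ∞ω) := by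
  exact WithTop.coe_le_coe.2 (le_top : (2 : ℕ∞) ≤ ⊤)

section ParametrizedCalculus

variable {EΘ : Type*} [NormedAddCommGroup EΘ] [NormedSpace ℝ EΘ]
  {Θ : Type*} [TopologicalSpace Θ] [ChartedSpace EΘ Θ]
  {X : Type*} [NormedAddCommGroup X] [NormedSpace ℝ X]
  {X' : Type*} [NormedAddCommGroup X'] [NormedSpace ℝ X']
  {X'' : Type*} [NormedAddCommGroup X''] [NormedSpace ℝ X'']
  {Y : Type*} [NormedAddCommGroup Y] [NormedSpace ℝ Y]

theorem contMDiffAt_prod_iff_contDiffAt {n : ℕ∞ω} {g : X × X' → Y} {x : X × X'} :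
    ContMDiffAt (𝓘(ℝ, X).prod 𝓘(ℝ, X')) 𝓘(ℝ, Y) n g x ↔ ContDiffAt ℝ n g x := by
  rw [← modelWithCornersSelf_prod, chartedSpaceSelf_prod]
  exact contMDiffAt_iff_contDiffAt

theorem contDiffAt_of_param [IsManifold 𝓘(ℝ, EΘ) ∞ Θ] {n : ℕ∞ω} (hn : n ≤ (∞ : ℕ∞ω)) {Q : Θ × X → Y}
    {θ₀ : Θ} {x₀ : X}
    (hQ : ContMDiffAt (𝓘(ℝ, EΘ).prod 𝓘(ℝ, X)) 𝓘(ℝ, Y) n Q (θ₀, x₀)) :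
    ContDiffAt ℝ n (fun r : EΘ × X => Q ((chartAt EΘ θ₀).symm r.1, r.2))
      (chartAt EΘ θ₀ θ₀, x₀) := by
  rw [← contMDiffAt_prod_iff_contDiffAt]
  have h1 : ContMDiffAt 𝓘(ℝ, EΘ) 𝓘(ℝ, EΘ) n (chartAt EΘ θ₀).symm (chartAt EΘ θ₀ θ₀) := by
    have := (contMDiffOn_chart_symm (I := 𝓘(ℝ, EΘ)) (n := ∞) (x := θ₀)).contMDiffAt
      ((chartAt EΘ θ₀).open_target.mem_nhds (mem_chart_target EΘ θ₀))
    exact this.of_le hn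
  have h2 : ContMDiffAt (𝓘(ℝ, EΘ).prod 𝓘(ℝ, X)) (𝓘(ℝ, EΘ).prod 𝓘(ℝ, X)) n
      (fun r : EΘ × X => ((chartAt EΘ θ₀).symm r.1, r.2)) (chartAt EΘ θ₀ θ₀, x₀) :=
    (h1.comp (chartAt EΘ θ₀ θ₀, x₀) contMDiffAt_fst).prodMk contMDiffAt_snd
  refine ContMDiffAt.comp_of_eq (g := Q) hQ h2 ?_
  simp [(chartAt EΘ θ₀).left_inv (mem_chart_source EΘ θ₀)]

/-- Properties of the slices of a function transfer from the chart of the parameter manifold. -/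
theorem eventually_of_chart {θ₀ : Θ} {p : (X → Y) → Prop} {Q : Θ × X → Y}
    (h : ∀ᶠ t in 𝓝 (chartAt EΘ θ₀ θ₀), p fun x => Q ((chartAt EΘ θ₀).symm t, x)) :
    ∀ᶠ θ in 𝓝 θ₀, p fun x => Q (θ, x) := by
  have h1 := ((chartAt EΘ θ₀).continuousAt (mem_chart_source EΘ θ₀)).tendsto.eventually h
  filter_upwards [h1, (chartAt EΘ θ₀).open_source.mem_nhds (mem_chart_source EΘ θ₀)] with θ h2 h3
  rwa [(chartAt EΘ θ₀).left_inv h3] at h2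

/-- Uniform bounds for the derivatives of the slices of a `C²` function. -/
theorem exists_slice_fderiv_bound [IsManifold 𝓘(ℝ, EΘ) ∞ Θ] {Q : Θ × X → Y} {θ₀ : Θ} {x₀ : X}
    (hQ : ContMDiffAt (𝓘(ℝ, EΘ).prod 𝓘(ℝ, X)) 𝓘(ℝ, Y) 2 Q (θ₀, x₀)) :
    ∃ C, 0 ≤ C ∧ ∃ ε > 0, ∀ᶠ θ in 𝓝 θ₀, ∀ x ∈ Metric.ball x₀ ε,
      ContDiffAt ℝ 2 (fun x => Q (θ, x)) x ∧ ‖fderiv ℝ (fun x => Q (θ, x)) x‖ ≤ C ∧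
      ∀ x' ∈ Metric.ball x₀ ε,
        ‖fderiv ℝ (fun x => Q (θ, x)) x - fderiv ℝ (fun x => Q (θ, x)) x'‖ ≤ C * ‖x - x'‖ := by
  set G : EΘ × X → Y := fun r => Q ((chartAt EΘ θ₀).symm r.1, r.2)
  set t₀ := chartAt EΘ θ₀ θ₀
  have hG : ContDiffAt ℝ 2 G (t₀, x₀) := contDiffAt_of_param two_le_infty hQ
  let D : EΘ × X → (X →L[ℝ] Y) := fun r => (fderiv ℝ G r).comp (ContinuousLinearMap.inr ℝ EΘ X)
  have hD : ContDiffAt ℝ 1 D (t₀, x₀) :=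
    (hG.fderiv_right (m := 1) (by norm_num)).clm_comp contDiffAt_const
  obtain ⟨K, s, hs, hK⟩ := hD.exists_lipschitzOnWith
  have hG2 : ∀ᶠ r in 𝓝 (t₀, x₀), ContDiffAt ℝ 2 G r := hG.eventually (by simp)
  have hDb : ∀ᶠ r in 𝓝 (t₀, x₀), ‖D r‖ ≤ ‖D (t₀, x₀)‖ + 1 :=
    (hD.continuousAt.norm.eventually_lt continuousAt_const (lt_add_one _)).mono fun _ h => h.le
  have hall := (hG2.and hDb).and hs
  rw [nhds_prod_eq] at hall
  obtain ⟨pa, ha, pb, hb, hab⟩ := eventually_prod_iff.1 hall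
  obtain ⟨ε, hε, hball⟩ := Metric.eventually_nhds_iff_ball.1 hb
  refine ⟨max (K : ℝ) (‖D (t₀, x₀)‖ + 1), by positivity, ε, hε, ?_⟩
  have := eventually_of_chart (EΘ := EΘ) (θ₀ := θ₀) (p := fun q => ∀ x ∈ Metric.ball x₀ ε,
      ContDiffAt ℝ 2 q x ∧ ‖fderiv ℝ q x‖ ≤ max (K : ℝ) (‖D (t₀, x₀)‖ + 1) ∧
      ∀ x' ∈ Metric.ball x₀ ε,
        ‖fderiv ℝ q x - fderiv ℝ q x'‖ ≤ max (K : ℝ) (‖D (t₀, x₀)‖ + 1) * ‖x - x'‖) (Q := Q)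
  refine this ?_
  filter_upwards [ha] with t ht x hx
  have key : ∀ x ∈ Metric.ball x₀ ε, fderiv ℝ (fun x => G (t, x)) x = D (t, x) := by
    intro x hx
    have h1 := (hab ht (hball x hx)).1.1
    have h2 : HasFDerivAt (fun x : X => (t, x)) (ContinuousLinearMap.inr ℝ EΘ X) x :=
      (hasFDerivAt_prodMk_right t x)
    exact ((h1.differentiableAt (by norm_num)).hasFDerivAt.comp x h2).fderiv
  refine ⟨?_, ?_, ?_⟩
  · exact ContDiffAt.comp (g := G) x (hab ht (hball x hx)).1.1
      (contDiffAt_const.prodMk contDiffAt_id)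
  · change ‖fderiv ℝ (fun x => G (t, x)) x‖ ≤ _
    rw [key x hx]
    exact (hab ht (hball x hx)).1.2.trans (le_max_right _ _)
  · intro x' hx'
    change ‖fderiv ℝ (fun x => G (t, x)) x - fderiv ℝ (fun x => G (t, x)) x'‖ ≤ _
    rw [key x hx, key x' hx']
    have := hK.dist_le_mul _ (hab ht (hball x hx)).2 _ (hab ht (hball x' hx')).2
    rw [dist_eq_norm] at this
    refine this.trans ?_
    rw [Prod.dist_eq, dist_self, max_eq_right dist_nonneg, dist_eq_norm]
    gcongr
    exact le_max_left _ _

/-- Bounds for a family of linear maps `H (θ, y, ·)` that is smooth in the parameters. -/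
theorem exists_linear_bound [IsManifold 𝓘(ℝ, EΘ) ∞ Θ] {θ₀ : Θ} {x₀ : X}
    (H : Θ → X → (X' →L[ℝ] Y))
    (hH : ContMDiffAt (𝓘(ℝ, EΘ).prod 𝓘(ℝ, X × X')) 𝓘(ℝ, Y) 2
      (fun r : Θ × (X × X') => H r.1 r.2.1 r.2.2) (θ₀, (x₀, 0))) :
    ∃ C, 0 ≤ C ∧ ∃ ε > 0, ∀ᶠ θ in 𝓝 θ₀, ∀ x ∈ Metric.ball x₀ ε, ‖H θ x‖ ≤ C ∧
      ∀ x' ∈ Metric.ball x₀ ε, ‖H θ x - H θ x'‖ ≤ C * ‖x - x'‖ := by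
  obtain ⟨C, hC, ε, hε, h⟩ := exists_slice_fderiv_bound hH
  refine ⟨C, hC, ε, hε, ?_⟩
  filter_upwards [h] with θ hθ x hx
  have key : ∀ x ∈ Metric.ball x₀ ε, H θ x = (fderiv ℝ (fun r : X × X' => H θ r.1 r.2)
      (x, 0)).comp (ContinuousLinearMap.inr ℝ X X') := by
    intro x hx
    have h1 := (hθ (x, 0) (by rw [← ball_prod_same]; exact ⟨hx, by simpa⟩)).1
    have h2 := (h1.differentiableAt (by norm_num)).hasFDerivAt.comp (0 : X')
      (hasFDerivAt_prodMk_right x (0 : X'))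
    exact ((H θ x).hasFDerivAt (x := 0)).unique h2
  have hinr : ‖ContinuousLinearMap.inr ℝ X X'‖ ≤ 1 :=
    ContinuousLinearMap.opNorm_le_bound _ zero_le_one fun v => by simp
  have hmem : ∀ x ∈ Metric.ball x₀ ε, (x, (0 : X')) ∈ Metric.ball (x₀, (0 : X')) ε := by
    intro x hx
    rw [← ball_prod_same]; exact ⟨hx, by simpa⟩
  constructor
  · rw [key x hx]
    refine (ContinuousLinearMap.opNorm_comp_le _ _).trans ?_
    have := (hθ (x, 0) (hmem x hx)).2.1
    calc _ ≤ C * 1 := by gcongr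
      _ = C := mul_one _
  · intro x' hx'
    rw [key x hx, key x' hx', ← ContinuousLinearMap.sub_comp]
    refine (ContinuousLinearMap.opNorm_comp_le _ _).trans ?_
    have := (hθ (x, 0) (hmem x hx)).2.2 _ (hmem x' hx')
    calc _ ≤ (C * ‖(x, (0 : X')) - (x', 0)‖) * 1 := by gcongr
      _ = _ := by simp [Prod.norm_def]

/-- A function that vanishes on `b = 0` has increments in `c` of size `‖b‖ ‖c - c'‖`. -/
theorem exists_mixed_bound [IsManifold 𝓘(ℝ, EΘ) ∞ Θ] {Q : Θ × (X × X' × X'') → Y}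
    {θ₀ : Θ} {a₀ : X} {c₀ : X''}
    (hQ : ContMDiffAt (𝓘(ℝ, EΘ).prod 𝓘(ℝ, X × X' × X'')) 𝓘(ℝ, Y) 2 Q (θ₀, (a₀, 0, c₀)))
    {ε₀ : ℝ} (hε₀ : 0 < ε₀)
    (hQ0 : ∀ᶠ θ in 𝓝 θ₀, ∀ a ∈ Metric.ball a₀ ε₀, ∀ c ∈ Metric.ball c₀ ε₀, Q (θ, (a, 0, c)) = 0) :
    ∃ C, 0 ≤ C ∧ ∃ ε > 0, ∀ᶠ θ in 𝓝 θ₀, ∀ a ∈ Metric.ball a₀ ε, ∀ b ∈ Metric.ball (0 : X') ε,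
      ∀ c ∈ Metric.ball c₀ ε, ‖Q (θ, (a, b, c))‖ ≤ C * ‖b‖ ∧ ∀ c' ∈ Metric.ball c₀ ε,
      ‖Q (θ, (a, b, c)) - Q (θ, (a, b, c'))‖ ≤ C * ‖b‖ * ‖c - c'‖ := by
  obtain ⟨C, hC, ε, hε, h⟩ := exists_slice_fderiv_bound hQ
  refine ⟨C, hC, min ε ε₀, lt_min hε hε₀, ?_⟩
  filter_upwards [h, hQ0] with θ hθ hθ0 a ha b hb c hc
  have hmem : ∀ b ∈ Metric.ball (0 : X') (min ε ε₀), ∀ c ∈ Metric.ball c₀ (min ε ε₀),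
      (a, b, c) ∈ Metric.ball (a₀, (0 : X'), c₀) ε := by
    intro b hb c hc
    rw [← ball_prod_same, ← ball_prod_same]
    exact ⟨Metric.ball_subset_ball (min_le_left _ _) ha,
      Metric.ball_subset_ball (min_le_left _ _) hb, Metric.ball_subset_ball (min_le_left _ _) hc⟩
  have h0 : (0 : X') ∈ Metric.ball (0 : X') (min ε ε₀) := by simp [hε, hε₀]
  let ι : X' →L[ℝ] X × X' × X'' :=
    (ContinuousLinearMap.inr ℝ X (X' × X'')).comp (ContinuousLinearMap.inl ℝ X' X'')
  have hι : ‖ι‖ ≤ 1 := ContinuousLinearMap.opNorm_le_bound _ zero_le_one fun v => by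
    simp [ι, Prod.norm_def]
  have hd : ∀ b ∈ Metric.ball (0 : X') (min ε ε₀), ∀ c ∈ Metric.ball c₀ (min ε ε₀),
      HasFDerivAt (fun b => Q (θ, (a, b, c)))
        ((fderiv ℝ (fun x => Q (θ, x)) (a, b, c)).comp ι) b := by
    intro b hb c hc
    have h1 : HasFDerivAt (fun b : X' => (a, b, c)) ι b :=
      (hasFDerivAt_prodMk_right a (b, c)).comp b (hasFDerivAt_prodMk_left b c)
    exact (((hθ _ (hmem b hb c hc)).1.differentiableAt (by norm_num)).hasFDerivAt.comp b h1 :)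
  have hz : ∀ c ∈ Metric.ball c₀ (min ε ε₀), Q (θ, (a, 0, c)) = 0 := fun c hc =>
    hθ0 a (Metric.ball_subset_ball (min_le_right _ _) ha) c
      (Metric.ball_subset_ball (min_le_right _ _) hc)
  constructor
  · have := (convex_ball (0 : X') (min ε ε₀)).norm_image_sub_le_of_norm_hasFDerivWithin_le
      (f := fun b => Q (θ, (a, b, c))) (C := C)
      (fun b hb => (hd b hb c hc).hasFDerivWithinAt) (fun b hb => by
        refine (ContinuousLinearMap.opNorm_comp_le _ _).trans ?_
        have := (hθ _ (hmem b hb c hc)).2.1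
        calc _ ≤ C * 1 := by gcongr
          _ = C := mul_one _) h0 hb
    simpa [hz c hc] using this
  · intro c' hc'
    have := (convex_ball (0 : X') (min ε ε₀)).norm_image_sub_le_of_norm_hasFDerivWithin_le
      (f := fun b => Q (θ, (a, b, c)) - Q (θ, (a, b, c'))) (C := C * ‖c - c'‖)
      (fun b hb => ((hd b hb c hc).sub (hd b hb c' hc')).hasFDerivWithinAt) (fun b hb => by
        rw [← ContinuousLinearMap.sub_comp]
        refine (ContinuousLinearMap.opNorm_comp_le _ _).trans ?_
        have := (hθ _ (hmem b hb c hc)).2.2 _ (hmem b hb c' hc')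
        calc _ ≤ (C * ‖(a, b, c) - (a, b, c')‖) * 1 := by gcongr
          _ = C * ‖c - c'‖ := by simp [Prod.norm_def]) h0 hb
    simp only [hz c hc, hz c' hc', sub_zero] at this
    linarith [this]

end ParametrizedCalculus

section Taylor

/-- The coefficients of a polynomial are bounded by its values on the unit interval. -/
theorem exists_coeff_bound (n : ℕ) : ∃ K, 0 ≤ K ∧ ∀ (c : Fin (n + 1) → ℂ) (M : ℝ),
    (∀ u ∈ Icc (0 : ℝ) 1, ‖∑ k : Fin (n + 1), (u : ℂ) ^ (k : ℕ) * c k‖ ≤ M) → ∀ i, ‖c i‖ ≤ K * M := by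
  let v : Fin (n + 1) → ℂ := fun j => ((((j : ℕ) : ℝ) / (n + 1) : ℝ) : ℂ)
  have hv : Function.Injective v := by
    intro i j hij
    have h0 : ((i : ℕ) : ℝ) / (n + 1) = ((j : ℕ) : ℝ) / (n + 1) := Complex.ofReal_injective hij
    have h1 : ((i : ℕ) : ℝ) = ((j : ℕ) : ℝ) := by field_simp at h0; exact h0
    exact Fin.ext (by exact_mod_cast h1)
  have hdet : IsUnit (Matrix.vandermonde v).det :=
    (Matrix.det_vandermonde_ne_zero_iff.2 hv).isUnit
  refine ⟨∑ i, ∑ j, ‖(Matrix.vandermonde v)⁻¹ i j‖, by positivity, fun c M hM i => ?_⟩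
  have hM0 : 0 ≤ M := (norm_nonneg _).trans (hM 0 (by simp))
  have hc : c = (Matrix.vandermonde v)⁻¹.mulVec ((Matrix.vandermonde v).mulVec c) := by
    rw [Matrix.mulVec_mulVec, Matrix.nonsing_inv_mul _ hdet, Matrix.one_mulVec]
  have hval : ∀ j, ‖(Matrix.vandermonde v).mulVec c j‖ ≤ M := by
    intro j
    refine hM (((j : ℕ) : ℝ) / (n + 1)) ⟨by positivity, ?_⟩
    rw [div_le_one (by positivity)]
    have := j.2
    exact_mod_cast this.le
  rw [hc]
  calc ‖∑ j, (Matrix.vandermonde v)⁻¹ i j * (Matrix.vandermonde v).mulVec c j‖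
      ≤ ∑ j, ‖(Matrix.vandermonde v)⁻¹ i j‖ * M := by
        refine norm_sum_le_of_le _ fun j _ => ?_
        rw [norm_mul]
        gcongr
        exact hval j
    _ = (∑ j, ‖(Matrix.vandermonde v)⁻¹ i j‖) * M := by rw [Finset.sum_mul]
    _ ≤ _ := by
        refine mul_le_mul_of_nonneg_right ?_ hM0
        exact Finset.single_le_sum (f := fun i => ∑ j, ‖(Matrix.vandermonde v)⁻¹ i j‖)
          (fun i _ => by positivity) (Finset.mem_univ i)

theorem taylorWithinEval_eq_sum_fin (r : ℝ → ℂ) (n : ℕ) (s : Set ℝ) (x : ℝ) :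
    taylorWithinEval r n s 0 x = ∑ k : Fin (n + 1), (x : ℂ) ^ (k : ℕ) *
      (((Nat.factorial k : ℝ)⁻¹ : ℝ) * iteratedDerivWithin k r s 0) := by
  rw [taylor_within_apply, Finset.sum_range]
  refine Finset.sum_congr rfl fun k _ => ?_
  rw [Complex.real_smul]
  push_cast
  ring

theorem norm_sub_taylor_le {r : ℝ → ℂ} {n : ℕ} {C x : ℝ}
    (hr : ContDiffOn ℝ (n + 1) r (Icc 0 1)) (hx : x ∈ Icc (0 : ℝ) 1)
    (hC : ∀ y ∈ Icc (0 : ℝ) 1, ‖iteratedDerivWithin (n + 1) r (Icc 0 1) y‖ ≤ C) :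
    ‖r x - taylorWithinEval r n (Icc 0 1) 0 x‖ ≤ C * x ^ (n + 1) := by
  have h := taylor_mean_remainder_bound zero_le_one hr hx hC
  have hC0 : 0 ≤ C := (norm_nonneg _).trans (hC 0 (by simp))
  rw [sub_zero] at h
  refine h.trans (div_le_self (mul_nonneg hC0 (pow_nonneg hx.1 _)) ?_)
  exact_mod_cast Nat.one_le_iff_ne_zero.2 (Nat.factorial_ne_zero n)

theorem norm_le_of_vanishing_order {r : ℝ → ℂ} {n : ℕ} {C A t₀ : ℝ}
    (hr : ContDiffOn ℝ (n + 1) r (Icc 0 1))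
    (hC : ∀ y ∈ Icc (0 : ℝ) 1, ‖iteratedDerivWithin (n + 1) r (Icc 0 1) y‖ ≤ C)
    (ht₀ : 0 < t₀) (hA : ∀ t ∈ Ioo 0 t₀, ‖r t‖ ≤ A * t ^ (n + 1)) {x : ℝ}
    (hx : x ∈ Icc (0 : ℝ) 1) : ‖r x‖ ≤ C * x ^ (n + 1) := by
  obtain ⟨K, hK, h⟩ := exists_coeff_bound n
  have hC0 : 0 ≤ C := (norm_nonneg _).trans (hC 0 (by simp))
  set c : Fin (n + 1) → ℂ := fun k =>
    (((Nat.factorial k : ℝ)⁻¹ : ℝ) * iteratedDerivWithin k r (Icc 0 1) 0)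
  have hcont : ContinuousWithinAt r (Icc 0 1) 0 := hr.continuousOn 0 (by simp)
  have hA0 : 0 ≤ A := by
    have h1 := (norm_nonneg _).trans (hA (t₀ / 2) ⟨by positivity, by linarith⟩)
    by_contra hneg
    have : A * (t₀ / 2) ^ (n + 1) < 0 := mul_neg_of_neg_of_pos (not_le.1 hneg) (by positivity)
    linarith
  have hzero : r 0 = 0 := by
    have h1 : Tendsto (fun t : ℝ => A * t ^ (n + 1)) (𝓝[>] 0) (𝓝 0) := by
      have : Continuous (fun t : ℝ => A * t ^ (n + 1)) := by fun_prop
      have := this.tendsto 0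
      simp only [ne_eq, Nat.add_eq_zero_iff, one_ne_zero, and_false, not_false_eq_true, zero_pow,
        mul_zero] at this
      exact this.mono_left nhdsWithin_le_nhds
    have h2 : Tendsto r (𝓝[>] 0) (𝓝 0) := by
      refine squeeze_zero_norm' ?_ h1
      filter_upwards [Ioo_mem_nhdsGT ht₀] with t ht using hA t ht
    have h3 : Tendsto r (𝓝[>] 0) (𝓝 (r 0)) :=
      hcont.tendsto.mono_left (nhdsWithin_le_of_mem (by
        filter_upwards [Ioo_mem_nhdsGT (zero_lt_one' ℝ)] with t ht using ⟨ht.1.le, ht.2.le⟩))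
    exact tendsto_nhds_unique h3 h2
  have hc : ∀ i, c i = 0 := by
    intro i
    have key : ∀ t ∈ Ioo 0 (min t₀ 1), ‖c i‖ ≤ K * (A + C) * t := by
      intro t ht
      have ht1 : t < t₀ := ht.2.trans_le (min_le_left _ _)
      have ht2 : t < 1 := ht.2.trans_le (min_le_right _ _)
      have h1 := h (fun k => (t : ℂ) ^ (k : ℕ) * c k) ((A + C) * t ^ (n + 1)) (by
        intro u hu
        have h2 : ∑ k : Fin (n + 1), (u : ℂ) ^ (k : ℕ) * ((t : ℂ) ^ (k : ℕ) * c k) =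
            taylorWithinEval r n (Icc 0 1) 0 (u * t) := by
          rw [taylorWithinEval_eq_sum_fin]
          refine Finset.sum_congr rfl fun k _ => ?_
          simp only [c]
          push_cast
          rw [mul_pow, mul_assoc]
        rw [h2]
        have hut : u * t ∈ Icc (0 : ℝ) 1 := ⟨mul_nonneg hu.1 ht.1.le, by nlinarith [hu.1, hu.2, ht.1]⟩
        have hle : u * t ≤ t := by nlinarith [hu.2, ht.1]
        have h3 := norm_sub_taylor_le hr hut hC
        have h4 : ‖r (u * t)‖ ≤ A * t ^ (n + 1) := by
          rcases eq_or_lt_of_le hu.1 with h0 | h0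
          · rw [← h0, zero_mul, hzero, norm_zero]
            exact mul_nonneg hA0 (pow_nonneg ht.1.le _)
          · refine (hA (u * t) ⟨mul_pos h0 ht.1, hle.trans_lt ht1⟩).trans ?_
            have := pow_le_pow_left₀ hut.1 hle (n + 1)
            gcongr
        have h5 : (u * t) ^ (n + 1) ≤ t ^ (n + 1) := pow_le_pow_left₀ hut.1 hle (n + 1)
        calc ‖taylorWithinEval r n (Icc 0 1) 0 (u * t)‖
            = ‖r (u * t) - (r (u * t) - taylorWithinEval r n (Icc 0 1) 0 (u * t))‖ := by
              rw [sub_sub_cancel]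
          _ ≤ A * t ^ (n + 1) + C * (u * t) ^ (n + 1) := (norm_sub_le _ _).trans (add_le_add h4 h3)
          _ ≤ A * t ^ (n + 1) + C * t ^ (n + 1) := by gcongr
          _ = _ := by ring) i
      rw [norm_mul, norm_pow, Complex.norm_real, Real.norm_of_nonneg ht.1.le] at h1
      have hti : 0 < t ^ (i : ℕ) := pow_pos ht.1 _
      have hpow : t ^ (n + 1) ≤ t ^ (i : ℕ) * t := by
        rw [← pow_succ]
        exact pow_le_pow_of_le_one ht.1.le ht2.le (by have := i.2; omega)
      have : t ^ (i : ℕ) * ‖c i‖ ≤ t ^ (i : ℕ) * (K * (A + C) * t) :=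
        h1.trans (by
          calc K * ((A + C) * t ^ (n + 1)) ≤ K * ((A + C) * (t ^ (i : ℕ) * t)) := by gcongr
            _ = _ := by ring)
      exact le_of_mul_le_mul_left this hti
    have hlim : Tendsto (fun t : ℝ => K * (A + C) * t) (𝓝[>] 0) (𝓝 0) := by
      have : Continuous (fun t : ℝ => K * (A + C) * t) := by fun_prop
      have := this.tendsto 0
      rw [mul_zero] at this
      exact this.mono_left nhdsWithin_le_nhds
    have := ge_of_tendsto hlim (by
      filter_upwards [Ioo_mem_nhdsGT (lt_min ht₀ zero_lt_one)] with t ht using key t ht)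
    exact norm_le_zero_iff.1 this
  have hT : taylorWithinEval r n (Icc 0 1) 0 x = 0 := by
    rw [taylorWithinEval_eq_sum_fin]
    refine Finset.sum_eq_zero fun k _ => ?_
    change _ * c k = 0
    rw [hc k, mul_zero]
  have := norm_sub_taylor_le hr hx hC
  rwa [hT, sub_zero] at this

/-- Landau's inequality between a function, its derivative and a higher derivative. -/
theorem exists_derivWithin_bound (n : ℕ) (hn : 1 ≤ n) : ∃ K, 0 ≤ K ∧
    ∀ (r : ℝ → ℂ) (M C : ℝ), ContDiffOn ℝ (n + 1) r (Icc 0 1) →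
    (∀ y ∈ Icc (0 : ℝ) 1, ‖iteratedDerivWithin (n + 1) r (Icc 0 1) y‖ ≤ C) →
    (∀ y ∈ Icc (0 : ℝ) 1, ‖r y‖ ≤ M) → ‖derivWithin r (Icc 0 1) 0‖ ≤ K * (M + C) := by
  obtain ⟨K, hK, h⟩ := exists_coeff_bound n
  refine ⟨K, hK, fun r M C hr hC hM => ?_⟩
  have hC0 : 0 ≤ C := (norm_nonneg _).trans (hC 0 (by simp))
  have := h (fun k => (((Nat.factorial k : ℝ)⁻¹ : ℝ) * iteratedDerivWithin k r (Icc 0 1) 0)) (M + C)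
    (by
      intro u hu
      rw [← taylorWithinEval_eq_sum_fin]
      have h1 := norm_sub_taylor_le hr hu hC
      have h2 : u ^ (n + 1) ≤ 1 := pow_le_one₀ hu.1 hu.2
      calc ‖taylorWithinEval r n (Icc 0 1) 0 u‖
          = ‖r u - (r u - taylorWithinEval r n (Icc 0 1) 0 u)‖ := by rw [sub_sub_cancel]
        _ ≤ M + C * u ^ (n + 1) := (norm_sub_le _ _).trans (add_le_add (hM u hu) h1)
        _ ≤ M + C * 1 := by gcongr
        _ = M + C := by ring) ⟨1, by omega⟩
  simpa using this

variable {E : Type*} [NormedAddCommGroup E] [NormedSpace ℝ E]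

theorem norm_iteratedDerivWithin_line_le {R : E → ℂ} {s : Set E} (hs : IsOpen s)
    {N : ℕ} (hR : ContDiffOn ℝ N R s) (z η : E) (hline : ∀ u ∈ Icc (0 : ℝ) 1, z + u • η ∈ s) :
    ContDiffOn ℝ N (fun u : ℝ => R (z + u • η)) (Icc 0 1) ∧
    ∀ n ≤ N, ∀ u ∈ Icc (0 : ℝ) 1,
    ‖iteratedDerivWithin n (fun u : ℝ => R (z + u • η)) (Icc 0 1) u‖ ≤
      ‖iteratedFDeriv ℝ n R (z + u • η)‖ * ‖η‖ ^ n := by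
  let g : ℝ →L[ℝ] E := ContinuousLinearMap.toSpanSingleton ℝ η
  have hg : ‖g‖ = ‖η‖ := ContinuousLinearMap.norm_toSpanSingleton η
  let R' : E → ℂ := fun y => R (z + y)
  let s' : Set E := (fun y => z + y) ⁻¹' s
  have hs' : IsOpen s' := hs.preimage (by fun_prop)
  have hR' : ContDiffOn ℝ N R' s' := hR.comp (by fun_prop) fun y hy => hy
  have hsg : IsOpen (g ⁻¹' s') := hs'.preimage g.continuous
  have hcomp : ContDiffOn ℝ N (R' ∘ g) (g ⁻¹' s') := hR'.comp_continuousLinearMap g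
  have hsub : Icc (0 : ℝ) 1 ⊆ g ⁻¹' s' := fun u hu => by
    simpa [g, s'] using hline u hu
  have heq : (fun u : ℝ => R (z + u • η)) = R' ∘ g := by
    ext u; simp [R', g]
  rw [heq]
  refine ⟨hcomp.mono hsub, fun n hn u hu => ?_⟩
  have h1 : iteratedDerivWithin n (R' ∘ g) (Icc 0 1) u = iteratedDeriv n (R' ∘ g) u := by
    rw [iteratedDerivWithin, iteratedDeriv]
    rw [iteratedFDerivWithin_eq_iteratedFDeriv (n := n) (uniqueDiffOn_Icc_zero_one) ?_ hu]
    exact ((hcomp.contDiffAt (hsg.mem_nhds (hsub hu))).of_le (mod_cast hn))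
  rw [h1, ← norm_iteratedFDeriv_eq_norm_iteratedDeriv,
    ← iteratedFDerivWithin_of_isOpen n hsg (hsub hu),
    g.iteratedFDerivWithin_comp_right hR' hs'.uniqueDiffOn hsg.uniqueDiffOn (hsub hu)
      (mod_cast hn)]
  refine (ContinuousMultilinearMap.norm_compContinuousLinearMap_le _ _).trans ?_
  rw [iteratedFDerivWithin_of_isOpen n hs' (hsub hu), iteratedFDeriv_comp_add_left]
  simp [hg, g]

/-- A smooth function that vanishes to order `n + 1` at the origin is bounded, together with its
derivative, in terms of its derivative of order `n + 1`. -/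
theorem exists_vanishing_order_bound (n : ℕ) : ∃ K, 0 ≤ K ∧
    ∀ (R : E → ℂ) (r₀ C : ℝ), ContDiffOn ℝ (n + 1 : ℕ) R (Metric.ball 0 r₀) →
    R =O[𝓝 0] (fun z => ‖z‖ ^ (n + 1)) →
    (∀ z ∈ Metric.ball (0 : E) r₀, ‖iteratedFDeriv ℝ (n + 1) R z‖ ≤ C) →
    (∀ z ∈ Metric.ball (0 : E) r₀, ‖R z‖ ≤ C * ‖z‖ ^ (n + 1)) ∧
    ∀ z ∈ Metric.ball (0 : E) (r₀ / 2), z ≠ 0 → ‖fderiv ℝ R z‖ ≤ K * C * ‖z‖ ^ n := by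
  have h1 : ∀ (R : E → ℂ) (r₀ C : ℝ), ContDiffOn ℝ (n + 1 : ℕ) R (Metric.ball 0 r₀) →
      R =O[𝓝 0] (fun z => ‖z‖ ^ (n + 1)) →
      (∀ z ∈ Metric.ball (0 : E) r₀, ‖iteratedFDeriv ℝ (n + 1) R z‖ ≤ C) →
      ∀ z ∈ Metric.ball (0 : E) r₀, ‖R z‖ ≤ C * ‖z‖ ^ (n + 1) := by
    intro R r₀ C hR hO hC z hz
    have hline : ∀ u ∈ Icc (0 : ℝ) 1, (0 : E) + u • z ∈ Metric.ball (0 : E) r₀ := by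
      intro u hu
      rw [zero_add, mem_ball_zero_iff, norm_smul, Real.norm_of_nonneg hu.1]
      rw [mem_ball_zero_iff] at hz
      nlinarith [hu.2, norm_nonneg z]
    obtain ⟨hsm, hder⟩ := norm_iteratedDerivWithin_line_le Metric.isOpen_ball hR 0 z hline
    obtain ⟨A, hA⟩ := hO.bound
    obtain ⟨ε, hε, hA'⟩ := Metric.eventually_nhds_iff_ball.1 hA
    have hA0 : ∀ y ∈ Metric.ball (0 : E) ε, ‖R y‖ ≤ |A| * ‖y‖ ^ (n + 1) := by
      intro y hy
      refine (hA' y hy).trans ?_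
      rw [norm_pow, norm_norm]
      gcongr
      exact le_abs_self A
    have := norm_le_of_vanishing_order (r := fun u : ℝ => R (0 + u • z)) (n := n)
      (C := C * ‖z‖ ^ (n + 1)) (A := |A| * ‖z‖ ^ (n + 1)) (t₀ := ε / (‖z‖ + 1)) (x := 1)
      (by exact_mod_cast hsm) (fun y hy => (hder (n + 1) le_rfl y hy).trans (by
        gcongr
        exact hC _ (hline y hy))) (by positivity) (by
        intro t ht
        have hmem : t • z ∈ Metric.ball (0 : E) ε := by
          rw [mem_ball_zero_iff, norm_smul, Real.norm_of_nonneg ht.1.le]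
          have := (lt_div_iff₀ (by positivity)).1 ht.2
          nlinarith [ht.1, norm_nonneg z]
        have := hA0 _ hmem
        rw [norm_smul, Real.norm_of_nonneg ht.1.le, mul_pow] at this
        rw [zero_add]
        linarith) (by simp)
    simpa using this
  rcases Nat.eq_zero_or_pos n with rfl | hn
  · refine ⟨1, zero_le_one, fun R r₀ C hR hO hC => ⟨h1 R r₀ C hR hO hC, fun z hz _ => ?_⟩⟩
    have hz' : z ∈ Metric.ball (0 : E) r₀ := by
      rw [mem_ball_zero_iff] at hz ⊢
      linarith [norm_nonneg z]
    have := hC z hz'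
    rw [zero_add, norm_iteratedFDeriv_one] at this
    simpa using this
  obtain ⟨K, hK, hd⟩ := exists_derivWithin_bound n hn
  refine ⟨K * (2 ^ (n + 1) + 1), by positivity, fun R r₀ C hR hO hC => ⟨h1 R r₀ C hR hO hC,
    fun z hz hz0 => ?_⟩⟩
  rw [mem_ball_zero_iff] at hz
  have hC0 : 0 ≤ C := (norm_nonneg _).trans (hC 0 (by
    rw [mem_ball_zero_iff, norm_zero]; linarith [norm_nonneg z]))
  have hzn : 0 < ‖z‖ := norm_pos_iff.2 hz0
  refine ContinuousLinearMap.opNorm_le_bound _ (by positivity) fun ζ => ?_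
  rcases eq_or_ne ζ 0 with rfl | hζ
  · simp
  have hζn : 0 < ‖ζ‖ := norm_pos_iff.2 hζ
  set η : E := (‖z‖ / ‖ζ‖) • ζ with hη
  have hηn : ‖η‖ = ‖z‖ := by
    rw [hη, norm_smul, Real.norm_of_nonneg (by positivity)]
    field_simp
  have hn2 : ∀ u ∈ Icc (0 : ℝ) 1, ‖z + u • η‖ ≤ 2 * ‖z‖ := by
    intro u hu
    refine (norm_add_le _ _).trans ?_
    rw [norm_smul, Real.norm_of_nonneg hu.1, hηn]
    nlinarith [hu.2]
  have hline : ∀ u ∈ Icc (0 : ℝ) 1, z + u • η ∈ Metric.ball (0 : E) r₀ := by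
    intro u hu
    rw [mem_ball_zero_iff]
    linarith [hn2 u hu]
  obtain ⟨hsm, hder⟩ := norm_iteratedDerivWithin_line_le Metric.isOpen_ball hR z η hline
  have h2 := hd (fun u : ℝ => R (z + u • η)) (C * (2 * ‖z‖) ^ (n + 1)) (C * ‖z‖ ^ (n + 1))
    (by exact_mod_cast hsm) (fun y hy => (hder (n + 1) le_rfl y hy).trans (by
      rw [hηn]
      gcongr
      exact hC _ (hline y hy)))
    (fun y hy => (h1 R r₀ C hR hO hC _ (hline y hy)).trans (by
      gcongr
      exact hn2 y hy))
  have hzmem : z ∈ Metric.ball (0 : E) r₀ := by rw [mem_ball_zero_iff]; linarith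
  have hfd : HasFDerivAt R (fderiv ℝ R z) z :=
    ((hR.contDiffAt (Metric.isOpen_ball.mem_nhds hzmem)).differentiableAt (by simp)).hasFDerivAt
  have h3 : HasDerivAt (fun u : ℝ => z + u • η) η 0 := by
    simpa using ((hasDerivAt_id (0 : ℝ)).smul_const η).const_add z
  have h4 : HasDerivAt (fun u : ℝ => R (z + u • η)) (fderiv ℝ R z η) 0 := by
    have h5 : HasFDerivAt R (fderiv ℝ R z) (z + (0 : ℝ) • η) := by simpa using hfd
    exact h5.comp_hasDerivAt (0 : ℝ) h3
  rw [h4.hasDerivWithinAt.derivWithin (uniqueDiffOn_Icc_zero_one 0 (by simp)), hη, map_smul,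
    norm_smul, Real.norm_of_nonneg (by positivity)] at h2
  have h6 : ‖fderiv ℝ R z ζ‖ = (‖ζ‖ / ‖z‖) * (‖z‖ / ‖ζ‖ * ‖fderiv ℝ R z ζ‖) := by
    field_simp
  rw [h6]
  calc _ ≤ (‖ζ‖ / ‖z‖) * (K * (C * (2 * ‖z‖) ^ (n + 1) + C * ‖z‖ ^ (n + 1))) := by gcongr
    _ = _ := by rw [mul_pow, pow_succ ‖z‖ n]; field_simp

end Taylor

section UniformBounds

variable {X : Type*} [NormedAddCommGroup X] [NormedSpace ℝ X]
  {Y : Type*} [NormedAddCommGroup Y] [NormedSpace ℝ Y]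
  {G : Type*} [NormedAddCommGroup G] [NormedSpace ℝ G]
  {EΘ : Type*} [NormedAddCommGroup EΘ] [NormedSpace ℝ EΘ]
  {Θ : Type*} [TopologicalSpace Θ] [ChartedSpace EΘ Θ]

/-- The sequence `u` is eventually bounded in `C^M` on a fixed neighbourhood of `x₀`. -/
def UniformlyCk (M : ℕ) (u : ℕ → X → Y) (x₀ : X) : Prop :=
  ∃ C, ∃ ε > 0, ∀ᶠ n in atTop, ContDiffOn ℝ M (u n) (Metric.ball x₀ ε) ∧
    ∀ d ≤ M, ∀ x ∈ Metric.ball x₀ ε, ‖iteratedFDeriv ℝ d (u n) x‖ ≤ C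

/-- Joint convergence of `u n x` to `y₀` as `n → ∞` and `x → x₀`. -/
def JointlyTendsto {X Y : Type*} [TopologicalSpace X] [TopologicalSpace Y]
    (u : ℕ → X → Y) (x₀ : X) (y₀ : Y) : Prop :=
  Tendsto (fun r : ℕ × X => u r.1 r.2) (atTop ×ˢ 𝓝 x₀) (𝓝 y₀)

theorem JointlyTendsto.comp {X Y Y' : Type*} [TopologicalSpace X] [TopologicalSpace Y]
    [TopologicalSpace Y'] {u : ℕ → Y → Y'} {v : ℕ → X → Y} {x₀ : X} {y₀ : Y} {z₀ : Y'}
    (hu : JointlyTendsto u y₀ z₀) (hv : JointlyTendsto v x₀ y₀) :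
    JointlyTendsto (fun n x => u n (v n x)) x₀ z₀ :=
  Tendsto.comp (f := fun r : ℕ × X => (r.1, v r.1 r.2)) hu (tendsto_fst.prodMk hv)

theorem JointlyTendsto.eventually_ball {Y : Type*} [TopologicalSpace Y] {u : ℕ → X → Y} {x₀ : X}
    {y₀ : Y} (hu : JointlyTendsto u x₀ y₀) {O : Set Y} (hO : O ∈ 𝓝 y₀) :
    ∃ ε > 0, ∀ᶠ n in atTop, ∀ x ∈ Metric.ball x₀ ε, u n x ∈ O := by
  obtain ⟨pa, ha, pb, hb, hab⟩ := eventually_prod_iff.1 (hu.eventually hO)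
  obtain ⟨ε, hε, hball⟩ := Metric.eventually_nhds_iff_ball.1 hb
  exact ⟨ε, hε, ha.mono fun n hn x hx => hab hn (hball x hx)⟩

theorem UniformlyCk.congr' {M : ℕ} {u v : ℕ → X → Y} {x₀ : X} (hu : UniformlyCk M u x₀)
    (h : ∃ ε > 0, ∀ᶠ n in atTop, ∀ x ∈ Metric.ball x₀ ε, u n x = v n x) : UniformlyCk M v x₀ := by
  obtain ⟨C, ε, hε, hu⟩ := hu
  obtain ⟨ε', hε', h⟩ := h
  refine ⟨C, min ε ε', lt_min hε hε', ?_⟩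
  filter_upwards [hu, h] with n hn hn'
  have hsub := Metric.ball_subset_ball (x := x₀) (min_le_left ε ε')
  have hsub' := Metric.ball_subset_ball (x := x₀) (min_le_right ε ε')
  refine ⟨(hn.1.mono hsub).congr fun x hx => (hn' x (hsub' hx)).symm, fun d hd x hx => ?_⟩
  have : v n =ᶠ[𝓝 x] u n := by
    filter_upwards [Metric.isOpen_ball.mem_nhds (hsub' hx)] with y hy using (hn' y hy).symm
  rw [(this.iteratedFDeriv ℝ d).eq_of_nhds]
  exact hn.2 d hd x (hsub hx)

theorem uniformlyCk_const {M : ℕ} {g : X → Y} {x₀ : X} (hg : ContDiffAt ℝ M g x₀) :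
    UniformlyCk M (fun _ => g) x₀ := by
  have hcont : ∀ d ∈ Finset.range (M + 1), ∀ᶠ x in 𝓝 x₀,
      ‖iteratedFDeriv ℝ d g x‖ ≤ ‖iteratedFDeriv ℝ d g x₀‖ + 1 := by
    intro d hd
    have : ContinuousAt (iteratedFDeriv ℝ d g) x₀ :=
      hg.continuousAt_iteratedFDeriv (by exact_mod_cast Nat.lt_succ_iff.1 (Finset.mem_range.1 hd))
    exact (this.norm.eventually_lt continuousAt_const (lt_add_one _)).mono fun _ h => h.le
  have hall := ((Finset.range (M + 1)).eventually_all.2 hcont).and (hg.eventually (by simp))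
  obtain ⟨ε, hε, h⟩ := Metric.eventually_nhds_iff_ball.1 hall
  refine ⟨∑ d ∈ Finset.range (M + 1), (‖iteratedFDeriv ℝ d g x₀‖ + 1), ε, hε,
    Eventually.of_forall fun n => ⟨fun x hx => (h x hx).2.contDiffWithinAt, fun d hd x hx => ?_⟩⟩
  have hd' : d ∈ Finset.range (M + 1) := Finset.mem_range.2 (Nat.lt_succ_of_le hd)
  exact ((h x hx).1 d hd').trans (Finset.single_le_sum
    (f := fun d => ‖iteratedFDeriv ℝ d g x₀‖ + 1) (fun i _ => by positivity) hd')

theorem UniformlyCk.comp {M : ℕ} {g : ℕ → Y → G} {v : ℕ → X → Y} {x₀ : X} {y₀ : Y}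
    (hg : UniformlyCk M g y₀) (hv : UniformlyCk M v x₀) (hvt : JointlyTendsto v x₀ y₀) :
    UniformlyCk M (fun n x => g n (v n x)) x₀ := by
  obtain ⟨C, ε, hε, hg⟩ := hg
  obtain ⟨D, ε', hε', hv⟩ := hv
  obtain ⟨ε'', hε'', hb⟩ := hvt.eventually_ball (Metric.ball_mem_nhds y₀ hε)
  have hD : 1 ≤ max 1 D := le_max_left _ _
  refine ⟨Nat.factorial M * |C| * max 1 D ^ M, min ε' ε'', lt_min hε' hε'', ?_⟩
  filter_upwards [hg, hv, hb] with n hgn hvn hbn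
  have hsub := Metric.ball_subset_ball (x := x₀) (min_le_left ε' ε'')
  have hsub' := Metric.ball_subset_ball (x := x₀) (min_le_right ε' ε'')
  have hmaps : MapsTo (v n) (Metric.ball x₀ (min ε' ε'')) (Metric.ball y₀ ε) :=
    fun x hx => hbn x (hsub' hx)
  have hvn' := hvn.1.mono hsub
  refine ⟨hgn.1.comp hvn' hmaps, fun d hd x hx => ?_⟩
  have hopen : IsOpen (Metric.ball x₀ (min ε' ε'')) := Metric.isOpen_ball
  have hopen' : IsOpen (Metric.ball y₀ ε) := Metric.isOpen_ball
  have key := norm_iteratedFDerivWithin_comp_le (n := d) (N := M) (C := |C|) (D := max 1 D)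
    hgn.1 hvn' (mod_cast hd) hopen'.uniqueDiffOn hopen.uniqueDiffOn hmaps hx
    (fun i hi => by
      rw [iteratedFDerivWithin_of_isOpen i hopen' (hmaps hx)]
      exact (hgn.2 i (hi.trans hd) _ (hmaps hx)).trans (le_abs_self C))
    (fun i hi1 hi => by
      rw [iteratedFDerivWithin_of_isOpen i hopen hx]
      refine (hvn.2 i (hi.trans hd) _ (hsub hx)).trans ((le_max_right 1 D).trans ?_)
      exact le_self_pow₀ hD (by omega))
  rw [iteratedFDerivWithin_of_isOpen d hopen hx] at key
  refine key.trans ?_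
  have h1 : (Nat.factorial d : ℝ) ≤ Nat.factorial M := by exact_mod_cast Nat.factorial_le hd
  have h2 : max 1 D ^ d ≤ max 1 D ^ M := pow_le_pow_right₀ hD hd
  gcongr

theorem uniformlyCk_param [IsManifold 𝓘(ℝ, EΘ) ∞ Θ] {M : ℕ} {Q : Θ × X → Y} {t : ℕ → Θ} {t₀ : Θ}
    {x₀ : X} (hQ : ContMDiffAt (𝓘(ℝ, EΘ).prod 𝓘(ℝ, X)) 𝓘(ℝ, Y) M Q (t₀, x₀))
    (ht : Tendsto t atTop (𝓝 t₀)) : UniformlyCk M (fun n x => Q (t n, x)) x₀ := by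
  have h1 := contDiffAt_of_param (WithTop.coe_le_coe.2 le_top) hQ
  have h2 := uniformlyCk_const h1
  have htc : Tendsto (fun n => chartAt EΘ t₀ (t n)) atTop (𝓝 (chartAt EΘ t₀ t₀)) :=
    ((chartAt EΘ t₀).continuousAt (mem_chart_source EΘ t₀)).tendsto.comp ht
  have h3 : JointlyTendsto (fun n (x : X) => (chartAt EΘ t₀ (t n), x)) x₀
      (chartAt EΘ t₀ t₀, x₀) := (htc.comp tendsto_fst).prodMk_nhds tendsto_snd
  have h4 : UniformlyCk M (fun n (x : X) => (chartAt EΘ t₀ (t n), x)) x₀ := by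
    obtain ⟨C, ε, hε, h⟩ := uniformlyCk_const (M := M) (g := fun r : EΘ × X => r)
      (x₀ := (chartAt EΘ t₀ t₀, x₀)) contDiffAt_id
    have h0 : ∀ᶠ n in atTop, ‖chartAt EΘ t₀ (t n)‖ ≤ ‖chartAt EΘ t₀ t₀‖ + 1 :=
      (htc.norm.eventually_lt_const (lt_add_one _)).mono fun _ h => h.le
    refine ⟨‖chartAt EΘ t₀ t₀‖ + 1 + (‖x₀‖ + ε) + ‖ContinuousLinearMap.inr ℝ EΘ X‖, ε, hε, ?_⟩
    filter_upwards [h0] with n hn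
    refine ⟨(contDiff_const.prodMk contDiff_id).contDiffOn, fun d hd x hx => ?_⟩
    have hx' : ‖x‖ ≤ ‖x₀‖ + ε := by
      rw [mem_ball_iff_norm] at hx
      linarith [norm_le_norm_add_norm_sub' x x₀]
    have hnn : 0 ≤ ‖ContinuousLinearMap.inr ℝ EΘ X‖ := norm_nonneg _
    have hfd : fderiv ℝ (fun x : X => (chartAt EΘ t₀ (t n), x)) =
        fun _ => ContinuousLinearMap.inr ℝ EΘ X := by
      ext1 x
      exact (hasFDerivAt_prodMk_right _ x).fderiv
    rcases d with _ | _ | d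
    · rw [norm_iteratedFDeriv_zero, Prod.norm_def]
      have := norm_nonneg x
      have := norm_nonneg (chartAt EΘ t₀ (t n))
      exact max_le (by linarith) (by linarith)
    · rw [zero_add, norm_iteratedFDeriv_one, hfd]
      have := norm_nonneg x
      have := norm_nonneg (chartAt EΘ t₀ t₀)
      linarith
    · rw [← norm_iteratedFDeriv_fderiv, hfd, iteratedFDeriv_const_of_ne (by omega)]
      simp only [Pi.zero_apply, norm_zero]
      positivity
  refine (h2.comp h4 h3).congr' ⟨1, one_pos, ?_⟩
  filter_upwards [ht.eventually ((chartAt EΘ t₀).open_source.mem_nhds (mem_chart_source EΘ t₀))]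
    with n hn x _
  simp [(chartAt EΘ t₀).left_inv hn]

variable {E : Type*} [NormedAddCommGroup E] [NormedSpace ℝ E]
  {Z : Type*} [TopologicalSpace Z] [ChartedSpace E Z] [IsManifold 𝓘(ℝ, E) ∞ Z]
  {S : Type*} [TopologicalSpace S] [ChartedSpace ℂ S] [IsManifold 𝓘(ℝ, ℂ) ∞ S]
  {N : Type*} [TopologicalSpace N]

/-- A map between manifolds, in the charts at `p` and `z`. -/
noncomputable def inCharts (f : S → Z) (p : S) (z : Z) (y : ℂ) : E :=
  chartAt E z (f ((chartAt ℂ p).symm y))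

theorem contDiffAt_inCharts {f : S → Z} {p : S} {z : Z} {y : ℂ}
    (hf : ContMDiffAt 𝓘(ℝ, ℂ) 𝓘(ℝ, E) ∞ f ((chartAt ℂ p).symm y))
    (hy : y ∈ (chartAt ℂ p).target) (hz : f ((chartAt ℂ p).symm y) ∈ (chartAt E z).source) :
    ContDiffAt ℝ ∞ (inCharts (E := E) f p z) y := by
  rw [← contMDiffAt_iff_contDiffAt]
  have h1 : ContMDiffAt 𝓘(ℝ, ℂ) 𝓘(ℝ, ℂ) ∞ (chartAt ℂ p).symm y :=
    (contMDiffOn_chart_symm (I := 𝓘(ℝ, ℂ)) (n := ∞) (x := p)).contMDiffAt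
      ((chartAt ℂ p).open_target.mem_nhds hy)
  have h2 : ContMDiffAt 𝓘(ℝ, E) 𝓘(ℝ, E) ∞ (chartAt E z) (f ((chartAt ℂ p).symm y)) :=
    (contMDiffOn_chart (I := 𝓘(ℝ, E)) (n := ∞) (x := z)).contMDiffAt
      ((chartAt E z).open_source.mem_nhds hz)
  exact h2.comp y (hf.comp y h1)

theorem SmoothlyTendsto.uniformlyCk {u : ℕ → N × (S → Z)} {x : N × (S → Z)}
    (h : SmoothlyTendsto E u x) (hu : ∀ n, ContMDiff 𝓘(ℝ, ℂ) 𝓘(ℝ, E) ∞ (u n).2)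
    (hx : ContMDiff 𝓘(ℝ, ℂ) 𝓘(ℝ, E) ∞ x.2) (p : S) (M : ℕ) :
    UniformlyCk M (fun n => inCharts (E := E) (u n).2 p (x.2 p)) (chartAt ℂ p p) ∧
    JointlyTendsto (fun n => inCharts (E := E) (u n).2 p (x.2 p)) (chartAt ℂ p p)
      (chartAt E (x.2 p) (x.2 p)) ∧
    ∃ B ∈ 𝓝 p, ∀ᶠ n in atTop, MapsTo (u n).2 B (chartAt E (x.2 p)).source := by
  obtain ⟨B, hB, hBs, hBx, hBu, hlim⟩ := h.2 p
  have hy0 : chartAt ℂ p p ∈ (chartAt ℂ p).target := mem_chart_target ℂ p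
  have hpp : (chartAt ℂ p).symm (chartAt ℂ p p) = p := (chartAt ℂ p).left_inv (mem_chart_source ℂ p)
  have himg : chartAt ℂ p '' B ∈ 𝓝 (chartAt ℂ p p) :=
    (chartAt ℂ p).image_mem_nhds (mem_chart_source ℂ p) hB
  have hx0 : ContDiffAt ℝ ∞ (inCharts (E := E) x.2 p (x.2 p)) (chartAt ℂ p p) :=
    contDiffAt_inCharts hx.contMDiffAt hy0 (by rw [hpp]; exact mem_chart_source E _)
  obtain ⟨C, ε₁, hε₁, hC⟩ := uniformlyCk_const (hx0.of_le (m := M) (mod_cast le_top))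
  obtain ⟨hC1, hC2⟩ := hC.exists.choose_spec
  obtain ⟨ε₂, hε₂, hball⟩ := Metric.mem_nhds_iff.1 himg
  have hBset : ∀ y ∈ Metric.ball (chartAt ℂ p p) ε₂, y ∈ (chartAt ℂ p).target ∧
      (chartAt ℂ p).symm y ∈ B := by
    intro y hy
    obtain ⟨p', hp', rfl⟩ := hball hy
    exact ⟨(chartAt ℂ p).map_source (hBs hp'), by rwa [(chartAt ℂ p).left_inv (hBs hp')]⟩
  refine ⟨⟨C + 1, min ε₁ ε₂, lt_min hε₁ hε₂, ?_⟩, ?_, B, hB, hBu⟩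
  · have hall : ∀ᶠ n in atTop, ∀ d ∈ Finset.range (M + 1), ∀ y ∈ chartAt ℂ p '' B,
        dist (iteratedFDeriv ℝ d (inCharts (E := E) x.2 p (x.2 p)) y)
          (iteratedFDeriv ℝ d (inCharts (E := E) (u n).2 p (x.2 p)) y) < 1 :=
      (Finset.eventually_all _).2 fun d _ => Metric.tendstoUniformlyOn_iff.1 (hlim d) 1 one_pos
    filter_upwards [hall, hBu] with n hn hnB
    refine ⟨fun y hy => ?_, fun d hd y hy => ?_⟩
    · have h2 := hBset y (Metric.ball_subset_ball (min_le_right _ _) hy)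
      exact ((contDiffAt_inCharts (hu n).contMDiffAt h2.1 (hnB h2.2)).of_le
        (mod_cast le_top)).contDiffWithinAt
    · have h1 := hn d (Finset.mem_range.2 (Nat.lt_succ_of_le hd)) y
        (hball (Metric.ball_subset_ball (min_le_right _ _) hy))
      have h2 := hC2 d hd y (Metric.ball_subset_ball (min_le_left _ _) hy)
      rw [dist_comm, dist_eq_norm] at h1
      linarith [norm_le_norm_add_norm_sub' (iteratedFDeriv ℝ d (inCharts (E := E) (u n).2 p (x.2 p)) y)
        (iteratedFDeriv ℝ d (inCharts (E := E) x.2 p (x.2 p)) y)]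
  · have hcont : ContinuousAt (inCharts (E := E) x.2 p (x.2 p)) (chartAt ℂ p p) := hx0.continuousAt
    have hval : inCharts (E := E) x.2 p (x.2 p) (chartAt ℂ p p) = chartAt E (x.2 p) (x.2 p) := by
      simp [inCharts, hpp]
    refine Metric.tendsto_nhds.2 fun δ hδ => ?_
    have h1 := Metric.tendstoUniformlyOn_iff.1 (hlim 0) (δ / 2) (half_pos hδ)
    have h2 := Metric.tendsto_nhds.1 hcont (δ / 2) (half_pos hδ)
    filter_upwards [prod_mem_prod h1 (inter_mem himg h2)] with r hr
    have h3 := hr.1 r.2 hr.2.1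
    have h4 : dist (inCharts (E := E) x.2 p (x.2 p) r.2) (inCharts (E := E) x.2 p (x.2 p)
      (chartAt ℂ p p)) < δ / 2 := hr.2.2
    rw [iteratedFDeriv_zero_eq_comp, iteratedFDeriv_zero_eq_comp] at h3
    simp only [Function.comp_apply, LinearIsometryEquiv.dist_map] at h3
    rw [hval] at h4
    calc dist (inCharts (E := E) (u r.1).2 p (x.2 p) r.2) (chartAt E (x.2 p) (x.2 p))
        ≤ dist (inCharts (E := E) (u r.1).2 p (x.2 p) r.2) (inCharts (E := E) x.2 p (x.2 p) r.2) +
          dist (inCharts (E := E) x.2 p (x.2 p) r.2) (chartAt E (x.2 p) (x.2 p)) :=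
          dist_triangle _ _ _
      _ < δ / 2 + δ / 2 := by
          rw [dist_comm (inCharts (E := E) (u r.1).2 p (x.2 p) r.2)]
          exact add_lt_add h3 h4
      _ = δ := add_halves δ

end UniformBounds

section TangentMaps

variable {ET : Type*} [NormedAddCommGroup ET] [NormedSpace ℝ ET]
  {T : Type*} [TopologicalSpace T] [ChartedSpace ET T] [IsManifold 𝓘(ℝ, ET) ∞ T]
  {EM : Type*} [NormedAddCommGroup EM] [NormedSpace ℝ EM]
  {M : Type*} [TopologicalSpace M] [ChartedSpace EM M] [IsManifold 𝓘(ℝ, EM) ∞ M]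
  {EM' : Type*} [NormedAddCommGroup EM'] [NormedSpace ℝ EM']
  {M' : Type*} [TopologicalSpace M'] [ChartedSpace EM' M'] [IsManifold 𝓘(ℝ, EM') ∞ M']
  {X : Type*} [NormedAddCommGroup X] [NormedSpace ℝ X]
  {Y : Type*} [NormedAddCommGroup Y] [NormedSpace ℝ Y]

theorem mfderiv_slice {f : T × M → M'} {t : T} {m : M}
    (hf : MDifferentiableAt (𝓘(ℝ, ET).prod 𝓘(ℝ, EM)) 𝓘(ℝ, EM') f (t, m)) (v : EM) :
    (mfderiv (𝓘(ℝ, ET).prod 𝓘(ℝ, EM)) 𝓘(ℝ, EM') f (t, m) ((0, v) : ET × EM) : EM') =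
      mfderiv 𝓘(ℝ, EM) 𝓘(ℝ, EM') (fun m => f (t, m)) m v := by
  have := mfderiv_prod_eq_add_apply (v := ((0, v) : ET × EM)) hf
  refine this.trans ?_
  erw [map_zero, zero_add]

/-- The derivative of a map in one of its two variables is a smooth map of tangent bundles. -/
theorem contMDiffAt_partialTangentMap {f : T × M → M'} {t₀ : T} (v₀ : TangentBundle 𝓘(ℝ, EM) M)
    (hf : ContMDiffAt (𝓘(ℝ, ET).prod 𝓘(ℝ, EM)) 𝓘(ℝ, EM') 3 f (t₀, v₀.1)) :
    ContMDiffAt (𝓘(ℝ, ET).prod 𝓘(ℝ, EM).tangent) 𝓘(ℝ, EM').tangent 2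
      (fun r : T × TangentBundle 𝓘(ℝ, EM) M =>
        (⟨f (r.1, r.2.1), mfderiv 𝓘(ℝ, EM) 𝓘(ℝ, EM') (fun m => f (r.1, m)) r.2.1 r.2.2⟩ :
          TangentBundle 𝓘(ℝ, EM') M')) (t₀, v₀) := by
  have : IsManifold 𝓘(ℝ, ET) 3 T := IsManifold.of_le (n := ∞) (WithTop.coe_le_coe.2 le_top)
  have : IsManifold 𝓘(ℝ, EM) 3 M := IsManifold.of_le (n := ∞) (WithTop.coe_le_coe.2 le_top)
  have : IsManifold 𝓘(ℝ, EM') 3 M' := IsManifold.of_le (n := ∞) (WithTop.coe_le_coe.2 le_top)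
  have : IsManifold 𝓘(ℝ, ET) 1 T := IsManifold.of_le (n := ∞) (WithTop.coe_le_coe.2 le_top)
  have : IsManifold 𝓘(ℝ, EM) 1 M := IsManifold.of_le (n := ∞) (WithTop.coe_le_coe.2 le_top)
  have : IsManifold 𝓘(ℝ, EM') 1 M' := IsManifold.of_le (n := ∞) (WithTop.coe_le_coe.2 le_top)
  have : IsManifold 𝓘(ℝ, ET) (2 + 1) T := IsManifold.of_le (n := ∞) (WithTop.coe_le_coe.2 le_top)
  obtain ⟨s₀, hs₀, hfs₀⟩ := (contMDiffAt_iff_contMDiffOn_nhds (by simp)).1 hf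
  obtain ⟨s, hss, hs, hmem⟩ := mem_nhds_iff.1 hs₀
  have hfs : ContMDiffOn (𝓘(ℝ, ET).prod 𝓘(ℝ, EM)) 𝓘(ℝ, EM') 3 f s := hfs₀.mono hss
  have h1 := hfs.contMDiffOn_tangentMapWithin (m := 2) (by norm_num) hs.uniqueMDiffOn
  let ι : T × TangentBundle 𝓘(ℝ, EM) M → TangentBundle (𝓘(ℝ, ET).prod 𝓘(ℝ, EM)) (T × M) :=
    fun r => (equivTangentBundleProd 𝓘(ℝ, ET) T 𝓘(ℝ, EM) M).symm (⟨r.1, 0⟩, r.2)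
  have hι : ContMDiff (𝓘(ℝ, ET).prod 𝓘(ℝ, EM).tangent) (𝓘(ℝ, ET).prod 𝓘(ℝ, EM)).tangent 2 ι := by
    refine (contMDiff_equivTangentBundleProd_symm (n := 2)).comp ?_
    refine ContMDiff.prodMk ?_ contMDiff_snd
    exact (Bundle.contMDiff_zeroSection ℝ (TangentSpace 𝓘(ℝ, ET) : T → Type _)).comp contMDiff_fst
  have hpre : (Bundle.TotalSpace.proj ⁻¹' s : Set (TangentBundle (𝓘(ℝ, ET).prod 𝓘(ℝ, EM)) (T × M)))
      ∈ 𝓝 (ι (t₀, v₀)) := by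
    refine (hs.preimage (FiberBundle.continuous_proj _ _)).mem_nhds ?_
    exact hmem
  have h2 := (h1.contMDiffAt hpre).comp (t₀, v₀) hι.contMDiffAt
  refine h2.congr_of_eventuallyEq ?_
  have h3 : ι ⁻¹' (Bundle.TotalSpace.proj ⁻¹' s) ∈ 𝓝 (t₀, v₀) :=
    hι.continuous.continuousAt.preimage_mem_nhds hpre
  filter_upwards [h3] with r hr
  have hr' : (r.1, r.2.1) ∈ s := hr
  have hd : MDifferentiableAt (𝓘(ℝ, ET).prod 𝓘(ℝ, EM)) 𝓘(ℝ, EM') f (r.1, r.2.1) :=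
    (hfs.contMDiffAt (hs.mem_nhds hr')).mdifferentiableAt (by norm_num)
  refine Bundle.TotalSpace.ext rfl (heq_of_eq ?_)
  change _ = mfderivWithin _ _ f s (r.1, r.2.1) _
  rw [mfderivWithin_of_isOpen hs hr']
  exact (mfderiv_slice hd r.2.2).symm

/-- The partial derivative of a map from a vector space to a manifold. -/
theorem contMDiffAt_pushforward {f : T × X → M} {t₀ : T} {x₀ w₀ : X}
    (hf : ContMDiffAt (𝓘(ℝ, ET).prod 𝓘(ℝ, X)) 𝓘(ℝ, EM) 3 f (t₀, x₀)) :
    ContMDiffAt (𝓘(ℝ, ET).prod 𝓘(ℝ, X × X)) 𝓘(ℝ, EM).tangent 2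
      (fun r : T × (X × X) =>
        (⟨f (r.1, r.2.1), mfderiv 𝓘(ℝ, X) 𝓘(ℝ, EM) (fun m => f (r.1, m)) r.2.1 r.2.2⟩ :
          TangentBundle 𝓘(ℝ, EM) M)) (t₀, (x₀, w₀)) := by
  have h1 := contMDiffAt_partialTangentMap (⟨x₀, w₀⟩ : TangentBundle 𝓘(ℝ, X) X) hf
  have h2 : ContMDiff 𝓘(ℝ, X × X) 𝓘(ℝ, X).tangent 2
      (fun r : X × X => (⟨r.1, r.2⟩ : TangentBundle 𝓘(ℝ, X) X)) := by
    intro r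
    refine (Bundle.contMDiffAt_totalSpace).2 ⟨?_, ?_⟩
    · exact contDiff_fst.contMDiff.contMDiffAt
    · have : ContMDiffAt 𝓘(ℝ, X × X) 𝓘(ℝ, X) 2 (fun r : X × X => r.2) r :=
        contDiff_snd.contMDiff.contMDiffAt
      convert! this with y
      simp
      rfl
  have h3 : ContMDiffAt (𝓘(ℝ, ET).prod 𝓘(ℝ, X × X)) (𝓘(ℝ, ET).prod 𝓘(ℝ, X).tangent) 2
      (fun r : T × (X × X) => (r.1, (⟨r.2.1, r.2.2⟩ : TangentBundle 𝓘(ℝ, X) X)))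
      (t₀, (x₀, w₀)) :=
    contMDiffAt_fst.prodMk (h2.contMDiffAt.comp (t₀, (x₀, w₀)) contMDiffAt_snd)
  exact ContMDiffAt.comp (t₀, (x₀, w₀)) h1 h3

/-- The partial derivative of a map from a manifold to a vector space. -/
theorem contMDiffAt_pullback {f : T × M → Y} {t₀ : T} (v₀ : TangentBundle 𝓘(ℝ, EM) M)
    (hf : ContMDiffAt (𝓘(ℝ, ET).prod 𝓘(ℝ, EM)) 𝓘(ℝ, Y) 3 f (t₀, v₀.1)) :
    ContMDiffAt (𝓘(ℝ, ET).prod 𝓘(ℝ, EM).tangent) 𝓘(ℝ, Y) 2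
      (fun r : T × TangentBundle 𝓘(ℝ, EM) M =>
        (mfderiv 𝓘(ℝ, EM) 𝓘(ℝ, Y) (fun m => f (r.1, m)) r.2.1 r.2.2 : Y)) (t₀, v₀) :=
  (contMDiff_snd_tangentBundle_modelSpace Y 𝓘(ℝ, Y)).contMDiffAt.comp (t₀, v₀)
    (contMDiffAt_partialTangentMap v₀ hf)

end TangentMaps

section Coordinates

variable {EΘ : Type*} [NormedAddCommGroup EΘ] [NormedSpace ℝ EΘ]
  {Θ : Type*} [TopologicalSpace Θ] [ChartedSpace EΘ Θ] [IsManifold 𝓘(ℝ, EΘ) ∞ Θ]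
  {EZ : Type*} [NormedAddCommGroup EZ] [NormedSpace ℝ EZ]
  {Z : Type*} [TopologicalSpace Z] [ChartedSpace EZ Z] [IsManifold 𝓘(ℝ, EZ) ∞ Z]
  {EP : Type*} [NormedAddCommGroup EP] [NormedSpace ℝ EP]
  {P : Type*} [TopologicalSpace P] [ChartedSpace EP P] [IsManifold 𝓘(ℝ, EP) ∞ P]
  {E : Type*} [NormedAddCommGroup E] [NormedSpace ℝ E]
  {X : Type*} [NormedAddCommGroup X] [NormedSpace ℝ X]

variable (EΘ EZ) in
/-- A smooth family of parametrizations `c θ` of open sets of `Z`, with inverses `c' θ`, near the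
parameter `θ₀` and the point `y₀`. -/
structure IsChartFamily (c : Θ → E → Z) (c' : Θ → Z → E) (θ₀ : Θ) (y₀ : E) : Prop where
  smooth : ContMDiffAt (𝓘(ℝ, EΘ).prod 𝓘(ℝ, E)) 𝓘(ℝ, EZ) 3 (fun r : Θ × E => c r.1 r.2) (θ₀, y₀)
  smooth' : ContMDiffAt (𝓘(ℝ, EΘ).prod 𝓘(ℝ, EZ)) 𝓘(ℝ, E) 3 (fun r : Θ × Z => c' r.1 r.2)
    (θ₀, c θ₀ y₀)
  left_inv : ∀ᶠ r in 𝓝 ((θ₀, y₀) : Θ × E), c' r.1 (c r.1 r.2) = r.2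
  right_inv : ∀ᶠ r in 𝓝 ((θ₀, c θ₀ y₀) : Θ × Z), c r.1 (c' r.1 r.2) = r.2

/-- A field of endomorphisms of `TZ` in the coordinates `c`. -/
noncomputable def coordEnd (B : ∀ z : Z, TangentSpace 𝓘(ℝ, EZ) z →L[ℝ] TangentSpace 𝓘(ℝ, EZ) z)
    (c : E → Z) (c' : Z → E) (y : E) : E →L[ℝ] E :=
  (mfderiv 𝓘(ℝ, EZ) 𝓘(ℝ, E) c' (c y)).comp ((B (c y)).comp (mfderiv 𝓘(ℝ, E) 𝓘(ℝ, EZ) c y))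

/-- A section of `Hom(TP, TZ)` in the coordinates `c` of `Z` and `e` of `P`. -/
noncomputable def coordHom
    (ν : ∀ (z : Z) (q : P), TangentSpace 𝓘(ℝ, EP) q →L[ℝ] TangentSpace 𝓘(ℝ, EZ) z)
    (c : E → Z) (c' : Z → E) (e : EP → P) (y : E) (q : EP) : EP →L[ℝ] E :=
  (mfderiv 𝓘(ℝ, EZ) 𝓘(ℝ, E) c' (c y)).comp ((ν (c y) (e q)).comp (mfderiv 𝓘(ℝ, EP) 𝓘(ℝ, EP) e q))

theorem eventually_forall_ball {p : Θ → X → Prop} {θ₀ : Θ} {x₀ : X}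
    (h : ∀ᶠ r in 𝓝 ((θ₀, x₀) : Θ × X), p r.1 r.2) :
    ∃ ε > 0, ∀ᶠ θ in 𝓝 θ₀, ∀ x ∈ Metric.ball x₀ ε, p θ x := by
  rw [nhds_prod_eq] at h
  obtain ⟨pa, ha, pb, hb, hab⟩ := eventually_prod_iff.1 h
  obtain ⟨ε, hε, hball⟩ := Metric.eventually_nhds_iff_ball.1 hb
  exact ⟨ε, hε, ha.mono fun n hn x hx => hab hn (hball x hx)⟩

namespace IsChartFamily

variable {c : Θ → E → Z} {c' : Θ → Z → E} {θ₀ : Θ} {y₀ : E}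

theorem contMDiffAt_coordEnd (hc : IsChartFamily EΘ EZ c c' θ₀ y₀)
    (B : ∀ z : Z, TangentSpace 𝓘(ℝ, EZ) z →L[ℝ] TangentSpace 𝓘(ℝ, EZ) z)
    (hB : ContMDiff 𝓘(ℝ, EZ).tangent 𝓘(ℝ, EZ).tangent 2
      (fun q : TangentBundle 𝓘(ℝ, EZ) Z => (⟨q.1, B q.1 q.2⟩ : TangentBundle 𝓘(ℝ, EZ) Z)))
    (w₀ : E) :
    ContMDiffAt (𝓘(ℝ, EΘ).prod 𝓘(ℝ, E × E)) 𝓘(ℝ, E) 2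
      (fun r : Θ × (E × E) => coordEnd B (c r.1) (c' r.1) r.2.1 r.2.2) (θ₀, (y₀, w₀)) := by
  have h1 := contMDiffAt_pushforward (w₀ := w₀) hc.smooth
  have h2 := hB.contMDiffAt.comp _ h1
  have h3 := ContMDiffAt.prodMk (contMDiffAt_fst (I := 𝓘(ℝ, EΘ)) (J := 𝓘(ℝ, E × E)) (n := 2)
    (p := ((θ₀, (y₀, w₀)) : Θ × (E × E)))) h2
  exact (contMDiffAt_pullback (T := Θ) (f := fun r : Θ × Z => c' r.1 r.2) (t₀ := θ₀) ⟨c θ₀ y₀, _⟩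
    hc.smooth').comp (θ₀, (y₀, w₀)) h3

theorem exists_coordEnd_bound (hc : IsChartFamily EΘ EZ c c' θ₀ y₀)
    (B : ∀ z : Z, TangentSpace 𝓘(ℝ, EZ) z →L[ℝ] TangentSpace 𝓘(ℝ, EZ) z)
    (hB : ContMDiff 𝓘(ℝ, EZ).tangent 𝓘(ℝ, EZ).tangent 2
      (fun q : TangentBundle 𝓘(ℝ, EZ) Z => (⟨q.1, B q.1 q.2⟩ : TangentBundle 𝓘(ℝ, EZ) Z))) :
    ∃ C, 0 ≤ C ∧ ∃ ε > 0, ∀ᶠ θ in 𝓝 θ₀, ∀ y ∈ Metric.ball y₀ ε,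
      ‖coordEnd B (c θ) (c' θ) y‖ ≤ C ∧ ∀ y' ∈ Metric.ball y₀ ε,
      ‖coordEnd B (c θ) (c' θ) y - coordEnd B (c θ) (c' θ) y'‖ ≤ C * ‖y - y'‖ :=
  exists_linear_bound (fun θ y => coordEnd B (c θ) (c' θ) y) (hc.contMDiffAt_coordEnd B hB 0)

theorem contMDiffAt_coordHom (hc : IsChartFamily EΘ EZ c c' θ₀ y₀)
    (ν : ∀ (z : Z) (q : P), TangentSpace 𝓘(ℝ, EP) q →L[ℝ] TangentSpace 𝓘(ℝ, EZ) z)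
    (hν : ContMDiff (𝓘(ℝ, EZ).prod 𝓘(ℝ, EP).tangent) 𝓘(ℝ, EZ).tangent 2
      (fun r : Z × TangentBundle 𝓘(ℝ, EP) P =>
        (⟨r.1, ν r.1 r.2.1 r.2.2⟩ : TangentBundle 𝓘(ℝ, EZ) Z)))
    (e : EP → P) (q₀ : EP) (he : ContMDiffAt 𝓘(ℝ, EP) 𝓘(ℝ, EP) 3 e q₀) (w₀ : EP) :
    ContMDiffAt (𝓘(ℝ, EΘ).prod 𝓘(ℝ, (E × EP) × EP)) 𝓘(ℝ, E) 2
      (fun r : Θ × ((E × EP) × EP) => coordHom ν (c r.1) (c' r.1) e r.2.1.1 r.2.1.2 r.2.2)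
      (θ₀, ((y₀, q₀), w₀)) := by
  have he' : ContMDiffAt (𝓘(ℝ, EΘ).prod 𝓘(ℝ, EP)) 𝓘(ℝ, EP) 3 (fun r : Θ × EP => e r.2) (θ₀, q₀) :=
    he.comp (θ₀, q₀) contMDiffAt_snd
  have h1 := contMDiffAt_pushforward (w₀ := w₀) he'
  have hp1 : ContMDiffAt (𝓘(ℝ, EΘ).prod 𝓘(ℝ, (E × EP) × EP)) (𝓘(ℝ, EΘ).prod 𝓘(ℝ, EP × EP)) 2
      (fun r : Θ × ((E × EP) × EP) => (r.1, (r.2.1.2, r.2.2))) (θ₀, ((y₀, q₀), w₀)) := by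
    refine contMDiffAt_fst.prodMk ?_
    have : ContMDiff 𝓘(ℝ, (E × EP) × EP) 𝓘(ℝ, EP × EP) 2
        (fun r : (E × EP) × EP => (r.1.2, r.2)) := ContDiff.contMDiff (by fun_prop)
    exact this.contMDiffAt.comp _ contMDiffAt_snd
  have hp2 : ContMDiffAt (𝓘(ℝ, EΘ).prod 𝓘(ℝ, (E × EP) × EP)) (𝓘(ℝ, EΘ).prod 𝓘(ℝ, E)) 2
      (fun r : Θ × ((E × EP) × EP) => (r.1, r.2.1.1)) (θ₀, ((y₀, q₀), w₀)) := by
    refine contMDiffAt_fst.prodMk ?_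
    have : ContMDiff 𝓘(ℝ, (E × EP) × EP) 𝓘(ℝ, E) 2
        (fun r : (E × EP) × EP => r.1.1) := ContDiff.contMDiff (by fun_prop)
    exact this.contMDiffAt.comp _ contMDiffAt_snd
  have h2 := ContMDiffAt.comp (θ₀, ((y₀, q₀), w₀)) h1 hp1
  have h3 := ContMDiffAt.comp (θ₀, ((y₀, q₀), w₀)) (hc.smooth.of_le (m := 2) (by norm_num)) hp2
  have h4 := hν.contMDiffAt.comp (θ₀, ((y₀, q₀), w₀)) (h3.prodMk h2)
  have h5 := ContMDiffAt.prodMk (contMDiffAt_fst (I := 𝓘(ℝ, EΘ)) (J := 𝓘(ℝ, (E × EP) × EP)) (n := 2)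
    (p := ((θ₀, ((y₀, q₀), w₀)) : Θ × ((E × EP) × EP)))) h4
  exact (contMDiffAt_pullback (T := Θ) (f := fun r : Θ × Z => c' r.1 r.2) (t₀ := θ₀) ⟨c θ₀ y₀, _⟩
    hc.smooth').comp (θ₀, ((y₀, q₀), w₀)) h5

theorem exists_coordHom_bound (hc : IsChartFamily EΘ EZ c c' θ₀ y₀)
    (ν : ∀ (z : Z) (q : P), TangentSpace 𝓘(ℝ, EP) q →L[ℝ] TangentSpace 𝓘(ℝ, EZ) z)
    (hν : ContMDiff (𝓘(ℝ, EZ).prod 𝓘(ℝ, EP).tangent) 𝓘(ℝ, EZ).tangent 2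
      (fun r : Z × TangentBundle 𝓘(ℝ, EP) P =>
        (⟨r.1, ν r.1 r.2.1 r.2.2⟩ : TangentBundle 𝓘(ℝ, EZ) Z)))
    (e : EP → P) (q₀ : EP) (he : ContMDiffAt 𝓘(ℝ, EP) 𝓘(ℝ, EP) 3 e q₀) :
    ∃ C, 0 ≤ C ∧ ∃ ε > 0, ∀ᶠ θ in 𝓝 θ₀, ∀ x ∈ Metric.ball (y₀, q₀) ε,
      ‖coordHom ν (c θ) (c' θ) e x.1 x.2‖ ≤ C ∧ ∀ x' ∈ Metric.ball (y₀, q₀) ε,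
      ‖coordHom ν (c θ) (c' θ) e x.1 x.2 - coordHom ν (c θ) (c' θ) e x'.1 x'.2‖ ≤ C * ‖x - x'‖ :=
  exists_linear_bound (fun θ (x : E × EP) => coordHom ν (c θ) (c' θ) e x.1 x.2)
    (hc.contMDiffAt_coordHom ν hν e q₀ he 0)

theorem exists_metric_bound (hc : IsChartFamily EΘ EZ c c' θ₀ y₀)
    (g : ∀ z : Z, TangentSpace 𝓘(ℝ, EZ) z →L[ℝ] TangentSpace 𝓘(ℝ, EZ) z →L[ℝ] ℝ)
    (hg : ContMDiff 𝓘(ℝ, EZ).tangent 𝓘(ℝ, ℝ) 2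
      (fun q : TangentBundle 𝓘(ℝ, EZ) Z => g q.1 q.2 q.2)) :
    ∃ C, 0 ≤ C ∧ ∃ ε > 0, ∀ᶠ θ in 𝓝 θ₀, ∀ y ∈ Metric.ball y₀ ε, ∀ w : E,
      Real.sqrt (g (c θ y) (mfderiv 𝓘(ℝ, E) 𝓘(ℝ, EZ) (c θ) y w)
        (mfderiv 𝓘(ℝ, E) 𝓘(ℝ, EZ) (c θ) y w)) ≤ C * ‖w‖ := by
  have h1 := contMDiffAt_pushforward (w₀ := (0 : E)) hc.smooth
  have h2 := (hg.contMDiffAt.comp _ h1).continuousAt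
  have h3 : ∀ᶠ r in 𝓝 ((θ₀, (y₀, 0)) : Θ × (E × E)), (g (c r.1 r.2.1)
      (mfderiv 𝓘(ℝ, E) 𝓘(ℝ, EZ) (c r.1) r.2.1 r.2.2)
        (mfderiv 𝓘(ℝ, E) 𝓘(ℝ, EZ) (c r.1) r.2.1 r.2.2)) < 1 := by
    have h4 := h2.tendsto.eventually_lt_const (u := 1) (by
      simp only [Function.comp_apply]
      erw [map_zero, map_zero]
      exact zero_lt_one)
    exact h4
  obtain ⟨ε, hε, h⟩ := eventually_forall_ball (p := fun θ (r : E × E) => (g (c θ r.1)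
      (mfderiv 𝓘(ℝ, E) 𝓘(ℝ, EZ) (c θ) r.1 r.2)
        (mfderiv 𝓘(ℝ, E) 𝓘(ℝ, EZ) (c θ) r.1 r.2)) < 1) h3
  refine ⟨2 / ε, by positivity, ε, hε, ?_⟩
  filter_upwards [h] with θ hθ y hy w
  rcases eq_or_ne w 0 with rfl | hw
  · erw [map_zero, map_zero]
    simp
  have hwn : 0 < ‖w‖ := norm_pos_iff.2 hw
  set a : ℝ := ε / (2 * ‖w‖) with ha
  have hapos : 0 < a := by positivity
  have hmem : (y, a • w) ∈ Metric.ball ((y₀, 0) : E × E) ε := by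
    rw [← ball_prod_same]
    refine ⟨hy, ?_⟩
    rw [mem_ball_zero_iff, norm_smul, Real.norm_of_nonneg hapos.le, ha]
    field_simp
    linarith
  have h5 := hθ _ hmem
  set u : TangentSpace 𝓘(ℝ, EZ) (c θ y) := mfderiv 𝓘(ℝ, E) 𝓘(ℝ, EZ) (c θ) y w with hu
  have h6 : (mfderiv 𝓘(ℝ, E) 𝓘(ℝ, EZ) (c θ) y (a • w) : TangentSpace 𝓘(ℝ, EZ) (c θ y)) = a • u :=
    map_smul _ _ _
  have h7 : g (c θ y) (a • u) (a • u) < 1 := by rw [← h6]; exact h5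
  rw [map_smul, map_smul, smul_apply, smul_eq_mul, smul_eq_mul] at h7
  refine Real.sqrt_le_iff.2 ⟨by positivity, ?_⟩
  have h8 : (2 / ε * ‖w‖) = a⁻¹ := by rw [ha]; field_simp
  rw [h8, inv_pow, ← one_div, le_div_iff₀ (by positivity)]
  nlinarith

theorem mfderiv_inv (hc : IsChartFamily EΘ EZ c c' θ₀ y₀) : ∃ ε > 0, ∀ᶠ θ in 𝓝 θ₀, ∀ y ∈ Metric.ball y₀ ε,
    MDifferentiableAt 𝓘(ℝ, E) 𝓘(ℝ, EZ) (c θ) y ∧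
    MDifferentiableAt 𝓘(ℝ, EZ) 𝓘(ℝ, E) (c' θ) (c θ y) ∧ c' θ (c θ y) = y ∧
    (∀ w : E, mfderiv 𝓘(ℝ, EZ) 𝓘(ℝ, E) (c' θ) (c θ y) (mfderiv 𝓘(ℝ, E) 𝓘(ℝ, EZ) (c θ) y w) = w) ∧
    (∀ u : EZ, (mfderiv 𝓘(ℝ, E) 𝓘(ℝ, EZ) (c θ) y
      (mfderiv 𝓘(ℝ, EZ) 𝓘(ℝ, E) (c' θ) (c θ y) u : E) : EZ) = u) := by
  have hcont : Tendsto (fun r : Θ × E => (r.1, c r.1 r.2)) (𝓝 (θ₀, y₀)) (𝓝 (θ₀, c θ₀ y₀)) :=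
    continuousAt_fst.prodMk hc.smooth.continuousAt
  have h1 : ∀ᶠ r in 𝓝 ((θ₀, y₀) : Θ × E), ContMDiffAt (𝓘(ℝ, EΘ).prod 𝓘(ℝ, E)) 𝓘(ℝ, EZ) 3
      (fun r : Θ × E => c r.1 r.2) r := (contMDiffAt_iff_contMDiffAt_nhds (by simp)).1 hc.smooth
  have h2 := hcont.eventually ((contMDiffAt_iff_contMDiffAt_nhds (by simp)).1 hc.smooth')
  have h3 := hc.left_inv.eventually_nhds
  have h4 := hcont.eventually hc.right_inv.eventually_nhds
  obtain ⟨ε, hε, h⟩ := eventually_forall_ball (p := fun θ y =>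
    ((ContMDiffAt (𝓘(ℝ, EΘ).prod 𝓘(ℝ, E)) 𝓘(ℝ, EZ) 3 (fun r : Θ × E => c r.1 r.2) (θ, y) ∧
    ContMDiffAt (𝓘(ℝ, EΘ).prod 𝓘(ℝ, EZ)) 𝓘(ℝ, E) 3 (fun r : Θ × Z => c' r.1 r.2) (θ, c θ y)) ∧
    (∀ᶠ r in 𝓝 (θ, y), c' r.1 (c r.1 r.2) = r.2)) ∧
    ∀ᶠ r in 𝓝 (θ, c θ y), c r.1 (c' r.1 r.2) = r.2) (((h1.and h2).and h3).and h4)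
  refine ⟨ε, hε, ?_⟩
  filter_upwards [h] with θ hθ y hy
  obtain ⟨⟨⟨k1, k2⟩, k3⟩, k4⟩ := hθ y hy
  have m1 : ContMDiffAt 𝓘(ℝ, E) 𝓘(ℝ, EZ) 3 (c θ) y :=
    ContMDiffAt.comp (g := fun r : Θ × E => c r.1 r.2) y k1 (contMDiffAt_const.prodMk contMDiffAt_id)
  have m2 : ContMDiffAt 𝓘(ℝ, EZ) 𝓘(ℝ, E) 3 (c' θ) (c θ y) :=
    ContMDiffAt.comp (g := fun r : Θ × Z => c' r.1 r.2) (c θ y) k2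
      (contMDiffAt_const.prodMk contMDiffAt_id)
  have d1 := m1.mdifferentiableAt (by norm_num)
  have d2 := m2.mdifferentiableAt (by norm_num)
  have k3' : ∀ᶠ x in 𝓝 y, c' θ (c θ x) = x :=
    (Continuous.prodMk_right θ).continuousAt.eventually k3
  have k4' : ∀ᶠ z in 𝓝 (c θ y), c θ (c' θ z) = z :=
    (Continuous.prodMk_right θ).continuousAt.eventually k4
  have k5 : c' θ (c θ y) = y := k3'.self_of_nhds
  refine ⟨d1, d2, k5, fun w => ?_, fun u => ?_⟩
  · have e1 := mfderiv_comp_apply y d2 d1 w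
    rw [← e1]
    have e2 : (c' θ ∘ c θ) =ᶠ[𝓝 y] id := k3'
    rw [e2.mfderiv_eq, mfderiv_id]
    rfl
  · have d1' : MDifferentiableAt 𝓘(ℝ, E) 𝓘(ℝ, EZ) (c θ) (c' θ (c θ y)) := by rwa [k5]
    have e1 := mfderiv_comp_apply (c θ y) d1' d2 u
    rw [k5] at e1
    refine e1.symm.trans ?_
    have e2 : (c θ ∘ c' θ) =ᶠ[𝓝 (c θ y)] id := k4'
    rw [e2.mfderiv_eq, mfderiv_id]
    rfl

end IsChartFamily

end Coordinates

section CoordinateFormula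

variable {EZ : Type*} [NormedAddCommGroup EZ] [NormedSpace ℝ EZ]
  {Z : Type*} [TopologicalSpace Z] [ChartedSpace EZ Z] [IsManifold 𝓘(ℝ, EZ) ∞ Z]
  {W : Type*} [NormedAddCommGroup W] [NormedSpace ℝ W]
  {EΘ : Type*} [NormedAddCommGroup EΘ] [NormedSpace ℝ EΘ]
  {Θ : Type*} [TopologicalSpace Θ] [ChartedSpace EΘ Θ]
  {EP : Type*} [NormedAddCommGroup EP] [NormedSpace ℝ EP]
  {P : Type*} [TopologicalSpace P] [ChartedSpace EP P] [IsManifold 𝓘(ℝ, EP) ∞ P]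
  {EN : Type*} [NormedAddCommGroup EN] [NormedSpace ℝ EN]
  {N : Type*} [TopologicalSpace N] [ChartedSpace EN N]
  {S : Type*} [TopologicalSpace S] [ChartedSpace ℂ S] [IsManifold 𝓘(ℝ, ℂ) ∞ S]
  {E : Type*} [NormedAddCommGroup E] [NormedSpace ℝ E]
  {ℓ : ℕ}

/-- The expression `(dF + J dF j) / 2 - ν(F, φ) dφ` in local coordinates. -/
noncomputable def coordDbar (J : E → E →L[ℝ] E) (ν : E → EP → EP →L[ℝ] E) (j : ℂ →L[ℝ] ℂ)
    (F : ℂ → E) (φ : ℂ → EP) (z : ℂ) : ℂ →L[ℝ] E :=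
  (1 / 2 : ℝ) • (fderiv ℝ F z + (J (F z)).comp ((fderiv ℝ F z).comp j)) -
    (ν (F z) (φ z)).comp (fderiv ℝ φ z)

theorem mdifferentiableAt_of_mem_maximalAtlas {e : OpenPartialHomeomorph S ℂ}
    (he : e ∈ IsManifold.maximalAtlas 𝓘(ℝ, ℂ) ∞ S) {p : S} (hp : p ∈ e.source) :
    MDifferentiableAt 𝓘(ℝ, ℂ) 𝓘(ℝ, ℂ) e p :=
  ((contMDiffOn_of_mem_maximalAtlas he).contMDiffAt
    (e.open_source.mem_nhds hp)).mdifferentiableAt (by simp)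

theorem mdifferentiableAt_symm_of_mem_maximalAtlas {e : OpenPartialHomeomorph S ℂ}
    (he : e ∈ IsManifold.maximalAtlas 𝓘(ℝ, ℂ) ∞ S) {z : ℂ} (hz : z ∈ e.target) :
    MDifferentiableAt 𝓘(ℝ, ℂ) 𝓘(ℝ, ℂ) e.symm z :=
  ((contMDiffOn_symm_of_mem_maximalAtlas he).contMDiffAt
    (e.open_target.mem_nhds hz)).mdifferentiableAt (by simp)

theorem mfderiv_mfderiv_symm {e : OpenPartialHomeomorph S ℂ}
    (he : e ∈ IsManifold.maximalAtlas 𝓘(ℝ, ℂ) ∞ S) {z : ℂ} (hz : z ∈ e.target) (ζ : ℂ) :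
    (mfderiv 𝓘(ℝ, ℂ) 𝓘(ℝ, ℂ) e (e.symm z) (mfderiv 𝓘(ℝ, ℂ) 𝓘(ℝ, ℂ) e.symm z ζ) : ℂ) = ζ := by
  have h1 := mfderiv_comp_apply z (mdifferentiableAt_of_mem_maximalAtlas he (e.map_target hz))
    (mdifferentiableAt_symm_of_mem_maximalAtlas he hz) ζ
  refine h1.symm.trans ?_
  have h2 : (e ∘ e.symm) =ᶠ[𝓝 z] id := by
    filter_upwards [e.open_target.mem_nhds hz] with x hx using e.right_inv hx
  rw [h2.mfderiv_eq, mfderiv_id]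
  rfl

theorem mfderiv_symm_mfderiv {e : OpenPartialHomeomorph S ℂ}
    (he : e ∈ IsManifold.maximalAtlas 𝓘(ℝ, ℂ) ∞ S) {z : ℂ} (hz : z ∈ e.target)
    (u : TangentSpace 𝓘(ℝ, ℂ) (e.symm z)) :
    (mfderiv 𝓘(ℝ, ℂ) 𝓘(ℝ, ℂ) e.symm z (mfderiv 𝓘(ℝ, ℂ) 𝓘(ℝ, ℂ) e (e.symm z) u) :
      TangentSpace 𝓘(ℝ, ℂ) (e.symm z)) = u := by
  have hz' : MDifferentiableAt 𝓘(ℝ, ℂ) 𝓘(ℝ, ℂ) e.symm (e (e.symm z)) := by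
    rw [e.right_inv hz]
    exact mdifferentiableAt_symm_of_mem_maximalAtlas he hz
  have h1 := mfderiv_comp_apply (e.symm z) hz'
    (mdifferentiableAt_of_mem_maximalAtlas he (e.map_target hz)) u
  rw [e.right_inv hz] at h1
  refine h1.symm.trans ?_
  have h2 : (e.symm ∘ e) =ᶠ[𝓝 (e.symm z)] id := by
    filter_upwards [e.open_source.mem_nhds (e.map_target hz)] with x hx using e.left_inv hx
  rw [h2.mfderiv_eq, mfderiv_id]
  rfl

/-- The derivative of a map with a coordinate expression `c ∘ F'`. -/
theorem mfderiv_eq_of_coord {G : Type*} [NormedAddCommGroup G] [NormedSpace ℝ G]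
    {EM : Type*} [NormedAddCommGroup EM] [NormedSpace ℝ EM]
    {M : Type*} [TopologicalSpace M] [ChartedSpace EM M]
    {e : OpenPartialHomeomorph S ℂ}
    (he : e ∈ IsManifold.maximalAtlas 𝓘(ℝ, ℂ) ∞ S) {z : ℂ} (hz : z ∈ e.target)
    {F : S → M} {c : G → M} {F' : ℂ → G} (hF : ∀ᶠ x in 𝓝 z, F (e.symm x) = c (F' x))
    (hc : MDifferentiableAt 𝓘(ℝ, G) 𝓘(ℝ, EM) c (F' z)) (hF' : DifferentiableAt ℝ F' z)
    (u : TangentSpace 𝓘(ℝ, ℂ) (e.symm z)) :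
    (mfderiv 𝓘(ℝ, ℂ) 𝓘(ℝ, EM) F (e.symm z) u : EM) =
      mfderiv 𝓘(ℝ, G) 𝓘(ℝ, EM) c (F' z)
        (fderiv ℝ F' z (mfderiv 𝓘(ℝ, ℂ) 𝓘(ℝ, ℂ) e (e.symm z) u : ℂ)) := by
  have hes : Tendsto e (𝓝 (e.symm z)) (𝓝 z) := by
    have := e.continuousAt (e.map_target hz)
    rwa [ContinuousAt, e.right_inv hz] at this
  have h2 : F =ᶠ[𝓝 (e.symm z)] (fun x => c (F' x)) ∘ e := by
    filter_upwards [hes.eventually hF, e.open_source.mem_nhds (e.map_target hz)] with x hx hx'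
    rw [e.left_inv hx'] at hx
    exact hx
  have hd : MDifferentiableAt 𝓘(ℝ, ℂ) 𝓘(ℝ, EM) (fun x => c (F' x)) (e (e.symm z)) := by
    rw [e.right_inv hz]
    exact hc.comp z hF'.mdifferentiableAt
  have h3 := mfderiv_comp_apply (e.symm z) hd
    (mdifferentiableAt_of_mem_maximalAtlas he (e.map_target hz)) u
  rw [h2.mfderiv_eq]
  refine h3.trans ?_
  rw [e.right_inv hz]
  have h4 := mfderiv_comp_apply z hc hF'.mdifferentiableAt
    (mfderiv 𝓘(ℝ, ℂ) 𝓘(ℝ, ℂ) e (e.symm z) u : ℂ)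
  refine h4.trans ?_
  rw [mfderiv_eq_fderiv]
  rfl

variable {T : SumFibration EZ Z W EΘ Θ} (A : CompatiblePair T EP P) (D : CurveFamily S EN N A.jP ℓ)

/-- The complex structure of the domain in the coordinate `e`. -/
noncomputable def coordJ (j : ∀ p : S, TangentSpace 𝓘(ℝ, ℂ) p →L[ℝ] TangentSpace 𝓘(ℝ, ℂ) p)
    (e : OpenPartialHomeomorph S ℂ) (z : ℂ) : ℂ →L[ℝ] ℂ :=
  (mfderiv 𝓘(ℝ, ℂ) 𝓘(ℝ, ℂ) e (e.symm z)).comp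
    ((j (e.symm z)).comp (mfderiv 𝓘(ℝ, ℂ) 𝓘(ℝ, ℂ) e.symm z))

theorem dbarSub_eq_coordDbar {e : OpenPartialHomeomorph S ℂ}
    (he : e ∈ IsManifold.maximalAtlas 𝓘(ℝ, ℂ) ∞ S) {z : ℂ} (hz : z ∈ e.target)
    {F : S → Z} {c : E → Z} {c' : Z → E} {F' : ℂ → E}
    (hF : ∀ᶠ x in 𝓝 z, F (e.symm x) = c (F' x))
    (hc : MDifferentiableAt 𝓘(ℝ, E) 𝓘(ℝ, EZ) c (F' z)) (hF' : DifferentiableAt ℝ F' z)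
    (hcc' : ∀ u : EZ, (mfderiv 𝓘(ℝ, E) 𝓘(ℝ, EZ) c (F' z)
      (mfderiv 𝓘(ℝ, EZ) 𝓘(ℝ, E) c' (c (F' z)) u : E) : EZ) = u)
    {b : N} {μ : Fin ℓ → ℂ} {ψ : EP → P} {φ' : ℂ → EP}
    (hφ : ∀ᶠ x in 𝓝 z, D.φ b μ (e.symm x) = ψ (φ' x))
    (hψ : MDifferentiableAt 𝓘(ℝ, EP) 𝓘(ℝ, EP) ψ (φ' z)) (hφ' : DifferentiableAt ℝ φ' z) (ζ : ℂ) :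
    (dbarSub A D b μ F (e.symm z) (mfderiv 𝓘(ℝ, ℂ) 𝓘(ℝ, ℂ) e.symm z ζ) : EZ) =
      mfderiv 𝓘(ℝ, E) 𝓘(ℝ, EZ) c (F' z) (coordDbar (coordEnd A.J c c') (coordHom A.ν c c' ψ)
        (coordJ (D.j b) e z) F' φ' z ζ) := by
  have hFz := hF.self_of_nhds
  have hφz := hφ.self_of_nhds
  have key1 : ∀ w : Z, w = c (F' z) → ∀ v : EZ, (A.J w v : EZ) = A.J (c (F' z)) v := by
    rintro _ rfl v; rfl
  have key2 : ∀ w : Z, w = c (F' z) → ∀ q : P, q = ψ (φ' z) →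
      ∀ v : EP, (A.ν w q v : EZ) = A.ν (c (F' z)) (ψ (φ' z)) v := by
    rintro _ rfl _ rfl v; rfl
  have e0 : ∀ u : TangentSpace 𝓘(ℝ, ℂ) (e.symm z), (dbarSub A D b μ F (e.symm z) u : EZ) =
      (1 / 2 : ℝ) • ((mfderiv 𝓘(ℝ, ℂ) 𝓘(ℝ, EZ) F (e.symm z) u : EZ) +
      (A.J (F (e.symm z)) (mfderiv 𝓘(ℝ, ℂ) 𝓘(ℝ, EZ) F (e.symm z) (D.j b (e.symm z) u)) : EZ)) -
      (A.ν (F (e.symm z)) (D.φ b μ (e.symm z))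
        (mfderiv 𝓘(ℝ, ℂ) 𝓘(ℝ, EP) (D.φ b μ) (e.symm z) u) : EZ) := fun u => rfl
  rw [e0]
  have e1 := mfderiv_eq_of_coord he hz hF hc hF'
  have e2 := mfderiv_eq_of_coord he hz hφ hψ hφ'
  set u : TangentSpace 𝓘(ℝ, ℂ) (e.symm z) := mfderiv 𝓘(ℝ, ℂ) 𝓘(ℝ, ℂ) e.symm z ζ with hu
  have hu' : (mfderiv 𝓘(ℝ, ℂ) 𝓘(ℝ, ℂ) e (e.symm z) u : ℂ) = ζ := mfderiv_mfderiv_symm he hz ζ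
  have t1 : (mfderiv 𝓘(ℝ, ℂ) 𝓘(ℝ, EZ) F (e.symm z) u : EZ) =
      mfderiv 𝓘(ℝ, E) 𝓘(ℝ, EZ) c (F' z) (fderiv ℝ F' z ζ) := by
    rw [← hu']; exact e1 u
  have t2 : (A.J (F (e.symm z)) (mfderiv 𝓘(ℝ, ℂ) 𝓘(ℝ, EZ) F (e.symm z) (D.j b (e.symm z) u)) : EZ) =
      A.J (c (F' z)) (mfderiv 𝓘(ℝ, E) 𝓘(ℝ, EZ) c (F' z)
        (fderiv ℝ F' z (coordJ (D.j b) e z ζ))) :=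
    (key1 _ hFz _).trans (congrArg (fun v : EZ => (A.J (c (F' z)) v : EZ)) (e1 _))
  have t3 : (A.ν (F (e.symm z)) (D.φ b μ (e.symm z))
        (mfderiv 𝓘(ℝ, ℂ) 𝓘(ℝ, EP) (D.φ b μ) (e.symm z) u) : EZ) =
      A.ν (c (F' z)) (ψ (φ' z)) (mfderiv 𝓘(ℝ, EP) 𝓘(ℝ, EP) ψ (φ' z) (fderiv ℝ φ' z ζ)) := by
    refine (key2 _ hFz _ hφz _).trans
      (congrArg (fun v : EP => (A.ν (c (F' z)) (ψ (φ' z)) v : EZ)) ?_)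
    rw [← hu']; exact e2 u
  refine (congrArg₂ (fun x y : EZ => x - y)
    (congrArg₂ (fun x y : EZ => (1 / 2 : ℝ) • (x + y)) t1 t2) t3).trans ?_
  let L' : EZ →L[ℝ] E := mfderiv 𝓘(ℝ, EZ) 𝓘(ℝ, E) c' (c (F' z))
  have e3 : (coordDbar (coordEnd A.J c c') (coordHom A.ν c c' ψ)
        (coordJ (D.j b) e z) F' φ' z ζ : E) =
      (1 / 2 : ℝ) • (fderiv ℝ F' z ζ + L'
        (A.J (c (F' z)) (mfderiv 𝓘(ℝ, E) 𝓘(ℝ, EZ) c (F' z)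
          (fderiv ℝ F' z (coordJ (D.j b) e z ζ))))) -
      L' (A.ν (c (F' z)) (ψ (φ' z))
        (mfderiv 𝓘(ℝ, EP) 𝓘(ℝ, EP) ψ (φ' z) (fderiv ℝ φ' z ζ))) := rfl
  rw [e3]
  have e4 : ∀ (L : E →L[ℝ] EZ) (x y w : E), L ((1 / 2 : ℝ) • (x + y) - w) =
      (1 / 2 : ℝ) • (L x + L y) - L w := by
    intro L x y w
    rw [map_sub, map_smul, map_add]
  refine Eq.trans ?_ (e4 (mfderiv 𝓘(ℝ, E) 𝓘(ℝ, EZ) c (F' z)) _ _ _).symm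
  erw [hcc', hcc']
  rfl

/-- The pointwise norm of a one-form in terms of its coordinate expression. -/
theorem ptNorm_le_of_coord {e : OpenPartialHomeomorph S ℂ}
    (he : e ∈ IsManifold.maximalAtlas 𝓘(ℝ, ℂ) ∞ S) {z : ℂ} (hz : z ∈ e.target) {b : N} {w : Z}
    {c : E → Z} {y : E} (hw : w = c y)
    (η : TangentSpace 𝓘(ℝ, ℂ) (e.symm z) →L[ℝ] TangentSpace 𝓘(ℝ, EZ) w) (η' : ℂ →L[ℝ] E)
    (hη : ∀ ζ : ℂ, (η (mfderiv 𝓘(ℝ, ℂ) 𝓘(ℝ, ℂ) e.symm z ζ) : EZ) =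
      mfderiv 𝓘(ℝ, E) 𝓘(ℝ, EZ) c y (η' ζ))
    {C B R : ℝ} (hC : 0 ≤ C) (hR : 0 ≤ R)
    (hg : ∀ x : E, Real.sqrt (A.g (c y) (mfderiv 𝓘(ℝ, E) 𝓘(ℝ, EZ) c y x)
      (mfderiv 𝓘(ℝ, E) 𝓘(ℝ, EZ) c y x)) ≤ C * ‖x‖)
    (hB : ∀ ζ : ℂ, D.h b (e.symm z) (mfderiv 𝓘(ℝ, ℂ) 𝓘(ℝ, ℂ) e.symm z ζ)
      (mfderiv 𝓘(ℝ, ℂ) 𝓘(ℝ, ℂ) e.symm z ζ) ≤ 1 → ‖ζ‖ ≤ B)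
    (hη' : ∀ ζ, ‖η' ζ‖ ≤ R * ‖ζ‖) :
    ptNorm A D b (e.symm z) w η ≤ ENNReal.ofReal (C * (R * B)) := by
  subst hw
  refine iSup_le fun u => iSup_le fun hu => ENNReal.ofReal_le_ofReal ?_
  set ζ : ℂ := mfderiv 𝓘(ℝ, ℂ) 𝓘(ℝ, ℂ) e (e.symm z) u with hζ
  have hu' : (mfderiv 𝓘(ℝ, ℂ) 𝓘(ℝ, ℂ) e.symm z ζ : TangentSpace 𝓘(ℝ, ℂ) (e.symm z)) = u :=
    mfderiv_symm_mfderiv he hz u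
  have h1 := hB ζ (by rw [hu']; exact hu)
  have h2 : (η u : TangentSpace 𝓘(ℝ, EZ) (c y)) = mfderiv 𝓘(ℝ, E) 𝓘(ℝ, EZ) c y (η' ζ) := by
    rw [← hu']; exact hη ζ
  rw [h2]
  refine (hg _).trans ?_
  have := hη' ζ
  gcongr
  exact this.trans (by gcongr)

end CoordinateFormula

section NeckEstimates

variable {W : Type*} [NormedAddCommGroup W] [NormedSpace ℝ W]
  {EP : Type*} [NormedAddCommGroup EP] [NormedSpace ℝ EP]

/-- Bounds for an almost complex structure and a perturbation in coordinates `(v, x, y)` in which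
both are tangent to `V = {x = y = 0}`. -/
structure TangentBounds (C ε : ℝ) (q₀ : EP)
    (J : W × (Fin 2 → ℂ) → W × (Fin 2 → ℂ) →L[ℝ] W × (Fin 2 → ℂ))
    (ν : W × (Fin 2 → ℂ) → EP → EP →L[ℝ] W × (Fin 2 → ℂ)) : Prop where
  J_norm : ∀ y ∈ Metric.ball 0 ε, ‖J y‖ ≤ C
  J_lip : ∀ y ∈ Metric.ball 0 ε, ∀ y' ∈ Metric.ball 0 ε, ‖J y - J y'‖ ≤ C * ‖y - y'‖
  J_tan : ∀ v ∈ Metric.ball (0 : W) ε, ∀ w, (J (v, 0) (w, 0)).2 = 0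
  ν_norm : ∀ y ∈ Metric.ball 0 ε, ∀ q ∈ Metric.ball q₀ ε, ‖ν y q‖ ≤ C
  ν_lip : ∀ y ∈ Metric.ball 0 ε, ∀ q ∈ Metric.ball q₀ ε, ∀ y' ∈ Metric.ball 0 ε,
    ∀ q' ∈ Metric.ball q₀ ε, ‖ν y q - ν y' q'‖ ≤ C * (‖y - y'‖ + ‖q - q'‖)
  ν_tan : ∀ v ∈ Metric.ball (0 : W) ε, ∀ q ∈ Metric.ball q₀ ε, ∀ w, (ν (v, 0) q w).2 = 0
  ν_mixed : ∀ y ∈ Metric.ball 0 ε, ∀ q ∈ Metric.ball q₀ ε, ∀ q' ∈ Metric.ball q₀ ε, ∀ w,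
    ‖(ν y q w - ν y q' w).2‖ ≤ C * ‖y.2‖ * ‖q - q'‖ * ‖w‖

/-- Bounds as in `TangentBounds`, for an almost complex structure that induces the standard one on
the normal space of `V` at the origin. -/
structure NodeBounds (C ε : ℝ) (q₀ : EP)
    (J : W × (Fin 2 → ℂ) → W × (Fin 2 → ℂ) →L[ℝ] W × (Fin 2 → ℂ))
    (ν : W × (Fin 2 → ℂ) → EP → EP →L[ℝ] W × (Fin 2 → ℂ)) : Prop
    extends TangentBounds C ε q₀ J ν where
  J_nor : ∀ n, (J 0 (0, n)).2 = Complex.I • n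

/-- Bounds for a map to `{y_j = 0, j ≠ i}` with contact of order `s` with `V` at the origin. -/
structure LeafBounds (C r : ℝ) (i : Fin 2) (s : ℕ) (a : ℂ) (f : ℂ → W × (Fin 2 → ℂ)) : Prop where
  diff : ∀ z ∈ Metric.ball (0 : ℂ) r, DifferentiableAt ℝ f z
  norm_le : ∀ z ∈ Metric.ball (0 : ℂ) r, ‖f z‖ ≤ C * ‖z‖
  fderiv_le : ∀ z ∈ Metric.ball (0 : ℂ) r, ‖fderiv ℝ f z‖ ≤ C
  leaf : ∀ z ∈ Metric.ball (0 : ℂ) r, ∀ j, j ≠ i → (f z).2 j = 0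
  rem : ∀ z ∈ Metric.ball (0 : ℂ) r, ‖(f z).2 i - a * z ^ s‖ ≤ C * ‖z‖ ^ (s + 1)
  rem' : ∀ z ∈ Metric.ball (0 : ℂ) r, z ≠ 0 →
    ‖fderiv ℝ (fun z => (f z).2 i - a * z ^ s) z‖ ≤ C * ‖z‖ ^ s
  a_le : ‖a‖ ≤ C
  le_a : 1 ≤ C * ‖a‖

/-- The normal coordinate of the map, interpolated to its leading term. -/
noncomputable def neckCoord (i : Fin 2) (s : ℕ) (a : ℂ) (f : ℂ → W × (Fin 2 → ℂ)) (t : ℂ → ℝ)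
    (z : ℂ) : ℂ :=
  a * z ^ s + ((1 - t z : ℝ) : ℂ) * ((f z).2 i - a * z ^ s)

/-- The glued map in local coordinates. -/
noncomputable def neckMap (i : Fin 2) (s : ℕ) (a lam : ℂ) (f : ℂ → W × (Fin 2 → ℂ)) (t : ℂ → ℝ)
    (z : ℂ) : W × (Fin 2 → ℂ) :=
  ((1 - t z) • (f z).1, pair i (neckCoord i s a f t z) (lam / neckCoord i s a f t z))

variable {C r : ℝ} {i : Fin 2} {s : ℕ} {a : ℂ} {f : ℂ → W × (Fin 2 → ℂ)} {t : ℂ → ℝ} {z : ℂ}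

theorem LeafBounds.neckCoord_bounds (hf : LeafBounds C r i s a f) (hC : 1 ≤ C) (hs : 1 ≤ s)
    (hz : z ∈ Metric.ball (0 : ℂ) r) (hz0 : z ≠ 0) (hz1 : 2 * C ^ 2 * ‖z‖ ≤ 1)
    (ht : DifferentiableAt ℝ t z) (ht0 : 0 ≤ t z) (ht1 : t z ≤ 1)
    (ht' : ‖fderiv ℝ t z‖ * ‖z‖ ≤ C) :
    ‖z‖ ^ s ≤ 2 * C * ‖neckCoord i s a f t z‖ ∧ ‖neckCoord i s a f t z‖ ≤ 2 * C * ‖z‖ ^ s ∧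
    ∃ X' : ℂ →L[ℝ] ℂ, HasFDerivAt (neckCoord i s a f t) X' z ∧
      (∀ ζ, ‖X' ζ‖ ≤ (s + 2) * C ^ 2 * ‖z‖ ^ (s - 1) * ‖ζ‖) ∧
      ∀ ζ, ‖X' (Complex.I * ζ) - Complex.I * X' ζ‖ ≤ 4 * C ^ 2 * ‖z‖ ^ s * ‖ζ‖ := by
  have hzp : 0 < ‖z‖ := norm_pos_iff.2 hz0
  have hrem := hf.rem z hz
  have hrem' := hf.rem' z hz hz0
  set R : ℂ → ℂ := fun z => (f z).2 i - a * z ^ s with hR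
  have hCC : C ≤ C ^ 2 := by nlinarith
  have hz2 : ‖z‖ ≤ 1 := by nlinarith
  have hps : 0 < ‖z‖ ^ s := by positivity
  have hp1 : ‖z‖ ^ (s + 1) = ‖z‖ ^ s * ‖z‖ := pow_succ _ _
  have hp0 : ‖z‖ ^ s = ‖z‖ ^ (s - 1) * ‖z‖ := by rw [← pow_succ, Nat.sub_add_cancel hs]
  have h1t : ‖((1 - t z : ℝ) : ℂ)‖ ≤ 1 := by
    rw [Complex.norm_real, Real.norm_of_nonneg (by linarith)]; linarith
  have hRt : ‖((1 - t z : ℝ) : ℂ) * R z‖ ≤ C * ‖z‖ ^ (s + 1) := by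
    rw [norm_mul]
    calc _ ≤ 1 * (C * ‖z‖ ^ (s + 1)) := by gcongr
      _ = _ := one_mul _
  have hX : neckCoord i s a f t z = a * z ^ s + ((1 - t z : ℝ) : ℂ) * R z := rfl
  have hpow : ‖a * z ^ s‖ = ‖a‖ * ‖z‖ ^ s := by rw [norm_mul, norm_pow]
  have hCz : 2 * C * (C * ‖z‖ ^ (s + 1)) ≤ ‖z‖ ^ s := by
    rw [hp1]; nlinarith
  refine ⟨?_, ?_, ?_⟩
  · have h2 : ‖a‖ * ‖z‖ ^ s - C * ‖z‖ ^ (s + 1) ≤ ‖neckCoord i s a f t z‖ := by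
      rw [hX, ← hpow]
      have := norm_sub_le_norm_add (a * z ^ s) (((1 - t z : ℝ) : ℂ) * R z)
      linarith
    have h3 : ‖z‖ ^ s ≤ C * ‖a‖ * ‖z‖ ^ s := by
      nlinarith [hf.le_a]
    nlinarith
  · rw [hX]
    refine (norm_add_le _ _).trans ?_
    rw [hpow]
    have : ‖a‖ * ‖z‖ ^ s ≤ C * ‖z‖ ^ s := by gcongr; exact hf.a_le
    have : ‖z‖ ^ (s + 1) ≤ ‖z‖ ^ s := by rw [hp1]; nlinarith
    nlinarith
  · have hRd : HasFDerivAt R (fderiv ℝ R z) z := by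
      have h1 : DifferentiableAt ℝ (fun z => (f z).2 i) z := by
        have := hf.diff z hz
        fun_prop
      have h2 : DifferentiableAt ℝ R z := by
        have : DifferentiableAt ℝ (fun z : ℂ => a * z ^ s) z := by fun_prop
        exact h1.sub this
      exact h2.hasFDerivAt
    have htd : HasFDerivAt (fun z => ((1 - t z : ℝ) : ℂ))
        (Complex.ofRealCLM.comp (-(fderiv ℝ t z))) z := by
      have h1 : HasFDerivAt (fun z => 1 - t z) (-(fderiv ℝ t z)) z := by
        simpa using ht.hasFDerivAt.const_sub 1
      exact Complex.ofRealCLM.hasFDerivAt.comp z h1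
    have hpd : HasFDerivAt (fun z : ℂ => a * z ^ s)
        ((a * (s * z ^ (s - 1))) • (ContinuousLinearMap.id ℝ ℂ)) z := by
      have h1 : HasDerivAt (fun z : ℂ => a * z ^ s) (a * (s * z ^ (s - 1))) z :=
        (hasDerivAt_pow s z).const_mul a
      have := h1.comp_hasFDerivAt (𝕜 := ℝ) z (hasFDerivAt_id z)
      exact this
    have hd := hpd.add (htd.mul hRd)
    refine ⟨_, hd, ?_, ?_⟩
    all_goals
      have hR' : ∀ ζ : ℂ, ‖fderiv ℝ R z ζ‖ ≤ C * ‖z‖ ^ s * ‖ζ‖ := fun ζ =>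
        (ContinuousLinearMap.le_opNorm _ _).trans (by gcongr)
      have hT' : ∀ ζ : ℂ, ‖R z * ((fderiv ℝ t z ζ : ℝ) : ℂ)‖ ≤ C ^ 2 * ‖z‖ ^ s * ‖ζ‖ := by
        intro ζ
        rw [norm_mul, Complex.norm_real]
        have h1 := (fderiv ℝ t z).le_opNorm ζ
        calc _ ≤ (C * ‖z‖ ^ (s + 1)) * (‖fderiv ℝ t z‖ * ‖ζ‖) := by gcongr
          _ = C * ‖z‖ ^ s * ‖ζ‖ * (‖fderiv ℝ t z‖ * ‖z‖) := by rw [hp1]; ring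
          _ ≤ C * ‖z‖ ^ s * ‖ζ‖ * C := by gcongr
          _ = _ := by ring
      have hS : ∀ ζ : ℂ, ‖((1 - t z : ℝ) : ℂ) * fderiv ℝ R z ζ - R z * ((fderiv ℝ t z ζ : ℝ) : ℂ)‖ ≤
          2 * C ^ 2 * ‖z‖ ^ s * ‖ζ‖ := by
        intro ζ
        refine (norm_sub_le _ _).trans ?_
        have h1 : ‖((1 - t z : ℝ) : ℂ) * fderiv ℝ R z ζ‖ ≤ C * ‖z‖ ^ s * ‖ζ‖ := by
          rw [norm_mul]
          calc _ ≤ 1 * (C * ‖z‖ ^ s * ‖ζ‖) := by gcongr; exact hR' ζ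
            _ = _ := one_mul _
        have h2 : C * ‖z‖ ^ s * ‖ζ‖ ≤ C ^ 2 * ‖z‖ ^ s * ‖ζ‖ := by gcongr
        linarith [hT' ζ]
    · intro ζ
      have e : ((a * (s * z ^ (s - 1))) • (ContinuousLinearMap.id ℝ ℂ) +
          (((1 - t z : ℝ) : ℂ) • fderiv ℝ R z +
            R z • (Complex.ofRealCLM.comp (-(fderiv ℝ t z))))) ζ = a * (s * z ^ (s - 1)) * ζ +
          (((1 - t z : ℝ) : ℂ) * fderiv ℝ R z ζ - R z * ((fderiv ℝ t z ζ : ℝ) : ℂ)) := by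
        simp [sub_eq_add_neg]
      refine (congrArg norm e).trans_le ((norm_add_le _ _).trans ?_)
      have h1 : ‖a * (s * z ^ (s - 1)) * ζ‖ ≤ s * C ^ 2 * ‖z‖ ^ (s - 1) * ‖ζ‖ := by
        rw [norm_mul, norm_mul, norm_mul, norm_pow, Complex.norm_natCast]
        calc ‖a‖ * (s * ‖z‖ ^ (s - 1)) * ‖ζ‖ ≤ C ^ 2 * (s * ‖z‖ ^ (s - 1)) * ‖ζ‖ := by
              gcongr; exact hf.a_le.trans hCC
          _ = _ := by ring
      have h2 : ‖z‖ ^ s ≤ ‖z‖ ^ (s - 1) := by rw [hp0]; nlinarith [pow_pos hzp (s - 1)]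
      have h3 : 2 * C ^ 2 * ‖z‖ ^ s * ‖ζ‖ ≤ 2 * C ^ 2 * ‖z‖ ^ (s - 1) * ‖ζ‖ := by gcongr
      linarith [hS ζ]
    · intro ζ
      have e : ∀ ζ, ((a * (s * z ^ (s - 1))) • (ContinuousLinearMap.id ℝ ℂ) +
          (((1 - t z : ℝ) : ℂ) • fderiv ℝ R z +
            R z • (Complex.ofRealCLM.comp (-(fderiv ℝ t z))))) ζ = a * (s * z ^ (s - 1)) * ζ +
          (((1 - t z : ℝ) : ℂ) * fderiv ℝ R z ζ - R z * ((fderiv ℝ t z ζ : ℝ) : ℂ)) := by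
        intro ζ
        simp [sub_eq_add_neg]
      have e2 : a * (s * z ^ (s - 1)) * (Complex.I * ζ) +
          (((1 - t z : ℝ) : ℂ) * fderiv ℝ R z (Complex.I * ζ) -
            R z * ((fderiv ℝ t z (Complex.I * ζ) : ℝ) : ℂ)) -
          Complex.I * (a * (s * z ^ (s - 1)) * ζ +
          (((1 - t z : ℝ) : ℂ) * fderiv ℝ R z ζ - R z * ((fderiv ℝ t z ζ : ℝ) : ℂ))) =
          (((1 - t z : ℝ) : ℂ) * fderiv ℝ R z (Complex.I * ζ) -
            R z * ((fderiv ℝ t z (Complex.I * ζ) : ℝ) : ℂ)) -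
          Complex.I * (((1 - t z : ℝ) : ℂ) * fderiv ℝ R z ζ -
            R z * ((fderiv ℝ t z ζ : ℝ) : ℂ)) := by ring
      refine (congrArg norm ((congrArg₂ (fun x y => x - Complex.I * y) (e _) (e _)).trans
        e2)).trans_le ((norm_sub_le _ _).trans ?_)
      have h1 := hS (Complex.I * ζ)
      have h2 := hS ζ
      rw [norm_mul Complex.I, Complex.norm_I, one_mul] at h1
      rw [norm_mul Complex.I, Complex.norm_I, one_mul]
      linarith

/-- Bounds for the quotient `lam / X`. -/
theorem hasFDerivAt_const_div {X : ℂ → ℂ} {X' : ℂ →L[ℝ] ℂ} (hX : HasFDerivAt X X' z) (h0 : X z ≠ 0)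
    (lam : ℂ) : HasFDerivAt (fun z => lam / X z) ((-(lam / X z ^ 2)) • X') z := by
  have h1 : HasDerivAt (fun x : ℂ => lam / x) (-(lam / X z ^ 2)) (X z) := by
    have := (hasDerivAt_inv h0).const_mul lam
    simpa [div_eq_mul_inv] using this
  exact h1.comp_hasFDerivAt (𝕜 := ℝ) z hX

theorem LeafBounds.quotient_bounds {M : ℝ} {lam w : ℂ} {X' : ℂ →L[ℝ] ℂ} {X : ℂ → ℂ}
    (hC : 1 ≤ C) (hM : 0 ≤ M) (hs : 1 ≤ s) (hz0 : z ≠ 0)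
    (hlam : ‖lam‖ ≤ C ^ 2 * (‖z‖ ^ s * ‖w‖ ^ s)) (hX1 : ‖z‖ ^ s ≤ 2 * C * ‖X z‖)
    (hX : HasFDerivAt X X' z) (hX2 : ∀ ζ, ‖X' ζ‖ ≤ M * ‖z‖ ^ (s - 1) * ‖ζ‖)
    (hX3 : ∀ ζ, ‖X' (Complex.I * ζ) - Complex.I * X' ζ‖ ≤ M * ‖z‖ ^ s * ‖ζ‖) :
    ‖lam / X z‖ ≤ 2 * C ^ 3 * ‖w‖ ^ s ∧
    ∃ Y' : ℂ →L[ℝ] ℂ, HasFDerivAt (fun z => lam / X z) Y' z ∧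
      (∀ ζ, ‖Y' ζ‖ ≤ 4 * C ^ 4 * M * (‖w‖ ^ s / ‖z‖) * ‖ζ‖) ∧
      ∀ ζ, ‖Y' (Complex.I * ζ) - Complex.I * Y' ζ‖ ≤ 4 * C ^ 4 * M * ‖w‖ ^ s * ‖ζ‖ := by
  have hzp : 0 < ‖z‖ := norm_pos_iff.2 hz0
  have hps : 0 < ‖z‖ ^ s := by positivity
  have hp0 : ‖z‖ ^ s = ‖z‖ ^ (s - 1) * ‖z‖ := by rw [← pow_succ, Nat.sub_add_cancel hs]
  have hXp : 0 < ‖X z‖ := by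
    by_contra h
    have : ‖X z‖ = 0 := le_antisymm (not_lt.1 h) (norm_nonneg _)
    rw [this] at hX1; linarith
  have h0 : X z ≠ 0 := norm_pos_iff.1 hXp
  have hq : ‖lam / X z ^ 2‖ * ‖z‖ ^ s ≤ 4 * C ^ 4 * ‖w‖ ^ s := by
    rw [norm_div, norm_pow, div_mul_eq_mul_div, div_le_iff₀ (by positivity)]
    calc ‖lam‖ * ‖z‖ ^ s ≤ C ^ 2 * (‖z‖ ^ s * ‖w‖ ^ s) * ‖z‖ ^ s := by gcongr
      _ = C ^ 2 * ‖w‖ ^ s * (‖z‖ ^ s) ^ 2 := by ring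
      _ ≤ C ^ 2 * ‖w‖ ^ s * (2 * C * ‖X z‖) ^ 2 := by gcongr
      _ = _ := by ring
  refine ⟨?_, _, hasFDerivAt_const_div hX h0 lam, ?_, ?_⟩
  · rw [norm_div, div_le_iff₀ hXp]
    calc ‖lam‖ ≤ C ^ 2 * (‖z‖ ^ s * ‖w‖ ^ s) := hlam
      _ ≤ C ^ 2 * (2 * C * ‖X z‖ * ‖w‖ ^ s) := by gcongr
      _ = _ := by ring
  · intro ζ
    rw [smul_apply, smul_eq_mul, norm_mul, norm_neg]
    have h2 : ‖lam / X z ^ 2‖ * ‖z‖ ^ (s - 1) ≤ 4 * C ^ 4 * (‖w‖ ^ s / ‖z‖) := by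
      rw [← mul_div_assoc, le_div_iff₀ hzp, mul_assoc, ← hp0]
      exact hq
    calc _ ≤ ‖lam / X z ^ 2‖ * (M * ‖z‖ ^ (s - 1) * ‖ζ‖) := by gcongr; exact hX2 ζ
      _ = (‖lam / X z ^ 2‖ * ‖z‖ ^ (s - 1)) * M * ‖ζ‖ := by ring
      _ ≤ (4 * C ^ 4 * (‖w‖ ^ s / ‖z‖)) * M * ‖ζ‖ := by gcongr
      _ = _ := by ring
  · intro ζ
    rw [smul_apply, smul_apply, smul_eq_mul, smul_eq_mul,
      mul_left_comm, ← mul_sub, norm_mul, norm_neg]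
    calc _ ≤ ‖lam / X z ^ 2‖ * (M * ‖z‖ ^ s * ‖ζ‖) := by gcongr; exact hX3 ζ
      _ = (‖lam / X z ^ 2‖ * ‖z‖ ^ s) * M * ‖ζ‖ := by ring
      _ ≤ (4 * C ^ 4 * ‖w‖ ^ s) * M * ‖ζ‖ := by gcongr
      _ = _ := by ring

end NeckEstimates

section DbarEstimates

variable {W : Type*} [NormedAddCommGroup W] [NormedSpace ℝ W]
  {EP : Type*} [NormedAddCommGroup EP] [NormedSpace ℝ EP]
  {C ε : ℝ} {q₀ : EP}
  {J : W × (Fin 2 → ℂ) → W × (Fin 2 → ℂ) →L[ℝ] W × (Fin 2 → ℂ)}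
  {ν : W × (Fin 2 → ℂ) → EP → EP →L[ℝ] W × (Fin 2 → ℂ)}

theorem coordDbar_apply {E : Type*} [NormedAddCommGroup E] [NormedSpace ℝ E]
    (J : E → E →L[ℝ] E) (ν : E → EP → EP →L[ℝ] E) (j : ℂ →L[ℝ] ℂ)
    (F : ℂ → E) (φ : ℂ → EP) (z ζ : ℂ) :
    coordDbar J ν j F φ z ζ = (1 / 2 : ℝ) • (fderiv ℝ F z ζ + J (F z) (fderiv ℝ F z (j ζ))) -
      ν (F z) (φ z) (fderiv ℝ φ z ζ) := rfl

theorem mem_ball_fst {y : W × (Fin 2 → ℂ)} (hy : y ∈ Metric.ball 0 ε) :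
    y.1 ∈ Metric.ball (0 : W) ε ∧ (y.1, (0 : Fin 2 → ℂ)) ∈ Metric.ball 0 ε := by
  rw [mem_ball_zero_iff] at hy ⊢
  have h1 := (norm_fst_le y).trans_lt hy
  refine ⟨h1, ?_⟩
  rw [mem_ball_zero_iff, Prod.norm_def, norm_zero]
  exact max_lt h1 ((norm_nonneg _).trans_lt h1)

theorem TangentBounds.norm_J_normal_sub (hN : TangentBounds C ε q₀ J ν) {y : W × (Fin 2 → ℂ)}
    (hy : y ∈ Metric.ball 0 ε) (u : W × (Fin 2 → ℂ)) :
    ‖(J y u).2 - (J 0 (0, u.2)).2‖ ≤ C * ‖y.2‖ * ‖u.1‖ + C * ‖y‖ * ‖u.2‖ := by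
  have hy0 := mem_ball_fst hy
  have h0 : (0 : W × (Fin 2 → ℂ)) ∈ Metric.ball 0 ε :=
    Metric.mem_ball_self ((norm_nonneg y).trans_lt (mem_ball_zero_iff.1 hy))
  have hu : u = (u.1, 0) + (0, u.2) := by simp
  have e : (J y u).2 - (J 0 (0, u.2)).2 =
      ((J y - J (y.1, 0)) (u.1, 0)).2 + ((J y - J 0) (0, u.2)).2 := by
    conv_lhs => rw [hu]
    rw [map_add, Prod.snd_add, sub_apply, sub_apply,
      Prod.snd_sub, Prod.snd_sub, hN.J_tan _ hy0.1]
    simp only [Prod.snd_add, zero_add, sub_zero]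
    abel
  rw [e]
  refine (norm_add_le _ _).trans (add_le_add ?_ ?_)
  · refine (norm_snd_le _).trans ((ContinuousLinearMap.le_opNorm _ _).trans ?_)
    have h1 := hN.J_lip _ hy _ hy0.2
    have h2 : ‖y - (y.1, 0)‖ = ‖y.2‖ := by simp [Prod.norm_def]
    have h3 : ‖(u.1, (0 : Fin 2 → ℂ))‖ = ‖u.1‖ := by simp [Prod.norm_def]
    rw [h2] at h1
    rw [h3]
    gcongr
  · refine (norm_snd_le _).trans ((ContinuousLinearMap.le_opNorm _ _).trans ?_)
    have h1 := hN.J_lip _ hy _ h0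
    have h3 : ‖((0 : W), u.2)‖ = ‖u.2‖ := by simp [Prod.norm_def]
    rw [sub_zero] at h1
    rw [h3]
    gcongr

theorem NodeBounds.norm_J_normal (hN : NodeBounds C ε q₀ J ν) {y : W × (Fin 2 → ℂ)}
    (hy : y ∈ Metric.ball 0 ε) (u : W × (Fin 2 → ℂ)) :
    ‖(J y u).2 - Complex.I • u.2‖ ≤ C * ‖y.2‖ * ‖u.1‖ + C * ‖y‖ * ‖u.2‖ := by
  rw [← hN.J_nor]
  exact hN.norm_J_normal_sub hy u

theorem TangentBounds.norm_ν_normal (hN : TangentBounds C ε q₀ J ν) {y : W × (Fin 2 → ℂ)}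
    (hy : y ∈ Metric.ball 0 ε) {q : EP} (hq : q ∈ Metric.ball q₀ ε) (w : EP) :
    ‖(ν y q w).2‖ ≤ C * ‖y.2‖ * ‖w‖ := by
  have hy0 := mem_ball_fst hy
  have e : (ν y q w).2 = ((ν y q - ν (y.1, 0) q) w).2 := by
    rw [sub_apply, Prod.snd_sub, hN.ν_tan _ hy0.1 _ hq, sub_zero]
  rw [e]
  refine (norm_snd_le _).trans ((ContinuousLinearMap.le_opNorm _ _).trans ?_)
  have h1 := hN.ν_lip _ hy _ hq _ hy0.2 _ hq
  have h2 : ‖y - (y.1, 0)‖ = ‖y.2‖ := by simp [Prod.norm_def]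
  rw [h2, sub_self, norm_zero, add_zero] at h1
  gcongr

theorem norm_half_smul_le {E : Type*} [NormedAddCommGroup E] [NormedSpace ℝ E] {x : E} {a b : ℝ}
    (hx : ‖x‖ ≤ 2 * a) (hab : a ≤ b) : ‖(1 / 2 : ℝ) • x‖ ≤ b := by
  rw [norm_smul, Real.norm_of_nonneg (by norm_num)]
  linarith

/-- Where the glued map is interpolated, `∂̄F - ν_F` is bounded, and its normal part is
of order `|z| ^ s`. -/
theorem NodeBounds.coordDbar_neck (hN : NodeBounds C ε q₀ J ν) {M : ℝ} (hC : 1 ≤ C) (hM : 1 ≤ M)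
    {s : ℕ} (hs : 1 ≤ s) {F : ℂ → W × (Fin 2 → ℂ)} {φ : ℂ → EP} {j : ℂ →L[ℝ] ℂ}
    (hj : ∀ ζ, j ζ = Complex.I * ζ) {z : ℂ}
    (hFε : F z ∈ Metric.ball 0 ε) (hφε : φ z ∈ Metric.ball q₀ ε)
    (hF : ‖F z‖ ≤ M * ‖z‖) (hF2 : ‖(F z).2‖ ≤ M * ‖z‖ ^ s)
    (hDF : ∀ ζ, ‖fderiv ℝ F z ζ‖ ≤ M * ‖ζ‖)
    (hDF2 : ∀ ζ, ‖(fderiv ℝ F z ζ).2‖ ≤ M * ‖z‖ ^ (s - 1) * ‖ζ‖)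
    (hDF3 : ∀ ζ, ‖(fderiv ℝ F z (Complex.I * ζ)).2 - Complex.I • (fderiv ℝ F z ζ).2‖ ≤
      M * ‖z‖ ^ s * ‖ζ‖)
    (hDφ : ∀ ζ, ‖fderiv ℝ φ z ζ‖ ≤ M * ‖ζ‖) (ζ : ℂ) :
    ‖coordDbar J ν j F φ z ζ‖ ≤ 3 * C * M ^ 2 * ‖ζ‖ ∧
      ‖(coordDbar J ν j F φ z ζ).2‖ ≤ 3 * C * M ^ 2 * ‖z‖ ^ s * ‖ζ‖ := by
  have hI : ‖Complex.I * ζ‖ = ‖ζ‖ := by rw [norm_mul, Complex.norm_I, one_mul]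
  rw [coordDbar_apply, hj]
  set u := fderiv ℝ F z (Complex.I * ζ) with hu
  have hu1 : ‖u‖ ≤ M * ‖ζ‖ := by have := hDF (Complex.I * ζ); rwa [hI] at this
  have hu2 : ‖u.2‖ ≤ M * ‖z‖ ^ (s - 1) * ‖ζ‖ := by have := hDF2 (Complex.I * ζ); rwa [hI] at this
  have hζ := norm_nonneg ζ
  have hCM : 1 ≤ C * M := one_le_mul_of_one_le_of_one_le hC hM
  have hp0 : ‖z‖ ^ s = ‖z‖ ^ (s - 1) * ‖z‖ := by rw [← pow_succ, Nat.sub_add_cancel hs]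
  constructor
  · have h1 : ‖J (F z) u‖ ≤ C * (M * ‖ζ‖) :=
      (ContinuousLinearMap.le_opNorm _ _).trans (by gcongr; exact hN.J_norm _ hFε)
    have h2 : ‖ν (F z) (φ z) (fderiv ℝ φ z ζ)‖ ≤ C * (M * ‖ζ‖) :=
      (ContinuousLinearMap.le_opNorm _ _).trans (by
        gcongr
        · exact hN.ν_norm _ hFε _ hφε
        · exact hDφ ζ)
    have h3 : ‖(1 / 2 : ℝ) • (fderiv ℝ F z ζ + J (F z) u)‖ ≤ C * M ^ 2 * ‖ζ‖ := by
      refine norm_half_smul_le (a := C * M ^ 2 * ‖ζ‖) ((norm_add_le _ _).trans ?_) le_rfl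
      have : M * ‖ζ‖ ≤ C * M ^ 2 * ‖ζ‖ := by gcongr; nlinarith
      have : C * (M * ‖ζ‖) ≤ C * M ^ 2 * ‖ζ‖ := by rw [← mul_assoc]; gcongr; nlinarith
      linarith [hDF ζ]
    have h4 : C * (M * ‖ζ‖) ≤ C * M ^ 2 * ‖ζ‖ := by rw [← mul_assoc]; gcongr; nlinarith
    have h5 : 0 ≤ C * M ^ 2 * ‖ζ‖ := by positivity
    exact (norm_sub_le _ _).trans (by linarith)
  · rw [Prod.snd_sub, Prod.smul_snd, Prod.snd_add]
    have h1 := hN.norm_J_normal hFε u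
    have h2 := hN.norm_ν_normal hFε hφε (fderiv ℝ φ z ζ)
    have h3 : (fderiv ℝ F z ζ).2 + (J (F z) u).2 = ((J (F z) u).2 - Complex.I • u.2) +
        Complex.I • (u.2 - Complex.I • (fderiv ℝ F z ζ).2) := by
      rw [smul_sub, smul_smul, Complex.I_mul_I, neg_one_smul]; abel
    set P := M * ‖z‖ ^ s * ‖ζ‖ with hP
    have hP0 : 0 ≤ P := by positivity
    have h4 : C * ‖(F z).2‖ * ‖u.1‖ ≤ C * M * P := by
      calc _ ≤ C * (M * ‖z‖ ^ s) * (M * ‖ζ‖) := by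
            gcongr; exact (norm_fst_le u).trans hu1
        _ = _ := by rw [hP]; ring
    have h5 : C * ‖F z‖ * ‖u.2‖ ≤ C * M * P := by
      calc _ ≤ C * (M * ‖z‖) * (M * ‖z‖ ^ (s - 1) * ‖ζ‖) := by gcongr
        _ = _ := by rw [hP, hp0]; ring
    have h6 : C * ‖(F z).2‖ * ‖fderiv ℝ φ z ζ‖ ≤ C * M * P := by
      calc _ ≤ C * (M * ‖z‖ ^ s) * (M * ‖ζ‖) := by gcongr; exact hDφ ζ
        _ = _ := by rw [hP]; ring
    have h7 : ‖Complex.I • (u.2 - Complex.I • (fderiv ℝ F z ζ).2)‖ ≤ C * M * P := by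
      rw [norm_smul, Complex.norm_I, one_mul]
      refine (hDF3 ζ).trans ?_
      exact le_mul_of_one_le_left hP0 hCM
    have h8 : ‖(1 / 2 : ℝ) • ((fderiv ℝ F z ζ).2 + (J (F z) u).2)‖ ≤ 2 * (C * M * P) := by
      refine norm_half_smul_le (a := 2 * (C * M * P)) ?_ le_rfl
      rw [h3]
      have : 0 ≤ C * M * P := by positivity
      exact (norm_add_le _ _).trans (by linarith)
    calc _ ≤ _ := norm_sub_le _ _
      _ ≤ 3 * (C * M * P) := by linarith
      _ = _ := by rw [hP]; ring

/-- Away from the interpolation region, the glued map differs from the solution `f` by terms of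
order `|w| ^ s`. -/
theorem NodeBounds.coordDbar_middle (hN : NodeBounds C ε q₀ J ν) {M : ℝ} (hC : 1 ≤ C) (hM : 1 ≤ M)
    {s : ℕ} (hs : 1 ≤ s) {F f : ℂ → W × (Fin 2 → ℂ)} {φ φ₀ : ℂ → EP} {j : ℂ →L[ℝ] ℂ}
    (hj : ∀ ζ, j ζ = Complex.I * ζ) {z w : ℂ} (hz0 : z ≠ 0) (hz1 : ‖z‖ ≤ 1) (hw : ‖w‖ ≤ ‖z‖)
    {κ : ℝ} (hκ : ‖w‖ / ‖z‖ ≤ κ)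
    (hFε : F z ∈ Metric.ball 0 ε) (hfε : f z ∈ Metric.ball 0 ε)
    (hφε : φ z ∈ Metric.ball q₀ ε) (hφ₀ε : φ₀ z ∈ Metric.ball q₀ ε)
    (hf : coordDbar J ν j f φ₀ z = 0)
    (hf2 : ‖(f z).2‖ ≤ M * ‖z‖ ^ s)
    (hFf : ‖F z - f z‖ ≤ M * ‖w‖ ^ s)
    (hDFf : ∀ ζ, ‖fderiv ℝ F z ζ - fderiv ℝ f z ζ‖ ≤ M * (‖w‖ ^ s / ‖z‖) * ‖ζ‖)
    (hDf : ∀ ζ, ‖fderiv ℝ f z ζ‖ ≤ M * ‖ζ‖)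
    (hDφ : ∀ ζ, ‖fderiv ℝ φ z ζ‖ ≤ M * ‖ζ‖)
    (hφφ : ‖φ z - φ₀ z‖ ≤ M * κ)
    (hDφφ : ∀ ζ, ‖fderiv ℝ φ z ζ - fderiv ℝ φ₀ z ζ‖ ≤ M * κ * ‖ζ‖) (ζ : ℂ) :
    ‖coordDbar J ν j F φ z ζ‖ ≤ 5 * C * M ^ 3 * κ * ‖ζ‖ ∧
      ‖(coordDbar J ν j F φ z ζ).2‖ ≤ 5 * C * M ^ 3 * κ * ‖z‖ ^ (s - 1) * ‖ζ‖ := by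
  have hzp : 0 < ‖z‖ := norm_pos_iff.2 hz0
  have hI : ‖Complex.I * ζ‖ = ‖ζ‖ := by rw [norm_mul, Complex.norm_I, one_mul]
  have hκ0 : 0 ≤ κ := le_trans (by positivity) hκ
  have hp0 : ‖z‖ ^ s = ‖z‖ ^ (s - 1) * ‖z‖ := by rw [← pow_succ, Nat.sub_add_cancel hs]
  have hps : ‖z‖ ^ (s - 1) ≤ 1 := pow_le_one₀ hzp.le hz1
  have hps' : ‖z‖ ^ s ≤ ‖z‖ ^ (s - 1) := by
    rw [hp0]; exact mul_le_of_le_one_right (by positivity) hz1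
  have hω : ‖w‖ ^ s / ‖z‖ ≤ κ * ‖z‖ ^ (s - 1) := by
    have : ‖w‖ ^ s = ‖w‖ ^ (s - 1) * ‖w‖ := by rw [← pow_succ, Nat.sub_add_cancel hs]
    rw [this, mul_div_assoc, mul_comm κ]
    gcongr
  have hω' : ‖w‖ ^ s ≤ κ * ‖z‖ ^ (s - 1) := by
    refine le_trans ?_ hω
    rw [le_div_iff₀ hzp]
    exact mul_le_of_le_one_right (by positivity) hz1
  set P := M ^ 3 * (κ * ‖z‖ ^ (s - 1)) * ‖ζ‖ with hP
  set Q := M ^ 3 * κ * ‖ζ‖ with hQ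
  have hP0 : 0 ≤ P := by positivity
  have hPQ : P ≤ Q := by
    rw [hP, hQ]; gcongr; exact mul_le_of_le_one_right hκ0 hps
  have hM12 : M ≤ M ^ 2 := by nlinarith
  have hM13 : M ^ 2 ≤ M ^ 3 := by nlinarith
  have hf' := congrArg (fun L => L ζ) hf
  simp only [coordDbar_apply, hj, zero_apply] at hf'
  rw [coordDbar_apply, hj]
  set x₁ := fderiv ℝ F z ζ - fderiv ℝ f z ζ with hx₁
  set x₂ := J (F z) (fderiv ℝ F z (Complex.I * ζ) - fderiv ℝ f z (Complex.I * ζ)) with hx₂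
  set x₃ := (J (F z) - J (f z)) (fderiv ℝ f z (Complex.I * ζ)) with hx₃
  set x₄ := (ν (F z) (φ z) - ν (f z) (φ z)) (fderiv ℝ φ z ζ) with hx₄
  set x₅ := ν (f z) (φ z) (fderiv ℝ φ z ζ) - ν (f z) (φ₀ z) (fderiv ℝ φ z ζ) with hx₅
  set x₆ := ν (f z) (φ₀ z) (fderiv ℝ φ z ζ - fderiv ℝ φ₀ z ζ) with hx₆
  have key : (1 / 2 : ℝ) • (fderiv ℝ F z ζ + J (F z) (fderiv ℝ F z (Complex.I * ζ))) -
      ν (F z) (φ z) (fderiv ℝ φ z ζ) =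
      ((1 / 2 : ℝ) • (x₁ + x₂ + x₃) - x₄) - (x₅ + x₆) := by
    rw [← sub_zero ((1 / 2 : ℝ) • (fderiv ℝ F z ζ + J (F z) (fderiv ℝ F z (Complex.I * ζ))) -
      ν (F z) (φ z) (fderiv ℝ φ z ζ)), ← hf', hx₁, hx₂, hx₃, hx₄, hx₅, hx₆]
    simp only [map_sub, sub_apply]
    module
  have b1 : ‖x₁‖ ≤ C * P := by
    have h1 : ‖x₁‖ ≤ P := (hDFf ζ).trans (by rw [hP]; gcongr; exact hM12.trans hM13)
    exact h1.trans (le_mul_of_one_le_left hP0 hC)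
  have b2 : ‖x₂‖ ≤ C * P := by
    refine (ContinuousLinearMap.le_opNorm _ _).trans ?_
    have h1 := hDFf (Complex.I * ζ)
    rw [hI] at h1
    have h2 : M * (‖w‖ ^ s / ‖z‖) * ‖ζ‖ ≤ P := by rw [hP]; gcongr; exact hM12.trans hM13
    gcongr
    · exact hN.J_norm _ hFε
    · exact h1.trans h2
  have b3 : ‖x₃‖ ≤ C * P := by
    refine (ContinuousLinearMap.le_opNorm _ _).trans ?_
    have h1 := hDf (Complex.I * ζ)
    rw [hI] at h1
    calc _ ≤ (C * (M * (κ * ‖z‖ ^ (s - 1)))) * (M * ‖ζ‖) := by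
          gcongr
          refine (hN.J_lip _ hFε _ hfε).trans ?_
          gcongr
          exact hFf.trans (by gcongr)
      _ = C * (M ^ 2 * (κ * ‖z‖ ^ (s - 1)) * ‖ζ‖) := by ring
      _ ≤ C * P := by rw [hP]; gcongr
  have b4 : ‖x₄‖ ≤ C * P := by
    refine (ContinuousLinearMap.le_opNorm _ _).trans ?_
    have h2 := hN.ν_lip _ hFε _ hφε _ hfε _ hφε
    rw [sub_self, norm_zero, add_zero] at h2
    calc _ ≤ (C * (M * (κ * ‖z‖ ^ (s - 1)))) * (M * ‖ζ‖) := by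
          gcongr
          · refine h2.trans ?_
            gcongr
            exact hFf.trans (by gcongr)
          · exact hDφ ζ
      _ = C * (M ^ 2 * (κ * ‖z‖ ^ (s - 1)) * ‖ζ‖) := by ring
      _ ≤ C * P := by rw [hP]; gcongr
  have b5 : ‖x₅‖ ≤ C * Q := by
    rw [hx₅, ← sub_apply]
    refine (ContinuousLinearMap.le_opNorm _ _).trans ?_
    have h2 := hN.ν_lip _ hfε _ hφε _ hfε _ hφ₀ε
    rw [sub_self, norm_zero, zero_add] at h2
    calc _ ≤ (C * (M * κ)) * (M * ‖ζ‖) := by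
          gcongr
          · exact h2.trans (by gcongr)
          · exact hDφ ζ
      _ = C * (M ^ 2 * κ * ‖ζ‖) := by ring
      _ ≤ C * Q := by rw [hQ]; gcongr
  have b6 : ‖x₆‖ ≤ C * Q := by
    refine (ContinuousLinearMap.le_opNorm _ _).trans ?_
    calc _ ≤ C * (M * κ * ‖ζ‖) := by
          gcongr
          · exact hN.ν_norm _ hfε _ hφ₀ε
          · exact hDφφ ζ
      _ ≤ C * Q := by rw [hQ]; gcongr; exact hM12.trans hM13
  have b5' : ‖x₅.2‖ ≤ C * P := by
    refine (hN.ν_mixed _ hfε _ hφε _ hφ₀ε _).trans ?_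
    calc _ ≤ C * (M * ‖z‖ ^ (s - 1)) * (M * κ) * (M * ‖ζ‖) := by
          gcongr
          · exact hf2.trans (by gcongr)
          · exact hDφ ζ
      _ = C * P := by rw [hP]; ring
  have b6' : ‖x₆.2‖ ≤ C * P := by
    refine (hN.norm_ν_normal hfε hφ₀ε _).trans ?_
    calc _ ≤ C * (M * ‖z‖ ^ (s - 1)) * (M * κ * ‖ζ‖) := by
          gcongr
          · exact hf2.trans (by gcongr)
          · exact hDφφ ζ
      _ = C * (M ^ 2 * (κ * ‖z‖ ^ (s - 1)) * ‖ζ‖) := by ring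
      _ ≤ C * P := by rw [hP]; gcongr
  have hA : ‖(1 / 2 : ℝ) • (x₁ + x₂ + x₃) - x₄‖ ≤ 3 * (C * P) := by
    have h1 : ‖x₁ + x₂ + x₃‖ ≤ 3 * (C * P) := norm_add₃_le.trans (by linarith)
    have h2 : 0 ≤ C * P := by positivity
    have h3 := norm_half_smul_le (b := 2 * (C * P)) (h1.trans_eq
      (by ring : _ = 2 * (3 / 2 * (C * P)))) (by linarith)
    exact (norm_sub_le _ _).trans (by linarith)
  have hCPQ : C * P ≤ C * Q := by gcongr
  rw [key]
  constructor
  · calc _ ≤ ‖(1 / 2 : ℝ) • (x₁ + x₂ + x₃) - x₄‖ + ‖x₅ + x₆‖ := norm_sub_le _ _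
      _ ≤ 5 * (C * Q) := by linarith [norm_add_le x₅ x₆]
      _ = _ := by rw [hQ]; ring
  · rw [Prod.snd_sub, Prod.snd_add]
    calc _ ≤ ‖((1 / 2 : ℝ) • (x₁ + x₂ + x₃) - x₄).2‖ + ‖x₅.2 + x₆.2‖ := norm_sub_le _ _
      _ ≤ 5 * (C * P) := by
          linarith [norm_add_le x₅.2 x₆.2, norm_snd_le ((1 / 2 : ℝ) • (x₁ + x₂ + x₃) - x₄)]
      _ = _ := by rw [hP]; ring

end DbarEstimates

section Cutoff

/-- `(|z|² + |w|²) ^ (1/2)` on the curve `z w = μ`. -/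
noncomputable def plumbRadius (μ z : ℂ) : ℝ := Real.sqrt (‖z‖ ^ 2 + ‖μ / z‖ ^ 2)

theorem norm_le_plumbRadius (μ z : ℂ) : ‖z‖ ≤ plumbRadius μ z :=
  Real.le_sqrt_of_sq_le (by nlinarith [sq_nonneg ‖μ / z‖])

theorem norm_div_le_of_sqrt_le {μ z : ℂ} (hz : z ≠ 0) (h : Real.sqrt ‖μ‖ ≤ ‖z‖) :
    ‖μ / z‖ ≤ ‖z‖ := by
  rw [norm_div, div_le_iff₀ (norm_pos_iff.2 hz)]
  have := Real.sqrt_le_left (norm_nonneg z) |>.1 h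
  nlinarith

theorem plumbRadius_le {μ z : ℂ} (hz : z ≠ 0) (h : Real.sqrt ‖μ‖ ≤ ‖z‖) :
    plumbRadius μ z ≤ 2 * ‖z‖ := by
  have h1 := norm_div_le_of_sqrt_le hz h
  refine Real.sqrt_le_iff.2 ⟨by positivity, ?_⟩
  nlinarith [norm_nonneg z, norm_nonneg (μ / z)]

theorem hasFDerivAt_plumbRadius {μ z : ℂ} (hz : z ≠ 0) : ∃ L : ℂ →L[ℝ] ℝ,
    HasFDerivAt (plumbRadius μ) L z ∧ (Real.sqrt ‖μ‖ ≤ ‖z‖ → ‖L‖ ≤ 2) := by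
  have hzp : 0 < ‖z‖ := norm_pos_iff.2 hz
  have h1 := (hasFDerivAt_id (𝕜 := ℝ) z).norm_sq
  have h2 := (hasFDerivAt_const_div (X := fun x => x) (hasFDerivAt_id (𝕜 := ℝ) z) hz μ).norm_sq
  have hpos : ‖z‖ ^ 2 + ‖μ / z‖ ^ 2 ≠ 0 := by positivity
  have h3 := (h1.add h2).sqrt hpos
  refine ⟨_, h3, fun h => ?_⟩
  have hw := norm_div_le_of_sqrt_le hz h
  have hρ := norm_le_plumbRadius μ z
  have hρ0 : 0 < plumbRadius μ z := hzp.trans_le hρ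
  change ‖(1 / (2 * plumbRadius μ z)) • _‖ ≤ 2
  rw [norm_smul, Real.norm_of_nonneg (by positivity), one_div, inv_mul_le_iff₀ (by positivity)]
  refine (norm_add_le _ _).trans ?_
  have b1 : ‖2 • (innerSL ℝ (id z)).comp (ContinuousLinearMap.id ℝ ℂ)‖ ≤ 2 * ‖z‖ := by
    refine ContinuousLinearMap.opNorm_le_bound _ (by positivity) fun ζ => ?_
    have := norm_inner_le_norm (𝕜 := ℝ) z ζ
    simp only [smul_apply, ContinuousLinearMap.comp_apply, innerSL_apply_apply,
      ContinuousLinearMap.id_apply, id, nsmul_eq_mul, norm_mul]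
    rw [Real.norm_of_nonneg (by norm_num : (0 : ℝ) ≤ ((2 : ℕ) : ℝ)), Nat.cast_ofNat]
    linarith
  have b2 : ‖2 • (innerSL ℝ (μ / z)).comp ((-(μ / z ^ 2)) • (ContinuousLinearMap.id ℝ ℂ))‖ ≤
      2 * ‖z‖ := by
    refine ContinuousLinearMap.opNorm_le_bound _ (by positivity) fun ζ => ?_
    have h4 := norm_inner_le_norm (𝕜 := ℝ) (μ / z) (-(μ / z ^ 2) * ζ)
    have h5 : ‖-(μ / z ^ 2) * ζ‖ ≤ ‖ζ‖ := by
      rw [norm_mul, norm_neg, pow_two, ← div_div, norm_div]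
      exact mul_le_of_le_one_left (norm_nonneg _) ((div_le_one hzp).2 hw)
    simp only [smul_apply, ContinuousLinearMap.comp_apply, innerSL_apply_apply,
      ContinuousLinearMap.id_apply, nsmul_eq_mul, norm_mul, smul_eq_mul]
    rw [Real.norm_of_nonneg (by norm_num : (0 : ℝ) ≤ ((2 : ℕ) : ℝ)), Nat.cast_ofNat]
    have h6 : ‖μ / z‖ * ‖-(μ / z ^ 2) * ζ‖ ≤ ‖z‖ * ‖ζ‖ := by gcongr
    rw [mul_assoc 2]
    exact mul_le_mul_of_nonneg_left (h4.trans h6) zero_le_two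
  refine (add_le_add b1 b2).trans ?_
  linarith

/-- The cutoff function on the neck. -/
noncomputable def neckCutoff (β : ℝ → ℝ) (μ z : ℂ) : ℝ :=
  β (plumbRadius μ z / ‖μ‖ ^ (1 / 4 : ℝ))

theorem IsCutoff.neckCutoff_eventually_zero {β : ℝ → ℝ} (hβ : IsCutoff β) {μ z : ℂ} (hμ : μ ≠ 0)
    (hz : z ≠ 0) (h : 2 * ‖μ‖ ^ (1 / 4 : ℝ) < plumbRadius μ z) :
    ∀ᶠ x in 𝓝 z, neckCutoff β μ x = 0 := by
  obtain ⟨L, hL, -⟩ := hasFDerivAt_plumbRadius (μ := μ) hz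
  filter_upwards [hL.continuousAt.tendsto.eventually_const_lt h] with x hx
  exact hβ.zero _ ((le_div_iff₀ (by positivity)).2 hx.le)

theorem IsCutoff.exists_neckCutoff_bound {β : ℝ → ℝ} (hβ : IsCutoff β) : ∃ C : ℝ,
    ∀ μ z : ℂ, μ ≠ 0 → z ≠ 0 → Real.sqrt ‖μ‖ ≤ ‖z‖ → DifferentiableAt ℝ (neckCutoff β μ) z ∧
      ‖fderiv ℝ (neckCutoff β μ) z‖ * ‖z‖ ≤ C := by
  have hc : Continuous (deriv β) := hβ.smooth.continuous_deriv (by simp)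
  obtain ⟨B, hB⟩ := (isCompact_Icc (a := (0 : ℝ)) (b := 2)).exists_bound_of_continuousOn
    hc.continuousOn
  have hB0 : 0 ≤ B := (norm_nonneg _).trans (hB 0 (by simp))
  refine ⟨B * 4, fun μ z hμ hz h => ?_⟩
  obtain ⟨L, hL, hL2⟩ := hasFDerivAt_plumbRadius (μ := μ) hz
  have hm : 0 < ‖μ‖ ^ (1 / 4 : ℝ) := by positivity
  set m := ‖μ‖ ^ (1 / 4 : ℝ) with hmdef
  have h1 : HasFDerivAt (fun x => plumbRadius μ x / m) (m⁻¹ • L) z := by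
    simpa [div_eq_mul_inv] using hL.mul_const (m⁻¹)
  have h2 : HasDerivAt β (deriv β (plumbRadius μ z / m)) (plumbRadius μ z / m) :=
    ((hβ.smooth.differentiable (by simp)) _).hasDerivAt
  have h3 : HasFDerivAt (neckCutoff β μ) (deriv β (plumbRadius μ z / m) • (m⁻¹ • L)) z :=
    h2.comp_hasFDerivAt z h1
  refine ⟨h3.differentiableAt, ?_⟩
  rcases lt_or_ge (2 * m) (plumbRadius μ z) with h4 | h4
  · have h5 : neckCutoff β μ =ᶠ[𝓝 z] fun _ => 0 := hβ.neckCutoff_eventually_zero hμ hz h4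
    rw [h5.fderiv_eq, fderiv_fun_const]
    simp only [Pi.zero_apply, norm_zero, zero_mul]
    positivity
  · rw [h3.fderiv, norm_smul, norm_smul, norm_inv, Real.norm_of_nonneg hm.le]
    have h5 := hB (plumbRadius μ z / m) ⟨by unfold plumbRadius; positivity,
      (div_le_iff₀ hm).2 h4⟩
    have h6 : ‖z‖ ≤ 2 * m := (norm_le_plumbRadius μ z).trans h4
    calc _ ≤ B * (m⁻¹ * 2) * (2 * m) := by gcongr; exact hL2 h
      _ = B * 4 := by field_simp; norm_num

end Cutoff

section Pair

theorem norm_pair_le {i : Fin 2} {x y : ℂ} {B : ℝ} (hx : ‖x‖ ≤ B) (hy : ‖y‖ ≤ B) :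
    ‖pair i x y‖ ≤ B := by
  refine (pi_norm_le_iff_of_nonneg ((norm_nonneg _).trans hx)).2 fun j => ?_
  unfold pair
  split_ifs <;> assumption

theorem hasFDerivAt_pair {G : Type*} [NormedAddCommGroup G] [NormedSpace ℝ G] (i : Fin 2)
    {X Y : G → ℂ} {X' Y' : G →L[ℝ] ℂ} {z : G} (hX : HasFDerivAt X X' z) (hY : HasFDerivAt Y Y' z) :
    ∃ L : G →L[ℝ] (Fin 2 → ℂ), HasFDerivAt (fun z => pair i (X z) (Y z)) L z ∧
      ∀ ζ, L ζ = pair i (X' ζ) (Y' ζ) := by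
  refine ⟨ContinuousLinearMap.pi fun j => if j = i then X' else Y', ?_, fun ζ => ?_⟩
  · refine hasFDerivAt_pi.2 fun j => ?_
    unfold pair
    split_ifs <;> assumption
  · ext j
    simp only [ContinuousLinearMap.pi_apply, pair]
    split_ifs <;> rfl

theorem pair_sub (i : Fin 2) (x y x' y' : ℂ) :
    pair i x y - pair i x' y' = pair i (x - x') (y - y') := by
  ext j
  simp only [pair, Pi.sub_apply]
  split_ifs <;> rfl

theorem smul_pair (i : Fin 2) (a x y : ℂ) : a • pair i x y = pair i (a * x) (a * y) := by
  ext j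
  simp only [pair, Pi.smul_apply, smul_eq_mul]
  split_ifs <;> rfl

theorem eq_pair_of_leaf {i : Fin 2} {n : Fin 2 → ℂ} (h : ∀ j, j ≠ i → n j = 0) :
    n = pair i (n i) 0 := by
  ext j
  unfold pair
  split_ifs with hj
  · rw [hj]
  · exact h j hj

end Pair

section NeckMap

variable {W : Type*} [NormedAddCommGroup W] [NormedSpace ℝ W]
  {C r : ℝ} {i : Fin 2} {s : ℕ} {a lam w : ℂ} {f : ℂ → W × (Fin 2 → ℂ)} {t : ℂ → ℝ} {z : ℂ}

/-- A constant that dominates all bounds for the glued map. -/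
noncomputable def neckConst (C : ℝ) (s : ℕ) : ℝ := 4 * (s + 6) * C ^ 6

theorem neckConst_bounds (hC : 1 ≤ C) (s : ℕ) : 1 ≤ neckConst C s ∧ C + C ^ 2 ≤ neckConst C s ∧
    2 * C ^ 3 ≤ neckConst C s ∧ 2 * C ≤ neckConst C s ∧
    (s + 6) * C ^ 2 ≤ neckConst C s ∧ 4 * C ^ 4 * ((s + 6) * C ^ 2) ≤ neckConst C s := by
  have hs : (0 : ℝ) ≤ s := Nat.cast_nonneg s
  have h2 : (1 : ℝ) ≤ C ^ 2 := one_le_pow₀ hC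
  have h6 : C ^ 2 ≤ C ^ 6 := pow_le_pow_right₀ hC (by norm_num)
  have h3 : C ^ 3 ≤ C ^ 6 := pow_le_pow_right₀ hC (by norm_num)
  have h1 : C ≤ C ^ 6 := by simpa using pow_le_pow_right₀ hC (show 1 ≤ 6 by norm_num)
  have h7 : 0 ≤ s * C ^ 6 := by positivity
  unfold neckConst
  refine ⟨by nlinarith, by nlinarith, by nlinarith, by nlinarith, ?_, ?_⟩
  · calc (s + 6) * C ^ 2 ≤ (s + 6) * C ^ 6 := by gcongr
      _ ≤ _ := by nlinarith
  · exact le_of_eq (by ring)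

theorem LeafBounds.neckMap_bounds (hf : LeafBounds C r i s a f) (hC : 1 ≤ C) (hs : 1 ≤ s)
    (hz : z ∈ Metric.ball (0 : ℂ) r) (hz0 : z ≠ 0) (hz1 : 2 * C ^ 2 * ‖z‖ ≤ 1)
    (ht : DifferentiableAt ℝ t z) (ht0 : 0 ≤ t z) (ht1 : t z ≤ 1)
    (ht' : ‖fderiv ℝ t z‖ * ‖z‖ ≤ C) (hw : ‖w‖ ≤ ‖z‖)
    (hlam : ‖lam‖ ≤ C ^ 2 * (‖z‖ ^ s * ‖w‖ ^ s)) :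
    DifferentiableAt ℝ (neckMap i s a lam f t) z ∧
    ‖neckMap i s a lam f t z‖ ≤ neckConst C s * ‖z‖ ∧
    ‖(neckMap i s a lam f t z).2‖ ≤ neckConst C s * ‖z‖ ^ s ∧
    (∀ ζ, ‖fderiv ℝ (neckMap i s a lam f t) z ζ‖ ≤ neckConst C s * ‖ζ‖) ∧
    (∀ ζ, ‖(fderiv ℝ (neckMap i s a lam f t) z ζ).2‖ ≤ neckConst C s * ‖z‖ ^ (s - 1) * ‖ζ‖) ∧
    ∀ ζ, ‖(fderiv ℝ (neckMap i s a lam f t) z (Complex.I * ζ)).2 -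
      Complex.I • (fderiv ℝ (neckMap i s a lam f t) z ζ).2‖ ≤ neckConst C s * ‖z‖ ^ s * ‖ζ‖ := by
  obtain ⟨k1, k2, k3, k4, k5, k6⟩ := neckConst_bounds hC s
  set M := neckConst C s with hM
  have hzp : 0 < ‖z‖ := norm_pos_iff.2 hz0
  have hC2 : 1 ≤ C ^ 2 := one_le_pow₀ hC
  have hz2 : ‖z‖ ≤ 1 := by nlinarith
  have hp0 : ‖z‖ ^ s = ‖z‖ ^ (s - 1) * ‖z‖ := by rw [← pow_succ, Nat.sub_add_cancel hs]
  have hps : ‖z‖ ^ (s - 1) ≤ 1 := pow_le_one₀ hzp.le hz2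
  have hpsz : ‖z‖ ^ s ≤ ‖z‖ := by rw [hp0]; exact mul_le_of_le_one_left hzp.le hps
  have hws : ‖w‖ ^ s ≤ ‖z‖ ^ s := by gcongr
  have hwz : ‖w‖ ^ s / ‖z‖ ≤ ‖z‖ ^ (s - 1) := by rw [div_le_iff₀ hzp, ← hp0]; exact hws
  obtain ⟨hX1, hX2, X', hX, hX3, hX4⟩ := hf.neckCoord_bounds hC hs hz hz0 hz1 ht ht0 ht1 ht'
  have hs0 : (0 : ℝ) ≤ s := Nat.cast_nonneg s
  have hX3' : ∀ ζ, ‖X' ζ‖ ≤ ((s + 6) * C ^ 2) * ‖z‖ ^ (s - 1) * ‖ζ‖ := fun ζ =>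
    (hX3 ζ).trans (by gcongr; norm_num)
  have hX4' : ∀ ζ, ‖X' (Complex.I * ζ) - Complex.I * X' ζ‖ ≤ ((s + 6) * C ^ 2) * ‖z‖ ^ s * ‖ζ‖ :=
    fun ζ => (hX4 ζ).trans (by gcongr; linarith)
  obtain ⟨hY1, Y', hY, hY3, hY4⟩ := LeafBounds.quotient_bounds (X := neckCoord i s a f t)
    (M := (s + 6) * C ^ 2) hC (by positivity) hs hz0 hlam hX1 hX hX3' hX4'
  obtain ⟨L2, hL2, hL2'⟩ := hasFDerivAt_pair i hX hY
  have hf1 : HasFDerivAt (fun x => (f x).1)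
      ((ContinuousLinearMap.fst ℝ W (Fin 2 → ℂ)).comp (fderiv ℝ f z)) z :=
    (ContinuousLinearMap.fst ℝ W (Fin 2 → ℂ)).hasFDerivAt.comp z (hf.diff z hz).hasFDerivAt
  have ht1d : HasFDerivAt (fun z => 1 - t z) (-(fderiv ℝ t z)) z := by
    simpa using ht.hasFDerivAt.const_sub 1
  have hL1 := ht1d.smul hf1
  have hd := hL1.prodMk hL2
  have hfd : fderiv ℝ (neckMap i s a lam f t) z = _ := HasFDerivAt.fderiv hd
  have hb2 : ∀ ζ, ‖L2 ζ‖ ≤ M * ‖z‖ ^ (s - 1) * ‖ζ‖ := by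
    intro ζ
    rw [hL2']
    refine norm_pair_le ((hX3' ζ).trans (by gcongr)) ((hY3 ζ).trans ?_)
    gcongr
  have hb1 : ∀ ζ, ‖((1 - t z) • (ContinuousLinearMap.fst ℝ W (Fin 2 → ℂ)).comp (fderiv ℝ f z) +
      (-(fderiv ℝ t z)).smulRight (f z).1) ζ‖ ≤ M * ‖ζ‖ := by
    intro ζ
    have e : ((1 - t z) • (ContinuousLinearMap.fst ℝ W (Fin 2 → ℂ)).comp (fderiv ℝ f z) +
      (-(fderiv ℝ t z)).smulRight (f z).1) ζ = (1 - t z) • (fderiv ℝ f z ζ).1 -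
        (fderiv ℝ t z ζ) • (f z).1 := by
      simp [sub_eq_add_neg]
    rw [e]
    refine (norm_sub_le _ _).trans ?_
    have b1 : ‖(1 - t z) • (fderiv ℝ f z ζ).1‖ ≤ C * ‖ζ‖ := by
      rw [norm_smul, Real.norm_of_nonneg (by linarith)]
      have h1 : ‖(fderiv ℝ f z ζ).1‖ ≤ C * ‖ζ‖ := (norm_fst_le _).trans
        ((ContinuousLinearMap.le_opNorm _ _).trans (by gcongr; exact hf.fderiv_le z hz))
      calc _ ≤ 1 * (C * ‖ζ‖) := by gcongr; linarith
        _ = _ := one_mul _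
    have b2 : ‖(fderiv ℝ t z ζ) • (f z).1‖ ≤ C ^ 2 * ‖ζ‖ := by
      rw [norm_smul]
      have h1 : ‖(f z).1‖ ≤ C * ‖z‖ := (norm_fst_le _).trans (hf.norm_le z hz)
      calc _ ≤ (‖fderiv ℝ t z‖ * ‖ζ‖) * (C * ‖z‖) := by
            gcongr; exact ContinuousLinearMap.le_opNorm _ _
        _ = (‖fderiv ℝ t z‖ * ‖z‖) * C * ‖ζ‖ := by ring
        _ ≤ C * C * ‖ζ‖ := by gcongr
        _ = _ := by ring
    calc _ ≤ C * ‖ζ‖ + C ^ 2 * ‖ζ‖ := add_le_add b1 b2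
      _ = (C + C ^ 2) * ‖ζ‖ := by ring
      _ ≤ _ := by gcongr
  have hF2 : ‖(neckMap i s a lam f t z).2‖ ≤ M * ‖z‖ ^ s := by
    refine norm_pair_le (hX2.trans (by gcongr)) (hY1.trans ?_)
    gcongr
  have hnorm : ∀ ζ, ‖fderiv ℝ (neckMap i s a lam f t) z ζ‖ ≤ M * ‖ζ‖ := by
    intro ζ
    rw [hfd]
    refine max_le (hb1 ζ) ((hb2 ζ).trans ?_)
    gcongr
    exact mul_le_of_le_one_right (by positivity) hps
  refine ⟨hd.differentiableAt, ?_, hF2, hnorm, ?_, ?_⟩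
  · refine max_le ?_ (hF2.trans (by gcongr))
    change ‖(1 - t z) • (f z).1‖ ≤ _
    rw [norm_smul, Real.norm_of_nonneg (by linarith)]
    have h1 : ‖(f z).1‖ ≤ C * ‖z‖ := (norm_fst_le _).trans (hf.norm_le z hz)
    calc _ ≤ 1 * (C * ‖z‖) := by gcongr; linarith
      _ ≤ _ := by rw [one_mul]; gcongr; linarith
  · intro ζ
    rw [hfd]
    exact hb2 ζ
  · intro ζ
    rw [hfd]
    change ‖L2 (Complex.I * ζ) - Complex.I • L2 ζ‖ ≤ _
    rw [hL2', hL2', smul_pair, pair_sub]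
    refine norm_pair_le ((hX4' ζ).trans ?_) ((hY4 ζ).trans ?_)
    · gcongr
    · gcongr

theorem LeafBounds.neckMap_sub_bounds (hf : LeafBounds C r i s a f) (hC : 1 ≤ C) (hs : 1 ≤ s)
    (hz : z ∈ Metric.ball (0 : ℂ) r) (hz0 : z ≠ 0) (hz1 : 2 * C ^ 2 * ‖z‖ ≤ 1)
    (ht : ∀ᶠ x in 𝓝 z, t x = 0)
    (hlam : ‖lam‖ ≤ C ^ 2 * (‖z‖ ^ s * ‖w‖ ^ s)) :
    ‖neckMap i s a lam f t z - f z‖ ≤ neckConst C s * ‖w‖ ^ s ∧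
    ∀ ζ, ‖fderiv ℝ (neckMap i s a lam f t) z ζ - fderiv ℝ f z ζ‖ ≤
      neckConst C s * (‖w‖ ^ s / ‖z‖) * ‖ζ‖ := by
  obtain ⟨k1, k2, k3, k4, k5, k6⟩ := neckConst_bounds hC s
  have hs0 : (0 : ℝ) ≤ s := Nat.cast_nonneg s
  set M := neckConst C s with hM
  have htz : t =ᶠ[𝓝 z] fun _ => 0 := ht
  have htd : DifferentiableAt ℝ t z := htz.differentiableAt_iff.2 (differentiableAt_const _)
  have ht' : fderiv ℝ t z = 0 := by rw [htz.fderiv_eq]; simp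
  obtain ⟨hX1, hX2, X', hX, hX3, hX4⟩ := hf.neckCoord_bounds hC hs hz hz0 hz1 htd
    ht.self_of_nhds.ge (ht.self_of_nhds.le.trans zero_le_one) (by rw [ht']; simp; linarith)
  have hX3' : ∀ ζ, ‖X' ζ‖ ≤ ((s + 6) * C ^ 2) * ‖z‖ ^ (s - 1) * ‖ζ‖ := fun ζ =>
    (hX3 ζ).trans (by gcongr; norm_num)
  have hX4' : ∀ ζ, ‖X' (Complex.I * ζ) - Complex.I * X' ζ‖ ≤ ((s + 6) * C ^ 2) * ‖z‖ ^ s * ‖ζ‖ :=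
    fun ζ => (hX4 ζ).trans (by gcongr; linarith)
  obtain ⟨hY1, Y', hY, hY3, hY4⟩ := LeafBounds.quotient_bounds (X := neckCoord i s a f t)
    (M := (s + 6) * C ^ 2) hC (by positivity) hs hz0 hlam hX1 hX hX3' hX4'
  have heq : ∀ᶠ x in 𝓝 z, neckMap i s a lam f t x =
      f x + ((0 : W), pair i 0 (lam / neckCoord i s a f t x)) := by
    filter_upwards [ht, Metric.isOpen_ball.mem_nhds hz] with x hx hxr
    have e1 : neckCoord i s a f t x = (f x).2 i := by simp [neckCoord, hx]
    refine Prod.ext ?_ ?_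
    · simp [neckMap, hx]
    · rw [neckMap, e1, Prod.snd_add]
      conv_rhs => rw [eq_pair_of_leaf (hf.leaf x hxr)]
      ext j
      simp only [pair, Pi.add_apply]
      split_ifs <;> simp
  obtain ⟨L2, hL2, hL2'⟩ := hasFDerivAt_pair i (hasFDerivAt_const (𝕜 := ℝ) (0 : ℂ) z) hY
  have hd := (hf.diff z hz).hasFDerivAt.add ((hasFDerivAt_const (𝕜 := ℝ) (0 : W) z).prodMk hL2)
  have hfd : fderiv ℝ (neckMap i s a lam f t) z = _ :=
    (Filter.EventuallyEq.fderiv_eq heq).trans hd.fderiv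
  constructor
  · rw [heq.self_of_nhds, add_sub_cancel_left]
    refine max_le (by simp only [norm_zero]; positivity) ?_
    refine norm_pair_le (by simp only [norm_zero]; positivity) (hY1.trans ?_)
    gcongr
  · intro ζ
    rw [hfd, add_apply, add_sub_cancel_left]
    refine max_le ?_ ?_
    · change ‖(0 : W)‖ ≤ _
      rw [norm_zero]; positivity
    · change ‖L2 ζ‖ ≤ _
      rw [hL2']
      refine norm_pair_le ?_ ((hY3 ζ).trans ?_)
      · rw [zero_apply, norm_zero]; positivity
      · gcongr

end NeckMap

section NodeEstimate

variable {W : Type*} [NormedAddCommGroup W] [NormedSpace ℝ W]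
  {EP : Type*} [NormedAddCommGroup EP] [NormedSpace ℝ EP]

theorem rpow_one_fifth_pow {x : ℝ} (hx : 0 ≤ x) : (x ^ (1 / 5 : ℝ)) ^ 5 = x := by
  rw [← Real.rpow_natCast, ← Real.rpow_mul hx]; norm_num

theorem norm_le_of_plumbRadius_le {μ z : ℂ} (h : plumbRadius μ z ≤ 2 * ‖μ‖ ^ (1 / 4 : ℝ)) :
    ‖z‖ ≤ 2 * ‖μ‖ ^ (1 / 5 : ℝ) * ‖z‖ ^ (1 / 5 : ℝ) := by
  have h1 := (norm_le_plumbRadius μ z).trans h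
  have h4 : (‖μ‖ ^ (1 / 4 : ℝ)) ^ 4 = ‖μ‖ := by
    rw [← Real.rpow_natCast, ← Real.rpow_mul (norm_nonneg _)]; norm_num
  have h2 : ‖z‖ ^ 4 ≤ 16 * ‖μ‖ := by
    calc _ ≤ (2 * ‖μ‖ ^ (1 / 4 : ℝ)) ^ 4 := by gcongr
      _ = _ := by rw [mul_pow, h4]; norm_num
  have ha := rpow_one_fifth_pow (norm_nonneg μ)
  have hy := rpow_one_fifth_pow (norm_nonneg z)
  set a := ‖μ‖ ^ (1 / 5 : ℝ)
  set y := ‖z‖ ^ (1 / 5 : ℝ)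
  have ha0 : 0 ≤ a := by positivity
  have hy0 : 0 ≤ y := by positivity
  have h3 : y ^ 4 ≤ 2 * a := by
    refine le_of_pow_le_pow_left₀ (n := 5) (by norm_num) (by positivity) ?_
    calc (y ^ 4) ^ 5 = ‖z‖ ^ 4 := by rw [← hy]; ring
      _ ≤ 16 * a ^ 5 := by rw [ha]; exact h2
      _ ≤ (2 * a) ^ 5 := by rw [mul_pow]; nlinarith [pow_nonneg ha0 5]
  calc ‖z‖ = y ^ 4 * y := by rw [← hy]; ring
    _ ≤ _ := by gcongr

theorem norm_div_le_of_lt_plumbRadius {μ z : ℂ} (hz : z ≠ 0) (hz1 : ‖z‖ ≤ 1)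
    (hμz : Real.sqrt ‖μ‖ ≤ ‖z‖) (h : 2 * ‖μ‖ ^ (1 / 4 : ℝ) < plumbRadius μ z) :
    ‖μ / z‖ ≤ ‖μ‖ ^ (1 / 5 : ℝ) * ‖z‖ ^ (1 / 5 : ℝ) := by
  have h1 : ‖μ‖ ^ (1 / 4 : ℝ) ≤ ‖z‖ := by linarith [plumbRadius_le hz hμz]
  have h4 : (‖μ‖ ^ (1 / 4 : ℝ)) ^ 4 = ‖μ‖ := by
    rw [← Real.rpow_natCast, ← Real.rpow_mul (norm_nonneg _)]; norm_num
  have h2 : ‖μ‖ ≤ ‖z‖ ^ 4 := by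
    rw [← h4]; gcongr
  have ha := rpow_one_fifth_pow (norm_nonneg μ)
  have hy := rpow_one_fifth_pow (norm_nonneg z)
  have hy1 : ‖z‖ ^ (1 / 5 : ℝ) ≤ 1 := Real.rpow_le_one (norm_nonneg _) hz1 (by norm_num)
  have hyp : 0 < ‖z‖ ^ (1 / 5 : ℝ) := by positivity
  set a := ‖μ‖ ^ (1 / 5 : ℝ)
  set y := ‖z‖ ^ (1 / 5 : ℝ)
  have ha0 : 0 ≤ a := by positivity
  have h3 : a ≤ y ^ 4 := by
    refine le_of_pow_le_pow_left₀ (n := 5) (by norm_num) (by positivity) ?_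
    calc a ^ 5 = ‖μ‖ := ha
      _ ≤ ‖z‖ ^ 4 := h2
      _ = (y ^ 4) ^ 5 := by rw [← hy]; ring
  rw [norm_div, div_le_iff₀ (norm_pos_iff.2 hz)]
  have h5 : a ^ 4 ≤ y ^ 6 := by
    calc a ^ 4 ≤ (y ^ 4) ^ 4 := by gcongr
      _ = y ^ 6 * y ^ 10 := by ring
      _ ≤ y ^ 6 * 1 := by gcongr; exact pow_le_one₀ hyp.le hy1
      _ = _ := mul_one _
  calc ‖μ‖ = a * a ^ 4 := by rw [← ha]; ring
    _ ≤ a * y ^ 6 := by gcongr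
    _ = a * y * ‖z‖ := by rw [← hy]; ring

/-- The estimate of `∂̄F - ν_F` near a node, in coordinates. -/
theorem exists_node_estimate {C ε : ℝ} (hC : 1 ≤ C) (hε : 0 < ε) {s : ℕ} (hs : 1 ≤ s) :
    ∃ K r₁ : ℝ, 1 ≤ K ∧ 0 < r₁ ∧ r₁ ≤ 1 ∧ ∀ (q₀ : EP)
      (J : W × (Fin 2 → ℂ) → W × (Fin 2 → ℂ) →L[ℝ] W × (Fin 2 → ℂ))
      (ν : W × (Fin 2 → ℂ) → EP → EP →L[ℝ] W × (Fin 2 → ℂ))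
      (j : ℂ →L[ℝ] ℂ) (f F : ℂ → W × (Fin 2 → ℂ)) (φ φ₀ : ℂ → EP) (i : Fin 2) (a lam μ : ℂ)
      (r κ κ₀ : ℝ) (β : ℝ → ℝ) (z : ℂ), NodeBounds C ε q₀ J ν → LeafBounds C r i s a f →
      IsCutoff β → DifferentiableAt ℝ (neckCutoff β μ) z →
      ‖fderiv ℝ (neckCutoff β μ) z‖ * ‖z‖ ≤ C → (∀ ζ, j ζ = Complex.I * ζ) →
      z ∈ Metric.ball (0 : ℂ) r → z ≠ 0 → ‖z‖ ≤ r₁ → Real.sqrt ‖μ‖ ≤ ‖z‖ → μ ≠ 0 →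
      coordDbar J ν j f φ₀ z = 0 → φ z ∈ Metric.ball q₀ ε → φ₀ z ∈ Metric.ball q₀ ε →
      (∀ ζ, ‖fderiv ℝ φ z ζ‖ ≤ C * ‖ζ‖) → ‖φ z - φ₀ z‖ ≤ C * (κ₀ + ‖μ / z‖ / ‖z‖) →
      (∀ ζ, ‖fderiv ℝ φ z ζ - fderiv ℝ φ₀ z ζ‖ ≤ C * (κ₀ + ‖μ / z‖ / ‖z‖) * ‖ζ‖) →
      0 ≤ κ₀ → κ₀ ≤ C * κ → ‖μ‖ ^ (1 / 5 : ℝ) ≤ C * κ → ‖lam‖ ≤ C ^ 2 * ‖μ‖ ^ s →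
      F =ᶠ[𝓝 z] neckMap i s a lam f (neckCutoff β μ) →
      DifferentiableAt ℝ F z ∧ F z ∈ Metric.ball 0 ε ∧ ‖(F z).2‖ ≤ K * ‖z‖ ^ (s - 1) ∧ ∀ ζ,
        ‖coordDbar J ν j F φ z ζ‖ * ‖z‖ ≤ K * κ * ‖z‖ ^ (1 / 5 : ℝ) * ‖ζ‖ ∧
        ‖(coordDbar J ν j F φ z ζ).2‖ * ‖z‖ ≤
          K * κ * ‖z‖ ^ (1 / 5 : ℝ) * ‖z‖ ^ (s - 1) * ‖ζ‖ := by
  obtain ⟨k1, k2, k3, k4, k5, k6⟩ := neckConst_bounds hC s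
  set M := neckConst C s with hM
  have hM0 : 0 < M := by linarith
  have hC2 : 1 ≤ C ^ 2 := one_le_pow₀ hC
  have hK1 : (1 : ℝ) ≤ 10 * C ^ 2 * M ^ 3 := by
    have := one_le_pow₀ k1 (n := 3)
    nlinarith [one_le_mul_of_one_le_of_one_le hC2 this]
  refine ⟨10 * C ^ 2 * M ^ 3, min (1 / (2 * C ^ 2)) (ε / (2 * M)), hK1, by positivity,
    (min_le_left _ _).trans ((div_le_one (by positivity)).2 (by linarith)), ?_⟩
  intro q₀ J ν j f F φ φ₀ i a lam μ r κ κ₀ β z hN hf hβ hcut hcut' hj hz hz0 hzr hμz hμ hsol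
    hφε hφ₀ε hDφ hφφ hDφφ hκ₀ hκ₀κ hμκ hlam hF
  have hzp : 0 < ‖z‖ := norm_pos_iff.2 hz0
  have hz1 : 2 * C ^ 2 * ‖z‖ ≤ 1 := by
    have := hzr.trans (min_le_left _ _)
    rw [le_div_iff₀ (by positivity)] at this
    linarith
  have hz2 : ‖z‖ ≤ 1 := by nlinarith
  have hzε : M * ‖z‖ < ε := by
    have := hzr.trans (min_le_right _ _)
    rw [le_div_iff₀ (by positivity)] at this
    nlinarith
  have hw := norm_div_le_of_sqrt_le hz0 hμz
  have hlam' : ‖lam‖ ≤ C ^ 2 * (‖z‖ ^ s * ‖μ / z‖ ^ s) := by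
    rw [← mul_pow, norm_div, mul_div_cancel₀ _ hzp.ne']
    exact hlam
  obtain ⟨hd, b1, b2, b3, b4, b5⟩ := hf.neckMap_bounds hC hs hz hz0 hz1 hcut (hβ.nonneg _)
    (hβ.le_one _) hcut' hw hlam'
  rw [← hF.fderiv_eq, ← hF.eq_of_nhds] at *
  have hFd : DifferentiableAt ℝ F z := (hF.differentiableAt_iff).2 hd
  have hFε : F z ∈ Metric.ball 0 ε := mem_ball_zero_iff.2 (b1.trans_lt hzε)
  have hp0 : ‖z‖ ^ s = ‖z‖ ^ (s - 1) * ‖z‖ := by rw [← pow_succ, Nat.sub_add_cancel hs]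
  have hps' : ‖z‖ ^ s ≤ ‖z‖ ^ (s - 1) := by
    rw [hp0]; exact mul_le_of_le_one_right (by positivity) hz2
  have hCM : C ≤ M := by linarith
  have hMK : M ≤ 10 * C ^ 2 * M ^ 3 := by
    have := one_le_pow₀ k1 (n := 2)
    calc M = 1 * 1 * (M * 1) := by ring
      _ ≤ 10 * C ^ 2 * (M * M ^ 2) := by gcongr; norm_num
      _ = _ := by ring
  have hκ : 0 ≤ κ := by
    by_contra h
    have : 0 ≤ C * κ := hκ₀.trans hκ₀κ
    nlinarith
  set y := ‖z‖ ^ (1 / 5 : ℝ) with hy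
  have hy0 : 0 < y := by positivity
  have hzy : ‖z‖ ≤ y := by
    calc ‖z‖ = ‖z‖ ^ (1 : ℝ) := (Real.rpow_one _).symm
      _ ≤ y := Real.rpow_le_rpow_of_exponent_ge hzp hz2 (by norm_num)
  refine ⟨hFd, hFε, b2.trans (by gcongr), fun ζ => ?_⟩
  rcases le_or_gt (plumbRadius μ z) (2 * ‖μ‖ ^ (1 / 4 : ℝ)) with hneck | hmid
  · obtain ⟨e1, e2⟩ := hN.coordDbar_neck hC k1 hs hj hFε hφε b1 b2 b3 b4 b5
      (fun ζ => (hDφ ζ).trans (by gcongr)) ζ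
    have h1 : ‖z‖ ≤ 2 * (C * κ) * y := (norm_le_of_plumbRadius_le hneck).trans (by gcongr)
    have h2 : 3 * C * M ^ 2 * (2 * (C * κ) * y) ≤ 10 * C ^ 2 * M ^ 3 * κ * y := by
      calc _ = 6 * C ^ 2 * (M ^ 2 * 1) * κ * y := by ring
        _ ≤ 10 * C ^ 2 * (M ^ 2 * M) * κ * y := by gcongr; norm_num
        _ = _ := by ring
    constructor
    · calc _ ≤ 3 * C * M ^ 2 * ‖ζ‖ * (2 * (C * κ) * y) := by gcongr
        _ = 3 * C * M ^ 2 * (2 * (C * κ) * y) * ‖ζ‖ := by ring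
        _ ≤ _ := by gcongr
    · calc _ ≤ 3 * C * M ^ 2 * ‖z‖ ^ (s - 1) * ‖ζ‖ * (2 * (C * κ) * y) := by
            refine mul_le_mul (e2.trans ?_) h1 (norm_nonneg _) (by positivity)
            gcongr
        _ = 3 * C * M ^ 2 * (2 * (C * κ) * y) * (‖z‖ ^ (s - 1) * ‖ζ‖) := by ring
        _ ≤ 10 * C ^ 2 * M ^ 3 * κ * y * (‖z‖ ^ (s - 1) * ‖ζ‖) := by gcongr
        _ = _ := by ring
  · have ht := hβ.neckCutoff_eventually_zero hμ hz0 hmid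
    obtain ⟨c1, c2⟩ := hf.neckMap_sub_bounds hC hs hz hz0 hz1 ht hlam'
    rw [← hF.fderiv_eq] at c2
    rw [← hF.eq_of_nhds] at c1
    have hfε : f z ∈ Metric.ball 0 ε := mem_ball_zero_iff.2
      ((hf.norm_le z hz).trans_lt (lt_of_le_of_lt (by gcongr) hzε))
    have hf2 : ‖(f z).2‖ ≤ M * ‖z‖ ^ s := by
      rw [eq_pair_of_leaf (hf.leaf z hz)]
      refine norm_pair_le ?_ (by rw [norm_zero]; positivity)
      have h1 := norm_le_norm_add_norm_sub' ((f z).2 i) (a * z ^ s)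
      have h2 : ‖a * z ^ s‖ ≤ C * ‖z‖ ^ s := by
        rw [norm_mul, norm_pow]; gcongr; exact hf.a_le
      have h3 : C * ‖z‖ ^ (s + 1) ≤ C * ‖z‖ ^ s := by
        gcongr C * ?_
        exact pow_le_pow_of_le_one hzp.le hz2 (by omega)
      have h4 : 2 * C * ‖z‖ ^ s ≤ M * ‖z‖ ^ s := by gcongr
      linarith [hf.rem z hz]
    set κ₁ := κ₀ + ‖μ / z‖ / ‖z‖ with hκ₁
    have hκ₁0 : 0 ≤ κ₁ := by positivity
    obtain ⟨e1, e2⟩ := hN.coordDbar_middle (κ := κ₁) hC k1 hs hj hz0 hz2 hw (by linarith)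
      hFε hfε hφε hφ₀ε hsol hf2 c1 c2
      (fun ζ => ((fderiv ℝ f z).le_opNorm ζ).trans (by
        gcongr; exact (hf.fderiv_le z hz).trans hCM))
      (fun ζ => (hDφ ζ).trans (by gcongr)) (hφφ.trans (by gcongr))
      (fun ζ => (hDφφ ζ).trans (by gcongr)) ζ
    have h1 : κ₁ * ‖z‖ ≤ 2 * (C * κ) * y := by
      have h2 : κ₁ * ‖z‖ = κ₀ * ‖z‖ + ‖μ / z‖ := by rw [hκ₁]; field_simp
      have h3 : κ₀ * ‖z‖ ≤ C * κ * y := by gcongr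
      have h4 : ‖μ / z‖ ≤ C * κ * y :=
        (norm_div_le_of_lt_plumbRadius hz0 hz2 hμz hmid).trans (by gcongr)
      linarith
    constructor
    · calc _ ≤ 5 * C * M ^ 3 * κ₁ * ‖ζ‖ * ‖z‖ := by gcongr
        _ = 5 * C * M ^ 3 * (κ₁ * ‖z‖) * ‖ζ‖ := by ring
        _ ≤ 5 * C * M ^ 3 * (2 * (C * κ) * y) * ‖ζ‖ := by gcongr
        _ = _ := by ring
    · calc _ ≤ 5 * C * M ^ 3 * κ₁ * ‖z‖ ^ (s - 1) * ‖ζ‖ * ‖z‖ := by gcongr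
        _ = 5 * C * M ^ 3 * (κ₁ * ‖z‖) * (‖z‖ ^ (s - 1) * ‖ζ‖) := by ring
        _ ≤ 5 * C * M ^ 3 * (2 * (C * κ) * y) * (‖z‖ ^ (s - 1) * ‖ζ‖) := by gcongr
        _ = _ := by ring

end NodeEstimate

theorem three_le_infty : (3 : ℕ∞ω) ≤ (∞ : ℕ∞ω) :=
  WithTop.coe_le_coe.2 (le_top : (3 : ℕ∞) ≤ ⊤)

section NodeCharts

variable {EZ : Type*} [NormedAddCommGroup EZ] [NormedSpace ℝ EZ]
  {Z : Type*} [TopologicalSpace Z] [ChartedSpace EZ Z] [IsManifold 𝓘(ℝ, EZ) ∞ Z]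
  {W : Type*} [NormedAddCommGroup W] [NormedSpace ℝ W]
  {EΘ : Type*} [NormedAddCommGroup EΘ] [NormedSpace ℝ EΘ]
  {Θ : Type*} [TopologicalSpace Θ] [ChartedSpace EΘ Θ] [IsManifold 𝓘(ℝ, EΘ) ∞ Θ]
  (T : SumFibration EZ Z W EΘ Θ)

theorem SumFibration.chart_contMDiffAt (θ₀ : Θ) {y₀ : W × (Fin 2 → ℂ)}
    (hy₀ : y₀ ∈ Metric.ball 0 T.ε) :
    ContMDiffAt (𝓘(ℝ, EΘ).prod 𝓘(ℝ, W × (Fin 2 → ℂ))) 𝓘(ℝ, EZ) ∞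
      (fun q : Θ × (W × (Fin 2 → ℂ)) => T.chart q.1 q.2) (θ₀, y₀) :=
  T.chart_smooth.contMDiffAt ((isOpen_univ.prod Metric.isOpen_ball).mem_nhds ⟨trivial, hy₀⟩)

theorem SumFibration.zero_mem_source (θ : Θ) : (0 : W × (Fin 2 → ℂ)) ∈ (T.chart θ).source := by
  rw [T.chart_source]; exact Metric.mem_ball_self T.ε_pos

theorem SumFibration.symm_contMDiffOn (θ : Θ) :
    ContMDiffOn 𝓘(ℝ, EZ) 𝓘(ℝ, W × (Fin 2 → ℂ)) ∞ (T.chart θ).symm (T.chart θ).target :=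
  T.chart_symm_smooth.comp (f := fun z : Z => (θ, z))
    ((contMDiff_const.prodMk contMDiff_id).contMDiffOn) fun _ hz => hz

/-- The domains of the inverse charts form a neighbourhood. -/
theorem SumFibration.target_mem_nhds [FiniteDimensional ℝ EZ] [FiniteDimensional ℝ W]
    [FiniteDimensional ℝ EΘ] (θ₀ : Θ) :
    {q : Θ × Z | q.2 ∈ (T.chart q.1).target} ∈ 𝓝 (θ₀, T.chart θ₀ 0) := by
  have : CompleteSpace EZ := FiniteDimensional.complete ℝ EZ
  have : CompleteSpace EΘ := FiniteDimensional.complete ℝ EΘ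
  have : CompleteSpace W := FiniteDimensional.complete ℝ W
  obtain ⟨z₀, hz₀⟩ : ∃ z, z = T.chart θ₀ 0 := ⟨_, rfl⟩
  rw [← hz₀]
  set Q : Θ × (W × (Fin 2 → ℂ)) → EZ := fun q => chartAt EZ z₀ (T.chart q.1 q.2) with hQ
  have hchart : ContMDiffAt 𝓘(ℝ, EZ) 𝓘(ℝ, EZ) ∞ (chartAt EZ z₀) z₀ :=
    (contMDiffOn_chart (I := 𝓘(ℝ, EZ)) (n := ∞) (x := z₀)).contMDiffAt
      ((chartAt EZ z₀).open_source.mem_nhds (mem_chart_source EZ z₀))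
  have h0 := T.chart_contMDiffAt θ₀ (Metric.mem_ball_self T.ε_pos)
  have hQs : ContMDiffAt (𝓘(ℝ, EΘ).prod 𝓘(ℝ, W × (Fin 2 → ℂ))) 𝓘(ℝ, EZ) ∞ Q (θ₀, 0) :=
    ContMDiffAt.comp_of_eq (g := chartAt EZ z₀) (y := z₀) hchart h0 hz₀.symm
  have hG := contDiffAt_of_param le_rfl hQs
  set G : EΘ × (W × (Fin 2 → ℂ)) → EZ := fun r => Q ((chartAt EΘ θ₀).symm r.1, r.2) with hGdef
  set t₀ := chartAt EΘ θ₀ θ₀ with ht₀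
  have hθ₀ : (chartAt EΘ θ₀).symm t₀ = θ₀ := (chartAt EΘ θ₀).left_inv (mem_chart_source EΘ θ₀)
  have hGd := hG.hasStrictFDerivAt (by simp)
  have hΨ := (hasStrictFDerivAt_fst (𝕜 := ℝ) (p := (t₀, (0 : W × (Fin 2 → ℂ))))).prodMk hGd
  have hsurj : Function.Surjective ((ContinuousLinearMap.fst ℝ EΘ (W × (Fin 2 → ℂ))).prod
      (fderiv ℝ G (t₀, 0))) := by
    set inv : EZ → W × (Fin 2 → ℂ) := fun x => (T.chart θ₀).symm ((chartAt EZ z₀).symm x)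
    have hx₀ : (chartAt EZ z₀).symm (chartAt EZ z₀ z₀) = z₀ :=
      (chartAt EZ z₀).left_inv (mem_chart_source EZ z₀)
    have hz₀t : z₀ ∈ (T.chart θ₀).target := hz₀ ▸ (T.chart θ₀).map_source (T.zero_mem_source θ₀)
    have hsymm : ContMDiffAt 𝓘(ℝ, EZ) 𝓘(ℝ, EZ) ∞ (chartAt EZ z₀).symm (chartAt EZ z₀ z₀) :=
      (contMDiffOn_chart_symm (I := 𝓘(ℝ, EZ)) (n := ∞) (x := z₀)).contMDiffAt
        ((chartAt EZ z₀).open_target.mem_nhds (mem_chart_target EZ z₀))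
    have hinv : DifferentiableAt ℝ inv (chartAt EZ z₀ z₀) := by
      rw [← mdifferentiableAt_iff_differentiableAt]
      refine ContMDiffAt.mdifferentiableAt (n := ∞) ?_ (by simp)
      refine ContMDiffAt.comp_of_eq (g := (T.chart θ₀).symm) ?_ hsymm hx₀
      exact (T.symm_contMDiffOn θ₀).contMDiffAt ((T.chart θ₀).open_target.mem_nhds hz₀t)
    have hinv0 : inv (chartAt EZ z₀ z₀) = 0 := by
      simp only [inv, hx₀]
      rw [hz₀]
      exact (T.chart θ₀).left_inv (T.zero_mem_source θ₀)
    have hid : (fun x => G (t₀, inv x)) =ᶠ[𝓝 (chartAt EZ z₀ z₀)] id := by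
      have h1 : ∀ᶠ x in 𝓝 (chartAt EZ z₀ z₀), (chartAt EZ z₀).symm x ∈ (T.chart θ₀).target := by
        have := hsymm.continuousAt.tendsto
        rw [hx₀] at this
        exact this.eventually ((T.chart θ₀).open_target.mem_nhds hz₀t)
      filter_upwards [h1, (chartAt EZ z₀).open_target.mem_nhds (mem_chart_target EZ z₀)] with x h2 h3
      simp only [hGdef, hQ, inv, hθ₀]
      rw [(T.chart θ₀).right_inv h2, (chartAt EZ z₀).right_inv h3]
      rfl
    intro ⟨dt, u⟩
    have h2 : HasFDerivAt G (fderiv ℝ G (t₀, 0)) (t₀, inv (chartAt EZ z₀ z₀)) := by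
      rw [hinv0]; exact hGd.hasFDerivAt
    have h3 := h2.comp (chartAt EZ z₀ z₀) ((hasFDerivAt_prodMk_right t₀ _).comp _ hinv.hasFDerivAt)
    have h4 := (hid.fderiv_eq).symm.trans h3.fderiv
    have h5 : ∀ u : EZ, fderiv ℝ G (t₀, 0) (0, fderiv ℝ inv (chartAt EZ z₀ z₀) u) = u := by
      intro u
      have := congrArg (fun L => L u) h4
      simp only [fderiv_id, ContinuousLinearMap.id_apply] at this
      exact this.symm
    refine ⟨(dt, fderiv ℝ inv (chartAt EZ z₀ z₀) (u - fderiv ℝ G (t₀, 0) (dt, 0))), ?_⟩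
    refine Prod.ext rfl ?_
    change fderiv ℝ G (t₀, 0) (dt, fderiv ℝ inv (chartAt EZ z₀ z₀) _) = u
    have h6 : ∀ x : W × (Fin 2 → ℂ), ((dt, x) : EΘ × (W × (Fin 2 → ℂ))) = (dt, 0) + (0, x) := by
      intro x; simp
    rw [h6, map_add, h5]
    abel
  have hmap := hΨ.map_nhds_eq_of_surj (LinearMap.range_eq_top.2 hsurj)
  have hcont : ContinuousAt (fun r : EΘ × (W × (Fin 2 → ℂ)) =>
      T.chart ((chartAt EΘ θ₀).symm r.1) r.2) (t₀, 0) := by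
    have h1 : ContinuousAt (fun r : EΘ × (W × (Fin 2 → ℂ)) => ((chartAt EΘ θ₀).symm r.1, r.2))
        (t₀, 0) := ContinuousAt.prodMk (ContinuousAt.comp_of_eq
          ((chartAt EΘ θ₀).symm.continuousAt (mem_chart_target EΘ θ₀)) continuousAt_fst rfl)
          continuousAt_snd
    refine ContinuousAt.comp_of_eq (g := fun q : Θ × (W × (Fin 2 → ℂ)) => T.chart q.1 q.2)
      (y := (θ₀, 0)) h0.continuousAt h1 ?_
    simp only [hθ₀]
  have hU : ∀ᶠ r in 𝓝 (t₀, (0 : W × (Fin 2 → ℂ))), r.2 ∈ Metric.ball 0 T.ε ∧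
      T.chart ((chartAt EΘ θ₀).symm r.1) r.2 ∈ (chartAt EZ z₀).source := by
    refine (continuousAt_snd.eventually (Metric.ball_mem_nhds _ T.ε_pos)).and ?_
    refine hcont.eventually ?_
    simp only [hθ₀, ← hz₀]
    exact (chartAt EZ z₀).open_source.mem_nhds (mem_chart_source EZ z₀)
  have himg := image_mem_map (m := fun r => (r.1, G r)) hU
  rw [hmap] at himg
  have hval : (t₀, G (t₀, 0)) = (chartAt EΘ θ₀ θ₀, chartAt EZ z₀ z₀) := by
    simp only [hGdef, hQ, hθ₀, ← hz₀, ← ht₀]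
  have hpull : Tendsto (fun q : Θ × Z => (chartAt EΘ θ₀ q.1, chartAt EZ z₀ q.2)) (𝓝 (θ₀, z₀))
      (𝓝 (chartAt EΘ θ₀ θ₀, chartAt EZ z₀ z₀)) :=
    ContinuousAt.prodMk
      (ContinuousAt.comp_of_eq ((chartAt EΘ θ₀).continuousAt (mem_chart_source EΘ θ₀))
        continuousAt_fst rfl)
      (ContinuousAt.comp_of_eq ((chartAt EZ z₀).continuousAt (mem_chart_source EZ z₀))
        continuousAt_snd rfl)
  rw [← hval] at hpull
  have hs1 : ∀ᶠ q in 𝓝 ((θ₀, z₀) : Θ × Z), q.1 ∈ (chartAt EΘ θ₀).source :=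
    continuousAt_fst.eventually ((chartAt EΘ θ₀).open_source.mem_nhds (mem_chart_source EΘ θ₀))
  have hs2 : ∀ᶠ q in 𝓝 ((θ₀, z₀) : Θ × Z), q.2 ∈ (chartAt EZ z₀).source :=
    continuousAt_snd.eventually ((chartAt EZ z₀).open_source.mem_nhds (mem_chart_source EZ z₀))
  filter_upwards [hpull.eventually himg, hs1, hs2] with q hq h1 h2
  obtain ⟨⟨t, y⟩, ⟨hy1, hy2⟩, hr⟩ := hq
  have e1 : t = chartAt EΘ θ₀ q.1 := congrArg Prod.fst hr
  have e2 : chartAt EZ z₀ (T.chart ((chartAt EΘ θ₀).symm t) y) = chartAt EZ z₀ q.2 :=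
    congrArg Prod.snd hr
  have e3 := (chartAt EZ z₀).injOn hy2 h2 e2
  rw [e1, (chartAt EΘ θ₀).left_inv h1] at e3
  change q.2 ∈ (T.chart q.1).target
  rw [← e3]
  refine (T.chart q.1).map_source ?_
  rw [T.chart_source]
  exact hy1

theorem SumFibration.isChartFamily [FiniteDimensional ℝ EZ] [FiniteDimensional ℝ W]
    [FiniteDimensional ℝ EΘ] (θ₀ : Θ) :
    IsChartFamily EΘ EZ (fun θ => T.chart θ) (fun θ => (T.chart θ).symm) θ₀ 0 where
  smooth := (T.chart_contMDiffAt θ₀ (Metric.mem_ball_self T.ε_pos)).of_le three_le_infty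
  smooth' := (T.chart_symm_smooth.contMDiffAt (T.target_mem_nhds θ₀)).of_le three_le_infty
  left_inv := by
    have : ∀ᶠ r in 𝓝 ((θ₀, 0) : Θ × (W × (Fin 2 → ℂ))), r.2 ∈ Metric.ball 0 T.ε :=
      continuousAt_snd.eventually (Metric.ball_mem_nhds _ T.ε_pos)
    filter_upwards [this] with r hr
    refine (T.chart r.1).left_inv ?_
    rw [T.chart_source]; exact hr
  right_inv := by
    filter_upwards [T.target_mem_nhds θ₀] with r hr using (T.chart r.1).right_inv hr

/-- A chart of the manifold as a constant family. -/
theorem isChartFamily_chartAt (z₀ : Z) :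
    IsChartFamily ℝ EZ (fun _ : ℝ => (chartAt EZ z₀).symm) (fun _ : ℝ => chartAt EZ z₀) 0
      (chartAt EZ z₀ z₀) := by
  have hx₀ : (chartAt EZ z₀).symm (chartAt EZ z₀ z₀) = z₀ :=
    (chartAt EZ z₀).left_inv (mem_chart_source EZ z₀)
  refine ⟨?_, ?_, ?_, ?_⟩
  · have h1 : ContMDiffAt 𝓘(ℝ, EZ) 𝓘(ℝ, EZ) 3 (chartAt EZ z₀).symm (chartAt EZ z₀ z₀) :=
      ((contMDiffOn_chart_symm (I := 𝓘(ℝ, EZ)) (n := ∞) (x := z₀)).contMDiffAt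
        ((chartAt EZ z₀).open_target.mem_nhds (mem_chart_target EZ z₀))).of_le three_le_infty
    exact ContMDiffAt.comp (g := (chartAt EZ z₀).symm) ((0 : ℝ), chartAt EZ z₀ z₀) h1
      contMDiffAt_snd
  · have h1 : ContMDiffAt 𝓘(ℝ, EZ) 𝓘(ℝ, EZ) 3 (chartAt EZ z₀) z₀ :=
      ((contMDiffOn_chart (I := 𝓘(ℝ, EZ)) (n := ∞) (x := z₀)).contMDiffAt
        ((chartAt EZ z₀).open_source.mem_nhds (mem_chart_source EZ z₀))).of_le three_le_infty
    refine ContMDiffAt.comp_of_eq (g := chartAt EZ z₀) (y := z₀) h1 contMDiffAt_snd ?_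
    exact hx₀
  · have : ∀ᶠ r in 𝓝 (((0 : ℝ), chartAt EZ z₀ z₀) : ℝ × EZ), r.2 ∈ (chartAt EZ z₀).target :=
      continuousAt_snd.eventually ((chartAt EZ z₀).open_target.mem_nhds (mem_chart_target EZ z₀))
    filter_upwards [this] with r hr using (chartAt EZ z₀).right_inv hr
  · have : ∀ᶠ r in 𝓝 (((0 : ℝ), z₀) : ℝ × Z), r.2 ∈ (chartAt EZ z₀).source :=
      continuousAt_snd.eventually ((chartAt EZ z₀).open_source.mem_nhds (mem_chart_source EZ z₀))
    rw [hx₀]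
    filter_upwards [this] with r hr using (chartAt EZ z₀).left_inv hr

end NodeCharts

section NodeStructure

variable {EZ : Type*} [NormedAddCommGroup EZ] [NormedSpace ℝ EZ]
  {Z : Type*} [TopologicalSpace Z] [ChartedSpace EZ Z] [IsManifold 𝓘(ℝ, EZ) ∞ Z]
  {W : Type*} [NormedAddCommGroup W] [NormedSpace ℝ W]
  {EΘ : Type*} [NormedAddCommGroup EΘ] [NormedSpace ℝ EΘ]
  {Θ : Type*} [TopologicalSpace Θ] [ChartedSpace EΘ Θ] [IsManifold 𝓘(ℝ, EΘ) ∞ Θ]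
  {EP : Type*} [NormedAddCommGroup EP] [NormedSpace ℝ EP]
  {P : Type*} [TopologicalSpace P] [ChartedSpace EP P] [IsManifold 𝓘(ℝ, EP) ∞ P]
  (T : SumFibration EZ Z W EΘ Θ)

theorem nonpos_of_le_mul {a K δ : ℝ} (hδ : 0 < δ) (h : ∀ x, 0 < x → x < δ → a ≤ K * x) : a ≤ 0 := by
  have h1 : Tendsto (fun x : ℝ => K * x) (𝓝[>] 0) (𝓝 0) := by
    have : Tendsto (fun x : ℝ => K * x) (𝓝 0) (𝓝 (K * 0)) := (continuous_const_mul K).tendsto 0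
    rw [mul_zero] at this
    exact this.mono_left nhdsWithin_le_nhds
  refine ge_of_tendsto h1 ?_
  filter_upwards [Ioo_mem_nhdsGT hδ] with x hx using h x hx.1 hx.2

/-- The derivative of `lam` in the chart at a node. -/
theorem SumFibration.mfderiv_lam_chart {θ : Θ} {y : W × (Fin 2 → ℂ)}
    (hy : y ∈ Metric.ball 0 T.ε) (hc : MDifferentiableAt 𝓘(ℝ, W × (Fin 2 → ℂ)) 𝓘(ℝ, EZ) (T.chart θ) y)
    (u : W × (Fin 2 → ℂ)) :
    (mfderiv 𝓘(ℝ, EZ) 𝓘(ℝ, ℂ) T.lam (T.chart θ y)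
      (mfderiv 𝓘(ℝ, W × (Fin 2 → ℂ)) 𝓘(ℝ, EZ) (T.chart θ) y u) : ℂ) =
      y.2 0 * u.2 1 + u.2 0 * y.2 1 := by
  have h1 := mfderiv_comp_apply y ((T.lam_smooth _).mdifferentiableAt (by simp)) hc u
  refine h1.symm.trans ?_
  have h2 : (T.lam ∘ T.chart θ) =ᶠ[𝓝 y] fun y => y.2 0 * y.2 1 := by
    filter_upwards [Metric.isOpen_ball.mem_nhds hy] with x hx using T.chart_lam θ x hx
  rw [h2.mfderiv_eq, mfderiv_eq_fderiv]
  have h3 : ∀ j : Fin 2, HasFDerivAt (fun y : W × (Fin 2 → ℂ) => y.2 j)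
      ((ContinuousLinearMap.proj (R := ℝ) (φ := fun _ : Fin 2 => ℂ) j).comp
        (ContinuousLinearMap.snd ℝ W (Fin 2 → ℂ))) y := fun j =>
    ((ContinuousLinearMap.proj (R := ℝ) (φ := fun _ : Fin 2 => ℂ) j).comp
        (ContinuousLinearMap.snd ℝ W (Fin 2 → ℂ))).hasFDerivAt
  have h4 : y.2 0 * u.2 1 + y.2 1 * u.2 0 = y.2 0 * u.2 1 + u.2 0 * y.2 1 := by ring
  exact (congrArg (fun L : W × (Fin 2 → ℂ) →L[ℝ] ℂ => L u) ((h3 0).fun_mul (h3 1)).fderiv).trans h4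

theorem SumFibration.mfderiv_lam_leaf {θ : Θ} {v : W} {i j : Fin 2} (hij : j ≠ i) {x : ℂ}
    (hy : (v, pair i x 0) ∈ Metric.ball (0 : W × (Fin 2 → ℂ)) T.ε)
    (hc : MDifferentiableAt 𝓘(ℝ, W × (Fin 2 → ℂ)) 𝓘(ℝ, EZ) (T.chart θ) (v, pair i x 0))
    (u : W × (Fin 2 → ℂ)) :
    (mfderiv 𝓘(ℝ, EZ) 𝓘(ℝ, ℂ) T.lam (T.chart θ (v, pair i x 0))
      (mfderiv 𝓘(ℝ, W × (Fin 2 → ℂ)) 𝓘(ℝ, EZ) (T.chart θ) (v, pair i x 0) u) : ℂ) = x * u.2 j := by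
  have h : pair i x 0 0 * u.2 1 + u.2 0 * pair i x 0 1 = x * u.2 j := by
    fin_cases i <;> fin_cases j <;> simp [pair] at hij ⊢
    ring
  exact (T.mfderiv_lam_chart hy hc u).trans h

theorem norm_leaf_sub (v : W) (i : Fin 2) (x : ℂ) :
    ‖((v, (0 : Fin 2 → ℂ)) : W × (Fin 2 → ℂ)) - (v, pair i x 0)‖ ≤ ‖x‖ := by
  rw [Prod.mk_sub_mk, sub_self]
  refine max_le (by simp) ?_
  rw [zero_sub, norm_neg]
  exact norm_pair_le le_rfl (by simp)

theorem leaf_mem_ball {v : W} {ε : ℝ} (hv : v ∈ Metric.ball (0 : W) ε) {i : Fin 2} {x : ℂ}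
    (hx : ‖x‖ < ε) : (v, pair i x 0) ∈ Metric.ball (0 : W × (Fin 2 → ℂ)) ε := by
  rw [mem_ball_zero_iff] at *
  refine max_lt hv ?_
  exact (norm_pair_le le_rfl (by simp)).trans_lt hx

variable {T}

/-- In the charts at the nodes, `J` preserves the coordinate directions along `V`. -/
theorem CompatiblePair.coordEnd_tangent (A : CompatiblePair T EP P) {θ : Θ} {ε C : ℝ}
    (hεT : ε ≤ T.ε)
    (hc : ∀ y ∈ Metric.ball (0 : W × (Fin 2 → ℂ)) ε,
      MDifferentiableAt 𝓘(ℝ, W × (Fin 2 → ℂ)) 𝓘(ℝ, EZ) (T.chart θ) y ∧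
      ∀ u : EZ, (mfderiv 𝓘(ℝ, W × (Fin 2 → ℂ)) 𝓘(ℝ, EZ) (T.chart θ) y
      (mfderiv 𝓘(ℝ, EZ) 𝓘(ℝ, W × (Fin 2 → ℂ)) (T.chart θ).symm (T.chart θ y) u :
        W × (Fin 2 → ℂ)) : EZ) = u)
    (hJ : ∀ y ∈ Metric.ball (0 : W × (Fin 2 → ℂ)) ε, ∀ y' ∈ Metric.ball (0 : W × (Fin 2 → ℂ)) ε,
      ‖coordEnd A.J (T.chart θ) (T.chart θ).symm y - coordEnd A.J (T.chart θ) (T.chart θ).symm y'‖ ≤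
        C * ‖y - y'‖) (hC : 0 ≤ C) {v : W} (hv : v ∈ Metric.ball (0 : W) ε) {j : Fin 2}
    {u : W × (Fin 2 → ℂ)} (hu : u.2 j = 0) :
    (coordEnd A.J (T.chart θ) (T.chart θ).symm (v, 0) u).2 j = 0 := by
  have hε : 0 < ε := (norm_nonneg v).trans_lt (mem_ball_zero_iff.1 hv)
  set Jh := coordEnd A.J (T.chart θ) (T.chart θ).symm with hJh
  obtain ⟨i, hij⟩ : ∃ i : Fin 2, j ≠ i := ⟨j + 1, by fin_cases j <;> simp⟩
  have key : ∀ x : ℂ, x ≠ 0 → ‖x‖ < ε → (Jh (v, pair i x 0) u).2 j = 0 := by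
    intro x hx hxε
    have hy := leaf_mem_ball hv (i := i) hxε
    have hyT := Metric.ball_subset_ball hεT hy
    obtain ⟨hd, hr⟩ := hc _ hy
    have h1 := T.mfderiv_lam_leaf hij hyT hd u
    rw [hu, mul_zero] at h1
    have h2 := A.J_fibre _ _ h1
    have h3 := T.mfderiv_lam_leaf hij hyT hd (Jh (v, pair i x 0) u)
    have h4 : (mfderiv 𝓘(ℝ, W × (Fin 2 → ℂ)) 𝓘(ℝ, EZ) (T.chart θ) (v, pair i x 0)
        (Jh (v, pair i x 0) u) : EZ) = A.J (T.chart θ (v, pair i x 0))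
        (mfderiv 𝓘(ℝ, W × (Fin 2 → ℂ)) 𝓘(ℝ, EZ) (T.chart θ) (v, pair i x 0) u) := hr _
    have h5 : x * (Jh (v, pair i x 0) u).2 j = 0 := by
      rw [← h3]
      refine (congrArg (fun w : EZ =>
        (mfderiv 𝓘(ℝ, EZ) 𝓘(ℝ, ℂ) T.lam (T.chart θ (v, pair i x 0)) w : ℂ)) h4).trans h2
    exact (mul_eq_zero.1 h5).resolve_left hx
  have h0 : ((v, 0) : W × (Fin 2 → ℂ)) ∈ Metric.ball 0 ε := by
    have := leaf_mem_ball hv (i := i) (x := 0) (by simpa using hε)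
    convert this using 2
    ext j; simp [pair]
  refine norm_le_zero_iff.1 (nonpos_of_le_mul (K := C * ‖u‖) hε fun x hx hxε => ?_)
  have hxn : ‖(x : ℂ)‖ = x := by rw [Complex.norm_real, Real.norm_of_nonneg hx.le]
  have h1 := key (x : ℂ) (by exact_mod_cast hx.ne') (by rwa [hxn])
  have h2 : (Jh (v, 0) u).2 j = ((Jh (v, 0) - Jh (v, pair i x 0)) u).2 j := by
    rw [sub_apply, Prod.snd_sub, Pi.sub_apply, h1, sub_zero]
  rw [h2]
  refine (norm_le_pi_norm _ j).trans ((norm_snd_le _).trans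
    ((ContinuousLinearMap.le_opNorm _ _).trans ?_))
  have h3 := hJ _ h0 _ (leaf_mem_ball hv (i := i) (x := x) (by rwa [hxn]))
  have h4 := norm_leaf_sub v i (x : ℂ)
  rw [hxn] at h4
  calc _ ≤ C * ‖((v, (0 : Fin 2 → ℂ)) : W × (Fin 2 → ℂ)) - (v, pair i x 0)‖ * ‖u‖ := by gcongr
    _ ≤ C * x * ‖u‖ := by gcongr
    _ = _ := by ring

/-- In the charts at the nodes, `ν` is tangent to `V` along `V`. -/
theorem CompatiblePair.coordHom_tangent (A : CompatiblePair T EP P) {θ : Θ} {ε C : ℝ}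
    (hεT : ε ≤ T.ε) {ψ : EP → P} {q : EP}
    (hc : ∀ y ∈ Metric.ball (0 : W × (Fin 2 → ℂ)) ε,
      MDifferentiableAt 𝓘(ℝ, W × (Fin 2 → ℂ)) 𝓘(ℝ, EZ) (T.chart θ) y ∧
      ∀ u : EZ, (mfderiv 𝓘(ℝ, W × (Fin 2 → ℂ)) 𝓘(ℝ, EZ) (T.chart θ) y
      (mfderiv 𝓘(ℝ, EZ) 𝓘(ℝ, W × (Fin 2 → ℂ)) (T.chart θ).symm (T.chart θ y) u :
        W × (Fin 2 → ℂ)) : EZ) = u)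
    (hν : ∀ y ∈ Metric.ball (0 : W × (Fin 2 → ℂ)) ε, ∀ y' ∈ Metric.ball (0 : W × (Fin 2 → ℂ)) ε,
      ‖coordHom A.ν (T.chart θ) (T.chart θ).symm ψ y q -
        coordHom A.ν (T.chart θ) (T.chart θ).symm ψ y' q‖ ≤ C * ‖y - y'‖)
    (hC : 0 ≤ C) {v : W} (hv : v ∈ Metric.ball (0 : W) ε) (w : EP) :
    (coordHom A.ν (T.chart θ) (T.chart θ).symm ψ (v, 0) q w).2 = 0 := by
  ext j
  rw [Pi.zero_apply]
  have hε : 0 < ε := (norm_nonneg v).trans_lt (mem_ball_zero_iff.1 hv)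
  set νh := coordHom A.ν (T.chart θ) (T.chart θ).symm ψ with hνh
  obtain ⟨i, hij⟩ : ∃ i : Fin 2, j ≠ i := ⟨j + 1, by fin_cases j <;> simp⟩
  have key : ∀ x : ℂ, x ≠ 0 → ‖x‖ < ε → (νh (v, pair i x 0) q w).2 j = 0 := by
    intro x hx hxε
    have hy := leaf_mem_ball hv (i := i) hxε
    have hyT := Metric.ball_subset_ball hεT hy
    obtain ⟨hd, hr⟩ := hc _ hy
    have h2 := A.ν_fibre (T.chart θ (v, pair i x 0)) (ψ q) (mfderiv 𝓘(ℝ, EP) 𝓘(ℝ, EP) ψ q w)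
    have h3 := T.mfderiv_lam_leaf hij hyT hd (νh (v, pair i x 0) q w)
    have h4 : (mfderiv 𝓘(ℝ, W × (Fin 2 → ℂ)) 𝓘(ℝ, EZ) (T.chart θ) (v, pair i x 0)
        (νh (v, pair i x 0) q w) : EZ) = A.ν (T.chart θ (v, pair i x 0)) (ψ q)
        (mfderiv 𝓘(ℝ, EP) 𝓘(ℝ, EP) ψ q w) := hr _
    have h5 : x * (νh (v, pair i x 0) q w).2 j = 0 := by
      rw [← h3]
      refine (congrArg (fun w : EZ =>
        (mfderiv 𝓘(ℝ, EZ) 𝓘(ℝ, ℂ) T.lam (T.chart θ (v, pair i x 0)) w : ℂ)) h4).trans h2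
    exact (mul_eq_zero.1 h5).resolve_left hx
  have h0 : ((v, 0) : W × (Fin 2 → ℂ)) ∈ Metric.ball 0 ε := by
    have := leaf_mem_ball hv (i := i) (x := 0) (by simpa using hε)
    convert this using 2
    ext j; simp [pair]
  refine norm_le_zero_iff.1 (nonpos_of_le_mul (K := C * ‖w‖) hε fun x hx hxε => ?_)
  have hxn : ‖(x : ℂ)‖ = x := by rw [Complex.norm_real, Real.norm_of_nonneg hx.le]
  have h1 := key (x : ℂ) (by exact_mod_cast hx.ne') (by rwa [hxn])
  have h2 : (νh (v, 0) q w).2 j = ((νh (v, 0) q - νh (v, pair i x 0) q) w).2 j := by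
    rw [sub_apply, Prod.snd_sub, Pi.sub_apply, h1, sub_zero]
  rw [h2]
  refine (norm_le_pi_norm _ j).trans ((norm_snd_le _).trans
    ((ContinuousLinearMap.le_opNorm _ _).trans ?_))
  have h3 := hν _ h0 _ (leaf_mem_ball hv (i := i) (x := x) (by rwa [hxn]))
  have h4 := norm_leaf_sub v i (x : ℂ)
  rw [hxn] at h4
  calc _ ≤ C * ‖((v, (0 : Fin 2 → ℂ)) : W × (Fin 2 → ℂ)) - (v, pair i x 0)‖ * ‖w‖ := by gcongr
    _ ≤ C * x * ‖w‖ := by gcongr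
    _ = _ := by ring

end NodeStructure

theorem norm_map_le_of_ball {X Y : Type*} [NormedAddCommGroup X] [NormedSpace ℝ X]
    [NormedAddCommGroup Y] [NormedSpace ℝ Y] (L : X →L[ℝ] Y) {ε B : ℝ} (hε : 0 < ε)
    (h : ∀ x ∈ Metric.ball (0 : X) ε, ‖L x‖ ≤ B) (x : X) : ‖L x‖ ≤ 2 / ε * B * ‖x‖ := by
  rcases eq_or_ne x 0 with rfl | hx
  · simp
  have hxn : 0 < ‖x‖ := norm_pos_iff.2 hx
  have hc : 0 < ε / (2 * ‖x‖) := by positivity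
  have h1 := h ((ε / (2 * ‖x‖)) • x) (by
    rw [mem_ball_zero_iff, norm_smul, Real.norm_of_nonneg hc.le]
    field_simp
    linarith)
  rw [map_smul, norm_smul, Real.norm_of_nonneg hc.le] at h1
  rw [div_mul_eq_mul_div, div_le_iff₀ (by positivity)] at h1
  rw [div_mul_eq_mul_div, div_mul_eq_mul_div, le_div_iff₀ hε]
  linarith

section NodeStructure

variable {EZ : Type*} [NormedAddCommGroup EZ] [NormedSpace ℝ EZ]
  {Z : Type*} [TopologicalSpace Z] [ChartedSpace EZ Z] [IsManifold 𝓘(ℝ, EZ) ∞ Z]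
  {W : Type*} [NormedAddCommGroup W] [NormedSpace ℝ W]
  {EΘ : Type*} [NormedAddCommGroup EΘ] [NormedSpace ℝ EΘ]
  {Θ : Type*} [TopologicalSpace Θ] [ChartedSpace EΘ Θ] [IsManifold 𝓘(ℝ, EΘ) ∞ Θ]
  {EP : Type*} [NormedAddCommGroup EP] [NormedSpace ℝ EP]
  {P : Type*} [TopologicalSpace P] [ChartedSpace EP P] [IsManifold 𝓘(ℝ, EP) ∞ P]
  {T : SumFibration EZ Z W EΘ Θ}

theorem SumFibration.chart_mem_V (θ : Θ) {y : W × (Fin 2 → ℂ)} (hy : y ∈ Metric.ball 0 T.ε) :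
    T.chart θ y ∈ T.V ↔ y.2 = 0 := by
  constructor
  · rintro ⟨h0, h1⟩
    rw [T.chart_comp θ y hy] at h0 h1
    ext j
    fin_cases j
    · exact h1 0 (by simp)
    · exact h0 1 (by simp)
  · intro h
    refine ⟨(T.chart_comp θ y hy 0).2 fun j _ => ?_, (T.chart_comp θ y hy 1).2 fun j _ => ?_⟩ <;>
    simp [h]

theorem SumFibration.tangentTo_V {θ : Θ} {v : W} (hv : v ∈ Metric.ball (0 : W) T.ε) (w : W)
    (hc : MDifferentiableAt 𝓘(ℝ, W × (Fin 2 → ℂ)) 𝓘(ℝ, EZ) (T.chart θ) (v, 0)) :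
    TangentTo T.V (T.chart θ (v, 0))
      (mfderiv 𝓘(ℝ, W × (Fin 2 → ℂ)) 𝓘(ℝ, EZ) (T.chart θ) (v, 0) (w, 0)) := by
  rw [mem_ball_zero_iff] at hv
  obtain ⟨c, hc0, hcw⟩ : ∃ c : ℝ, 0 < c ∧ ‖v‖ + c * ‖w‖ < T.ε := by
    refine ⟨(T.ε - ‖v‖) / (2 * (‖w‖ + 1)), div_pos (by linarith) (by positivity), ?_⟩
    have h1 : (T.ε - ‖v‖) / (2 * (‖w‖ + 1)) * ‖w‖ < T.ε - ‖v‖ := by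
      rw [div_mul_eq_mul_div, div_lt_iff₀ (by positivity)]
      nlinarith [norm_nonneg w]
    linarith
  set κ : ℝ → W × (Fin 2 → ℂ) := fun t => (v + (c * Real.sin (t / c)) • w, 0) with hκ
  have hκs : ContDiff ℝ ∞ κ := by
    have : ContDiff ℝ ∞ (fun t : ℝ => c * Real.sin (t / c)) :=
      contDiff_const.mul (Real.contDiff_sin.comp (contDiff_id.div_const c))
    exact (contDiff_const.add (this.smul contDiff_const)).prodMk contDiff_const
  have hκb : ∀ t, κ t ∈ Metric.ball (0 : W × (Fin 2 → ℂ)) T.ε := by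
    intro t
    rw [mem_ball_zero_iff]
    refine max_lt ?_ (by simpa [hκ] using T.ε_pos)
    refine (norm_add_le _ _).trans_lt (lt_of_le_of_lt ?_ hcw)
    rw [norm_smul, norm_mul, Real.norm_of_nonneg hc0.le]
    gcongr
    calc c * ‖Real.sin (t / c)‖ ≤ c * 1 := by gcongr; exact Real.abs_sin_le_one _
      _ = c := mul_one c
  have hκ0 : κ 0 = (v, 0) := by simp [hκ]
  have hκd : HasFDerivAt κ ((ContinuousLinearMap.id ℝ ℝ).smulRight ((w, 0) : W × (Fin 2 → ℂ))) 0 := by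
    have h1 : HasDerivAt (fun t : ℝ => c * Real.sin (t / c)) 1 0 := by
      have := ((Real.hasDerivAt_sin (0 / c)).comp (0 : ℝ) ((hasDerivAt_id (0 : ℝ)).div_const c)).const_mul c
      refine this.congr_deriv ?_
      simp [hc0.ne']
    have h2 : HasDerivAt κ ((w, 0) : W × (Fin 2 → ℂ)) 0 := by
      have h3 := ((h1.smul_const w).const_add v).prodMk (hasDerivAt_const (0 : ℝ) (0 : Fin 2 → ℂ))
      simpa using h3
    exact h2.hasFDerivAt
  refine ⟨fun t => T.chart θ (κ t), ?_, ?_, ?_, ?_⟩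
  · have h1 := T.chart_smooth.comp_contMDiff (f := fun t : ℝ => (θ, κ t))
      (contMDiff_const.prodMk hκs.contMDiff) fun t => ⟨trivial, hκb t⟩
    exact h1
  · simp only [hκ0]
  · intro t
    exact (T.chart_mem_V θ (hκb t)).2 rfl
  · have hc' : MDifferentiableAt 𝓘(ℝ, W × (Fin 2 → ℂ)) 𝓘(ℝ, EZ) (T.chart θ) (κ 0) := by rwa [hκ0]
    have h1 := mfderiv_comp_apply (0 : ℝ) hc' hκd.differentiableAt.mdifferentiableAt (1 : ℝ)
    refine h1.trans ?_
    rw [mfderiv_eq_fderiv, hκd.fderiv, hκ0]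
    have h2 : ((ContinuousLinearMap.id ℝ ℝ).smulRight ((w, 0) : W × (Fin 2 → ℂ))) (1 : ℝ) = (w, 0) := by
      simp
    exact congrArg (fun x : W × (Fin 2 → ℂ) =>
      (mfderiv 𝓘(ℝ, W × (Fin 2 → ℂ)) 𝓘(ℝ, EZ) (T.chart θ) (v, 0) x : EZ)) h2

theorem contMDiffAt_coordHom_normal [FiniteDimensional ℝ EZ] [FiniteDimensional ℝ W]
    [FiniteDimensional ℝ EΘ] (A : CompatiblePair T EP P) (θ₀ : Θ) (q₀ : P) :
    ContMDiffAt (𝓘(ℝ, EΘ).prod 𝓘(ℝ, W × (Fin 2 → ℂ) × (EP × EP))) 𝓘(ℝ, Fin 2 → ℂ) 2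
      (fun r : Θ × (W × (Fin 2 → ℂ) × (EP × EP)) =>
        (coordHom A.ν (T.chart r.1) (T.chart r.1).symm (chartAt EP q₀).symm (r.2.1, r.2.2.1)
          r.2.2.2.1 r.2.2.2.2).2) (θ₀, (0, 0, (chartAt EP q₀ q₀, 0))) := by
  have he : ContMDiffAt 𝓘(ℝ, EP) 𝓘(ℝ, EP) 3 (chartAt EP q₀).symm (chartAt EP q₀ q₀) :=
    ((contMDiffOn_chart_symm (I := 𝓘(ℝ, EP)) (n := ∞) (x := q₀)).contMDiffAt
      ((chartAt EP q₀).open_target.mem_nhds (mem_chart_target EP q₀))).of_le three_le_infty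
  have h1 := (T.isChartFamily θ₀).contMDiffAt_coordHom A.ν (A.ν_smooth.of_le two_le_infty) _ _ he 0
  have h2 : ContMDiffAt (𝓘(ℝ, EΘ).prod 𝓘(ℝ, W × (Fin 2 → ℂ) × (EP × EP)))
      (𝓘(ℝ, EΘ).prod 𝓘(ℝ, ((W × (Fin 2 → ℂ)) × EP) × EP)) 2
      (fun r : Θ × (W × (Fin 2 → ℂ) × (EP × EP)) =>
        (r.1, (((r.2.1, r.2.2.1), r.2.2.2.1), r.2.2.2.2)))
      (θ₀, (0, 0, (chartAt EP q₀ q₀, 0))) := by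
    refine contMDiffAt_fst.prodMk ?_
    have : ContMDiff 𝓘(ℝ, W × (Fin 2 → ℂ) × (EP × EP)) 𝓘(ℝ, ((W × (Fin 2 → ℂ)) × EP) × EP) 2
        (fun r : W × (Fin 2 → ℂ) × (EP × EP) => (((r.1, r.2.1), r.2.2.1), r.2.2.2)) :=
      ContDiff.contMDiff (by fun_prop)
    exact this.contMDiffAt.comp _ contMDiffAt_snd
  have h3 := ContMDiffAt.comp_of_eq h1 h2 rfl
  have h4 : ContMDiff 𝓘(ℝ, W × (Fin 2 → ℂ)) 𝓘(ℝ, Fin 2 → ℂ) 2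
      (fun y : W × (Fin 2 → ℂ) => y.2) := ContDiff.contMDiff (by fun_prop)
  exact h4.contMDiffAt.comp _ h3

/-- Uniform bounds for `J`, `ν`, the metric and the normal projection in the charts at the nodes. -/
theorem exists_nodeBounds [FiniteDimensional ℝ EZ] [FiniteDimensional ℝ W]
    [FiniteDimensional ℝ EΘ] (A : CompatiblePair T EP P) (Nm : NormalSplitting T) (θ₀ : Θ) (q₀ : P) :
    ∃ C ε : ℝ, 1 ≤ C ∧ 0 < ε ∧ ε ≤ T.ε ∧ ∀ᶠ θ in 𝓝 θ₀,
      TangentBounds C ε (chartAt EP q₀ q₀) (coordEnd A.J (T.chart θ) (T.chart θ).symm)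
        (coordHom A.ν (T.chart θ) (T.chart θ).symm (chartAt EP q₀).symm) ∧
      (∀ n : Fin 2 → ℂ, ∀ j, n j = 0 →
        (coordEnd A.J (T.chart θ) (T.chart θ).symm 0 (0, n)).2 j = 0) ∧
      (∀ q ∈ Metric.ball (chartAt EP q₀ q₀) ε,
        MDifferentiableAt 𝓘(ℝ, EP) 𝓘(ℝ, EP) (chartAt EP q₀).symm q) ∧
      ∀ y ∈ Metric.ball (0 : W × (Fin 2 → ℂ)) ε,
        MDifferentiableAt 𝓘(ℝ, W × (Fin 2 → ℂ)) 𝓘(ℝ, EZ) (T.chart θ) y ∧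
        (∀ w : W × (Fin 2 → ℂ), mfderiv 𝓘(ℝ, EZ) 𝓘(ℝ, W × (Fin 2 → ℂ)) (T.chart θ).symm (T.chart θ y)
          (mfderiv 𝓘(ℝ, W × (Fin 2 → ℂ)) 𝓘(ℝ, EZ) (T.chart θ) y w) = w) ∧
        (∀ u : EZ, (mfderiv 𝓘(ℝ, W × (Fin 2 → ℂ)) 𝓘(ℝ, EZ) (T.chart θ) y
          (mfderiv 𝓘(ℝ, EZ) 𝓘(ℝ, W × (Fin 2 → ℂ)) (T.chart θ).symm (T.chart θ y) u :
            W × (Fin 2 → ℂ)) : EZ) = u) ∧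
        (∀ w : W × (Fin 2 → ℂ), Real.sqrt (A.g (T.chart θ y)
          (mfderiv 𝓘(ℝ, W × (Fin 2 → ℂ)) 𝓘(ℝ, EZ) (T.chart θ) y w)
          (mfderiv 𝓘(ℝ, W × (Fin 2 → ℂ)) 𝓘(ℝ, EZ) (T.chart θ) y w)) ≤ C * ‖w‖) ∧
        ∀ u, ‖coordEnd Nm.proj (T.chart θ) (T.chart θ).symm y u‖ ≤
          C * (‖y.2‖ * ‖u‖ + ‖u.2‖) := by
  have hc := T.isChartFamily θ₀
  have he : ContMDiffAt 𝓘(ℝ, EP) 𝓘(ℝ, EP) 3 (chartAt EP q₀).symm (chartAt EP q₀ q₀) :=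
    ((contMDiffOn_chart_symm (I := 𝓘(ℝ, EP)) (n := ∞) (x := q₀)).contMDiffAt
      ((chartAt EP q₀).open_target.mem_nhds (mem_chart_target EP q₀))).of_le three_le_infty
  obtain ⟨C1, hC1, ε1, hε1, h1⟩ := hc.exists_coordEnd_bound A.J (A.J_smooth.of_le two_le_infty)
  obtain ⟨C2, hC2, ε2, hε2, h2⟩ := hc.exists_coordHom_bound A.ν (A.ν_smooth.of_le two_le_infty) _ _ he
  obtain ⟨C3, hC3, ε3, hε3, h3⟩ := hc.exists_metric_bound A.g (A.g_smooth.of_le two_le_infty)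
  obtain ⟨C4, hC4, ε4, hε4, h4⟩ := hc.exists_coordEnd_bound Nm.proj
    (Nm.proj_smooth.of_le two_le_infty)
  obtain ⟨ε5, hε5, h5⟩ := hc.mfderiv_inv
  obtain ⟨ε7, hε7, h7⟩ := Metric.isOpen_iff.1 (chartAt EP q₀).open_target _ (mem_chart_target EP q₀)
  set ε0 := min (min (min ε1 ε2) (min ε3 ε4)) (min (min ε5 ε7) T.ε) with hε0
  have hpos : 0 < ε0 := lt_min (lt_min (lt_min hε1 hε2) (lt_min hε3 hε4))
    (lt_min (lt_min hε5 hε7) T.ε_pos)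
  have l1 : ε0 ≤ ε1 := (min_le_left _ _).trans ((min_le_left _ _).trans (min_le_left _ _))
  have l2 : ε0 ≤ ε2 := (min_le_left _ _).trans ((min_le_left _ _).trans (min_le_right _ _))
  have l3 : ε0 ≤ ε3 := (min_le_left _ _).trans ((min_le_right _ _).trans (min_le_left _ _))
  have l4 : ε0 ≤ ε4 := (min_le_left _ _).trans ((min_le_right _ _).trans (min_le_right _ _))
  have l5 : ε0 ≤ ε5 := (min_le_right _ _).trans ((min_le_left _ _).trans (min_le_left _ _))
  have l7 : ε0 ≤ ε7 := (min_le_right _ _).trans ((min_le_left _ _).trans (min_le_right _ _))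
  have lT : ε0 ≤ T.ε := (min_le_right _ _).trans (min_le_right _ _)
  have htan : ∀ᶠ θ in 𝓝 θ₀, ∀ v ∈ Metric.ball (0 : W) ε0,
      ∀ q ∈ Metric.ball (chartAt EP q₀ q₀) ε0, ∀ w,
      (coordHom A.ν (T.chart θ) (T.chart θ).symm (chartAt EP q₀).symm (v, 0) q w).2 = 0 := by
    filter_upwards [h2, h5] with θ g2 g5 v hv q hq w
    refine A.coordHom_tangent lT (fun y hy => ?_) (fun y hy y' hy' => ?_) hC2 hv w
    · obtain ⟨m1, -, -, -, m2⟩ := g5 y (Metric.ball_subset_ball l5 hy)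
      exact ⟨m1, m2⟩
    · have hb : ∀ y ∈ Metric.ball (0 : W × (Fin 2 → ℂ)) ε0, (y, q) ∈
          Metric.ball ((0 : W × (Fin 2 → ℂ)), chartAt EP q₀ q₀) ε2 := fun y hy => by
        rw [← ball_prod_same]
        exact ⟨Metric.ball_subset_ball l2 hy, Metric.ball_subset_ball l2 hq⟩
      have := (g2 _ (hb y hy)).2 _ (hb y' hy')
      simpa [Prod.norm_def] using this
  obtain ⟨C6, hC6, ε6, hε6, h6⟩ := exists_mixed_bound (contMDiffAt_coordHom_normal A θ₀ q₀)
    hpos (by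
      filter_upwards [htan] with θ g a ha c hc'
      rw [← ball_prod_same] at hc'
      exact g a ha c.1 hc'.1 c.2)
  set C := 1 + C1 + 2 * C2 + C3 + C4 + 2 / ε6 * C6 with hCdef
  have hC6' : 0 ≤ 2 / ε6 * C6 := by positivity
  refine ⟨C, min ε0 ε6, by linarith, lt_min hpos hε6, (min_le_left _ _).trans lT, ?_⟩
  have hle : min ε0 ε6 ≤ ε0 := min_le_left _ _
  filter_upwards [h1, h2, h3, h4, h5, h6, htan] with θ g1 g2 g3 g4 g5 g6 g7
  have hJtan : ∀ v ∈ Metric.ball (0 : W) ε0, ∀ u : W × (Fin 2 → ℂ), ∀ j, u.2 j = 0 →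
      (coordEnd A.J (T.chart θ) (T.chart θ).symm (v, 0) u).2 j = 0 := by
    intro v hv u j hu
    refine A.coordEnd_tangent lT (fun y hy => ?_) (fun y hy y' hy' => ?_) hC1 hv hu
    · obtain ⟨m1, -, -, -, m2⟩ := g5 y (Metric.ball_subset_ball l5 hy)
      exact ⟨m1, m2⟩
    · exact (g1 y (Metric.ball_subset_ball l1 hy)).2 _ (Metric.ball_subset_ball l1 hy')
  have hb2 : ∀ y ∈ Metric.ball (0 : W × (Fin 2 → ℂ)) (min ε0 ε6),
      ∀ q ∈ Metric.ball (chartAt EP q₀ q₀) (min ε0 ε6), (y, q) ∈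
      Metric.ball ((0 : W × (Fin 2 → ℂ)), chartAt EP q₀ q₀) ε2 := fun y hy q hq => by
    rw [← ball_prod_same]
    exact ⟨Metric.ball_subset_ball (hle.trans l2) hy, Metric.ball_subset_ball (hle.trans l2) hq⟩
  refine ⟨⟨?_, ?_, ?_, ?_, ?_, ?_, ?_⟩, ?_, ?_, ?_⟩
  · exact fun y hy => (g1 y (Metric.ball_subset_ball (hle.trans l1) hy)).1.trans (by linarith)
  · intro y hy y' hy'
    refine ((g1 y (Metric.ball_subset_ball (hle.trans l1) hy)).2 _
      (Metric.ball_subset_ball (hle.trans l1) hy')).trans ?_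
    gcongr; linarith
  · intro v hv w
    ext j
    exact hJtan v (Metric.ball_subset_ball hle hv) (w, 0) j rfl
  · exact fun y hy q hq => (g2 _ (hb2 y hy q hq)).1.trans (by linarith)
  · intro y hy q hq y' hy' q' hq'
    refine ((g2 _ (hb2 y hy q hq)).2 _ (hb2 y' hy' q' hq')).trans ?_
    have : ‖(y, q) - (y', q')‖ ≤ ‖y - y'‖ + ‖q - q'‖ := by
      rw [Prod.mk_sub_mk]
      exact max_le (by simp) (by simp)
    gcongr
    linarith
  · exact fun v hv q hq w => g7 v (Metric.ball_subset_ball hle hv) q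
      (Metric.ball_subset_ball hle hq) w
  · intro y hy q hq q' hq' w
    have hy1 : y.1 ∈ Metric.ball (0 : W) ε6 :=
      Metric.ball_subset_ball (min_le_right _ _) (mem_ball_fst hy).1
    have hy2 : y.2 ∈ Metric.ball (0 : Fin 2 → ℂ) ε6 := by
      rw [mem_ball_zero_iff] at hy ⊢
      exact (norm_snd_le y).trans_lt (hy.trans_le (min_le_right _ _))
    set L : EP →L[ℝ] (Fin 2 → ℂ) := (ContinuousLinearMap.snd ℝ W (Fin 2 → ℂ)).comp
      (coordHom A.ν (T.chart θ) (T.chart θ).symm (chartAt EP q₀).symm y q -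
        coordHom A.ν (T.chart θ) (T.chart θ).symm (chartAt EP q₀).symm y q')
    have hL := norm_map_le_of_ball L (B := C6 * ‖y.2‖ * ‖q - q'‖) hε6 (fun x hx => by
      have hm : ∀ q ∈ Metric.ball (chartAt EP q₀ q₀) (min ε0 ε6), (q, x) ∈
          Metric.ball (chartAt EP q₀ q₀, (0 : EP)) ε6 := fun q hq => by
        rw [← ball_prod_same]
        exact ⟨Metric.ball_subset_ball (min_le_right _ _) hq, hx⟩
      have := (g6 y.1 hy1 y.2 hy2 _ (hm q hq)).2 _ (hm q' hq')
      simpa [Prod.norm_def, L] using this) w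
    refine hL.trans ?_
    calc _ = (2 / ε6 * C6) * ‖y.2‖ * ‖q - q'‖ * ‖w‖ := by ring
      _ ≤ _ := by gcongr; linarith
  · intro n j hn
    exact hJtan 0 (Metric.mem_ball_self hpos) (0, n) j hn
  · intro q hq
    exact ((contMDiffOn_chart_symm (I := 𝓘(ℝ, EP)) (n := ∞) (x := q₀)).contMDiffAt
      ((chartAt EP q₀).open_target.mem_nhds (h7 (Metric.ball_subset_ball (hle.trans l7) hq)))
      ).mdifferentiableAt (by simp)
  · intro y hy
    obtain ⟨m1, m2, m3, m4, m5⟩ := g5 y (Metric.ball_subset_ball (hle.trans l5) hy)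
    refine ⟨m1, m4, m5, fun w => (g3 y (Metric.ball_subset_ball (hle.trans l3) hy) w).trans ?_, ?_⟩
    · gcongr; linarith
    · intro u
      obtain ⟨hy1, hy0⟩ := mem_ball_fst hy
      set B := coordEnd Nm.proj (T.chart θ) (T.chart θ).symm with hB
      have hB0 : B (y.1, 0) (u.1, 0) = 0 := by
        have hv : (T.chart θ (y.1, 0)) ∈ T.V :=
          (T.chart_mem_V θ (Metric.ball_subset_ball (hle.trans lT) hy0)).2 rfl
        have ht := T.tangentTo_V (Metric.ball_subset_ball (hle.trans lT) hy1) u.1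
          (g5 _ (Metric.ball_subset_ball (hle.trans l5) hy0)).1
        have h := (Nm.proj_ker _ hv _).2 ht
        exact (congrArg (fun x : EZ => (mfderiv 𝓘(ℝ, EZ) 𝓘(ℝ, W × (Fin 2 → ℂ)) (T.chart θ).symm
          (T.chart θ (y.1, 0)) x : W × (Fin 2 → ℂ))) h).trans (map_zero _)
      have hu : u = (u.1, 0) + (0, u.2) := by simp
      have e : B y u = (B y - B (y.1, 0)) (u.1, 0) + B y (0, u.2) := by
        conv_lhs => rw [hu]
        rw [map_add, sub_apply, hB0, sub_zero]
      obtain ⟨k1, k2⟩ := g4 y (Metric.ball_subset_ball (hle.trans l4) hy)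
      have k3 := k2 _ (Metric.ball_subset_ball (hle.trans l4) hy0)
      have h2 : ‖y - (y.1, 0)‖ = ‖y.2‖ := by simp [Prod.norm_def]
      have h3 : ‖(u.1, (0 : Fin 2 → ℂ))‖ ≤ ‖u‖ := by
        refine max_le (norm_fst_le u) (by simp)
      have h4 : ‖((0 : W), u.2)‖ = ‖u.2‖ := by simp [Prod.norm_def]
      rw [h2] at k3
      rw [e]
      have hC4C : C4 ≤ C := by linarith
      calc _ ≤ ‖B y - B (y.1, 0)‖ * ‖(u.1, (0 : Fin 2 → ℂ))‖ + ‖B y‖ * ‖((0 : W), u.2)‖ :=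
            (norm_add_le _ _).trans (add_le_add (ContinuousLinearMap.le_opNorm _ _)
              (ContinuousLinearMap.le_opNorm _ _))
        _ ≤ (C * ‖y.2‖) * ‖u‖ + C * ‖u.2‖ := by
            rw [h4]
            gcongr
            · exact k3.trans (by gcongr)
            · exact k1.trans hC4C
        _ = _ := by ring

end NodeStructure

theorem iteratedFDeriv_monomial_eq_zero (a : ℂ) (n : ℕ) (z : ℂ) :
    iteratedFDeriv ℝ (n + 1) (fun z : ℂ => a * z ^ n) z = 0 := by
  induction n generalizing a z with
  | zero =>
    have : (fun z : ℂ => a * z ^ 0) = fun _ => a := by ext; simp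
    rw [this, iteratedFDeriv_const_of_ne (by norm_num)]
    rfl
  | succ n ih =>
    rw [← norm_eq_zero, ← norm_iteratedFDeriv_fderiv]
    let L : ℂ →L[ℝ] (ℂ →L[ℝ] ℂ) := ContinuousLinearMap.mul ℝ ℂ
    have h1 : fderiv ℝ (fun z : ℂ => a * z ^ (n + 1)) =
        L ∘ fun z => (a * (n + 1)) * z ^ n := by
      ext1 z
      have h2 : HasDerivAt (fun z : ℂ => a * z ^ (n + 1)) (a * ((n + 1 : ℕ) * z ^ n)) z :=
        (hasDerivAt_pow (n + 1) z).const_mul a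
      have h3 := (h2.comp_hasFDerivAt (𝕜 := ℝ) z (hasFDerivAt_id z)).fderiv
      refine Eq.trans h3 ?_
      ext
      simp [L]
      exact Or.inl (by ring)
    have h4 : ContDiffAt ℝ (n + 1 : ℕ) (fun z : ℂ => (a * (n + 1)) * z ^ n) z := by fun_prop
    refine le_antisymm ?_ (norm_nonneg _)
    rw [h1]
    refine (L.norm_iteratedFDeriv_comp_left h4 le_rfl).trans ?_
    rw [ih, norm_zero, mul_zero]

section NodeSequence

variable {EZ : Type*} [NormedAddCommGroup EZ] [NormedSpace ℝ EZ]
  {Z : Type*} [TopologicalSpace Z] [ChartedSpace EZ Z] [IsManifold 𝓘(ℝ, EZ) ∞ Z]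
  {W : Type*} [NormedAddCommGroup W] [NormedSpace ℝ W]
  {EΘ : Type*} [NormedAddCommGroup EΘ] [NormedSpace ℝ EΘ]
  {Θ : Type*} [TopologicalSpace Θ] [ChartedSpace EΘ Θ] [IsManifold 𝓘(ℝ, EΘ) ∞ Θ]
  {S : Type*} [TopologicalSpace S] [ChartedSpace ℂ S] [IsManifold 𝓘(ℝ, ℂ) ∞ S]
  {N : Type*} [TopologicalSpace N]
  {T : SumFibration EZ Z W EΘ Θ}

theorem SmoothlyTendsto.jointlyTendsto {u : ℕ → N × (S → Z)} {x : N × (S → Z)}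
    (h : SmoothlyTendsto EZ u x) (hu : ∀ n, ContMDiff 𝓘(ℝ, ℂ) 𝓘(ℝ, EZ) ∞ (u n).2)
    (hx : ContMDiff 𝓘(ℝ, ℂ) 𝓘(ℝ, EZ) ∞ x.2) (p : S) :
    JointlyTendsto (fun n => (u n).2) p (x.2 p) := by
  obtain ⟨-, h2, B, hB, hBu⟩ := h.uniformlyCk hu hx p 0
  have h3 : Tendsto (fun r : ℕ × S => (r.1, chartAt ℂ p r.2)) (atTop ×ˢ 𝓝 p)
      (atTop ×ˢ 𝓝 (chartAt ℂ p p)) :=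
    tendsto_fst.prodMk (((chartAt ℂ p).continuousAt (mem_chart_source ℂ p)).tendsto.comp tendsto_snd)
  have h4 := (((chartAt EZ (x.2 p)).symm.continuousAt (mem_chart_target EZ (x.2 p))).tendsto.comp
    h2).comp h3
  rw [(chartAt EZ (x.2 p)).left_inv (mem_chart_source EZ _)] at h4
  refine h4.congr' ?_
  filter_upwards [prod_mem_prod hBu (inter_mem hB ((chartAt ℂ p).open_source.mem_nhds
    (mem_chart_source ℂ p)))] with r hr
  simp only [Function.comp_apply, inCharts]
  rw [(chartAt ℂ p).left_inv hr.2.2]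
  exact (chartAt EZ (x.2 p)).left_inv (hr.1 hr.2.1)

theorem SmoothlyTendsto.tendsto_apply {u : ℕ → N × (S → Z)} {x : N × (S → Z)}
    (h : SmoothlyTendsto EZ u x) (hu : ∀ n, ContMDiff 𝓘(ℝ, ℂ) 𝓘(ℝ, EZ) ∞ (u n).2)
    (hx : ContMDiff 𝓘(ℝ, ℂ) 𝓘(ℝ, EZ) ∞ x.2) (p : S) :
    Tendsto (fun n => (u n).2 p) atTop (𝓝 (x.2 p)) :=
  Tendsto.comp (f := fun n => (n, p)) (g := fun r : ℕ × S => (u r.1).2 r.2)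
    (h.jointlyTendsto hu hx p) (tendsto_id.prodMk tendsto_const_nhds)

theorem contDiffAt_coord_transition {e : OpenPartialHomeomorph S ℂ}
    (he : e ∈ IsManifold.maximalAtlas 𝓘(ℝ, ℂ) ∞ S) {p : S} (hp : p ∈ e.source) :
    ContDiffAt ℝ ∞ (fun z => chartAt ℂ p (e.symm z)) (e p) := by
  rw [← contMDiffAt_iff_contDiffAt]
  have h1 : ContMDiffAt 𝓘(ℝ, ℂ) 𝓘(ℝ, ℂ) ∞ e.symm (e p) :=
    (contMDiffOn_symm_of_mem_maximalAtlas he).contMDiffAt (e.open_target.mem_nhds (e.map_source hp))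
  have h2 : ContMDiffAt 𝓘(ℝ, ℂ) 𝓘(ℝ, ℂ) ∞ (chartAt ℂ p) p :=
    (contMDiffOn_chart (I := 𝓘(ℝ, ℂ)) (n := ∞) (x := p)).contMDiffAt
      ((chartAt ℂ p).open_source.mem_nhds (mem_chart_source ℂ p))
  exact ContMDiffAt.comp_of_eq h2 h1 (e.left_inv hp)

theorem tendsto_symm_coord {e : OpenPartialHomeomorph S ℂ} {p : S} (hp : p ∈ e.source) :
    Tendsto e.symm (𝓝 (e p)) (𝓝 p) := by
  have := e.symm.continuousAt (e.map_source hp)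
  rwa [ContinuousAt, e.left_inv hp] at this

/-- A smoothly convergent sequence, in the charts at a node. -/
theorem SmoothlyTendsto.nodeCoord [FiniteDimensional ℝ EZ] [FiniteDimensional ℝ W]
    [FiniteDimensional ℝ EΘ] {u : ℕ → N × (S → Z)} {x : N × (S → Z)}
    (h : SmoothlyTendsto EZ u x) (hu : ∀ n, ContMDiff 𝓘(ℝ, ℂ) 𝓘(ℝ, EZ) ∞ (u n).2)
    (hx : ContMDiff 𝓘(ℝ, ℂ) 𝓘(ℝ, EZ) ∞ x.2) {e : OpenPartialHomeomorph S ℂ}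
    (he : e ∈ IsManifold.maximalAtlas 𝓘(ℝ, ℂ) ∞ S) {p : S} (hp : p ∈ e.source)
    {θ : ℕ → Θ} {θ₀ : Θ} (hθ : Tendsto θ atTop (𝓝 θ₀)) (hθ₀ : T.chart θ₀ 0 = x.2 p) (M : ℕ) :
    UniformlyCk M (fun n z => (T.chart (θ n)).symm ((u n).2 (e.symm z))) (e p) ∧
    ∃ r > 0, ∀ᶠ n in atTop, ∀ z ∈ Metric.ball (e p) r,
      z ∈ e.target ∧ (u n).2 (e.symm z) ∈ (T.chart (θ n)).target := by
  have htar := T.target_mem_nhds θ₀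
  rw [hθ₀] at htar
  have hjoint : JointlyTendsto (fun n z => (u n).2 (e.symm z)) (e p) (x.2 p) :=
    (h.jointlyTendsto hu hx p).comp (v := fun _ => e.symm)
      ((tendsto_symm_coord hp).comp tendsto_snd)
  have hjoint2 : JointlyTendsto (fun n z => (θ n, (u n).2 (e.symm z))) (e p) (θ₀, x.2 p) :=
    (hθ.comp tendsto_fst).prodMk_nhds hjoint
  constructor
  · obtain ⟨h1, h2, B, hB, hBu⟩ := h.uniformlyCk hu hx p M
    set z₀ := x.2 p with hz₀
    have hΓ : ContMDiffAt (𝓘(ℝ, EΘ).prod 𝓘(ℝ, EZ)) 𝓘(ℝ, W × (Fin 2 → ℂ)) M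
        (fun r : Θ × EZ => (T.chart r.1).symm ((chartAt EZ z₀).symm r.2))
        (θ₀, chartAt EZ z₀ z₀) := by
      refine ContMDiffAt.of_le (n := ∞) ?_ (mod_cast le_top)
      have g1 : ContMDiffAt 𝓘(ℝ, EZ) 𝓘(ℝ, EZ) ∞ (chartAt EZ z₀).symm (chartAt EZ z₀ z₀) :=
        (contMDiffOn_chart_symm (I := 𝓘(ℝ, EZ)) (n := ∞) (x := z₀)).contMDiffAt
          ((chartAt EZ z₀).open_target.mem_nhds (mem_chart_target EZ z₀))
      have g2 : ContMDiffAt (𝓘(ℝ, EΘ).prod 𝓘(ℝ, EZ)) (𝓘(ℝ, EΘ).prod 𝓘(ℝ, EZ)) ∞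
          (fun r : Θ × EZ => (r.1, (chartAt EZ z₀).symm r.2)) (θ₀, chartAt EZ z₀ z₀) :=
        contMDiffAt_fst.prodMk (ContMDiffAt.comp (g := (chartAt EZ z₀).symm)
          ((θ₀, chartAt EZ z₀ z₀) : Θ × EZ) g1 contMDiffAt_snd)
      refine ContMDiffAt.comp_of_eq (T.chart_symm_smooth.contMDiffAt htar) g2 ?_
      simp only [(chartAt EZ z₀).left_inv (mem_chart_source EZ z₀)]
    have h3 := uniformlyCk_param hΓ hθ
    have hχ := contDiffAt_coord_transition he hp
    have hpp : chartAt ℂ p (e.symm (e p)) = chartAt ℂ p p := by rw [e.left_inv hp]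
    have hχt : JointlyTendsto (fun _ : ℕ => fun z => chartAt ℂ p (e.symm z)) (e p)
        (chartAt ℂ p p) := by
      have := hχ.continuousAt.tendsto.comp (tendsto_snd (f := (atTop : Filter ℕ)))
      simp only [hpp] at this
      exact this
    have h4 := h1.comp (uniformlyCk_const (hχ.of_le (m := M) (mod_cast le_top))) hχt
    have h5 := h3.comp h4 (h2.comp hχt)
    refine h5.congr' ?_
    have hev : ∀ᶠ z in 𝓝 (e p), e.symm z ∈ B ∩ (chartAt ℂ p).source :=
      (tendsto_symm_coord hp).eventually (inter_mem hB ((chartAt ℂ p).open_source.mem_nhds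
        (mem_chart_source ℂ p)))
    obtain ⟨ε, hε, hball⟩ := Metric.eventually_nhds_iff_ball.1 hev
    refine ⟨ε, hε, hBu.mono fun n hn z hz => ?_⟩
    obtain ⟨hz1, hz2⟩ := hball z hz
    simp only [inCharts]
    rw [(chartAt ℂ p).left_inv hz2, (chartAt EZ z₀).left_inv (hn hz1)]
  · obtain ⟨r, hr, h1⟩ := hjoint2.eventually_ball htar
    obtain ⟨r', hr', h2⟩ := Metric.isOpen_iff.1 e.open_target _ (e.map_source hp)
    refine ⟨min r r', lt_min hr hr', h1.mono fun n hn z hz => ⟨?_, ?_⟩⟩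
    · exact h2 (Metric.ball_subset_ball (min_le_right _ _) hz)
    · exact hn z (Metric.ball_subset_ball (min_le_left _ _) hz)

end NodeSequence

section LeafBounds

variable {W : Type*} [NormedAddCommGroup W] [NormedSpace ℝ W]

/-- The `i`-th normal coordinate. -/
noncomputable def normalCoord (W : Type*) [NormedAddCommGroup W] [NormedSpace ℝ W] (i : Fin 2) :
    W × (Fin 2 → ℂ) →L[ℝ] ℂ :=
  (ContinuousLinearMap.proj (R := ℝ) (φ := fun _ : Fin 2 => ℂ) i).comp
    (ContinuousLinearMap.snd ℝ W (Fin 2 → ℂ))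

theorem norm_normalCoord_le (i : Fin 2) : ‖normalCoord W i‖ ≤ 1 :=
  ContinuousLinearMap.opNorm_le_bound _ zero_le_one fun y => by
    rw [one_mul]
    exact (norm_le_pi_norm y.2 i).trans (norm_snd_le y)

theorem exists_leaf_estimates (s : ℕ) : ∃ K, 1 ≤ K ∧ ∀ (C r : ℝ) (i : Fin 2) (a : ℂ)
    (f : ℂ → W × (Fin 2 → ℂ)), 0 ≤ C → 0 < r → ContDiffOn ℝ (s + 1 : ℕ) f (Metric.ball 0 r) →
    (∀ d ≤ s + 1, ∀ z ∈ Metric.ball (0 : ℂ) r, ‖iteratedFDeriv ℝ d f z‖ ≤ C) → f 0 = 0 →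
    (fun z => (f z).2 i - a * z ^ s) =O[𝓝 0] (fun z => ‖z‖ ^ (s + 1)) →
    (∀ z ∈ Metric.ball (0 : ℂ) (r / 2), DifferentiableAt ℝ f z ∧ ‖f z‖ ≤ C * ‖z‖ ∧
      ‖fderiv ℝ f z‖ ≤ C ∧ ‖(f z).2 i - a * z ^ s‖ ≤ C * ‖z‖ ^ (s + 1) ∧ (z ≠ 0 →
      ‖fderiv ℝ (fun z => (f z).2 i - a * z ^ s) z‖ ≤ K * C * ‖z‖ ^ s)) := by
  obtain ⟨K, hK, h⟩ := exists_vanishing_order_bound (E := ℂ) s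
  refine ⟨max 1 K, le_max_left _ _, fun C r i a f hC hr hf hfd hf0 hO z hz => ?_⟩
  have hd : ∀ z ∈ Metric.ball (0 : ℂ) r, ContDiffAt ℝ (s + 1 : ℕ) f z := fun z hz =>
    hf.contDiffAt (Metric.isOpen_ball.mem_nhds hz)
  have hdd : ∀ z ∈ Metric.ball (0 : ℂ) r, DifferentiableAt ℝ f z := fun z hz =>
    (hd z hz).differentiableAt (by exact_mod_cast Nat.succ_ne_zero s)
  have hsub : Metric.ball (0 : ℂ) (r / 2) ⊆ Metric.ball 0 r :=
    Metric.ball_subset_ball (by linarith)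
  have hfder : ∀ z ∈ Metric.ball (0 : ℂ) r, ‖fderiv ℝ f z‖ ≤ C := fun z hz => by
    rw [← norm_iteratedFDeriv_one]; exact hfd 1 (by omega) z hz
  have hpoly : ContDiff ℝ (s + 1 : ℕ) (fun z : ℂ => a * z ^ s) := by fun_prop
  have hcoord : ContDiffOn ℝ (s + 1 : ℕ) (fun z => (f z).2 i) (Metric.ball 0 r) :=
    (normalCoord W i).contDiff.comp_contDiffOn hf
  obtain ⟨h1, h2⟩ := h (fun z => (f z).2 i - a * z ^ s) r C (hcoord.sub hpoly.contDiffOn) hO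
    (fun z hz => by
      have e := iteratedFDeriv_sub_apply
        (hcoord.contDiffAt (Metric.isOpen_ball.mem_nhds hz)) (hpoly.contDiffAt (x := z))
      have e2 : (fun z => (f z).2 i - a * z ^ s) = (fun z => (f z).2 i) - fun z => a * z ^ s := rfl
      rw [e2, e, iteratedFDeriv_monomial_eq_zero, sub_zero]
      refine ((normalCoord W i).norm_iteratedFDeriv_comp_left (hd z hz) le_rfl).trans ?_
      calc _ ≤ 1 * C := by
            gcongr
            · exact norm_normalCoord_le i
            · exact hfd _ le_rfl z hz
        _ = C := one_mul C)
  refine ⟨hdd z (hsub hz), ?_, hfder z (hsub hz), h1 z (hsub hz), fun hz0 => (h2 z hz hz0).trans ?_⟩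
  · have := (convex_ball (0 : ℂ) r).norm_image_sub_le_of_norm_fderiv_le (𝕜 := ℝ) hdd hfder
      (Metric.mem_ball_self hr) (hsub hz)
    simpa [hf0] using this
  · gcongr
    exact le_max_right _ _

end LeafBounds

section LeadingCoefficient

variable {EZ : Type*} [NormedAddCommGroup EZ] [NormedSpace ℝ EZ]
  {Z : Type*} [TopologicalSpace Z] [ChartedSpace EZ Z] [IsManifold 𝓘(ℝ, EZ) ∞ Z]
  {W : Type*} [NormedAddCommGroup W] [NormedSpace ℝ W]
  {EΘ : Type*} [NormedAddCommGroup EΘ] [NormedSpace ℝ EΘ]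
  {Θ : Type*} [TopologicalSpace Θ] [ChartedSpace EΘ Θ] [IsManifold 𝓘(ℝ, EΘ) ∞ Θ]
  {T : SumFibration EZ Z W EΘ Θ}

/-- The transition maps between charts at the same point preserve `V`. -/
theorem SumFibration.exists_transition_bound [FiniteDimensional ℝ EZ] [FiniteDimensional ℝ W]
    [FiniteDimensional ℝ EΘ] {θ₀ θ' : Θ} (h : T.chart θ' 0 = T.chart θ₀ 0) :
    ∃ C > 0, ∀ᶠ y in 𝓝 (0 : W × (Fin 2 → ℂ)),
      T.chart θ₀ y ∈ (T.chart θ').target ∧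
      ‖((T.chart θ').symm (T.chart θ₀ y)).2‖ ≤ C * ‖y.2‖ := by
  have h0t : T.chart θ₀ 0 ∈ (T.chart θ').target := by
    rw [← h]; exact (T.chart θ').map_source (T.zero_mem_source θ')
  have hs1 : ContMDiffAt 𝓘(ℝ, W × (Fin 2 → ℂ)) 𝓘(ℝ, EZ) ∞ (T.chart θ₀) 0 :=
    ContMDiffAt.comp (g := fun r : Θ × (W × (Fin 2 → ℂ)) => T.chart r.1 r.2)
      (0 : W × (Fin 2 → ℂ)) (T.chart_contMDiffAt θ₀ (Metric.mem_ball_self T.ε_pos))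
      (contMDiffAt_const.prodMk contMDiffAt_id)
  have hs2 : ContMDiffAt 𝓘(ℝ, EZ) 𝓘(ℝ, W × (Fin 2 → ℂ)) ∞ (T.chart θ').symm (T.chart θ₀ 0) :=
    (T.symm_contMDiffOn θ').contMDiffAt ((T.chart θ').open_target.mem_nhds h0t)
  set g : W × (Fin 2 → ℂ) → (Fin 2 → ℂ) := fun y => ((T.chart θ').symm (T.chart θ₀ y)).2 with hg
  have hgs : ContDiffAt ℝ 1 g 0 := by
    have := contMDiffAt_iff_contDiffAt.1 (hs2.comp (0 : W × (Fin 2 → ℂ)) hs1)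
    exact (contDiffAt_snd.comp (0 : W × (Fin 2 → ℂ)) this).of_le (mod_cast le_top)
  obtain ⟨K, t, ht, hK⟩ := hgs.exists_lipschitzOnWith
  have htar : ∀ᶠ y in 𝓝 (0 : W × (Fin 2 → ℂ)), T.chart θ₀ y ∈ (T.chart θ').target :=
    hs1.continuousAt.eventually ((T.chart θ').open_target.mem_nhds h0t)
  have hV : ∀ᶠ y in 𝓝 (0 : W × (Fin 2 → ℂ)), y ∈ t ∧ T.chart θ₀ y ∈ (T.chart θ').target ∧
      y ∈ Metric.ball 0 T.ε := by
    filter_upwards [ht, htar, Metric.ball_mem_nhds _ T.ε_pos] with y h1 h2 h3 using ⟨h1, h2, h3⟩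
  have hproj : Tendsto (fun y : W × (Fin 2 → ℂ) => (y.1, (0 : Fin 2 → ℂ))) (𝓝 0) (𝓝 0) := by
    have : Continuous (fun y : W × (Fin 2 → ℂ) => (y.1, (0 : Fin 2 → ℂ))) := by fun_prop
    exact this.tendsto 0
  refine ⟨K + 1, by positivity, ?_⟩
  filter_upwards [hV, hproj.eventually hV] with y hy hy0
  refine ⟨hy.2.1, ?_⟩
  have hzero : g (y.1, 0) = 0 := by
    have h1 : T.chart θ₀ (y.1, 0) ∈ T.V := (T.chart_mem_V θ₀ hy0.2.2).2 rfl
    have h2 := (T.chart θ').map_target hy0.2.1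
    rw [T.chart_source] at h2
    rw [← (T.chart θ').right_inv hy0.2.1, T.chart_mem_V θ' h2] at h1
    exact h1
  have h3 := hK.dist_le_mul _ hy.1 _ hy0.1
  rw [hzero, dist_zero_right, dist_eq_norm] at h3
  have h4 : ‖y - (y.1, 0)‖ = ‖y.2‖ := by simp [Prod.norm_def]
  rw [h4] at h3
  refine h3.trans ?_
  gcongr
  linarith

theorem norm_ge_of_isBigO {a : ℂ} (ha : a ≠ 0) {s : ℕ} {g : ℂ → ℂ}
    (h : (fun z => g z - a * z ^ s) =O[𝓝 0] (fun z => ‖z‖ ^ (s + 1))) :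
    ∀ᶠ z in 𝓝 (0 : ℂ), ‖a‖ / 2 * ‖z‖ ^ s ≤ ‖g z‖ := by
  obtain ⟨C, hC, h⟩ := h.exists_pos
  have han : 0 < ‖a‖ := norm_pos_iff.2 ha
  filter_upwards [h.bound, Metric.ball_mem_nhds (0 : ℂ) (ε := ‖a‖ / (2 * C)) (by positivity)]
    with z h1 h2
  rw [mem_ball_zero_iff, lt_div_iff₀ (by positivity)] at h2
  rw [Real.norm_of_nonneg (by positivity), pow_succ] at h1
  have h3 : ‖a * z ^ s‖ = ‖a‖ * ‖z‖ ^ s := by rw [norm_mul, norm_pow]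
  have h4 := norm_sub_norm_le (a * z ^ s) (g z)
  rw [norm_sub_rev, h3] at h4
  have h5 : C * (‖z‖ ^ s * ‖z‖) ≤ ‖a‖ / 2 * ‖z‖ ^ s := by
    have : C * ‖z‖ ≤ ‖a‖ / 2 := by linarith
    calc _ = C * ‖z‖ * ‖z‖ ^ s := by ring
      _ ≤ _ := by gcongr
  linarith

/-- Contact of order `s` is independent of the chart: a lower bound. -/
theorem exists_contact_lower_bound [FiniteDimensional ℝ EZ] [FiniteDimensional ℝ W]
    [FiniteDimensional ℝ EΘ] {θ₀ θ' : Θ} (h : T.chart θ' 0 = T.chart θ₀ 0) {g : ℂ → Z}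
    (hg : ContinuousAt g 0) (hg0 : g 0 = T.chart θ₀ 0) {i : Fin 2} {s : ℕ} {a : ℂ} (ha : a ≠ 0)
    (hcontact : (fun z : ℂ => ((T.chart θ').symm (g z)).2 i - a * z ^ s)
      =O[𝓝 0] (fun z : ℂ => ‖z‖ ^ (s + 1))) :
    ∃ c > 0, ∀ᶠ z in 𝓝 (0 : ℂ), c * ‖z‖ ^ s ≤ ‖((T.chart θ₀).symm (g z)).2‖ := by
  obtain ⟨C, hC, htr⟩ := T.exists_transition_bound h
  have h0t : T.chart θ₀ 0 ∈ (T.chart θ₀).target := (T.chart θ₀).map_source (T.zero_mem_source θ₀)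
  have hgt : Tendsto g (𝓝 0) (𝓝 (T.chart θ₀ 0)) := by rw [← hg0]; exact hg
  have h1 : ∀ᶠ z in 𝓝 (0 : ℂ), g z ∈ (T.chart θ₀).target :=
    hgt.eventually ((T.chart θ₀).open_target.mem_nhds h0t)
  have h2 : Tendsto (fun z => (T.chart θ₀).symm (g z)) (𝓝 0) (𝓝 0) := by
    have h3 := ((T.chart θ₀).symm.continuousAt h0t).tendsto.comp hgt
    rwa [(T.chart θ₀).left_inv (T.zero_mem_source θ₀)] at h3
  refine ⟨‖a‖ / (2 * C), by have := norm_pos_iff.2 ha; positivity, ?_⟩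
  filter_upwards [h1, h2.eventually htr, norm_ge_of_isBigO ha hcontact] with z k1 k2 k3
  rw [(T.chart θ₀).right_inv k1] at k2
  have k4 := k3.trans ((norm_le_pi_norm _ i).trans k2.2)
  have k5 : ‖a‖ / (2 * C) * ‖z‖ ^ s = (‖a‖ / 2 * ‖z‖ ^ s) / C := by field_simp
  rw [k5, div_le_iff₀ hC]
  linarith

end LeadingCoefficient

theorem LeafBounds.mono {W : Type*} [NormedAddCommGroup W] [NormedSpace ℝ W] {C C' r r' : ℝ}
    {i : Fin 2} {s : ℕ} {a : ℂ} {f : ℂ → W × (Fin 2 → ℂ)} (h : LeafBounds C r i s a f)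
    (hC : C ≤ C') (hr : r' ≤ r) : LeafBounds C' r' i s a f := by
  have hsub := Metric.ball_subset_ball (x := (0 : ℂ)) hr
  refine ⟨fun z hz => h.diff z (hsub hz), fun z hz => (h.norm_le z (hsub hz)).trans (by gcongr),
    fun z hz => (h.fderiv_le z (hsub hz)).trans hC, fun z hz => h.leaf z (hsub hz),
    fun z hz => (h.rem z (hsub hz)).trans (by gcongr),
    fun z hz hz0 => (h.rem' z (hsub hz) hz0).trans (by gcongr), h.a_le.trans hC,
    h.le_a.trans (by gcongr)⟩

theorem TangentBounds.mono {W : Type*} [NormedAddCommGroup W] [NormedSpace ℝ W]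
    {EP : Type*} [NormedAddCommGroup EP] [NormedSpace ℝ EP] {C C' ε : ℝ} {q₀ : EP}
    {J : W × (Fin 2 → ℂ) → W × (Fin 2 → ℂ) →L[ℝ] W × (Fin 2 → ℂ)}
    {ν : W × (Fin 2 → ℂ) → EP → EP →L[ℝ] W × (Fin 2 → ℂ)} (h : TangentBounds C ε q₀ J ν)
    (hC : C ≤ C') : TangentBounds C' ε q₀ J ν :=
  ⟨fun y hy => (h.J_norm y hy).trans hC,
    fun y hy y' hy' => (h.J_lip y hy y' hy').trans (by gcongr), h.J_tan,
    fun y hy q hq => (h.ν_norm y hy q hq).trans hC,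
    fun y hy q hq y' hy' q' hq' => (h.ν_lip y hy q hq y' hy' q' hq').trans (by gcongr), h.ν_tan,
    fun y hy q hq q' hq' w => (h.ν_mixed y hy q hq q' hq' w).trans (by gcongr)⟩

section NodeSequence

variable {EZ : Type*} [NormedAddCommGroup EZ] [NormedSpace ℝ EZ] [FiniteDimensional ℝ EZ]
  {Z : Type*} [TopologicalSpace Z] [T2Space Z] [ChartedSpace EZ Z] [IsManifold 𝓘(ℝ, EZ) ∞ Z]
  {W : Type*} [NormedAddCommGroup W] [NormedSpace ℝ W] [FiniteDimensional ℝ W]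
  {EΘ : Type*} [NormedAddCommGroup EΘ] [NormedSpace ℝ EΘ] [FiniteDimensional ℝ EΘ]
  {Θ : Type*} [TopologicalSpace Θ] [ChartedSpace EΘ Θ] [IsManifold 𝓘(ℝ, EΘ) ∞ Θ]
  {EP : Type*} [NormedAddCommGroup EP] [NormedSpace ℝ EP]
  {P : Type*} [TopologicalSpace P] [ChartedSpace EP P] [IsManifold 𝓘(ℝ, EP) ∞ P]
  {EN : Type*} [NormedAddCommGroup EN] [NormedSpace ℝ EN]
  {N : Type*} [TopologicalSpace N] [ChartedSpace EN N]
  {S : Type*} [TopologicalSpace S] [ChartedSpace ℂ S] [IsManifold 𝓘(ℝ, ℂ) ∞ S]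
  {ℓ : ℕ} {T : SumFibration EZ Z W EΘ Θ} {A : CompatiblePair T EP P}
  {D : CurveFamily S EN N A.jP ℓ}

theorem CurveFamily.pt_mem_source (D : CurveFamily S EN N A.jP ℓ) (i : Fin 2) (k : Fin ℓ) :
    D.pt i k ∈ (D.coord i k).source := by
  refine (D.coord i k).map_target ?_
  rw [D.coord_target]
  exact Metric.mem_ball_self two_pos

theorem CurveFamily.coord_pt (D : CurveFamily S EN N A.jP ℓ) (i : Fin 2) (k : Fin ℓ) :
    D.coord i k (D.pt i k) = 0 := by
  refine (D.coord i k).right_inv ?_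
  rw [D.coord_target]
  exact Metric.mem_ball_self two_pos

/-- The chart at the limit parameter is centred at the image of the node. -/
theorem chart_limit_centre {s : Fin ℓ → ℕ} {u : ℕ → N × (S → Z)}
    {x : N × (S → Z)} (h : SmoothlyTendsto EZ u x) (hu : ∀ n, u n ∈ moduli A D s)
    (hx : x ∈ moduli A D s) {θ : ℕ → Θ} {θ₀ : Θ} (hθ : Tendsto θ atTop (𝓝 θ₀)) {i : Fin 2}
    {k : Fin ℓ} {a : ℕ → ℂ} (hcon : ∀ n, HasContact A D (u n).2 i k (s k) (θ n) (a n)) :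
    T.chart θ₀ 0 = x.2 (D.pt i k) := by
  have h1 := h.tendsto_apply (fun n => (hu n).1) hx.1 (D.pt i k)
  have h2 : Tendsto (fun n => T.chart (θ n) 0) atTop (𝓝 (T.chart θ₀ 0)) :=
    (T.chart_contMDiffAt θ₀ (Metric.mem_ball_self T.ε_pos)).continuousAt.tendsto.comp
      (hθ.prodMk_nhds tendsto_const_nhds)
  refine tendsto_nhds_unique h2 (h1.congr fun n => (hcon n).1.symm)

theorem exists_leafBounds {s : Fin ℓ → ℕ} {u : ℕ → N × (S → Z)}
    {x : N × (S → Z)} (h : SmoothlyTendsto EZ u x) (hu : ∀ n, u n ∈ moduli A D s)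
    (hx : x ∈ moduli A D s) {θ : ℕ → Θ} {θ₀ : Θ} (hθ : Tendsto θ atTop (𝓝 θ₀)) (i : Fin 2)
    (k : Fin ℓ) {a : ℕ → ℂ} (hcon : ∀ n, HasContact A D (u n).2 i k (s k) (θ n) (a n)) :
    ∃ C r : ℝ, 1 ≤ C ∧ 0 < r ∧ ∀ᶠ n in atTop, LeafBounds C r i (s k) (a n)
      (fun z => (T.chart (θ n)).symm ((u n).2 ((D.coord i k).symm z))) ∧
      ∀ z ∈ Metric.ball (0 : ℂ) r, z ∈ (D.coord i k).target ∧
        (u n).2 ((D.coord i k).symm z) ∈ (T.chart (θ n)).target := by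
  have hθ₀ := chart_limit_centre h hu hx hθ hcon
  have hp := D.pt_mem_source i k
  have he := D.coord_smooth i k
  obtain ⟨⟨C₀, r₀, hr₀, hCk⟩, r₁, hr₁, htar⟩ := h.nodeCoord (fun n => (hu n).1) hx.1 he hp hθ hθ₀
    (s k + 1)
  rw [D.coord_pt] at hCk htar
  set f : ℕ → ℂ → W × (Fin 2 → ℂ) :=
    fun n z => (T.chart (θ n)).symm ((u n).2 ((D.coord i k).symm z)) with hf
  have hf0 : ∀ n, f n 0 = 0 := by
    intro n
    change (T.chart (θ n)).symm ((u n).2 (D.pt i k)) = 0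
    rw [← (hcon n).1, (T.chart (θ n)).left_inv (T.zero_mem_source (θ n))]
  obtain ⟨K, hK, hest⟩ := exists_leaf_estimates (W := W) (s k)
  have hC₀ : 0 ≤ C₀ := by
    obtain ⟨n, hn⟩ := hCk.exists
    exact (norm_nonneg _).trans (hn.2 0 (Nat.zero_le _) 0 (Metric.mem_ball_self hr₀))
  have hest' : ∀ᶠ n in atTop, ∀ z ∈ Metric.ball (0 : ℂ) (r₀ / 2), DifferentiableAt ℝ (f n) z ∧
      ‖f n z‖ ≤ C₀ * ‖z‖ ∧ ‖fderiv ℝ (f n) z‖ ≤ C₀ ∧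
      ‖(f n z).2 i - a n * z ^ s k‖ ≤ C₀ * ‖z‖ ^ (s k + 1) ∧ (z ≠ 0 →
      ‖fderiv ℝ (fun z => (f n z).2 i - a n * z ^ s k) z‖ ≤ K * C₀ * ‖z‖ ^ s k) :=
    hCk.mono fun n hn => hest C₀ r₀ i (a n) (f n) hC₀ hr₀ hn.1 hn.2 (hf0 n) (hcon n).2.2
  have hleaf : ∀ᶠ n in atTop, ∀ z ∈ Metric.ball (0 : ℂ) r₁, ∀ j, j ≠ i → (f n z).2 j = 0 := by
    filter_upwards [htar] with n hn z hz
    obtain ⟨hz1, hz2⟩ := hn z hz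
    have h1 := (T.chart (θ n)).map_target hz2
    rw [T.chart_source] at h1
    refine (T.chart_comp (θ n) _ h1 i).1 ?_
    rw [(T.chart (θ n)).right_inv hz2]
    have h2 := (hu n).2.1 ((D.coord i k).symm z)
    rwa [D.coord_side i k _ ((D.coord i k).map_target hz1)] at h2
  -- the limit map
  obtain ⟨θ', a', hc', ha', hO'⟩ := hx.2.2.2.2.1 i k
  have hcoord0 : (D.coord i k).symm 0 = D.pt i k := rfl
  have hsymm0 : Tendsto (D.coord i k).symm (𝓝 0) (𝓝 (D.pt i k)) := by
    have := tendsto_symm_coord hp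
    rwa [D.coord_pt] at this
  have hgt : Tendsto (fun z => x.2 ((D.coord i k).symm z)) (𝓝 0) (𝓝 (T.chart θ₀ 0)) := by
    rw [hθ₀]
    exact (hx.1.continuous.tendsto _).comp hsymm0
  obtain ⟨c, hc, hlow⟩ := exists_contact_lower_bound (θ₀ := θ₀) (hc'.trans hθ₀.symm)
    (g := fun z => x.2 ((D.coord i k).symm z)) (by
      change Tendsto _ _ (𝓝 (x.2 (D.pt i k)))
      rw [← hθ₀]; exact hgt) (by rw [hθ₀, hcoord0]) ha' hO'
  have htar0 := (T.target_mem_nhds θ₀)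
  have htar1 : ∀ᶠ z in 𝓝 (0 : ℂ), {q : Θ × Z | q.2 ∈ (T.chart q.1).target} ∈
      𝓝 (θ₀, x.2 ((D.coord i k).symm z)) :=
    (tendsto_const_nhds.prodMk_nhds hgt).eventually (eventually_eventually_nhds.2 htar0)
  obtain ⟨r₂, hr₂, hb⟩ := Metric.eventually_nhds_iff_ball.1 (hlow.and htar1)
  -- a fixed small point
  obtain ⟨ρ, hρ, hρ1, hρ2, hρ3, hρ4⟩ : ∃ ρ : ℝ, 0 < ρ ∧ ρ < r₀ / 2 ∧ ρ < r₁ ∧ ρ < r₂ ∧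
      C₀ * ρ ≤ c / 4 := by
    refine ⟨min (min (r₀ / 4) (r₁ / 2)) (min (r₂ / 2) (c / (4 * (C₀ + 1)))), by positivity, ?_, ?_,
      ?_, ?_⟩
    · exact ((min_le_left _ _).trans (min_le_left _ _)).trans_lt (by linarith)
    · exact ((min_le_left _ _).trans (min_le_right _ _)).trans_lt (by linarith)
    · exact ((min_le_right _ _).trans (min_le_left _ _)).trans_lt (by linarith)
    · calc C₀ * _ ≤ (C₀ + 1) * (c / (4 * (C₀ + 1))) := by
            gcongr
            · linarith
            · exact (min_le_right _ _).trans (min_le_right _ _)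
        _ = c / 4 := by field_simp
  have hρn : ‖(ρ : ℂ)‖ = ρ := by rw [Complex.norm_real, Real.norm_of_nonneg hρ.le]
  have hmem : ∀ r, ρ < r → (ρ : ℂ) ∈ Metric.ball (0 : ℂ) r := fun r hr => by
    rwa [mem_ball_zero_iff, hρn]
  have hlim : Tendsto (fun n => f n ρ) atTop
      (𝓝 ((T.chart θ₀).symm (x.2 ((D.coord i k).symm ρ)))) := by
    have h1 := (T.chart_symm_smooth.contMDiffAt (hb _ (hmem _ hρ3)).2).continuousAt
    exact h1.tendsto.comp (hθ.prodMk_nhds (h.tendsto_apply (fun n => (hu n).1) hx.1 _))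
  have hρlow := (hb _ (hmem _ hρ3)).1
  rw [hρn] at hρlow
  have hlow2 : ∀ᶠ n in atTop, c / 2 * ρ ^ s k < ‖(f n ρ).2‖ := by
    refine ((continuous_snd.tendsto _).comp hlim).norm.eventually_const_lt ?_
    refine lt_of_lt_of_le ?_ hρlow
    have : 0 < ρ ^ s k := by positivity
    nlinarith
  have hρs : 0 < ρ ^ s k := by positivity
  set C := 1 + C₀ + K * C₀ + (C₀ * ρ + C₀ * ρ ^ (s k + 1)) / ρ ^ s k + 4 / c with hC
  have hKC : 0 ≤ K * C₀ := by positivity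
  have hC3 : 0 ≤ (C₀ * ρ + C₀ * ρ ^ (s k + 1)) / ρ ^ s k := by positivity
  have hC4 : 0 < 4 / c := by positivity
  refine ⟨C, min (r₀ / 2) r₁, by linarith, by positivity, ?_⟩
  filter_upwards [hest', hleaf, htar, hlow2] with n h1 h2 h3 h4
  have hs1 : Metric.ball (0 : ℂ) (min (r₀ / 2) r₁) ⊆ Metric.ball 0 (r₀ / 2) :=
    Metric.ball_subset_ball (min_le_left _ _)
  have hs2 : Metric.ball (0 : ℂ) (min (r₀ / 2) r₁) ⊆ Metric.ball 0 r₁ :=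
    Metric.ball_subset_ball (min_le_right _ _)
  have hCC : C₀ ≤ C := by linarith
  obtain ⟨-, e1, -, e2, -⟩ := h1 _ (hmem _ hρ1)
  rw [hρn] at e1 e2
  have e3 : ‖a n * (ρ : ℂ) ^ s k‖ = ‖a n‖ * ρ ^ s k := by rw [norm_mul, norm_pow, hρn]
  have hfi : ‖(f n ρ).2‖ = ‖(f n ρ).2 i‖ := by
    refine le_antisymm ?_ (norm_le_pi_norm _ i)
    rw [eq_pair_of_leaf (h2 _ (hmem _ hρ2))]
    refine norm_pair_le (by simp [pair]) (by simp)
  refine ⟨⟨fun z hz => (h1 z (hs1 hz)).1, fun z hz => (h1 z (hs1 hz)).2.1.trans (by gcongr),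
    fun z hz => (h1 z (hs1 hz)).2.2.1.trans hCC, fun z hz => h2 z (hs2 hz),
    fun z hz => (h1 z (hs1 hz)).2.2.2.1.trans (by gcongr),
    fun z hz hz0 => ((h1 z (hs1 hz)).2.2.2.2 hz0).trans (by gcongr; linarith), ?_, ?_⟩,
    fun z hz => h3 z (hs2 hz)⟩
  · have e4 : ‖a n‖ * ρ ^ s k ≤ C₀ * ρ + C₀ * ρ ^ (s k + 1) := by
      rw [← e3]
      have := norm_le_norm_add_norm_sub ((f n ρ).2 i) (a n * (ρ : ℂ) ^ s k)
      have e5 := (norm_le_pi_norm (f n ρ).2 i).trans (norm_snd_le _)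
      linarith
    rw [← le_div_iff₀ hρs] at e4
    linarith
  · have e4 : c / 4 * ρ ^ s k ≤ ‖a n‖ * ρ ^ s k := by
      rw [← e3]
      have := norm_le_norm_add_norm_sub' ((f n ρ).2 i) (a n * (ρ : ℂ) ^ s k)
      have e5 : C₀ * ρ ^ (s k + 1) ≤ c / 4 * ρ ^ s k := by
        rw [pow_succ]
        calc _ = C₀ * ρ * ρ ^ s k := by ring
          _ ≤ _ := by gcongr
      rw [hfi] at h4
      linarith
    have e6 : c / 4 ≤ ‖a n‖ := le_of_mul_le_mul_right e4 hρs
    calc (1 : ℝ) = 4 / c * (c / 4) := by field_simp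
      _ ≤ C * ‖a n‖ := by gcongr; linarith

end NodeSequence

section NormalComplexStructure

variable {W : Type*} [NormedAddCommGroup W] [NormedSpace ℝ W]
  {EP : Type*} [NormedAddCommGroup EP] [NormedSpace ℝ EP]
  {C ε : ℝ} {q₀ : EP}
  {J : W × (Fin 2 → ℂ) → W × (Fin 2 → ℂ) →L[ℝ] W × (Fin 2 → ℂ)}
  {ν : W × (Fin 2 → ℂ) → EP → EP →L[ℝ] W × (Fin 2 → ℂ)}

theorem norm_normal_le {u : W × (Fin 2 → ℂ)} {i : Fin 2} (h : ∀ j, j ≠ i → u.2 j = 0) :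
    u.2 = pair i (u.2 i) 0 ∧ ‖u.2‖ ≤ ‖u.2 i‖ := by
  have e := eq_pair_of_leaf h
  refine ⟨e, ?_⟩
  conv_lhs => rw [e]
  exact norm_pair_le le_rfl (by simp)

/-- The equation for a map with contact of finite order with `V` determines `J` in the normal
direction. -/
theorem TangentBounds.J_normal_of_contact (hN : TangentBounds C ε q₀ J ν) (hε : 0 < ε) (hC : 1 ≤ C)
    {r a : _} {i : Fin 2} {s : ℕ} (hs : 1 ≤ s) {f : ℂ → W × (Fin 2 → ℂ)} (hr : 0 < r)
    (hf : LeafBounds C r i s a f) {j : ℂ → ℂ →L[ℝ] ℂ} {φ : ℂ → EP}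
    (hj : ∀ z ∈ Metric.ball (0 : ℂ) r, z ≠ 0 → ∀ ζ, j z ζ = Complex.I * ζ)
    (hφ : ∀ z ∈ Metric.ball (0 : ℂ) r, z ≠ 0 → φ z ∈ Metric.ball q₀ ε)
    (hφ' : ∀ z ∈ Metric.ball (0 : ℂ) r, z ≠ 0 → ∀ ζ, ‖fderiv ℝ φ z ζ‖ ≤ C * ‖ζ‖)
    (heq : ∀ z ∈ Metric.ball (0 : ℂ) r, z ≠ 0 → coordDbar J ν (j z) f φ z = 0) (x : ℂ) :
    (J 0 (0, pair i x 0)).2 i = Complex.I * x := by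
  have hC0 : 0 < C := by linarith
  have ha : a ≠ 0 := by
    rintro rfl
    have := hf.le_a
    rw [norm_zero, mul_zero] at this
    linarith
  set L : ℂ → ℂ := fun x => (J 0 (0, pair i x 0)).2 i with hL
  set δ := min (min r 1) (ε / C) with hδ
  have hδ0 : 0 < δ := by positivity
  have hLsub : ∀ x y, L x - L y = L (x - y) := by
    intro x y
    simp only [hL]
    rw [← Pi.sub_apply, ← Prod.snd_sub, ← map_sub, Prod.mk_sub_mk, pair_sub, sub_zero, sub_zero]
  have h0 : (0 : W × (Fin 2 → ℂ)) ∈ Metric.ball 0 ε := Metric.mem_ball_self hε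
  have hLn : ∀ x, ‖L x‖ ≤ C * ‖x‖ := by
    intro x
    refine (norm_le_pi_norm _ i).trans ((norm_snd_le _).trans
      ((ContinuousLinearMap.le_opNorm _ _).trans ?_))
    gcongr
    · exact hN.J_norm _ h0
    · exact max_le (by simp) (norm_pair_le le_rfl (by simp))
  have hsa : (s : ℂ) * a ≠ 0 := mul_ne_zero (by exact_mod_cast (by omega)) ha
  set B := ‖x‖ / (s * ‖a‖) with hB
  have hB0 : 0 ≤ B := by positivity
  rw [← sub_eq_zero, ← norm_le_zero_iff]
  refine nonpos_of_le_mul (K := 9 * C ^ 3 * B + C ^ 2 * ‖x‖) hδ0 fun t ht htδ => ?_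
  set z : ℂ := (t : ℂ) with hz
  have hzn : ‖z‖ = t := by rw [hz, Complex.norm_real, Real.norm_of_nonneg ht.le]
  have hz0 : z ≠ 0 := by rw [← norm_pos_iff, hzn]; exact ht
  have htr : t < r := htδ.trans_le ((min_le_left _ _).trans (min_le_left _ _))
  have ht1 : t ≤ 1 := htδ.le.trans ((min_le_left _ _).trans (min_le_right _ _))
  have htε : C * t < ε := by
    have := htδ.trans_le (min_le_right _ _)
    rw [lt_div_iff₀ hC0] at this
    linarith
  have hzr : z ∈ Metric.ball (0 : ℂ) r := by rwa [mem_ball_zero_iff, hzn]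
  have hfz : f z ∈ Metric.ball 0 ε := by
    rw [mem_ball_zero_iff]
    have := hf.norm_le z hzr
    rw [hzn] at this
    linarith
  have hps : t ^ s = t ^ (s - 1) * t := by rw [← pow_succ, Nat.sub_add_cancel hs]
  have hpp : 0 < t ^ (s - 1) := by positivity
  -- the derivative of the normal coordinate
  have hfd := (hf.diff z hzr).hasFDerivAt
  set f' := fderiv ℝ f z with hf'
  have hfi : ∀ l, HasFDerivAt (fun z => (f z).2 l)
      (((ContinuousLinearMap.proj (R := ℝ) (φ := fun _ : Fin 2 => ℂ) l).comp
        (ContinuousLinearMap.snd ℝ W (Fin 2 → ℂ))).comp f') z := fun l =>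
    ((ContinuousLinearMap.proj (R := ℝ) (φ := fun _ : Fin 2 => ℂ) l).comp
        (ContinuousLinearMap.snd ℝ W (Fin 2 → ℂ))).hasFDerivAt.comp z hfd
  have hleaf' : ∀ l, l ≠ i → ∀ ζ, (f' ζ).2 l = 0 := by
    intro l hl ζ
    have h1 : (fun z => (f z).2 l) =ᶠ[𝓝 z] fun _ => 0 := by
      filter_upwards [Metric.isOpen_ball.mem_nhds hzr] with y hy using hf.leaf y hy l hl
    have h2 := (hfi l).unique ((hasFDerivAt_const (0 : ℂ) z).congr_of_eventuallyEq h1)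
    exact congrArg (fun M : ℂ →L[ℝ] ℂ => M ζ) h2
  have hmono : HasFDerivAt (fun z : ℂ => a * z ^ s)
      ((a * (s * z ^ (s - 1))) • (ContinuousLinearMap.id ℝ ℂ)) z := by
    have h1 : HasDerivAt (fun z : ℂ => a * z ^ s) (a * (s * z ^ (s - 1))) z :=
      (hasDerivAt_pow s z).const_mul a
    have h2 := h1.hasFDerivAt.restrictScalars ℝ
    refine h2.congr_fderiv ?_
    ext; simp [mul_comm]
  have hrem' : ∀ ζ, ‖(f' ζ).2 i - a * (s * z ^ (s - 1)) * ζ‖ ≤ C * t ^ s * ‖ζ‖ := by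
    intro ζ
    have h1 := hf.rem' z hzr hz0
    rw [((hfi i).fun_sub hmono).fderiv, hzn] at h1
    have h2 := ContinuousLinearMap.le_of_opNorm_le _ h1 ζ
    simpa using h2
  -- the vector whose image is close to `x`
  obtain ⟨ζ, hζ, hζn⟩ : ∃ ζ : ℂ, a * (s * z ^ (s - 1)) * (Complex.I * ζ) = x ∧
      ‖ζ‖ * t ^ (s - 1) = B := by
    have hzs : z ^ (s - 1) ≠ 0 := pow_ne_zero _ hz0
    refine ⟨x / (Complex.I * (s * a * z ^ (s - 1))), ?_, ?_⟩
    · have := Complex.I_ne_zero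
      have h3 : (s : ℂ) ≠ 0 := left_ne_zero_of_mul hsa
      field_simp
    · rw [norm_div, norm_mul, norm_mul, norm_mul, norm_pow, hzn, Complex.norm_I, one_mul, hB,
        Complex.norm_natCast]
      field_simp
  have hI : ‖Complex.I * ζ‖ = ‖ζ‖ := by rw [norm_mul, Complex.norm_I, one_mul]
  have hζt : ‖ζ‖ * t ^ s = B * t := by rw [hps, ← mul_assoc, hζn]
  set u := f' (Complex.I * ζ) with hu
  have e1 : ‖u.2 i - x‖ ≤ C * (B * t) := by
    have := hrem' (Complex.I * ζ)
    rw [hζ, hI] at this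
    calc _ ≤ _ := this
      _ = C * (‖ζ‖ * t ^ s) := by ring
      _ = _ := by rw [hζt]
  have e2 : ‖(f' ζ).2 i + Complex.I * x‖ ≤ C * (B * t) := by
    have := hrem' ζ
    have h3 : a * (s * z ^ (s - 1)) * ζ = -(Complex.I * x) := by
      rw [← hζ]; linear_combination (a * (s * z ^ (s - 1)) * ζ) * Complex.I_sq
    rw [h3, sub_neg_eq_add] at this
    calc _ ≤ _ := this
      _ = C * (‖ζ‖ * t ^ s) := by ring
      _ = _ := by rw [hζt]
  have hf'n : ∀ ζ, ‖f' ζ‖ ≤ C * ‖ζ‖ := fun ζ =>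
    ContinuousLinearMap.le_of_opNorm_le _ (hf.fderiv_le z hzr) ζ
  have hX : ‖(f z).2‖ ≤ 2 * C * t ^ s := by
    refine (norm_normal_le fun l hl => hf.leaf z hzr l hl).2.trans ?_
    have h1 := hf.rem z hzr
    rw [hzn, pow_succ] at h1
    have h2 := norm_le_norm_add_norm_sub' ((f z).2 i) (a * z ^ s)
    rw [norm_mul, norm_pow, hzn] at h2
    have h3 : ‖a‖ * t ^ s ≤ C * t ^ s := by gcongr; exact hf.a_le
    have h4 : C * (t ^ s * t) ≤ C * t ^ s := by
      gcongr
      exact mul_le_of_le_one_right (by positivity) ht1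
    linarith
  obtain ⟨eu, -⟩ := norm_normal_le fun l hl => hleaf' l hl (Complex.I * ζ)
  have hun : ‖u.2‖ ≤ ‖x‖ + C * (B * t) := by
    refine (norm_normal_le fun l hl => hleaf' l hl (Complex.I * ζ)).2.trans ?_
    have := norm_le_norm_add_norm_sub' (u.2 i) x
    linarith
  -- the equation
  have hE := congrArg (fun M : ℂ →L[ℝ] W × (Fin 2 → ℂ) => (M ζ).2 i) (heq z hzr hz0)
  simp only [coordDbar_apply, hj z hzr hz0, Prod.snd_sub, Prod.smul_snd, Prod.snd_add,
    Pi.sub_apply, Pi.smul_apply, Pi.add_apply, zero_apply, Prod.snd_zero, Pi.zero_apply] at hE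
  have k1 := hN.norm_J_normal_sub hfz u
  have k2 := hN.norm_ν_normal hfz (hφ z hzr hz0) (fderiv ℝ φ z ζ)
  have k3 := (norm_le_pi_norm _ i).trans k1
  have k4 := (norm_le_pi_norm _ i).trans k2
  have e3 : L (u.2 i) = (J 0 (0, u.2)).2 i := by simp only [hL]; rw [← eu]
  rw [Pi.sub_apply, ← e3] at k3
  have k5 : C * ‖(f z).2‖ * ‖u.1‖ ≤ 2 * C ^ 3 * (B * t) := by
    calc _ ≤ C * (2 * C * t ^ s) * (C * ‖ζ‖) := by
          gcongr
          exact (norm_fst_le u).trans ((hf'n _).trans_eq (by rw [hI]))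
      _ = 2 * C ^ 3 * (‖ζ‖ * t ^ s) := by ring
      _ = _ := by rw [hζt]
  have k6 : C * ‖(f z).2‖ * ‖fderiv ℝ φ z ζ‖ ≤ 2 * C ^ 3 * (B * t) := by
    calc _ ≤ C * (2 * C * t ^ s) * (C * ‖ζ‖) := by gcongr; exact hφ' z hzr hz0 ζ
      _ = 2 * C ^ 3 * (‖ζ‖ * t ^ s) := by ring
      _ = _ := by rw [hζt]
  have k7 : C * ‖f z‖ * ‖u.2‖ ≤ C ^ 2 * ‖x‖ * t + C ^ 3 * (B * t) := by
    have h1 : C * (B * t) ≤ C * (B * 1) := by gcongr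
    have h2 := hf.norm_le z hzr
    rw [hzn] at h2
    calc _ ≤ C * (C * t) * (‖x‖ + C * (B * 1)) := by gcongr; linarith
      _ = _ := by ring
  have k8 : ‖L x - L (u.2 i)‖ ≤ C ^ 2 * (B * t) := by
    rw [hLsub]
    refine (hLn _).trans ?_
    rw [norm_sub_rev]
    calc _ ≤ C * (C * (B * t)) := by gcongr
      _ = _ := by ring
  set nu := (ν (f z) (φ z) (fderiv ℝ φ z ζ)).2 i
  set Ju := (J (f z) u).2 i
  have e4 : L x - Complex.I * x = (L x - L (u.2 i)) - (Ju - L (u.2 i)) + (2 : ℝ) • nu -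
      ((f' ζ).2 i + Complex.I * x) := by
    have h1 : (2 : ℝ) • nu = (f' ζ).2 i + Ju := by
      rw [← sub_eq_zero.1 hE, smul_smul]; norm_num; rfl
    rw [h1]; ring
  have hBt : 0 ≤ B * t := by positivity
  have hC2 : C ^ 2 * (B * t) ≤ C ^ 3 * (B * t) := by
    gcongr ?_ * _
    exact pow_le_pow_right₀ hC (by norm_num)
  have hC3 : C * (B * t) ≤ C ^ 3 * (B * t) := by gcongr; exact le_self_pow₀ hC (by norm_num)
  have h2n : ‖(2 : ℝ) • nu‖ ≤ 2 * (2 * C ^ 3 * (B * t)) := by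
    rw [norm_smul, Real.norm_of_nonneg two_pos.le]
    linarith
  change ‖L x - Complex.I * x‖ ≤ _
  rw [e4]
  have t1 := norm_sub_le (L x - L (u.2 i) - (Ju - L (u.2 i)) + (2 : ℝ) • nu)
    ((f' ζ).2 i + Complex.I * x)
  have t2 := norm_add_le (L x - L (u.2 i) - (Ju - L (u.2 i))) ((2 : ℝ) • nu)
  have t3 := norm_sub_le (L x - L (u.2 i)) (Ju - L (u.2 i))
  nlinarith

end NormalComplexStructure

section NodeMap

variable {EP : Type*} [NormedAddCommGroup EP] [NormedSpace ℝ EP] [FiniteDimensional ℝ EP]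
  {P : Type*} [TopologicalSpace P] [ChartedSpace EP P] [IsManifold 𝓘(ℝ, EP) ∞ P]
  {EN : Type*} [NormedAddCommGroup EN] [NormedSpace ℝ EN] [FiniteDimensional ℝ EN]
  {N : Type*} [TopologicalSpace N] [ChartedSpace EN N] [IsManifold 𝓘(ℝ, EN) ∞ N]
  {S : Type*} [TopologicalSpace S] [ChartedSpace ℂ S] [IsManifold 𝓘(ℝ, ℂ) ∞ S]
  {jP : ∀ q : P, TangentSpace 𝓘(ℝ, EP) q →L[ℝ] TangentSpace 𝓘(ℝ, EP) q}
  {ℓ : ℕ} (D : CurveFamily S EN N jP ℓ)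

/-- The map `φnode`, as a function of the coordinate of the `i`-th side and of the other one. -/
noncomputable def CurveFamily.φside (i : Fin 2) (k : Fin ℓ) (b : N) (μ : Fin ℓ → ℂ) (z w : ℂ) : P :=
  D.φnode k b μ (pair i z w 0) (pair i z w 1)

theorem CurveFamily.φ_eq_φside (i : Fin 2) (k : Fin ℓ) (b : N) {μ : Fin ℓ → ℂ}
    (hμ : ∀ k, ‖μ k‖ < 1) {p : S} (hp : p ∈ (D.coord i k).source)
    (hk : μ k = 0 ∨ ‖μ k‖ < 2 * ‖D.coord i k p‖) :
    D.φ b μ p = D.φside i k b μ (D.coord i k p) (μ k / D.coord i k p) := by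
  fin_cases i
  · exact D.φ_eq_left k b μ hμ p hp hk
  · exact D.φ_eq_right k b μ hμ p hp hk

theorem CurveFamily.φside_contMDiffAt (i : Fin 2) (k : Fin ℓ) {b : N} {μ : Fin ℓ → ℂ} {z w : ℂ}
    (hμ : ∀ k, ‖μ k‖ < 1) (hz : ‖z‖ < 2) (hw : ‖w‖ < 2) :
    ContMDiffAt (𝓘(ℝ, EN).prod 𝓘(ℝ, (Fin ℓ → ℂ) × ℂ × ℂ)) 𝓘(ℝ, EP) ∞
      (fun r : N × ((Fin ℓ → ℂ) × ℂ × ℂ) => D.φside i k r.1 r.2.1 r.2.2.1 r.2.2.2)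
      (b, (μ, z, w)) := by
  have hpn : ∀ l, ‖pair i z w l‖ < 2 := fun l => by
    unfold pair; split_ifs <;> assumption
  have hopen : IsOpen {r : N × ((Fin ℓ → ℂ) × ℂ × ℂ) |
      (∀ k, ‖r.2.1 k‖ < 1) ∧ ‖r.2.2.1‖ < 2 ∧ ‖r.2.2.2‖ < 2} := by
    have h1 : IsOpen {r : N × ((Fin ℓ → ℂ) × ℂ × ℂ) | ∀ k, ‖r.2.1 k‖ < 1} := by
      simp only [Set.ofPred_forall]
      exact isOpen_iInter_of_finite fun k => isOpen_lt (by fun_prop) continuous_const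
    have h2 : IsOpen {r : N × ((Fin ℓ → ℂ) × ℂ × ℂ) | ‖r.2.2.1‖ < 2} :=
      isOpen_lt (by fun_prop) continuous_const
    have h3 : IsOpen {r : N × ((Fin ℓ → ℂ) × ℂ × ℂ) | ‖r.2.2.2‖ < 2} :=
      isOpen_lt (by fun_prop) continuous_const
    exact h1.inter (h2.inter h3)
  have h1 := (D.φnode_smooth k).contMDiffAt (x := (b, (μ, pair i z w 0, pair i z w 1)))
    (hopen.mem_nhds ⟨hμ, hpn 0, hpn 1⟩)
  have h2 : ContDiff ℝ ∞ (fun r : (Fin ℓ → ℂ) × ℂ × ℂ =>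
      (r.1, pair i r.2.1 r.2.2 0, pair i r.2.1 r.2.2 1)) := by
    have : ∀ l, ContDiff ℝ ∞ (fun r : (Fin ℓ → ℂ) × ℂ × ℂ => pair i r.2.1 r.2.2 l) := fun l => by
      unfold pair
      split_ifs <;> fun_prop
    exact contDiff_fst.prodMk ((this 0).prodMk (this 1))
  have h3 : ContMDiffAt (𝓘(ℝ, EN).prod 𝓘(ℝ, (Fin ℓ → ℂ) × ℂ × ℂ))
      (𝓘(ℝ, EN).prod 𝓘(ℝ, (Fin ℓ → ℂ) × ℂ × ℂ)) ∞
      (fun r : N × ((Fin ℓ → ℂ) × ℂ × ℂ) =>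
        (r.1, (r.2.1, pair i r.2.2.1 r.2.2.2 0, pair i r.2.2.1 r.2.2.2 1))) (b, (μ, z, w)) :=
    contMDiffAt_fst.prodMk (h2.contMDiff.contMDiffAt.comp _ contMDiffAt_snd)
  exact ContMDiffAt.comp_of_eq h1 h3 rfl

/-- The map `φside` in the chart of `P` at `q₀`. -/
noncomputable def CurveFamily.φcoord (q₀ : P) (i : Fin 2) (k : Fin ℓ) (b : N) (μ : Fin ℓ → ℂ)
    (z : ℂ) : EP :=
  chartAt EP q₀ (D.φside i k b μ z (μ k / z))

/-- Uniform estimates for `φ` near a node, and its convergence to the map of the nodal curve. -/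
theorem CurveFamily.exists_φcoord_bound (b₀ : N) (i : Fin 2) (k : Fin ℓ) {ε : ℝ} (hε : 0 < ε) :
    ∃ C r : ℝ, 1 ≤ C ∧ 0 < r ∧ r ≤ 1 ∧ ∀ᶠ b in 𝓝 b₀, ∀ μ : Fin ℓ → ℂ, ‖μ‖ < r → ∀ z : ℂ, z ≠ 0 →
      ‖z‖ < r → ‖μ k / z‖ ≤ ‖z‖ →
      let q₀ := D.φside i k b₀ 0 0 0
      D.φcoord q₀ i k b μ z ∈ Metric.ball (chartAt EP q₀ q₀) ε ∧
      DifferentiableAt ℝ (D.φcoord q₀ i k b μ) z ∧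
      (∀ ζ, ‖fderiv ℝ (D.φcoord q₀ i k b μ) z ζ‖ ≤ C * ‖ζ‖) ∧
      ‖D.φcoord q₀ i k b μ z - D.φcoord q₀ i k b 0 z‖ ≤ C * (‖μ‖ + ‖μ k / z‖ / ‖z‖) ∧
      (∀ ζ, ‖fderiv ℝ (D.φcoord q₀ i k b μ) z ζ - fderiv ℝ (D.φcoord q₀ i k b 0) z ζ‖ ≤
        C * (‖μ‖ + ‖μ k / z‖ / ‖z‖) * ‖ζ‖) ∧
      ∀ᶠ x in 𝓝 z, D.φ b μ ((D.coord i k).symm x) =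
        (chartAt EP q₀).symm (D.φcoord q₀ i k b μ x) := by
  obtain ⟨q₀, hq₀⟩ : ∃ q₀, q₀ = D.φside i k b₀ 0 0 0 := ⟨_, rfl⟩
  set Q : N × ((Fin ℓ → ℂ) × ℂ × ℂ) → EP :=
    fun r => chartAt EP q₀ (D.φside i k r.1 r.2.1 r.2.2.1 r.2.2.2) with hQdef
  have hφ := D.φside_contMDiffAt i k (b := b₀) (μ := 0) (z := 0) (w := 0) (by simp) (by simp)
    (by simp)
  have hQ : ContMDiffAt (𝓘(ℝ, EN).prod 𝓘(ℝ, (Fin ℓ → ℂ) × ℂ × ℂ)) 𝓘(ℝ, EP) 2 Q (b₀, 0) := by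
    have h1 : ContMDiffAt 𝓘(ℝ, EP) 𝓘(ℝ, EP) ∞ (chartAt EP q₀) q₀ :=
      contMDiffAt_of_mem_maximalAtlas (IsManifold.chart_mem_maximalAtlas q₀) (mem_chart_source EP q₀)
    exact (ContMDiffAt.comp_of_eq h1 hφ hq₀.symm).of_le two_le_infty
  obtain ⟨C, hC, ε₁, hε₁, h1⟩ := exists_slice_fderiv_bound hQ
  have hsrc : ∀ᶠ r in 𝓝 ((b₀, (0 : (Fin ℓ → ℂ) × ℂ × ℂ))),
      D.φside i k r.1 r.2.1 r.2.2.1 r.2.2.2 ∈ (chartAt EP q₀).source ∧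
      Q r ∈ Metric.ball (chartAt EP q₀ q₀) ε := by
    refine (hφ.continuousAt.eventually ((chartAt EP q₀).open_source.mem_nhds ?_)).and
      (hQ.continuousAt.eventually (Metric.isOpen_ball.mem_nhds ?_))
    · simp only [← hq₀, mem_chart_source]
    · simp only [hQdef, ← hq₀, Prod.fst_zero, Prod.snd_zero]
      exact Metric.mem_ball_self hε
  obtain ⟨ε₂, hε₂, h2⟩ := eventually_forall_ball
    (p := fun b x => D.φside i k b x.1 x.2.1 x.2.2 ∈ (chartAt EP q₀).source ∧
      Q (b, x) ∈ Metric.ball (chartAt EP q₀ q₀) ε) hsrc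
  refine ⟨2 * C + 1, min (min ε₁ ε₂) 1, by linarith, by positivity, min_le_right _ _, ?_⟩
  filter_upwards [h1, h2] with b g1 g2 μ hμ z hz hzr hw
  rw [← hq₀]
  have hr1 : min (min ε₁ ε₂) 1 ≤ ε₁ := (min_le_left _ _).trans (min_le_left _ _)
  have hr2 : min (min ε₁ ε₂) 1 ≤ ε₂ := (min_le_left _ _).trans (min_le_right _ _)
  have hzp : 0 < ‖z‖ := norm_pos_iff.2 hz
  have hz1 : ‖z‖ ≤ 1 := hzr.le.trans (min_le_right _ _)
  have hk1 : ∀ k, ‖μ k‖ < 1 := fun k =>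
    (norm_le_pi_norm μ k).trans_lt (hμ.trans_le (min_le_right _ _))
  have mem : ∀ ν : Fin ℓ → ℂ, ‖ν‖ ≤ ‖μ‖ → ‖ν k / z‖ ≤ ‖z‖ →
      (ν, z, ν k / z) ∈ Metric.ball (0 : (Fin ℓ → ℂ) × ℂ × ℂ) (min (min ε₁ ε₂) 1) := by
    intro ν hν hν'
    rw [mem_ball_zero_iff]
    exact max_lt (hν.trans_lt hμ) (max_lt hzr (hν'.trans_lt hzr))
  have hder : ∀ ν : Fin ℓ → ℂ, ‖ν‖ ≤ ‖μ‖ → ‖ν k / z‖ ≤ ‖z‖ →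
      HasFDerivAt (D.φcoord q₀ i k b ν)
        ((fderiv ℝ (fun x => Q (b, x)) (ν, z, ν k / z)).comp
          ((0 : ℂ →L[ℝ] (Fin ℓ → ℂ)).prod ((ContinuousLinearMap.id ℝ ℂ).prod
            ((-(ν k / z ^ 2)) • ContinuousLinearMap.id ℝ ℂ)))) z := by
    intro ν hν hν'
    have h3 := ((g1 _ (Metric.ball_subset_ball hr1 (mem ν hν hν'))).1.differentiableAt
      (by norm_num)).hasFDerivAt
    exact h3.comp z ((hasFDerivAt_const ν z).prodMk ((hasFDerivAt_id z).prodMk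
      (hasFDerivAt_const_div (hasFDerivAt_id z) hz (ν k))))
  have m1 := mem μ le_rfl hw
  have m0 := mem 0 (by simp) (by simp)
  have d1 := hder μ le_rfl hw
  have d0 := hder 0 (by simp) (by simp)
  obtain ⟨-, b1, b2⟩ := g1 _ (Metric.ball_subset_ball hr1 m1)
  obtain ⟨-, b3, -⟩ := g1 _ (Metric.ball_subset_ball hr1 m0)
  have hwz : ‖μ k / z‖ ≤ ‖μ k / z‖ / ‖z‖ := by
    rw [le_div_iff₀ hzp]
    exact mul_le_of_le_one_right (norm_nonneg _) hz1
  have hsub : ‖((μ, z, μ k / z) : (Fin ℓ → ℂ) × ℂ × ℂ) -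
      (0, z, (0 : Fin ℓ → ℂ) k / z)‖ ≤ ‖μ‖ + ‖μ k / z‖ := by
    rw [Prod.mk_sub_mk, Prod.mk_sub_mk]
    simp only [sub_zero, sub_self, Pi.zero_apply, zero_div]
    have := norm_nonneg μ
    have := norm_nonneg (μ k / z)
    refine max_le (by linarith) (max_le ?_ (by linarith))
    rw [norm_zero]
    positivity
  have hmz : ‖μ k / z ^ 2‖ = ‖μ k / z‖ / ‖z‖ := by
    rw [norm_div, norm_div, norm_pow, div_div, sq]
  have hvec : ∀ ζ : ℂ, ‖((0 : Fin ℓ → ℂ), ζ, -(μ k / z ^ 2) * ζ)‖ ≤ ‖ζ‖ := by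
    intro ζ
    refine max_le (by simp) (max_le le_rfl ?_)
    rw [norm_mul, norm_neg, hmz]
    exact mul_le_of_le_one_left (norm_nonneg _) ((div_le_one hzp).2 hw)
  refine ⟨(g2 _ (Metric.ball_subset_ball hr2 m1)).2, d1.differentiableAt, ?_, ?_, ?_, ?_⟩
  · intro ζ
    rw [d1.fderiv]
    calc _ ≤ C * ‖((0 : Fin ℓ → ℂ), ζ, -(μ k / z ^ 2) * ζ)‖ :=
          ContinuousLinearMap.le_of_opNorm_le _ b1 _
      _ ≤ (2 * C + 1) * ‖ζ‖ := by gcongr; linarith; exact hvec ζ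
  · have h3 := (convex_ball (0 : (Fin ℓ → ℂ) × ℂ × ℂ) ε₁).norm_image_sub_le_of_norm_fderiv_le
      (f := fun x => Q (b, x)) (fun y hy => (g1 y hy).1.differentiableAt (by norm_num))
      (fun y hy => (g1 y hy).2.1) (Metric.ball_subset_ball hr1 m0) (Metric.ball_subset_ball hr1 m1)
    calc _ ≤ _ := h3
      _ ≤ C * (‖μ‖ + ‖μ k / z‖) := by gcongr
      _ ≤ (2 * C + 1) * (‖μ‖ + ‖μ k / z‖ / ‖z‖) := by gcongr; linarith
  · intro ζ
    rw [d1.fderiv, d0.fderiv]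
    set Q1 := fderiv ℝ (fun x => Q (b, x)) (μ, z, μ k / z)
    set Q0 := fderiv ℝ (fun x => Q (b, x)) (0, z, (0 : Fin ℓ → ℂ) k / z)
    have e : Q1 ((0 : Fin ℓ → ℂ), ζ, -(μ k / z ^ 2) * ζ) -
        Q0 ((0 : Fin ℓ → ℂ), ζ, -((0 : Fin ℓ → ℂ) k / z ^ 2) * ζ) =
        (Q1 - Q0) ((0 : Fin ℓ → ℂ), ζ, -(μ k / z ^ 2) * ζ) +
          Q0 (0, 0, -(μ k / z ^ 2) * ζ) := by
      rw [sub_apply, sub_add, ← map_sub]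
      simp
    change ‖Q1 ((0 : Fin ℓ → ℂ), ζ, -(μ k / z ^ 2) * ζ) -
        Q0 ((0 : Fin ℓ → ℂ), ζ, -((0 : Fin ℓ → ℂ) k / z ^ 2) * ζ)‖ ≤ _
    rw [e]
    have h4 : ‖((0 : Fin ℓ → ℂ), (0 : ℂ), -(μ k / z ^ 2) * ζ)‖ ≤ ‖μ k / z‖ / ‖z‖ * ‖ζ‖ := by
      rw [← hmz]
      have h0 : 0 ≤ ‖μ k / z ^ 2‖ * ‖ζ‖ := by positivity
      refine max_le (norm_zero.trans_le h0) (max_le (norm_zero.trans_le h0) ?_)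
      rw [norm_mul, norm_neg]
    have h5 := b2 _ (Metric.ball_subset_ball hr1 m0)
    have h6 := norm_nonneg μ
    calc _ ≤ ‖Q1 - Q0‖ * ‖((0 : Fin ℓ → ℂ), ζ, -(μ k / z ^ 2) * ζ)‖ +
          ‖Q0‖ * ‖((0 : Fin ℓ → ℂ), (0 : ℂ), -(μ k / z ^ 2) * ζ)‖ :=
          (norm_add_le _ _).trans (add_le_add (ContinuousLinearMap.le_opNorm _ _)
            (ContinuousLinearMap.le_opNorm _ _))
      _ ≤ C * (‖μ‖ + ‖μ k / z‖ / ‖z‖) * ‖ζ‖ + C * (‖μ k / z‖ / ‖z‖ * ‖ζ‖) := by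
          gcongr
          · exact h5.trans (by gcongr; exact hsub.trans (by gcongr))
          · exact hvec ζ
      _ ≤ C * (‖μ‖ + ‖μ k / z‖ / ‖z‖) * ‖ζ‖ + (C + 1) * (‖μ‖ + ‖μ k / z‖ / ‖z‖) * ‖ζ‖ := by
          rw [← mul_assoc]
          gcongr <;> linarith
      _ = _ := by ring
  · have c1 : ∀ᶠ x in 𝓝 z, ‖μ k‖ < 2 * ‖x‖ := by
      have hlt : ‖μ k‖ < 2 * ‖z‖ := by
        rw [norm_div, div_le_iff₀ hzp] at hw
        nlinarith
      exact (continuous_const.mul continuous_norm).continuousAt.eventually_const_lt hlt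
    have c2 : ∀ᶠ x in 𝓝 z, x ∈ (D.coord i k).target := by
      refine (D.coord i k).open_target.mem_nhds ?_
      rw [D.coord_target, mem_ball_zero_iff]
      linarith
    have c3 : ∀ᶠ x in 𝓝 z, (μ, x, μ k / x) ∈ Metric.ball (0 : (Fin ℓ → ℂ) × ℂ × ℂ) ε₂ := by
      have : ContinuousAt (fun x : ℂ => (μ, x, μ k / x)) z :=
        continuousAt_const.prodMk (continuousAt_id.prodMk (continuousAt_const.div continuousAt_id hz))
      exact this.eventually (Metric.isOpen_ball.mem_nhds (Metric.ball_subset_ball hr2 m1))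
    filter_upwards [c1, c2, c3] with x x1 x2 x3
    rw [D.φ_eq_φside i k b hk1 ((D.coord i k).map_target x2)
      (Or.inr (by rwa [(D.coord i k).right_inv x2])), (D.coord i k).right_inv x2]
    exact ((chartAt EP q₀).left_inv (g2 _ x3).1).symm

end NodeMap

section NodeData

variable {EZ : Type*} [NormedAddCommGroup EZ] [NormedSpace ℝ EZ] [FiniteDimensional ℝ EZ]
  {Z : Type*} [TopologicalSpace Z] [T2Space Z] [ChartedSpace EZ Z] [IsManifold 𝓘(ℝ, EZ) ∞ Z]
  {W : Type*} [NormedAddCommGroup W] [NormedSpace ℝ W] [FiniteDimensional ℝ W]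
  {EΘ : Type*} [NormedAddCommGroup EΘ] [NormedSpace ℝ EΘ] [FiniteDimensional ℝ EΘ]
  {Θ : Type*} [TopologicalSpace Θ] [ChartedSpace EΘ Θ] [IsManifold 𝓘(ℝ, EΘ) ∞ Θ]
  {EP : Type*} [NormedAddCommGroup EP] [NormedSpace ℝ EP] [FiniteDimensional ℝ EP]
  {P : Type*} [TopologicalSpace P] [ChartedSpace EP P] [IsManifold 𝓘(ℝ, EP) ∞ P]
  {EN : Type*} [NormedAddCommGroup EN] [NormedSpace ℝ EN] [FiniteDimensional ℝ EN]
  {N : Type*} [TopologicalSpace N] [ChartedSpace EN N] [IsManifold 𝓘(ℝ, EN) ∞ N]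
  {S : Type*} [TopologicalSpace S] [ChartedSpace ℂ S] [IsManifold 𝓘(ℝ, ℂ) ∞ S]
  {ℓ : ℕ} {T : SumFibration EZ Z W EΘ Θ} {A : CompatiblePair T EP P} {Nm : NormalSplitting T}
  {D : CurveFamily S EN N A.jP ℓ}

theorem CurveFamily.coordJ_coord (D : CurveFamily S EN N A.jP ℓ) (b : N) (i : Fin 2) (k : Fin ℓ)
    {z : ℂ} (hz : z ∈ (D.coord i k).target) (ζ : ℂ) :
    coordJ (D.j b) (D.coord i k) z ζ = Complex.I * ζ := by
  have h1 := D.coord_holo i k b _ ((D.coord i k).map_target hz)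
    (mfderiv 𝓘(ℝ, ℂ) 𝓘(ℝ, ℂ) (D.coord i k).symm z ζ)
  refine h1.trans (congrArg (fun w : ℂ => Complex.I * w) ?_)
  exact mfderiv_mfderiv_symm (D.coord_smooth i k) hz ζ

/-- The map `f` on the disc around a node, in the coordinates of the chart `θ`. -/
noncomputable abbrev CurveFamily.leafMap (T : SumFibration EZ Z W EΘ Θ)
    {jP : ∀ q : P, TangentSpace 𝓘(ℝ, EP) q →L[ℝ] TangentSpace 𝓘(ℝ, EP) q}
    (D : CurveFamily S EN N jP ℓ) (f : S → Z) (i : Fin 2) (k : Fin ℓ) (θ : Θ) (z : ℂ) :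
    W × (Fin 2 → ℂ) :=
  (T.chart θ).symm (f ((D.coord i k).symm z))

theorem coordDbar_leafMap_eq_zero {b : N} {f : S → Z} (hf : ∀ p, dbarSub A D b 0 f p = 0)
    (i : Fin 2) (k : Fin ℓ) (θ : Θ) (q₀ : P) {z : ℂ} (hz : z ∈ (D.coord i k).target)
    (hfz : ∀ᶠ x in 𝓝 z, f ((D.coord i k).symm x) ∈ (T.chart θ).target)
    (hF : DifferentiableAt ℝ (D.leafMap T f i k θ) z)
    (hc : MDifferentiableAt 𝓘(ℝ, W × (Fin 2 → ℂ)) 𝓘(ℝ, EZ) (T.chart θ) (D.leafMap T f i k θ z))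
    (hl : ∀ w : W × (Fin 2 → ℂ), mfderiv 𝓘(ℝ, EZ) 𝓘(ℝ, W × (Fin 2 → ℂ)) (T.chart θ).symm
        (T.chart θ (D.leafMap T f i k θ z))
          (mfderiv 𝓘(ℝ, W × (Fin 2 → ℂ)) 𝓘(ℝ, EZ) (T.chart θ) (D.leafMap T f i k θ z) w) = w)
    (hr : ∀ u : EZ, (mfderiv 𝓘(ℝ, W × (Fin 2 → ℂ)) 𝓘(ℝ, EZ) (T.chart θ) (D.leafMap T f i k θ z)
          (mfderiv 𝓘(ℝ, EZ) 𝓘(ℝ, W × (Fin 2 → ℂ)) (T.chart θ).symm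
            (T.chart θ (D.leafMap T f i k θ z)) u : W × (Fin 2 → ℂ)) : EZ) = u)
    (hφ : ∀ᶠ x in 𝓝 z, D.φ b 0 ((D.coord i k).symm x) =
      (chartAt EP q₀).symm (D.φcoord q₀ i k b 0 x))
    (hψ : MDifferentiableAt 𝓘(ℝ, EP) 𝓘(ℝ, EP) (chartAt EP q₀).symm (D.φcoord q₀ i k b 0 z))
    (hφ' : DifferentiableAt ℝ (D.φcoord q₀ i k b 0) z) :
    coordDbar (coordEnd A.J (T.chart θ) (T.chart θ).symm)
      (coordHom A.ν (T.chart θ) (T.chart θ).symm (chartAt EP q₀).symm)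
      (coordJ (D.j b) (D.coord i k) z) (D.leafMap T f i k θ) (D.φcoord q₀ i k b 0) z = 0 := by
  ext1 ζ
  have hF2 : ∀ᶠ x in 𝓝 z, f ((D.coord i k).symm x) = T.chart θ (D.leafMap T f i k θ x) :=
    hfz.mono fun x hx => ((T.chart θ).right_inv hx).symm
  have h1 := dbarSub_eq_coordDbar A D (D.coord_smooth i k) hz hF2 hc hF hr hφ hψ hφ' ζ
  have h2 : (dbarSub A D b 0 f ((D.coord i k).symm z)
      (mfderiv 𝓘(ℝ, ℂ) 𝓘(ℝ, ℂ) (D.coord i k).symm z ζ) : EZ) = 0 := by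
    rw [hf]; rfl
  have h3 := h1.symm.trans h2
  rw [← hl (coordDbar _ _ _ _ _ _ ζ)]
  refine (congrArg (fun x : EZ => (mfderiv 𝓘(ℝ, EZ) 𝓘(ℝ, W × (Fin 2 → ℂ)) (T.chart θ).symm
          (T.chart θ (D.leafMap T f i k θ z)) x : W × (Fin 2 → ℂ))) h3).trans (map_zero _)

variable (A Nm D) in
/-- Bounds for a holomorphic curve and for the target near a node, in coordinates. -/
structure NodeData (C ε r : ℝ) (q₀ : P) (i : Fin 2) (k : Fin ℓ) (s : ℕ) (b : N) (f : S → Z) (θ : Θ)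
    (a : ℂ) : Prop where
  bounds : NodeBounds C ε (chartAt EP q₀ q₀) (coordEnd A.J (T.chart θ) (T.chart θ).symm)
    (coordHom A.ν (T.chart θ) (T.chart θ).symm (chartAt EP q₀).symm)
  leaf : LeafBounds C r i s a (D.leafMap T f i k θ)
  mem : ∀ z ∈ Metric.ball (0 : ℂ) r, z ∈ (D.coord i k).target ∧
    f ((D.coord i k).symm z) ∈ (T.chart θ).target
  chart_P : ∀ q ∈ Metric.ball (chartAt EP q₀ q₀) ε,
    MDifferentiableAt 𝓘(ℝ, EP) 𝓘(ℝ, EP) (chartAt EP q₀).symm q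
  chart : ∀ y ∈ Metric.ball (0 : W × (Fin 2 → ℂ)) ε,
    MDifferentiableAt 𝓘(ℝ, W × (Fin 2 → ℂ)) 𝓘(ℝ, EZ) (T.chart θ) y ∧
    (∀ w : W × (Fin 2 → ℂ), mfderiv 𝓘(ℝ, EZ) 𝓘(ℝ, W × (Fin 2 → ℂ)) (T.chart θ).symm (T.chart θ y)
      (mfderiv 𝓘(ℝ, W × (Fin 2 → ℂ)) 𝓘(ℝ, EZ) (T.chart θ) y w) = w) ∧
    (∀ u : EZ, (mfderiv 𝓘(ℝ, W × (Fin 2 → ℂ)) 𝓘(ℝ, EZ) (T.chart θ) y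
      (mfderiv 𝓘(ℝ, EZ) 𝓘(ℝ, W × (Fin 2 → ℂ)) (T.chart θ).symm (T.chart θ y) u :
        W × (Fin 2 → ℂ)) : EZ) = u) ∧
    (∀ w : W × (Fin 2 → ℂ), Real.sqrt (A.g (T.chart θ y)
      (mfderiv 𝓘(ℝ, W × (Fin 2 → ℂ)) 𝓘(ℝ, EZ) (T.chart θ) y w)
      (mfderiv 𝓘(ℝ, W × (Fin 2 → ℂ)) 𝓘(ℝ, EZ) (T.chart θ) y w)) ≤ C * ‖w‖) ∧
    ∀ u, ‖coordEnd Nm.proj (T.chart θ) (T.chart θ).symm y u‖ ≤ C * (‖y.2‖ * ‖u‖ + ‖u.2‖)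
  φ : ∀ μ : Fin ℓ → ℂ, ‖μ‖ < r → ∀ z : ℂ, z ≠ 0 → ‖z‖ < r → ‖μ k / z‖ ≤ ‖z‖ →
    D.φcoord q₀ i k b μ z ∈ Metric.ball (chartAt EP q₀ q₀) ε ∧
    DifferentiableAt ℝ (D.φcoord q₀ i k b μ) z ∧
    (∀ ζ, ‖fderiv ℝ (D.φcoord q₀ i k b μ) z ζ‖ ≤ C * ‖ζ‖) ∧
    ‖D.φcoord q₀ i k b μ z - D.φcoord q₀ i k b 0 z‖ ≤ C * (‖μ‖ + ‖μ k / z‖ / ‖z‖) ∧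
    (∀ ζ, ‖fderiv ℝ (D.φcoord q₀ i k b μ) z ζ - fderiv ℝ (D.φcoord q₀ i k b 0) z ζ‖ ≤
      C * (‖μ‖ + ‖μ k / z‖ / ‖z‖) * ‖ζ‖) ∧
    ∀ᶠ x in 𝓝 z, D.φ b μ ((D.coord i k).symm x) =
      (chartAt EP q₀).symm (D.φcoord q₀ i k b μ x)
  eqn : ∀ z ∈ Metric.ball (0 : ℂ) r, z ≠ 0 →
    coordDbar (coordEnd A.J (T.chart θ) (T.chart θ).symm)
      (coordHom A.ν (T.chart θ) (T.chart θ).symm (chartAt EP q₀).symm)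
      (coordJ (D.j b) (D.coord i k) z) (D.leafMap T f i k θ) (D.φcoord q₀ i k b 0) z = 0

theorem pair_zero_add_pair (n : Fin 2 → ℂ) : n = pair 0 (n 0) 0 + pair 1 (n 1) 0 := by
  ext j
  fin_cases j <;> simp [pair]

variable (Nm) in
theorem exists_nodeData {s : Fin ℓ → ℕ} {u : ℕ → N × (S → Z)} (hs : ∀ k, 1 ≤ s k)
    {x : N × (S → Z)} (h : SmoothlyTendsto EZ u x) (hu : ∀ n, u n ∈ moduli A D s)
    (hx : x ∈ moduli A D s) {k : Fin ℓ} {θ : ℕ → Θ} {θ₀ : Θ} (hθ : Tendsto θ atTop (𝓝 θ₀))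
    {a : ℕ → Fin 2 → ℂ}
    (hcon : ∀ n i, HasContact A D (u n).2 i k (s k) (θ n) (a n i)) :
    ∃ C ε r : ℝ, 1 ≤ C ∧ 0 < ε ∧ ε ≤ T.ε ∧ 0 < r ∧ r ≤ 1 ∧ ∀ᶠ n in atTop, ∀ i,
      NodeData A Nm D C ε r (D.φnode k x.1 0 0 0) i k (s k) (u n).1 (u n).2 (θ n) (a n i) := by
  obtain ⟨q₀, hq₀⟩ : ∃ q₀, q₀ = D.φnode k x.1 0 0 0 := ⟨_, rfl⟩
  rw [← hq₀]
  have hq : ∀ i, D.φside i k x.1 0 0 0 = q₀ := fun i => by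
    rw [hq₀]; unfold CurveFamily.φside pair; simp
  obtain ⟨C₁, ε, hC₁, hε, hεT, h1⟩ := exists_nodeBounds A Nm θ₀ q₀
  choose C₂ r₂ hC₂ hr₂ h2 using fun i => exists_leafBounds h hu hx hθ i k (fun n => hcon n i)
  choose C₃ r₃ hC₃ hr₃ hr₃' h3 using fun i => D.exists_φcoord_bound x.1 i k hε
  simp only [hq] at h3
  set C := C₁ + C₂ 0 + C₂ 1 + C₃ 0 + C₃ 1 with hC
  have c1 : C₁ ≤ C := by linarith [hC₂ 0, hC₂ 1, hC₃ 0, hC₃ 1]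
  have c2 : ∀ i, C₂ i ≤ C := fun i => by
    fin_cases i <;> simp only [Fin.zero_eta, Fin.mk_one] <;> linarith [hC₂ 0, hC₂ 1, hC₃ 0, hC₃ 1]
  have c3 : ∀ i, C₃ i ≤ C := fun i => by
    fin_cases i <;> simp only [Fin.zero_eta, Fin.mk_one] <;> linarith [hC₂ 0, hC₂ 1, hC₃ 0, hC₃ 1]
  have hC1 : 1 ≤ C := hC₁.trans c1
  set r := min (min (min (r₂ 0) (r₂ 1)) (min (r₃ 0) (r₃ 1))) (ε / C) with hr
  have hr0 : 0 < r := lt_min (lt_min (lt_min (hr₂ 0) (hr₂ 1)) (lt_min (hr₃ 0) (hr₃ 1)))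
    (by positivity)
  have l2 : ∀ i, r ≤ r₂ i := fun i => by
    refine ((min_le_left _ _).trans (min_le_left _ _)).trans ?_
    fin_cases i
    · exact min_le_left _ _
    · exact min_le_right _ _
  have l3 : ∀ i, r ≤ r₃ i := fun i => by
    refine ((min_le_left _ _).trans (min_le_right _ _)).trans ?_
    fin_cases i
    · exact min_le_left _ _
    · exact min_le_right _ _
  have lε : C * r ≤ ε := by
    have : r ≤ ε / C := min_le_right _ _
    rwa [le_div_iff₀ (by linarith), mul_comm] at this
  refine ⟨C, ε, r, hC1, hε, hεT, hr0, (l3 0).trans (hr₃' 0), ?_⟩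
  have h3' : ∀ i, ∀ᶠ n in atTop, _ := fun i => h.1.eventually (h3 i)
  filter_upwards [hθ.eventually h1, eventually_all.2 h2, eventually_all.2 h3'] with n g1 g2 g3
  obtain ⟨t1, t2, t3, t4⟩ := g1
  have hleaf : ∀ i, LeafBounds C r i (s k) (a n i) (D.leafMap T (u n).2 i k (θ n)) := fun i =>
    (g2 i).1.mono (c2 i) (l2 i)
  have hmem : ∀ i, ∀ z ∈ Metric.ball (0 : ℂ) r, z ∈ (D.coord i k).target ∧
    (u n).2 ((D.coord i k).symm z) ∈ (T.chart (θ n)).target := fun i z hz =>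
    (g2 i).2 z (Metric.ball_subset_ball (l2 i) hz)
  have hball : ∀ i, ∀ z ∈ Metric.ball (0 : ℂ) r,
      D.leafMap T (u n).2 i k (θ n) z ∈ Metric.ball (0 : W × (Fin 2 → ℂ)) ε := fun i z hz => by
    rw [mem_ball_zero_iff] at *
    calc _ ≤ C * ‖z‖ := (hleaf i).norm_le z (by rwa [mem_ball_zero_iff])
      _ < C * r := by gcongr
      _ ≤ ε := lε
  have hφ := fun (i : Fin 2) (μ : Fin ℓ → ℂ) (hμ : ‖μ‖ < r) (z : ℂ) (hz : z ≠ 0) (hzr : ‖z‖ < r) =>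
    g3 i μ (hμ.trans_le (l3 i)) z hz (hzr.trans_le (l3 i))
  have heqn : ∀ i, ∀ z ∈ Metric.ball (0 : ℂ) r, z ≠ 0 →
    coordDbar (coordEnd A.J (T.chart (θ n)) (T.chart (θ n)).symm)
      (coordHom A.ν (T.chart (θ n)) (T.chart (θ n)).symm (chartAt EP q₀).symm)
      (coordJ (D.j (u n).1) (D.coord i k) z) (D.leafMap T (u n).2 i k (θ n))
        (D.φcoord q₀ i k (u n).1 0) z = 0 := by
    intro i z hz hz0
    obtain ⟨d1, d2, d3, -⟩ := t4 _ (hball i z hz)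
    obtain ⟨e1, e2, -, -, -, e3⟩ := hφ i 0 (by simpa using hr0) z hz0 (mem_ball_zero_iff.1 hz)
      (by simp)
    exact coordDbar_leafMap_eq_zero (hu n).2.2.2.2.2 i k (θ n) q₀ (hmem i z hz).1
      (by filter_upwards [Metric.isOpen_ball.mem_nhds hz] with y hy using (hmem i y hy).2)
      ((hleaf i).diff z hz) d1 d2 d3 e3 (t3 _ e1) e2
  have t1' : TangentBounds C ε (chartAt EP q₀ q₀)
      (coordEnd A.J (T.chart (θ n)) (T.chart (θ n)).symm)
      (coordHom A.ν (T.chart (θ n)) (T.chart (θ n)).symm (chartAt EP q₀).symm) := t1.mono c1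
  have hnor : ∀ i x, (coordEnd A.J (T.chart (θ n)) (T.chart (θ n)).symm 0 (0, pair i x 0)).2 i =
      Complex.I * x := by
    intro i x
    refine t1'.J_normal_of_contact hε hC1 (hs k) hr0 (hleaf i)
      (fun z hz _ ζ => D.coordJ_coord (u n).1 i k (hmem i z hz).1 ζ)
      (fun z hz hz0 => (hφ i 0 (by simpa using hr0) z hz0 (mem_ball_zero_iff.1 hz) (by simp)).1)
      (fun z hz hz0 ζ => ((hφ i 0 (by simpa using hr0) z hz0 (mem_ball_zero_iff.1 hz)
        (by simp)).2.2.1 ζ).trans (by gcongr; exact c3 i)) (heqn i) x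
  intro i
  refine ⟨⟨t1', fun m => ?_⟩, hleaf i, hmem i, t3, fun y hy => ?_, fun μ hμ z hz hzr hw => ?_,
    heqn i⟩
  · have e : ((0 : W), m) = (0, pair 0 (m 0) 0) + (0, pair 1 (m 1) 0) := by
      rw [Prod.mk_add_mk, ← pair_zero_add_pair, add_zero]
    rw [e, map_add, Prod.snd_add]
    ext j
    rw [Pi.add_apply, Pi.smul_apply, smul_eq_mul]
    fin_cases j
    · simp only [Fin.zero_eta]
      rw [hnor 0, t2 (pair 1 (m 1) 0) 0 (by simp [pair]), add_zero]
    · simp only [Fin.mk_one]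
      rw [hnor 1, t2 (pair 0 (m 0) 0) 1 (by simp [pair]), zero_add]
  · obtain ⟨d1, d2, d3, d4, d5⟩ := t4 y hy
    exact ⟨d1, d2, d3, fun w => (d4 w).trans (by gcongr), fun w => (d5 w).trans (by gcongr)⟩
  · obtain ⟨d1, d2, d3, d4, d5, d6⟩ := hφ i μ hμ z hz hzr hw
    exact ⟨d1, d2, fun ζ => (d3 ζ).trans (by gcongr; exact c3 i), d4.trans (by gcongr; exact c3 i),
      fun ζ => (d5 ζ).trans (by gcongr; exact c3 i), d6⟩

theorem NodeData.mono {C C' ε r : ℝ} {q₀ : P} {i : Fin 2} {k : Fin ℓ} {s : ℕ} {b : N} {f : S → Z}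
    {θ : Θ} {a : ℂ} (h : NodeData A Nm D C ε r q₀ i k s b f θ a) (hC : C ≤ C') :
    NodeData A Nm D C' ε r q₀ i k s b f θ a := by
  refine ⟨⟨h.bounds.toTangentBounds.mono hC, h.bounds.J_nor⟩, h.leaf.mono hC le_rfl, h.mem,
    h.chart_P, fun y hy => ?_, fun μ hμ z hz hzr hw => ?_, h.eqn⟩
  · obtain ⟨d1, d2, d3, d4, d5⟩ := h.chart y hy
    exact ⟨d1, d2, d3, fun w => (d4 w).trans (by gcongr), fun w => (d5 w).trans (by gcongr)⟩
  · obtain ⟨d1, d2, d3, d4, d5, d6⟩ := h.φ μ hμ z hz hzr hw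
    exact ⟨d1, d2, fun ζ => (d3 ζ).trans (by gcongr), d4.trans (by gcongr),
      fun ζ => (d5 ζ).trans (by gcongr), d6⟩

theorem CurveFamily.nodeRho_symm (D : CurveFamily S EN N A.jP ℓ) (μ : Fin ℓ → ℂ) (i : Fin 2)
    (k : Fin ℓ) {x : ℂ} (hx : x ∈ (D.coord i k).target) :
    D.nodeRho μ i k ((D.coord i k).symm x) = plumbRadius (μ k) x := by
  unfold CurveFamily.nodeRho plumbRadius
  rw [(D.coord i k).right_inv hx]

theorem CurveFamily.eq_of_mem_source {jP : ∀ q : P, TangentSpace 𝓘(ℝ, EP) q →L[ℝ] TangentSpace 𝓘(ℝ, EP) q}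
    (D : CurveFamily S EN N jP ℓ) {i i' : Fin 2} {k k' : Fin ℓ}
    {p : S} (h : p ∈ (D.coord i k).source) (h' : p ∈ (D.coord i' k').source) : i' = i ∧ k' = k := by
  have hi : i' = i := (D.coord_side i' k' p h').symm.trans (D.coord_side i k p h)
  refine ⟨hi, ?_⟩
  subst hi
  by_contra hk
  exact (Set.disjoint_left.1 (D.coord_disjoint i' k' k hk)) h' h

theorem LeafBounds.coord_ne_zero {C r : ℝ} {i : Fin 2} {s : ℕ} {a : ℂ} {f : ℂ → W × (Fin 2 → ℂ)}
    (hf : LeafBounds C r i s a f) (hC : 1 ≤ C) (hs : 1 ≤ s) {z : ℂ}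
    (hz : z ∈ Metric.ball (0 : ℂ) r) (hz0 : z ≠ 0) (hz1 : 2 * C ^ 2 * ‖z‖ ≤ 1) :
    (f z).2 i ≠ 0 := by
  have h := (hf.neckCoord_bounds (t := fun _ => 0) hC hs hz hz0 hz1 (by fun_prop) le_rfl zero_le_one
    (by simp; linarith)).1
  have hp : 0 < ‖z‖ ^ s := pow_pos (norm_pos_iff.2 hz0) _
  simp only [neckCoord, sub_zero, Complex.ofReal_one, one_mul, add_sub_cancel] at h
  intro h0
  rw [h0, norm_zero, mul_zero] at h
  linarith

/-- The approximate map in the coordinates at a node. -/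
theorem IsApproxMap.eventually_eq_neckMap {s : Fin ℓ → ℕ} {β : ℝ → ℝ} (hβ : IsCutoff β) {f : S → Z}
    {lam : ℂ} {θ : Fin ℓ → Θ} {a : Fin 2 → Fin ℓ → ℂ} {μ : Fin ℓ → ℂ} {F : S → Z}
    (hF : IsApproxMap A D s β f lam θ a μ F) {C ε r : ℝ} (hC : 1 ≤ C) (hεT : ε ≤ T.ε)
    {q₀ : P} {i : Fin 2} {k : Fin ℓ} {b : N} (hs : 1 ≤ s k) (hμ : μ k ≠ 0)
    (hd : NodeData A Nm D C ε r q₀ i k (s k) b f (θ k) (a i k)) {z : ℂ}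
    (hz : z ∈ Metric.ball (0 : ℂ) r) (hz0 : z ≠ 0) (hz1 : 2 * C ^ 2 * ‖z‖ < 1)
    (hc : ContinuousAt (neckMap i (s k) (a i k) lam (D.leafMap T f i k (θ k))
      (neckCutoff β (μ k))) z)
    (hb : neckMap i (s k) (a i k) lam (D.leafMap T f i k (θ k)) (neckCutoff β (μ k)) z ∈
      Metric.ball (0 : W × (Fin 2 → ℂ)) ε) :
    ∀ᶠ x in 𝓝 z, F ((D.coord i k).symm x) = T.chart (θ k)
      (neckMap i (s k) (a i k) lam (D.leafMap T f i k (θ k)) (neckCutoff β (μ k)) x) := by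
  have e1 : ∀ᶠ x : ℂ in 𝓝 z, 2 * C ^ 2 * ‖x‖ < 1 :=
    (continuous_const.mul continuous_norm).continuousAt.eventually_lt_const hz1
  filter_upwards [Metric.isOpen_ball.mem_nhds hz, isOpen_ne.mem_nhds hz0, e1,
    hc.eventually (Metric.isOpen_ball.mem_nhds hb)] with x hx hx0 hx1 hxb
  obtain ⟨ht, hft⟩ := hd.mem x hx
  have hsrc := (D.coord i k).map_target ht
  have hco := (D.coord i k).right_inv ht
  have ha : a i k ≠ 0 := (hF.contact i k).2.1
  rcases le_or_gt (plumbRadius (μ k) x) (2 * ‖μ k‖ ^ (1 / 4 : ℝ)) with hle | hgt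
  · rw [hF.neck i k _ hsrc (by rwa [D.nodeRho_symm μ i k ht]), D.nodeRho_symm μ i k ht]
    unfold neckValue neckMap neckCoord neckCutoff
    rw [hco]
    have hne : a i k * x ^ s k ≠ 0 := mul_ne_zero ha (pow_ne_zero _ hx0)
    have e : ∀ t : ℂ, ∀ y : ℂ, a i k * x ^ s k * (1 + t * (y / (a i k * x ^ s k) - 1)) =
        a i k * x ^ s k + t * (y - a i k * x ^ s k) := by
      intro t y
      field_simp
    simp only [e]
  · have ho := hF.outside ((D.coord i k).symm x) (by
      intro i' k' h'
      obtain ⟨rfl, rfl⟩ := D.eq_of_mem_source hsrc h'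
      rwa [D.nodeRho_symm μ i' k' ht])
    rw [ho, D.coord_side i k _ hsrc]
    have hcut : neckCutoff β (μ k) x = 0 :=
      hβ.zero _ ((le_div_iff₀ (by positivity)).2 hgt.le)
    have hX := hd.leaf.coord_ne_zero hC hs hx hx0 hx1.le
    have hnc : neckCoord i (s k) (a i k) (D.leafMap T f i k (θ k)) (neckCutoff β (μ k)) x =
        (D.leafMap T f i k (θ k) x).2 i := by
      unfold neckCoord; rw [hcut]; simp
    have hnm : neckMap i (s k) (a i k) lam (D.leafMap T f i k (θ k)) (neckCutoff β (μ k)) x =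
        ((D.leafMap T f i k (θ k) x).1, pair i ((D.leafMap T f i k (θ k) x).2 i)
          (lam / (D.leafMap T f i k (θ k) x).2 i)) := by
      unfold neckMap; rw [hnc, hcut]; simp
    rw [hnm] at hxb ⊢
    have hsource := (T.chart (θ k)).map_target hft
    rw [T.chart_source] at hsource
    have hleaf : D.leafMap T f i k (θ k) x = ((D.leafMap T f i k (θ k) x).1,
        pair i ((D.leafMap T f i k (θ k) x).2 i) 0) :=
      Prod.ext rfl (eq_pair_of_leaf (hd.leaf.leaf x hx))
    have hfx : f ((D.coord i k).symm x) = T.chart (θ k) ((D.leafMap T f i k (θ k) x).1,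
        pair i ((D.leafMap T f i k (θ k) x).2 i) 0) := by
      rw [← hleaf]
      exact ((T.chart (θ k)).right_inv hft).symm
    rw [hfx]
    refine (T.chart_lift i (θ k) _ _ lam hX ?_ (Metric.ball_subset_ball hεT hxb)).2
    rw [← hleaf]
    exact hsource

theorem CurveFamily.norm_le_of_h_le (D : CurveFamily S EN N A.jP ℓ) (b : N) (i : Fin 2) (k : Fin ℓ)
    {z : ℂ} (hz : z ∈ (D.coord i k).target) (hz0 : z ≠ 0) (hz1 : ‖z‖ ≤ 1) {ζ : ℂ}
    (h : D.h b ((D.coord i k).symm z) (mfderiv 𝓘(ℝ, ℂ) 𝓘(ℝ, ℂ) (D.coord i k).symm z ζ)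
      (mfderiv 𝓘(ℝ, ℂ) 𝓘(ℝ, ℂ) (D.coord i k).symm z ζ) ≤ 1) : ‖ζ‖ ≤ ‖z‖ := by
  have hzp := norm_pos_iff.2 hz0
  have h1 := D.h_cylindrical i k b _ ((D.coord i k).map_target hz)
    (by rwa [(D.coord i k).right_inv hz]) (by rwa [(D.coord i k).right_inv hz])
    (mfderiv 𝓘(ℝ, ℂ) 𝓘(ℝ, ℂ) (D.coord i k).symm z ζ)
  have h2 : toComplex (mfderiv 𝓘(ℝ, ℂ) 𝓘(ℝ, ℂ) (D.coord i k) ((D.coord i k).symm z)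
      (mfderiv 𝓘(ℝ, ℂ) 𝓘(ℝ, ℂ) (D.coord i k).symm z ζ)) = ζ :=
    mfderiv_mfderiv_symm (D.coord_smooth i k) hz ζ
  rw [h2, (D.coord i k).right_inv hz] at h1
  rw [h1, sq_le_one_iff₀ (by positivity), div_le_one hzp] at h
  exact h

/-- The pointwise estimates near a node. -/
theorem exists_node_ptNorm_bound {C ε r : ℝ} (hC : 1 ≤ C) (hε : 0 < ε) (hεT : ε ≤ T.ε)
    (hr : 0 < r) {s : Fin ℓ → ℕ} (hs : ∀ k, 1 ≤ s k) (k : Fin ℓ) {β : ℝ → ℝ} (hβ : IsCutoff β)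
    (hcut : ∀ μ z : ℂ, μ ≠ 0 → z ≠ 0 → Real.sqrt ‖μ‖ ≤ ‖z‖ →
      DifferentiableAt ℝ (neckCutoff β μ) z ∧ ‖fderiv ℝ (neckCutoff β μ) z‖ * ‖z‖ ≤ C) :
    ∃ K r₁ : ℝ, 0 ≤ K ∧ 0 < r₁ ∧ r₁ ≤ 1 ∧ r₁ ≤ r ∧ ∀ (q₀ : P) (i : Fin 2) (b : N) (f : S → Z)
      (lam : ℂ) (θ : Fin ℓ → Θ) (a : Fin 2 → Fin ℓ → ℂ) (μ : Fin ℓ → ℂ) (F : S → Z) (κ : ℝ) (z : ℂ),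
      NodeData A Nm D C ε r q₀ i k (s k) b f (θ k) (a i k) →
      IsApproxMap A D s β f lam θ a μ F → ‖μ‖ < r → μ k ≠ 0 → ‖μ‖ ≤ C * κ →
      ‖μ k‖ ^ (1 / 5 : ℝ) ≤ C * κ → ‖lam‖ ≤ C ^ 2 * ‖μ k‖ ^ s k → 0 ≤ κ →
      ‖z‖ < r₁ → Real.sqrt ‖μ k‖ ≤ ‖z‖ →
      ptNorm A D b ((D.coord i k).symm z) (F ((D.coord i k).symm z))
        (dbarSub A D b μ F ((D.coord i k).symm z)) ≤ ENNReal.ofReal (K * κ * ‖z‖ ^ (1 / 5 : ℝ)) ∧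
      ptNorm A D b ((D.coord i k).symm z) (F ((D.coord i k).symm z))
        ((Nm.proj (F ((D.coord i k).symm z))).comp (dbarSub A D b μ F ((D.coord i k).symm z))) ≤
        ENNReal.ofReal (K * κ * ‖z‖ ^ (1 / 5 : ℝ) * ‖z‖ ^ (s k - 1)) := by
  obtain ⟨K, r₁, hK, hr₁, hr₁', hest⟩ := exists_node_estimate (W := W) (EP := EP) hC hε (hs k)
  set r₂ := min (min r₁ r) (1 / (2 * C ^ 2)) with hr₂
  have hC0 : 0 < C := by linarith
  have hK0 : 0 < K := by linarith
  refine ⟨C * K + C * (C * (K ^ 2 + K)), r₂, by positivity, by positivity,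
    ((min_le_left _ _).trans (min_le_left _ _)).trans hr₁',
    (min_le_left _ _).trans (min_le_right _ _), ?_⟩
  intro q₀ i b f lam θ a μ F κ z hd hF hμr hμ0 hμκ hμκ' hlam hκ hzr hμz
  have hz0 : z ≠ 0 := by
    rw [← norm_pos_iff]
    exact (Real.sqrt_pos.2 (norm_pos_iff.2 hμ0)).trans_le hμz
  have hzp : 0 < ‖z‖ := norm_pos_iff.2 hz0
  have hzr1 : ‖z‖ ≤ r₁ := hzr.le.trans ((min_le_left _ _).trans (min_le_left _ _))
  have hzr2 : ‖z‖ < r := hzr.trans_le ((min_le_left _ _).trans (min_le_right _ _))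
  have hz1 : ‖z‖ ≤ 1 := hzr1.trans hr₁'
  have hzC : 2 * C ^ 2 * ‖z‖ < 1 := by
    have := hzr.trans_le (min_le_right _ _)
    rw [lt_div_iff₀ (by positivity)] at this
    linarith
  have hzb : z ∈ Metric.ball (0 : ℂ) r := by rwa [mem_ball_zero_iff]
  have ht := (hd.mem z hzb).1
  have hw := norm_div_le_of_sqrt_le hz0 hμz
  obtain ⟨p1, p2, p3, p4, p5, p6⟩ := hd.φ μ hμr z hz0 hzr2 hw
  obtain ⟨p1', -⟩ := hd.φ 0 (by simpa using hr) z hz0 hzr2 (by simp)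
  obtain ⟨k1, k2⟩ := hcut (μ k) z hμ0 hz0 hμz
  set Fh := neckMap i (s k) (a i k) lam (D.leafMap T f i k (θ k)) (neckCutoff β (μ k)) with hFh
  obtain ⟨n1, n2, n3, n4⟩ := hest _ _ _ (coordJ (D.j b) (D.coord i k) z) _ Fh
    (D.φcoord q₀ i k b μ) _ i _ lam (μ k) r κ ‖μ‖ β z hd.bounds hd.leaf hβ k1 k2
    (D.coordJ_coord b i k ht) hzb hz0 hzr1 hμz hμ0 (hd.eqn z hzb hz0) p1 p1' p3 p4 p5
    (norm_nonneg _) hμκ hμκ' hlam EventuallyEq.rfl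
  have hform := hF.eventually_eq_neckMap hβ hC hεT (hs k) hμ0 hd hzb hz0 hzC n1.continuousAt n2
  obtain ⟨c1, c2, c3, c4, c5⟩ := hd.chart _ n2
  set η := coordDbar (coordEnd A.J (T.chart (θ k)) (T.chart (θ k)).symm)
    (coordHom A.ν (T.chart (θ k)) (T.chart (θ k)).symm (chartAt EP q₀).symm)
    (coordJ (D.j b) (D.coord i k) z) Fh (D.φcoord q₀ i k b μ) z with hη
  have hform2 := fun ζ => dbarSub_eq_coordDbar A D (D.coord_smooth i k) ht hform c1 n1 c3 p6
    (hd.chart_P _ p1) p2 ζ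
  have hFz := hform.self_of_nhds
  have hx : 0 < ‖z‖ ^ (1 / 5 : ℝ) := by positivity
  have hx1 : ‖z‖ ^ (1 / 5 : ℝ) ≤ 1 := Real.rpow_le_one hzp.le hz1 (by norm_num)
  have hs1 : 0 < ‖z‖ ^ (s k - 1) := by positivity
  set R := K * κ * ‖z‖ ^ (1 / 5 : ℝ) with hR
  have hR0 : 0 ≤ R := by positivity
  have b1 : ∀ ζ, ‖η ζ‖ ≤ R / ‖z‖ * ‖ζ‖ := fun ζ => by
    rw [div_mul_eq_mul_div, le_div_iff₀ hzp]
    exact (n4 ζ).1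
  have b2 : ∀ ζ, ‖(η ζ).2‖ ≤ R * ‖z‖ ^ (s k - 1) / ‖z‖ * ‖ζ‖ := fun ζ => by
    rw [div_mul_eq_mul_div, le_div_iff₀ hzp]
    exact (n4 ζ).2
  constructor
  · refine (ptNorm_le_of_coord A D (D.coord_smooth i k) ht hFz _ η hform2 hC0.le
      (by positivity) c4 (fun ζ => D.norm_le_of_h_le b i k ht hz0 hz1) b1).trans
      (ENNReal.ofReal_le_ofReal ?_)
    rw [div_mul_cancel₀ _ hzp.ne', hR]
    calc C * (K * κ * ‖z‖ ^ (1 / 5 : ℝ)) = C * K * κ * ‖z‖ ^ (1 / 5 : ℝ) := by ring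
      _ ≤ _ := by gcongr; exact le_add_of_nonneg_right (by positivity)
  · set B := coordEnd Nm.proj (T.chart (θ k)) (T.chart (θ k)).symm (Fh z) with hB
    refine (ptNorm_le_of_coord A D (D.coord_smooth i k) ht hFz _ (B.comp η) ?_ hC0.le
      (R := C * (K ^ 2 + K) * κ * ‖z‖ ^ (1 / 5 : ℝ) * ‖z‖ ^ (s k - 1) / ‖z‖)
      (by positivity) c4 (fun ζ => D.norm_le_of_h_le b i k ht hz0 hz1) ?_).trans
      (ENNReal.ofReal_le_ofReal ?_)
    · intro ζ
      have key : ∀ w : Z, w = T.chart (θ k) (Fh z) → ∀ v : EZ,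
          (Nm.proj w v : EZ) = Nm.proj (T.chart (θ k) (Fh z)) v := by
        rintro _ rfl v; rfl
      refine (key _ hFz _).trans ?_
      refine (congrArg (fun v : EZ => (Nm.proj (T.chart (θ k) (Fh z)) v : EZ)) (hform2 ζ)).trans ?_
      exact (c3 _).symm
    · intro ζ
      calc ‖B (η ζ)‖ ≤ C * (‖(Fh z).2‖ * ‖η ζ‖ + ‖(η ζ).2‖) := c5 _
        _ ≤ C * (K * ‖z‖ ^ (s k - 1) * (R / ‖z‖ * ‖ζ‖) + R * ‖z‖ ^ (s k - 1) / ‖z‖ * ‖ζ‖) := by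
          gcongr
          · exact b1 ζ
          · exact b2 ζ
        _ = _ := by rw [hR]; ring
    · rw [div_mul_cancel₀ _ hzp.ne']
      calc C * (C * (K ^ 2 + K) * κ * ‖z‖ ^ (1 / 5 : ℝ) * ‖z‖ ^ (s k - 1)) =
          C * (C * (K ^ 2 + K)) * κ * ‖z‖ ^ (1 / 5 : ℝ) * ‖z‖ ^ (s k - 1) := by ring
        _ ≤ _ := by gcongr; exact le_add_of_nonneg_left (by positivity)

end NodeData

/-- The rate `|λ| ^ (1 / (5 |s|))`. -/
noncomputable def glueRate {ℓ : ℕ} (s : Fin ℓ → ℕ) (lam : ℂ) : ℝ :=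
  ‖lam‖ ^ (1 / (5 * ((∏ k, s k : ℕ) : ℝ)))

theorem glueRate_nonneg {ℓ : ℕ} (s : Fin ℓ → ℕ) (lam : ℂ) : 0 ≤ glueRate s lam := by
  unfold glueRate; positivity

theorem glueRate_exponent_pos {ℓ : ℕ} {s : Fin ℓ → ℕ} (hs : ∀ k, 1 ≤ s k) :
    0 < 1 / (5 * ((∏ k, s k : ℕ) : ℝ)) := by
  have : 0 < ∏ k, s k := Finset.prod_pos fun k _ => hs k
  positivity

theorem tendsto_glueRate {ℓ : ℕ} {s : Fin ℓ → ℕ} (hs : ∀ k, 1 ≤ s k) {lam : ℕ → ℂ}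
    (h : Tendsto lam atTop (𝓝 0)) : Tendsto (fun n => glueRate s (lam n)) atTop (𝓝 0) := by
  have he := glueRate_exponent_pos hs
  have h1 : Tendsto (fun n => ‖lam n‖) atTop (𝓝 0) := by simpa using h.norm
  have h2 := h1.rpow_const (p := 1 / (5 * ((∏ k, s k : ℕ) : ℝ))) (Or.inr he.le)
  rwa [Real.zero_rpow he.ne'] at h2

theorem norm_le_glueRate {ℓ : ℕ} {s : Fin ℓ → ℕ} (hs : ∀ k, 1 ≤ s k) {lam : ℂ} (h : ‖lam‖ ≤ 1) :
    ‖lam‖ ≤ glueRate s lam := by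
  have hp : 1 ≤ ∏ k, s k := Nat.one_le_iff_ne_zero.2 (Finset.prod_pos fun k _ => hs k).ne'
  rcases (norm_nonneg lam).eq_or_lt with h0 | h0
  · rw [← h0]; exact glueRate_nonneg s lam
  · have : 1 / (5 * ((∏ k, s k : ℕ) : ℝ)) ≤ 1 := by
      rw [div_le_one (by positivity)]
      have : (1 : ℝ) ≤ ((∏ k, s k : ℕ) : ℝ) := by exact_mod_cast hp
      linarith
    calc ‖lam‖ = ‖lam‖ ^ (1 : ℝ) := (Real.rpow_one _).symm
      _ ≤ _ := Real.rpow_le_rpow_of_exponent_ge h0 h this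

theorem rpow_le_glueRate {ℓ : ℕ} {s : Fin ℓ → ℕ} (hs : ∀ k, 1 ≤ s k) (k : Fin ℓ) {lam : ℂ}
    (h0 : lam ≠ 0) (h : ‖lam‖ ≤ 1) {C m : ℝ} (hC : 1 ≤ C) (hm : 0 ≤ m)
    (hml : m ^ s k ≤ C * ‖lam‖) : m ^ (1 / 5 : ℝ) ≤ C * glueRate s lam := by
  have hl : 0 < ‖lam‖ := norm_pos_iff.2 h0
  have hsk : (1 : ℝ) ≤ s k := by exact_mod_cast hs k
  have hle : (s k : ℝ) ≤ ((∏ k, s k : ℕ) : ℝ) := by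
    exact_mod_cast Finset.single_le_prod' (f := s) (fun k _ => hs k) (Finset.mem_univ k)
  have e : m ^ (1 / 5 : ℝ) = (m ^ s k) ^ (1 / (5 * (s k : ℝ))) := by
    rw [← Real.rpow_natCast, ← Real.rpow_mul hm]
    congr 1
    field_simp
  rw [e]
  calc (m ^ s k) ^ (1 / (5 * (s k : ℝ))) ≤ (C * ‖lam‖) ^ (1 / (5 * (s k : ℝ))) := by gcongr
    _ = C ^ (1 / (5 * (s k : ℝ))) * ‖lam‖ ^ (1 / (5 * (s k : ℝ))) :=
        Real.mul_rpow (by linarith) hl.le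
    _ ≤ C ^ (1 : ℝ) * glueRate s lam := by
        have h1 : 1 / (5 * (s k : ℝ)) ≤ 1 := by
          rw [div_le_one (by positivity)]; linarith
        have h2 : 1 / (5 * ((∏ k, s k : ℕ) : ℝ)) ≤ 1 / (5 * (s k : ℝ)) := by gcongr
        gcongr
        exact Real.rpow_le_rpow_of_exponent_ge hl h h2
    _ = _ := by rw [Real.rpow_one]

section ApproxSeq

variable {EZ : Type*} [NormedAddCommGroup EZ] [NormedSpace ℝ EZ] [FiniteDimensional ℝ EZ]
  {Z : Type*} [TopologicalSpace Z] [T2Space Z] [ChartedSpace EZ Z] [IsManifold 𝓘(ℝ, EZ) ∞ Z]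
  {W : Type*} [NormedAddCommGroup W] [NormedSpace ℝ W] [FiniteDimensional ℝ W]
  {EΘ : Type*} [NormedAddCommGroup EΘ] [NormedSpace ℝ EΘ] [FiniteDimensional ℝ EΘ]
  {Θ : Type*} [TopologicalSpace Θ] [ChartedSpace EΘ Θ] [IsManifold 𝓘(ℝ, EΘ) ∞ Θ]
  {EP : Type*} [NormedAddCommGroup EP] [NormedSpace ℝ EP] [FiniteDimensional ℝ EP]
  {P : Type*} [TopologicalSpace P] [ChartedSpace EP P] [IsManifold 𝓘(ℝ, EP) ∞ P]
  {EN : Type*} [NormedAddCommGroup EN] [NormedSpace ℝ EN] [FiniteDimensional ℝ EN]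
  {N : Type*} [TopologicalSpace N] [ChartedSpace EN N] [IsManifold 𝓘(ℝ, EN) ∞ N]
  {S : Type*} [TopologicalSpace S] [ChartedSpace ℂ S] [IsManifold 𝓘(ℝ, ℂ) ∞ S]
  {ℓ : ℕ} {T : SumFibration EZ Z W EΘ Θ} {A : CompatiblePair T EP P}
  {D : CurveFamily S EN N A.jP ℓ}

variable (A D) in
/-- A sequence of approximate maps made from a convergent sequence of holomorphic curves. -/
structure ApproxSeq (s : Fin ℓ → ℕ) (β : ℝ → ℝ) (x : N × (S → Z)) (θ₀ : Fin ℓ → Θ)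
    (u : ℕ → N × (S → Z)) (lam : ℕ → ℂ) (θ : ℕ → Fin ℓ → Θ) (a : ℕ → Fin 2 → Fin ℓ → ℂ)
    (μ : ℕ → Fin ℓ → ℂ) (F : ℕ → S → Z) : Prop where
  lim_mem : x ∈ moduli A D s
  mem : ∀ n, u n ∈ moduli A D s
  tendsto : SmoothlyTendsto EZ u x
  tendsto_θ : ∀ k, Tendsto (fun n => θ n k) atTop (𝓝 (θ₀ k))
  lam_ne : ∀ n, lam n ≠ 0
  tendsto_lam : Tendsto lam atTop (𝓝 0)
  approx : ∀ n, IsApproxMap A D s β (u n).2 (lam n) (θ n) (a n) (μ n) (F n)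

variable {s : Fin ℓ → ℕ} {β : ℝ → ℝ} {x : N × (S → Z)} {θ₀ : Fin ℓ → Θ}
    {u : ℕ → N × (S → Z)} {lam : ℕ → ℂ} {θ : ℕ → Fin ℓ → Θ} {a : ℕ → Fin 2 → Fin ℓ → ℂ}
    {μ : ℕ → Fin ℓ → ℂ} {F : ℕ → S → Z}

theorem ApproxSeq.gluing_bounds (H : ApproxSeq A D s β x θ₀ u lam θ a μ F) (hs : ∀ k, 1 ≤ s k) :
    ∃ C : ℝ, 1 ≤ C ∧ ∀ᶠ n in atTop, ‖lam n‖ ≤ glueRate s (lam n) ∧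
      ‖μ n‖ ≤ C * glueRate s (lam n) ∧ ∀ k, μ n k ≠ 0 ∧
      ‖μ n k‖ ^ (1 / 5 : ℝ) ≤ C * glueRate s (lam n) ∧ ‖lam n‖ ≤ C ^ 2 * ‖μ n k‖ ^ s k := by
  choose C₁ r₁ hC₁ hr₁ h1 using fun (q : Fin 2 × Fin ℓ) => exists_leafBounds H.tendsto H.mem
    H.lim_mem (H.tendsto_θ q.2) q.1 q.2 (fun n => (H.approx n).contact q.1 q.2)
  set C := 1 + ∑ q, C₁ q with hC
  have hC1 : ∀ q, C₁ q ≤ C := fun q => by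
    have := Finset.single_le_sum (f := C₁) (fun q _ => zero_le_one.trans (hC₁ q))
      (Finset.mem_univ q)
    linarith
  have hC0 : 1 ≤ C := by
    have := Finset.sum_nonneg (f := C₁) (s := Finset.univ) (fun q _ => zero_le_one.trans (hC₁ q))
    linarith
  have hCC : C ≤ C ^ 2 := by nlinarith
  refine ⟨C ^ 2, hC0.trans hCC, ?_⟩
  have hl1 : ∀ᶠ n in atTop, ‖lam n‖ ≤ 1 := by
    have : Tendsto (fun n => ‖lam n‖) atTop (𝓝 0) := by simpa using H.tendsto_lam.norm
    exact (this.eventually_lt_const one_pos).mono fun n hn => hn.le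
  have hr1 : ∀ᶠ n in atTop, C ^ 2 * glueRate s (lam n) < 1 := by
    have := (tendsto_glueRate hs H.tendsto_lam).const_mul (C ^ 2)
    rw [mul_zero] at this
    exact this.eventually_lt_const one_pos
  filter_upwards [hl1, hr1, eventually_all.2 h1] with n g1 g2 g3
  have hk : ∀ k, μ n k ≠ 0 ∧ ‖μ n k‖ ^ (1 / 5 : ℝ) ≤ C ^ 2 * glueRate s (lam n) ∧
      ‖lam n‖ ≤ C ^ 2 * ‖μ n k‖ ^ s k := by
    intro k
    have hg := (H.approx n).gluing k
    have hμ : μ n k ≠ 0 := by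
      intro h0
      rw [h0, zero_pow (by have := hs k; omega), mul_zero] at hg
      exact H.lam_ne n hg.symm
    have hgn : ‖a n 0 k‖ * ‖a n 1 k‖ * ‖μ n k‖ ^ s k = ‖lam n‖ := by
      rw [← hg, norm_mul, norm_mul, norm_pow]
    have a0 := (g3 (0, k)).1.a_le.trans (hC1 _)
    have a1 := (g3 (1, k)).1.a_le.trans (hC1 _)
    have b0 : 1 ≤ C * ‖a n 0 k‖ := (g3 (0, k)).1.le_a.trans (by gcongr; exact hC1 _)
    have b1 : 1 ≤ C * ‖a n 1 k‖ := (g3 (1, k)).1.le_a.trans (by gcongr; exact hC1 _)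
    refine ⟨hμ, rpow_le_glueRate hs k (H.lam_ne n) g1 (hC0.trans hCC) (norm_nonneg _) ?_, ?_⟩
    · rw [← hgn]
      have := one_le_mul_of_one_le_of_one_le b0 b1
      calc ‖μ n k‖ ^ s k = 1 * ‖μ n k‖ ^ s k := (one_mul _).symm
        _ ≤ (C * ‖a n 0 k‖ * (C * ‖a n 1 k‖)) * ‖μ n k‖ ^ s k := by gcongr
        _ = _ := by ring
    · rw [← hgn, sq]
      gcongr
  refine ⟨norm_le_glueRate hs g1, ?_, fun k => ?_⟩
  · refine (pi_norm_le_iff_of_nonneg (by have := glueRate_nonneg s (lam n); positivity)).2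
      fun k => ?_
    have h3 : ‖μ n k‖ ≤ ‖μ n k‖ ^ (1 / 5 : ℝ) := by
      have h4 : ‖μ n k‖ ^ (1 / 5 : ℝ) ≤ 1 := (hk k).2.1.trans g2.le
      rcases le_or_gt ‖μ n k‖ 1 with h5 | h5
      · calc ‖μ n k‖ = ‖μ n k‖ ^ (1 : ℝ) := (Real.rpow_one _).symm
          _ ≤ _ := Real.rpow_le_rpow_of_exponent_ge (norm_pos_iff.2 (hk k).1) h5 (by norm_num)
      · exact absurd h4 (not_le.2 (Real.one_lt_rpow h5 (by norm_num)))
    exact h3.trans (hk k).2.1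
  · refine ⟨(hk k).1, (hk k).2.1, (hk k).2.2.trans ?_⟩
    gcongr

theorem ApproxSeq.tendsto_μ (H : ApproxSeq A D s β x θ₀ u lam θ a μ F) (hs : ∀ k, 1 ≤ s k) :
    Tendsto μ atTop (𝓝 0) := by
  obtain ⟨C, -, h⟩ := H.gluing_bounds hs
  have := (tendsto_glueRate hs H.tendsto_lam).const_mul C
  rw [mul_zero] at this
  exact squeeze_zero_norm' (h.mono fun n hn => hn.2.1) this

/-- The pointwise estimates near a node, for a sequence of approximate maps. -/
theorem ApproxSeq.node_bound (H : ApproxSeq A D s β x θ₀ u lam θ a μ F) (hs : ∀ k, 1 ≤ s k)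
    (hβ : IsCutoff β) (Nm : NormalSplitting T) (i : Fin 2) (k : Fin ℓ) :
    ∃ K r : ℝ, 0 ≤ K ∧ 0 < r ∧ r ≤ 1 ∧ ∀ᶠ n in atTop, ∀ z : ℂ, ‖z‖ < r →
      Real.sqrt ‖μ n k‖ ≤ ‖z‖ →
      ptNorm A D (u n).1 ((D.coord i k).symm z) (F n ((D.coord i k).symm z))
        (dbarSub A D (u n).1 (μ n) (F n) ((D.coord i k).symm z)) ≤
        ENNReal.ofReal (K * glueRate s (lam n) * ‖z‖ ^ (1 / 5 : ℝ)) ∧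
      ptNorm A D (u n).1 ((D.coord i k).symm z) (F n ((D.coord i k).symm z))
        ((Nm.proj (F n ((D.coord i k).symm z))).comp
          (dbarSub A D (u n).1 (μ n) (F n) ((D.coord i k).symm z))) ≤
        ENNReal.ofReal (K * glueRate s (lam n) * ‖z‖ ^ (1 / 5 : ℝ) * ‖z‖ ^ (s k - 1)) := by
  obtain ⟨C₁, hC₁, h1⟩ := H.gluing_bounds hs
  obtain ⟨C₂, ε, r, hC₂, hε, hεT, hr, hr1, h2⟩ := exists_nodeData Nm hs H.tendsto H.mem H.lim_mem
    (k := k) (H.tendsto_θ k) (a := fun n i => a n i k) (fun n i => (H.approx n).contact i k)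
  obtain ⟨C₃, h3⟩ := hβ.exists_neckCutoff_bound
  set C := max (max C₁ C₂) C₃ with hC
  have l1 : C₁ ≤ C := (le_max_left _ _).trans (le_max_left _ _)
  have l2 : C₂ ≤ C := (le_max_right _ _).trans (le_max_left _ _)
  have l3 : C₃ ≤ C := le_max_right _ _
  have hC1 := hC₁.trans l1
  obtain ⟨K, r₁, hK, hr₁, hr₁', -, hest⟩ := exists_node_ptNorm_bound (A := A) (D := D) (Nm := Nm)
    hC1 hε hεT hr hs k hβ
    fun μ z hμ hz hμz => ⟨(h3 μ z hμ hz hμz).1, (h3 μ z hμ hz hμz).2.trans l3⟩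
  refine ⟨K, r₁, hK, hr₁, hr₁', ?_⟩
  have hμr : ∀ᶠ n in atTop, ‖μ n‖ < r := by
    have : Tendsto (fun n => ‖μ n‖) atTop (𝓝 0) := by simpa using (H.tendsto_μ hs).norm
    exact this.eventually_lt_const hr
  filter_upwards [h1, h2, hμr] with n g1 g2 g3 z hz hμz
  obtain ⟨-, m2, m3⟩ := g1
  obtain ⟨m4, m5, m6⟩ := m3 k
  have hκ := glueRate_nonneg s (lam n)
  exact hest _ i _ _ _ _ _ _ _ _ z ((g2 i).mono l2) (H.approx n) g3 m4
    (m2.trans (by gcongr)) (m5.trans (by gcongr)) (m6.trans (by gcongr)) hκ hz hμz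

end ApproxSeq

/-- A bound for the difference of the expressions `∂̄F - ν` of two maps that are close. -/
theorem norm_coordDbar_le_of_close {E : Type*} [NormedAddCommGroup E] [NormedSpace ℝ E]
    {EP : Type*} [NormedAddCommGroup EP] [NormedSpace ℝ EP]
    {J : E → E →L[ℝ] E} {ν : E → EP → EP →L[ℝ] E} {j : ℂ →L[ℝ] ℂ} {F f : ℂ → E} {φ φ₀ : ℂ → EP}
    {z : ℂ} {C κ : ℝ} (hC : 1 ≤ C) (hκ : 0 ≤ κ) (hJ : ‖J (f z)‖ ≤ C)
    (hJJ : ‖J (F z) - J (f z)‖ ≤ C * κ) (hν : ‖ν (f z) (φ₀ z)‖ ≤ C)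
    (hνν : ‖ν (F z) (φ z) - ν (f z) (φ₀ z)‖ ≤ C * κ) (hj : ∀ ζ, ‖j ζ‖ ≤ C * ‖ζ‖)
    (hF : ∀ ζ, ‖fderiv ℝ F z ζ‖ ≤ C * ‖ζ‖)
    (hFf : ∀ ζ, ‖fderiv ℝ F z ζ - fderiv ℝ f z ζ‖ ≤ C * κ * ‖ζ‖)
    (hφ : ∀ ζ, ‖fderiv ℝ φ z ζ‖ ≤ C * ‖ζ‖)
    (hφφ : ∀ ζ, ‖fderiv ℝ φ z ζ - fderiv ℝ φ₀ z ζ‖ ≤ C * κ * ‖ζ‖)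
    (h0 : coordDbar J ν j f φ₀ z = 0) (ζ : ℂ) :
    ‖coordDbar J ν j F φ z ζ‖ ≤ 4 * C ^ 3 * κ * ‖ζ‖ := by
  have hC0 : 0 ≤ C := by linarith
  have h1 := congrArg (fun L : ℂ →L[ℝ] E => L ζ) h0
  simp only [coordDbar_apply, zero_apply] at h1
  have e : coordDbar J ν j F φ z ζ = (1 / 2 : ℝ) • ((fderiv ℝ F z ζ - fderiv ℝ f z ζ) +
      ((J (F z) - J (f z)) (fderiv ℝ F z (j ζ)) +
        J (f z) (fderiv ℝ F z (j ζ) - fderiv ℝ f z (j ζ)))) -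
      ((ν (F z) (φ z) - ν (f z) (φ₀ z)) (fderiv ℝ φ z ζ) +
        ν (f z) (φ₀ z) (fderiv ℝ φ z ζ - fderiv ℝ φ₀ z ζ)) := by
    rw [coordDbar_apply, ← sub_zero ((1 / 2 : ℝ) • _ - _), ← h1]
    simp only [sub_apply, map_sub, smul_add, smul_sub]
    abel
  have hζ := norm_nonneg ζ
  have b1 : ‖(J (F z) - J (f z)) (fderiv ℝ F z (j ζ))‖ ≤ C ^ 3 * κ * ‖ζ‖ := by
    refine (ContinuousLinearMap.le_opNorm _ _).trans ?_
    calc _ ≤ (C * κ) * (C * (C * ‖ζ‖)) := by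
          gcongr
          exact (hF _).trans (by gcongr; exact hj ζ)
      _ = _ := by ring
  have b2 : ‖J (f z) (fderiv ℝ F z (j ζ) - fderiv ℝ f z (j ζ))‖ ≤ C ^ 3 * κ * ‖ζ‖ := by
    refine (ContinuousLinearMap.le_opNorm _ _).trans ?_
    calc _ ≤ C * (C * κ * (C * ‖ζ‖)) := by
          gcongr
          exact (hFf _).trans (by gcongr; exact hj ζ)
      _ = _ := by ring
  have b3 : ‖(ν (F z) (φ z) - ν (f z) (φ₀ z)) (fderiv ℝ φ z ζ)‖ ≤ C ^ 2 * κ * ‖ζ‖ := by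
    refine (ContinuousLinearMap.le_opNorm _ _).trans ?_
    calc _ ≤ (C * κ) * (C * ‖ζ‖) := by gcongr; exact hφ ζ
      _ = _ := by ring
  have b4 : ‖ν (f z) (φ₀ z) (fderiv ℝ φ z ζ - fderiv ℝ φ₀ z ζ)‖ ≤ C ^ 2 * κ * ‖ζ‖ := by
    refine (ContinuousLinearMap.le_opNorm _ _).trans ?_
    calc _ ≤ C * (C * κ * ‖ζ‖) := by gcongr; exact hφφ ζ
      _ = _ := by ring
  have c1 : C * κ * ‖ζ‖ ≤ C ^ 3 * κ * ‖ζ‖ := by gcongr; exact le_self_pow₀ hC (by norm_num)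
  have c2 : C ^ 2 * κ * ‖ζ‖ ≤ C ^ 3 * κ * ‖ζ‖ := by gcongr 1; gcongr 1; exact pow_le_pow_right₀ hC (by norm_num)
  rw [e]
  refine (norm_sub_le _ _).trans ?_
  have d1 := norm_half_smul_le (a := 3 / 2 * (C ^ 3 * κ * ‖ζ‖)) (b := 2 * (C ^ 3 * κ * ‖ζ‖))
    ((norm_add_le (fderiv ℝ F z ζ - fderiv ℝ f z ζ) ((J (F z) - J (f z)) (fderiv ℝ F z (j ζ)) +
        J (f z) (fderiv ℝ F z (j ζ) - fderiv ℝ f z (j ζ)))).trans (by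
      have := norm_add_le ((J (F z) - J (f z)) (fderiv ℝ F z (j ζ)))
        (J (f z) (fderiv ℝ F z (j ζ) - fderiv ℝ f z (j ζ)))
      linarith [hFf ζ])) (by
      have : 0 ≤ C ^ 3 * κ * ‖ζ‖ := by positivity
      linarith)
  have d2 := norm_add_le ((ν (F z) (φ z) - ν (f z) (φ₀ z)) (fderiv ℝ φ z ζ))
    (ν (f z) (φ₀ z) (fderiv ℝ φ z ζ - fderiv ℝ φ₀ z ζ))
  linarith

section RegularPoints

variable {EP : Type*} [NormedAddCommGroup EP] [NormedSpace ℝ EP] [FiniteDimensional ℝ EP]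
  {P : Type*} [TopologicalSpace P] [ChartedSpace EP P] [IsManifold 𝓘(ℝ, EP) ∞ P]
  {EN : Type*} [NormedAddCommGroup EN] [NormedSpace ℝ EN] [FiniteDimensional ℝ EN]
  {N : Type*} [TopologicalSpace N] [ChartedSpace EN N] [IsManifold 𝓘(ℝ, EN) ∞ N]
  {S : Type*} [TopologicalSpace S] [T2Space S] [ChartedSpace ℂ S] [IsManifold 𝓘(ℝ, ℂ) ∞ S]
  {jP : ∀ q : P, TangentSpace 𝓘(ℝ, EP) q →L[ℝ] TangentSpace 𝓘(ℝ, EP) q}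
  {ℓ : ℕ} (D : CurveFamily S EN N jP ℓ)

theorem CurveFamily.isClosed_disc (i : Fin 2) (k : Fin ℓ) {c : ℝ} (hc : c < 2) :
    IsClosed ((D.coord i k).symm '' Metric.closedBall 0 c) := by
  refine ((isCompact_closedBall (0 : ℂ) c).image_of_continuousOn ?_).isClosed
  refine (D.coord i k).continuousOn_symm.mono ?_
  rw [D.coord_target]
  exact Metric.closedBall_subset_ball hc

theorem CurveFamily.φ_contMDiffAt (b₀ : N) {p₀ : S} (hp : ∀ i k, p₀ ≠ D.pt i k) :
    ContMDiffAt (𝓘(ℝ, EN).prod (𝓘(ℝ, Fin ℓ → ℂ).prod 𝓘(ℝ, ℂ))) 𝓘(ℝ, EP) ∞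
      (fun r : N × ((Fin ℓ → ℂ) × S) => D.φ r.1 r.2.1 r.2.2) (b₀, (0, p₀)) := by
  have hmu : ∀ᶠ r in 𝓝 ((b₀, (0, p₀)) : N × ((Fin ℓ → ℂ) × S)), ∀ k, ‖r.2.1 k‖ < 1 := by
    refine eventually_all.2 fun k => ?_
    have : ContinuousAt (fun r : N × ((Fin ℓ → ℂ) × S) => ‖r.2.1 k‖) (b₀, (0, p₀)) := by fun_prop
    exact this.eventually_lt_const (by simp)
  by_cases h : ∃ i k, p₀ ∈ (D.coord i k).source
  · obtain ⟨i, k, hs⟩ := h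
    obtain ⟨z₀, hz₀⟩ : ∃ z₀, D.coord i k p₀ = z₀ := ⟨_, rfl⟩
    have hz0 : z₀ ≠ 0 := by
      rintro rfl
      refine hp i k ?_
      unfold CurveFamily.pt
      rw [← hz₀, (D.coord i k).left_inv hs]
    have hz2 : ‖z₀‖ < 2 := by
      have := (D.coord i k).map_source hs
      rwa [D.coord_target, mem_ball_zero_iff, hz₀] at this
    have h1 := D.φside_contMDiffAt i k (b := b₀) (μ := 0) (z := z₀) (w := 0) (by simp) hz2 (by simp)
    have hco : ContMDiffAt (𝓘(ℝ, EN).prod (𝓘(ℝ, Fin ℓ → ℂ).prod 𝓘(ℝ, ℂ))) 𝓘(ℝ, ℂ) ∞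
        (fun r : N × ((Fin ℓ → ℂ) × S) => D.coord i k r.2.2) (b₀, (0, p₀)) := by
      have : ContMDiffAt 𝓘(ℝ, ℂ) 𝓘(ℝ, ℂ) ∞ (D.coord i k) p₀ :=
        contMDiffAt_of_mem_maximalAtlas (D.coord_smooth i k) hs
      exact ContMDiffAt.comp_of_eq (g := D.coord i k) (y := p₀) this
        (contMDiffAt_snd.comp _ contMDiffAt_snd) rfl
    have hm : ContMDiffAt (𝓘(ℝ, EN).prod (𝓘(ℝ, Fin ℓ → ℂ).prod 𝓘(ℝ, ℂ))) 𝓘(ℝ, Fin ℓ → ℂ) ∞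
        (fun r : N × ((Fin ℓ → ℂ) × S) => r.2.1) (b₀, (0, p₀)) :=
      contMDiffAt_fst.comp _ contMDiffAt_snd
    have hdiv : ContMDiffAt 𝓘(ℝ, (Fin ℓ → ℂ) × ℂ) 𝓘(ℝ, (Fin ℓ → ℂ) × ℂ × ℂ) ∞
        (fun r : (Fin ℓ → ℂ) × ℂ => (r.1, r.2, r.1 k / r.2)) (0, z₀) := by
      refine ContDiffAt.contMDiffAt ?_
      refine contDiffAt_fst.prodMk (contDiffAt_snd.prodMk ?_)
      have e1 : ContDiffAt ℝ ∞ (fun r : (Fin ℓ → ℂ) × ℂ => r.1 k) (0, z₀) := by fun_prop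
      have e2 : ContDiffAt ℝ ∞ (fun r : (Fin ℓ → ℂ) × ℂ => r.2) (0, z₀) := by fun_prop
      simp only [div_eq_mul_inv]
      exact e1.mul (e2.inv hz0)
    have h2 := ContMDiffAt.comp_of_eq hdiv (hm.prodMk_space hco) (by simp only [hz₀])
    have h3 := ContMDiffAt.comp_of_eq h1 (contMDiffAt_fst.prodMk h2)
      (by simp [hz₀])
    refine h3.congr_of_eventuallyEq ?_
    have e1 : ∀ᶠ r in 𝓝 ((b₀, (0, p₀)) : N × ((Fin ℓ → ℂ) × S)), r.2.2 ∈ (D.coord i k).source := by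
      have : ContinuousAt (fun r : N × ((Fin ℓ → ℂ) × S) => r.2.2) (b₀, (0, p₀)) := by fun_prop
      exact this.eventually ((D.coord i k).open_source.mem_nhds hs)
    have e2 : ∀ᶠ r in 𝓝 ((b₀, (0, p₀)) : N × ((Fin ℓ → ℂ) × S)),
        ‖r.2.1 k‖ < 2 * ‖D.coord i k r.2.2‖ := by
      have c1 : ContinuousAt (fun r : N × ((Fin ℓ → ℂ) × S) => ‖r.2.1 k‖) (b₀, (0, p₀)) := by
        fun_prop
      have c2 := (hco.continuousAt.norm).const_mul 2
      refine c1.eventually_lt c2 ?_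
      simp only [hz₀, Pi.zero_apply, norm_zero]
      have := norm_pos_iff.2 hz0
      positivity
    filter_upwards [hmu, e1, e2] with r r1 r2 r3
    exact D.φ_eq_φside i k r.1 r1 r2 (Or.inr r3)
  · push Not at h
    refine D.φ_smooth.contMDiffAt ?_
    have h1 : ∀ᶠ r in 𝓝 ((b₀, (0, p₀)) : N × ((Fin ℓ → ℂ) × S)), ∀ i k,
        r.2.2 ∉ (D.coord i k).symm '' Metric.closedBall 0 1 := by
      refine eventually_all.2 fun i => eventually_all.2 fun k => ?_
      have : ContinuousAt (fun r : N × ((Fin ℓ → ℂ) × S) => r.2.2) (b₀, (0, p₀)) := by fun_prop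
      refine this.eventually ((D.isClosed_disc i k one_lt_two).isOpen_compl.mem_nhds ?_)
      rintro ⟨z, hz, hzp⟩
      refine h i k ?_
      have hzp' : (D.coord i k).symm z = p₀ := hzp
      rw [← hzp']
      refine (D.coord i k).map_target ?_
      rw [D.coord_target]
      exact Metric.closedBall_subset_ball one_lt_two hz
    exact hmu.and h1

/-- Uniform estimates for `φ` near a point that is not a node. -/
theorem CurveFamily.exists_φ_bound (b₀ : N) {p₀ : S} (hp : ∀ i k, p₀ ≠ D.pt i k) {ε : ℝ}
    (hε : 0 < ε) :
    ∃ C r : ℝ, 1 ≤ C ∧ 0 < r ∧ ∀ᶠ b in 𝓝 b₀, ∀ μ : Fin ℓ → ℂ, ‖μ‖ < r →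
      ∀ z ∈ Metric.ball (chartAt ℂ p₀ p₀) r,
      let q₀ := D.φ b₀ 0 p₀
      let ψ := fun (μ : Fin ℓ → ℂ) (z : ℂ) => chartAt EP q₀ (D.φ b μ ((chartAt ℂ p₀).symm z))
      ψ μ z ∈ Metric.ball (chartAt EP q₀ q₀) ε ∧
      DifferentiableAt ℝ (ψ μ) z ∧
      (∀ ζ, ‖fderiv ℝ (ψ μ) z ζ‖ ≤ C * ‖ζ‖) ∧
      ‖ψ μ z - ψ 0 z‖ ≤ C * ‖μ‖ ∧
      (∀ ζ, ‖fderiv ℝ (ψ μ) z ζ - fderiv ℝ (ψ 0) z ζ‖ ≤ C * ‖μ‖ * ‖ζ‖) ∧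
      ∀ᶠ x in 𝓝 z, D.φ b μ ((chartAt ℂ p₀).symm x) = (chartAt EP q₀).symm (ψ μ x) := by
  obtain ⟨q₀, hq₀⟩ : ∃ q₀, q₀ = D.φ b₀ 0 p₀ := ⟨_, rfl⟩
  obtain ⟨z₀, hz₀⟩ : ∃ z₀, chartAt ℂ p₀ p₀ = z₀ := ⟨_, rfl⟩
  rw [hz₀]
  have hpz : (chartAt ℂ p₀).symm z₀ = p₀ := by
    rw [← hz₀, (chartAt ℂ p₀).left_inv (mem_chart_source ℂ p₀)]
  set G : N × ((Fin ℓ → ℂ) × ℂ) → P := fun r => D.φ r.1 r.2.1 ((chartAt ℂ p₀).symm r.2.2) with hG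
  set Q : N × ((Fin ℓ → ℂ) × ℂ) → EP := fun r => chartAt EP q₀ (G r) with hQdef
  have hGs : ContMDiffAt (𝓘(ℝ, EN).prod 𝓘(ℝ, (Fin ℓ → ℂ) × ℂ)) 𝓘(ℝ, EP) ∞ G (b₀, (0, z₀)) := by
    have h1 : ContMDiffAt 𝓘(ℝ, ℂ) 𝓘(ℝ, ℂ) ∞ (chartAt ℂ p₀).symm z₀ :=
      (contMDiffOn_chart_symm (I := 𝓘(ℝ, ℂ)) (n := ∞) (x := p₀)).contMDiffAt
        ((chartAt ℂ p₀).open_target.mem_nhds (by rw [← hz₀]; exact mem_chart_target ℂ p₀))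
    have f1 : ContMDiffAt (𝓘(ℝ, EN).prod 𝓘(ℝ, (Fin ℓ → ℂ) × ℂ)) 𝓘(ℝ, Fin ℓ → ℂ) ∞
        (fun r : N × ((Fin ℓ → ℂ) × ℂ) => r.2.1) (b₀, (0, z₀)) := by
      have : ContMDiff 𝓘(ℝ, (Fin ℓ → ℂ) × ℂ) 𝓘(ℝ, Fin ℓ → ℂ) ∞
        (fun r : (Fin ℓ → ℂ) × ℂ => r.1) := contDiff_fst.contMDiff
      exact this.contMDiffAt.comp _ contMDiffAt_snd
    have f2 : ContMDiffAt (𝓘(ℝ, EN).prod 𝓘(ℝ, (Fin ℓ → ℂ) × ℂ)) 𝓘(ℝ, ℂ) ∞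
        (fun r : N × ((Fin ℓ → ℂ) × ℂ) => r.2.2) (b₀, (0, z₀)) := by
      have : ContMDiff 𝓘(ℝ, (Fin ℓ → ℂ) × ℂ) 𝓘(ℝ, ℂ) ∞
        (fun r : (Fin ℓ → ℂ) × ℂ => r.2) := contDiff_snd.contMDiff
      exact this.contMDiffAt.comp _ contMDiffAt_snd
    have f3 := ContMDiffAt.comp_of_eq h1 f2 rfl
    exact ContMDiffAt.comp_of_eq (D.φ_contMDiffAt b₀ hp)
      (contMDiffAt_fst.prodMk (f1.prodMk f3)) (by simp [hpz])
  have hG0 : G (b₀, (0, z₀)) = q₀ := by simp only [hG, hpz, hq₀]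
  have hQ : ContMDiffAt (𝓘(ℝ, EN).prod 𝓘(ℝ, (Fin ℓ → ℂ) × ℂ)) 𝓘(ℝ, EP) 2 Q (b₀, (0, z₀)) := by
    have h1 : ContMDiffAt 𝓘(ℝ, EP) 𝓘(ℝ, EP) ∞ (chartAt EP q₀) q₀ :=
      contMDiffAt_of_mem_maximalAtlas (IsManifold.chart_mem_maximalAtlas q₀) (mem_chart_source EP q₀)
    exact (ContMDiffAt.comp_of_eq h1 hGs hG0).of_le two_le_infty
  obtain ⟨C, hC, ε₁, hε₁, h1⟩ := exists_slice_fderiv_bound hQ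
  have hsrc : ∀ᶠ r in 𝓝 ((b₀, ((0 : Fin ℓ → ℂ), z₀))),
      G r ∈ (chartAt EP q₀).source ∧ Q r ∈ Metric.ball (chartAt EP q₀ q₀) ε := by
    refine (hGs.continuousAt.eventually ((chartAt EP q₀).open_source.mem_nhds ?_)).and
      (hQ.continuousAt.eventually (Metric.isOpen_ball.mem_nhds ?_))
    · rw [hG0]; exact mem_chart_source EP q₀
    · simp only [hQdef, hG0]
      exact Metric.mem_ball_self hε
  obtain ⟨ε₂, hε₂, h2⟩ := eventually_forall_ball
    (p := fun b x => G (b, x) ∈ (chartAt EP q₀).source ∧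
      Q (b, x) ∈ Metric.ball (chartAt EP q₀ q₀) ε) hsrc
  refine ⟨C + 1, min ε₁ ε₂, by linarith, by positivity, ?_⟩
  filter_upwards [h1, h2] with b g1 g2 μ hμ z hz
  rw [← hq₀]
  have mem : ∀ ν : Fin ℓ → ℂ, ‖ν‖ ≤ ‖μ‖ → ∀ x ∈ Metric.ball z₀ (min ε₁ ε₂),
      (ν, x) ∈ Metric.ball ((0 : Fin ℓ → ℂ), z₀) (min ε₁ ε₂) := by
    intro ν hν x hx
    rw [← ball_prod_same]
    exact ⟨by rw [mem_ball_zero_iff]; exact hν.trans_lt hμ, hx⟩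
  have hr1 := Metric.ball_subset_ball (x := ((0 : Fin ℓ → ℂ), z₀)) (min_le_left ε₁ ε₂)
  have hr2 := Metric.ball_subset_ball (x := ((0 : Fin ℓ → ℂ), z₀)) (min_le_right ε₁ ε₂)
  have hder : ∀ ν : Fin ℓ → ℂ, ‖ν‖ ≤ ‖μ‖ → HasFDerivAt (fun z => Q (b, (ν, z)))
      ((fderiv ℝ (fun x => Q (b, x)) (ν, z)).comp (ContinuousLinearMap.inr ℝ (Fin ℓ → ℂ) ℂ)) z := by
    intro ν hν
    have h3 := ((g1 _ (hr1 (mem ν hν z hz))).1.differentiableAt (by norm_num)).hasFDerivAt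
    exact h3.comp z (hasFDerivAt_prodMk_right ν z)
  have m1 := mem μ le_rfl z hz
  have m0 := mem 0 (by simp) z hz
  have d1 := hder μ le_rfl
  have d0 := hder 0 (by simp)
  obtain ⟨-, b1, b2⟩ := g1 _ (hr1 m1)
  have hsub : ‖((μ, z) : (Fin ℓ → ℂ) × ℂ) - (0, z)‖ ≤ ‖μ‖ := by
    rw [Prod.mk_sub_mk, sub_zero, sub_self]
    exact max_le le_rfl (by simp)
  have hinr : ∀ ζ : ℂ, ‖((0 : Fin ℓ → ℂ), ζ)‖ ≤ ‖ζ‖ := fun ζ => max_le (by simp) le_rfl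
  refine ⟨(g2 _ (hr2 m1)).2, d1.differentiableAt, fun ζ => ?_, ?_, fun ζ => ?_, ?_⟩
  · change ‖fderiv ℝ (fun z => Q (b, (μ, z))) z ζ‖ ≤ _
    rw [d1.fderiv]
    calc _ ≤ C * ‖((0 : Fin ℓ → ℂ), ζ)‖ := ContinuousLinearMap.le_of_opNorm_le _ b1 _
      _ ≤ (C + 1) * ‖ζ‖ := by gcongr; linarith; exact hinr ζ
  · have h3 := (convex_ball ((0 : Fin ℓ → ℂ), z₀) ε₁).norm_image_sub_le_of_norm_fderiv_le
      (f := fun x => Q (b, x)) (fun y hy => (g1 y hy).1.differentiableAt (by norm_num))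
      (fun y hy => (g1 y hy).2.1) (hr1 m0) (hr1 m1)
    refine h3.trans ?_
    gcongr
    linarith
  · change ‖fderiv ℝ (fun z => Q (b, (μ, z))) z ζ - fderiv ℝ (fun z => Q (b, (0, z))) z ζ‖ ≤ _
    rw [d1.fderiv, d0.fderiv]
    have h5 := b2 _ (hr1 m0)
    calc _ = ‖(fderiv ℝ (fun x => Q (b, x)) (μ, z) - fderiv ℝ (fun x => Q (b, x)) (0, z))
          ((0 : Fin ℓ → ℂ), ζ)‖ := rfl
      _ ≤ _ := ContinuousLinearMap.le_of_opNorm_le _ h5 _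
      _ ≤ (C + 1) * ‖μ‖ * ‖ζ‖ := by
          gcongr
          · linarith
          · exact hinr ζ
  · filter_upwards [Metric.isOpen_ball.mem_nhds hz] with x hx
    exact ((chartAt EP q₀).left_inv (g2 _ (hr2 (mem μ le_rfl x hx))).1).symm

/-- The metric of the domain in the chart at `p₀`. -/
noncomputable def CurveFamily.coordMetric (p₀ : S) (b : N) (z ζ : ℂ) : ℝ :=
  D.h b ((chartAt ℂ p₀).symm z) (mfderiv 𝓘(ℝ, ℂ) 𝓘(ℝ, ℂ) (chartAt ℂ p₀).symm z ζ)
    (mfderiv 𝓘(ℝ, ℂ) 𝓘(ℝ, ℂ) (chartAt ℂ p₀).symm z ζ)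

theorem CurveFamily.coordMetric_smul (p₀ : S) (b : N) (z : ℂ) (c : ℝ) (ζ : ℂ) :
    D.coordMetric p₀ b z (c • ζ) = c ^ 2 * D.coordMetric p₀ b z ζ := by
  unfold CurveFamily.coordMetric
  set u : TangentSpace 𝓘(ℝ, ℂ) ((chartAt ℂ p₀).symm z) :=
    mfderiv 𝓘(ℝ, ℂ) 𝓘(ℝ, ℂ) (chartAt ℂ p₀).symm z ζ with hu
  have h6 : (mfderiv 𝓘(ℝ, ℂ) 𝓘(ℝ, ℂ) (chartAt ℂ p₀).symm z (c • ζ) :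
      TangentSpace 𝓘(ℝ, ℂ) ((chartAt ℂ p₀).symm z)) = c • u := map_smul _ _ _
  rw [h6, map_smul, map_smul, smul_apply, smul_eq_mul, smul_eq_mul]
  ring

theorem CurveFamily.continuousAt_coordMetric (b₀ : N) {p₀ : S} (hp : ∀ i k, p₀ ≠ D.pt i k) (ζ : ℂ) :
    ContinuousAt (fun r : (N × ℂ) × ℂ => D.coordMetric p₀ r.1.1 r.1.2 r.2)
      ((b₀, chartAt ℂ p₀ p₀), ζ) := by
  have hpz : (chartAt ℂ p₀).symm (chartAt ℂ p₀ p₀) = p₀ :=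
    (chartAt ℂ p₀).left_inv (mem_chart_source ℂ p₀)
  have h0 : ContMDiffAt 𝓘(ℝ, ℂ) 𝓘(ℝ, ℂ) 3 (chartAt ℂ p₀).symm (chartAt ℂ p₀ p₀) :=
    ((contMDiffOn_chart_symm (I := 𝓘(ℝ, ℂ)) (n := ∞) (x := p₀)).contMDiffAt
      ((chartAt ℂ p₀).open_target.mem_nhds (mem_chart_target ℂ p₀))).of_le three_le_infty
  have h1 : ContMDiffAt (𝓘(ℝ, EN).prod 𝓘(ℝ, ℂ)) 𝓘(ℝ, ℂ) 3
      (fun r : N × ℂ => (chartAt ℂ p₀).symm r.2) (b₀, chartAt ℂ p₀ p₀) :=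
    ContMDiffAt.comp_of_eq h0 contMDiffAt_snd rfl
  have h2 := (contMDiffAt_pushforward (w₀ := ζ) h1).continuousAt
  have hopen : IsOpen {r : N × TangentBundle 𝓘(ℝ, ℂ) S | ∀ i k, r.2.1 ≠ (D.coord i k).symm 0} := by
    simp only [Set.ofPred_forall]
    refine isOpen_iInter_of_finite fun i => isOpen_iInter_of_finite fun k => ?_
    exact isOpen_ne.preimage ((FiberBundle.continuous_proj ℂ (TangentSpace 𝓘(ℝ, ℂ))).comp
      continuous_snd)
  have h3 : ContinuousAt (fun r : N × TangentBundle 𝓘(ℝ, ℂ) S => D.h r.1 r.2.1 r.2.2 r.2.2)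
      (b₀, ⟨(chartAt ℂ p₀).symm (chartAt ℂ p₀ p₀),
        mfderiv 𝓘(ℝ, ℂ) 𝓘(ℝ, ℂ) (chartAt ℂ p₀).symm (chartAt ℂ p₀ p₀) ζ⟩) := by
    refine (D.h_smooth.contMDiffAt (hopen.mem_nhds ?_)).continuousAt
    intro i k
    change (chartAt ℂ p₀).symm (chartAt ℂ p₀ p₀) ≠ _
    rw [hpz]
    exact hp i k
  have h4 : ContinuousAt (fun r : N × (ℂ × ℂ) => D.coordMetric p₀ r.1 r.2.1 r.2.2)
      (b₀, (chartAt ℂ p₀ p₀, ζ)) :=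
    ContinuousAt.comp_of_eq h3 (continuousAt_fst.prodMk h2) rfl
  have h5 : ContinuousAt (fun r : (N × ℂ) × ℂ => (r.1.1, (r.1.2, r.2)))
      ((b₀, chartAt ℂ p₀ p₀), ζ) := by fun_prop
  exact ContinuousAt.comp_of_eq h4 h5 rfl

/-- Near a point that is not a node, the metrics of the domains are uniformly equivalent to the
Euclidean metric of a chart. -/
theorem CurveFamily.exists_metric_bound (b₀ : N) {p₀ : S} (hp : ∀ i k, p₀ ≠ D.pt i k) :
    ∃ B r : ℝ, 1 ≤ B ∧ 0 < r ∧ ∀ᶠ b in 𝓝 b₀, ∀ z ∈ Metric.ball (chartAt ℂ p₀ p₀) r,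
      z ∈ (chartAt ℂ p₀).target ∧ (∀ i k, (chartAt ℂ p₀).symm z ≠ D.pt i k) ∧
      ∀ ζ, D.coordMetric p₀ b z ζ ≤ B ^ 2 * ‖ζ‖ ^ 2 ∧ ‖ζ‖ ^ 2 ≤ B ^ 2 * D.coordMetric p₀ b z ζ := by
  obtain ⟨z₀, hz₀⟩ : ∃ z₀, chartAt ℂ p₀ p₀ = z₀ := ⟨_, rfl⟩
  have hpz : (chartAt ℂ p₀).symm z₀ = p₀ := by
    rw [← hz₀, (chartAt ℂ p₀).left_inv (mem_chart_source ℂ p₀)]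
  have hzt : z₀ ∈ (chartAt ℂ p₀).target := by rw [← hz₀]; exact mem_chart_target ℂ p₀
  have hc : ∀ ζ, ContinuousAt (fun r : (N × ℂ) × ℂ => D.coordMetric p₀ r.1.1 r.1.2 r.2)
      ((b₀, z₀), ζ) := fun ζ => by rw [← hz₀]; exact D.continuousAt_coordMetric b₀ hp ζ
  rw [hz₀]
  have hcs : Continuous (fun ζ => D.coordMetric p₀ b₀ z₀ ζ) :=
    continuous_iff_continuousAt.2 fun ζ =>
      ContinuousAt.comp (f := fun ζ : ℂ => ((b₀, z₀), ζ)) (hc ζ) (by fun_prop)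
  have hK := isCompact_sphere (0 : ℂ) 1
  have hne : (Metric.sphere (0 : ℂ) 1).Nonempty := ⟨1, by simp⟩
  obtain ⟨ζm, hζm, hmin⟩ := hK.exists_isMinOn hne hcs.continuousOn
  obtain ⟨ζM, hζM, hmax⟩ := hK.exists_isMaxOn hne hcs.continuousOn
  have hpos : 0 < D.coordMetric p₀ b₀ z₀ ζm := by
    refine D.h_pos b₀ _ (fun i k => by rw [hpz]; exact hp i k) _ ?_
    intro h
    have h1 := mfderiv_mfderiv_symm (e := chartAt ℂ p₀)
      (IsManifold.chart_mem_maximalAtlas (I := 𝓘(ℝ, ℂ)) (n := ∞) p₀) hzt ζm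
    have h2 : ζm = 0 := h1.symm.trans ((congrArg (fun v : ℂ =>
      (mfderiv 𝓘(ℝ, ℂ) 𝓘(ℝ, ℂ) (chartAt ℂ p₀) ((chartAt ℂ p₀).symm z₀) v : ℂ)) h).trans
        (map_zero _))
    rw [h2] at hζm
    simp at hζm
  set m := D.coordMetric p₀ b₀ z₀ ζm with hm
  set M := D.coordMetric p₀ b₀ z₀ ζM with hM
  have hev : ∀ᶠ x in 𝓝 (b₀, z₀), ∀ ζ ∈ Metric.sphere (0 : ℂ) 1,
      m / 2 < D.coordMetric p₀ x.1 x.2 ζ ∧ D.coordMetric p₀ x.1 x.2 ζ < M + 1 := by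
    refine hK.eventually_forall_of_forall_eventually fun ζ hζ => ?_
    have h1 : m ≤ D.coordMetric p₀ b₀ z₀ ζ := hmin hζ
    have h2 : D.coordMetric p₀ b₀ z₀ ζ ≤ M := hmax hζ
    exact ((hc ζ).eventually_const_lt (by simp only; linarith)).and
      ((hc ζ).eventually_lt_const (by simp only; linarith))
  have hev2 : ∀ᶠ x in 𝓝 (b₀, z₀), x.2 ∈ (chartAt ℂ p₀).target ∧
      ∀ i k, (chartAt ℂ p₀).symm x.2 ≠ D.pt i k := by
    have h1 : ∀ᶠ z in 𝓝 z₀, z ∈ (chartAt ℂ p₀).target ∧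
        ∀ i k, (chartAt ℂ p₀).symm z ≠ D.pt i k := by
      refine ((chartAt ℂ p₀).open_target.mem_nhds hzt |> Filter.Eventually.and <|
        eventually_all.2 fun i => eventually_all.2 fun k => ?_)
      exact ((chartAt ℂ p₀).continuousAt_symm hzt).eventually_ne (by rw [hpz]; exact hp i k)
    have h2 : Tendsto (fun x : N × ℂ => x.2) (𝓝 (b₀, z₀)) (𝓝 z₀) := continuousAt_snd
    exact h2.eventually h1
  obtain ⟨r, hr, h⟩ := eventually_forall_ball (p := fun b z =>
    (∀ ζ ∈ Metric.sphere (0 : ℂ) 1,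
      m / 2 < D.coordMetric p₀ b z ζ ∧ D.coordMetric p₀ b z ζ < M + 1) ∧
    (z ∈ (chartAt ℂ p₀).target ∧ ∀ i k, (chartAt ℂ p₀).symm z ≠ D.pt i k)) (hev.and hev2)
  have hM0 : 0 < M := hpos.trans_le (hmax hζm)
  set B := 1 + (M + 1) + 2 / m with hB
  have h2m : 0 < 2 / m := by positivity
  have hB1 : 1 ≤ B := by linarith
  have hBB : B ≤ B ^ 2 := by nlinarith
  refine ⟨B, r, hB1, hr, ?_⟩
  filter_upwards [h] with b hb z hz
  obtain ⟨k1, k2, k3⟩ := hb z hz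
  refine ⟨k2, k3, fun ζ => ?_⟩
  rcases eq_or_ne ζ 0 with rfl | hζ
  · have : D.coordMetric p₀ b z 0 = 0 := by
      have := D.coordMetric_smul p₀ b z 0 0
      simpa using this
    rw [this]; simp
  have hζp : 0 < ‖ζ‖ := norm_pos_iff.2 hζ
  have e : D.coordMetric p₀ b z ζ = ‖ζ‖ ^ 2 * D.coordMetric p₀ b z (‖ζ‖⁻¹ • ζ) := by
    rw [← D.coordMetric_smul, smul_smul, mul_inv_cancel₀ hζp.ne', one_smul]
  obtain ⟨l1, l2⟩ := k1 (‖ζ‖⁻¹ • ζ) (by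
    rw [mem_sphere_zero_iff_norm, norm_smul, norm_inv, norm_norm, inv_mul_cancel₀ hζp.ne'])
  rw [e]
  constructor
  · rw [mul_comm]
    gcongr
    linarith
  · have : 1 ≤ B ^ 2 * D.coordMetric p₀ b z (‖ζ‖⁻¹ • ζ) := by
      calc (1 : ℝ) = 2 / m * (m / 2) := by field_simp
        _ ≤ B ^ 2 * D.coordMetric p₀ b z (‖ζ‖⁻¹ • ζ) := by
          gcongr
          linarith
    calc ‖ζ‖ ^ 2 = ‖ζ‖ ^ 2 * 1 := (mul_one _).symm
      _ ≤ ‖ζ‖ ^ 2 * (B ^ 2 * D.coordMetric p₀ b z (‖ζ‖⁻¹ • ζ)) := by gcongr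
      _ = _ := by ring

/-- The complex structure of the domain is bounded in a chart, since it is an isometry. -/
theorem CurveFamily.norm_coordJ_le {b : N} {p₀ : S} {z : ℂ} (hz : z ∈ (chartAt ℂ p₀).target)
    (hzn : ∀ i k, (chartAt ℂ p₀).symm z ≠ D.pt i k) {B : ℝ}
    (hB : ∀ ζ, D.coordMetric p₀ b z ζ ≤ B ^ 2 * ‖ζ‖ ^ 2 ∧
      ‖ζ‖ ^ 2 ≤ B ^ 2 * D.coordMetric p₀ b z ζ) (ζ : ℂ) :
    ‖coordJ (D.j b) (chartAt ℂ p₀) z ζ‖ ≤ B ^ 2 * ‖ζ‖ := by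
  set u : TangentSpace 𝓘(ℝ, ℂ) ((chartAt ℂ p₀).symm z) :=
    mfderiv 𝓘(ℝ, ℂ) 𝓘(ℝ, ℂ) (chartAt ℂ p₀).symm z ζ with hu
  have h1 : (mfderiv 𝓘(ℝ, ℂ) 𝓘(ℝ, ℂ) (chartAt ℂ p₀).symm z
      (coordJ (D.j b) (chartAt ℂ p₀) z ζ) : TangentSpace 𝓘(ℝ, ℂ) ((chartAt ℂ p₀).symm z)) =
      D.j b _ u :=
    mfderiv_symm_mfderiv (e := chartAt ℂ p₀)
      (IsManifold.chart_mem_maximalAtlas (I := 𝓘(ℝ, ℂ)) (n := ∞) p₀) hz (D.j b _ u)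
  have h2 : D.coordMetric p₀ b z (coordJ (D.j b) (chartAt ℂ p₀) z ζ) = D.coordMetric p₀ b z ζ := by
    unfold CurveFamily.coordMetric
    rw [h1]
    exact D.h_hermitian b _ hzn u u
  have h3 := (hB (coordJ (D.j b) (chartAt ℂ p₀) z ζ)).2
  rw [h2] at h3
  refine le_of_sq_le_sq ?_ (by positivity)
  calc _ ≤ B ^ 2 * D.coordMetric p₀ b z ζ := h3
    _ ≤ B ^ 2 * (B ^ 2 * ‖ζ‖ ^ 2) := by gcongr; exact (hB ζ).1
    _ = _ := by ring

end RegularPoints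

section Lift

variable {EZ : Type*} [NormedAddCommGroup EZ] [NormedSpace ℝ EZ] [FiniteDimensional ℝ EZ]
  {Z : Type*} [TopologicalSpace Z] [ChartedSpace EZ Z] [IsManifold 𝓘(ℝ, EZ) ∞ Z]
  {W : Type*} [NormedAddCommGroup W] [NormedSpace ℝ W]
  {EΘ : Type*} [NormedAddCommGroup EΘ] [NormedSpace ℝ EΘ]
  {Θ : Type*} [TopologicalSpace Θ] [ChartedSpace EΘ Θ]
  (T : SumFibration EZ Z W EΘ Θ)

/-- The identification of the central fibre with nearby fibres, in the chart at `w₀`. -/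
noncomputable def SumFibration.coordLift (i : Fin 2) (w₀ : Z) (lam : ℂ) (y : EZ) : EZ :=
  chartAt EZ w₀ (T.lift i lam ((chartAt EZ w₀).symm y))

theorem SumFibration.exists_lift_bound {i : Fin 2} {w₀ : Z}
    (hw : w₀ ∈ T.comp i \ (T.comp 0 ∩ T.comp 1)) :
    ∃ C r : ℝ, 1 ≤ C ∧ 0 < r ∧ ∀ lam : ℂ, ‖lam‖ < r → ∀ y ∈ Metric.ball (chartAt EZ w₀ w₀) r,
      T.lift i lam ((chartAt EZ w₀).symm y) ∈ (chartAt EZ w₀).source ∧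
      DifferentiableAt ℝ (T.coordLift i w₀ lam) y ∧ ‖fderiv ℝ (T.coordLift i w₀ lam) y‖ ≤ C ∧
      ‖T.coordLift i w₀ lam y - T.coordLift i w₀ 0 y‖ ≤ C * ‖lam‖ ∧
      ‖fderiv ℝ (T.coordLift i w₀ lam) y - fderiv ℝ (T.coordLift i w₀ 0) y‖ ≤ C * ‖lam‖ := by
  obtain ⟨y₀, hy₀⟩ : ∃ y₀, chartAt EZ w₀ w₀ = y₀ := ⟨_, rfl⟩
  have hyw : (chartAt EZ w₀).symm y₀ = w₀ := by
    rw [← hy₀, (chartAt EZ w₀).left_inv (mem_chart_source EZ w₀)]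
  rw [hy₀]
  set G : ℝ × (ℂ × EZ) → Z := fun r => T.lift i r.2.1 ((chartAt EZ w₀).symm r.2.2) with hG
  set Q : ℝ × (ℂ × EZ) → EZ := fun r => T.coordLift i w₀ r.2.1 r.2.2 with hQdef
  have hGs : ContMDiffAt (𝓘(ℝ, ℝ).prod 𝓘(ℝ, ℂ × EZ)) 𝓘(ℝ, EZ) ∞ G (0, (0, y₀)) := by
    have h1 : ContMDiffAt 𝓘(ℝ, EZ) 𝓘(ℝ, EZ) ∞ (chartAt EZ w₀).symm y₀ :=
      (contMDiffOn_chart_symm (I := 𝓘(ℝ, EZ)) (n := ∞) (x := w₀)).contMDiffAt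
        ((chartAt EZ w₀).open_target.mem_nhds (by rw [← hy₀]; exact mem_chart_target EZ w₀))
    have f1 : ContMDiffAt (𝓘(ℝ, ℝ).prod 𝓘(ℝ, ℂ × EZ)) 𝓘(ℝ, ℂ) ∞
        (fun r : ℝ × (ℂ × EZ) => r.2.1) (0, (0, y₀)) := by
      have : ContMDiff 𝓘(ℝ, ℂ × EZ) 𝓘(ℝ, ℂ) ∞ (fun r : ℂ × EZ => r.1) := contDiff_fst.contMDiff
      exact this.contMDiffAt.comp _ contMDiffAt_snd
    have f2 : ContMDiffAt (𝓘(ℝ, ℝ).prod 𝓘(ℝ, ℂ × EZ)) 𝓘(ℝ, EZ) ∞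
        (fun r : ℝ × (ℂ × EZ) => r.2.2) (0, (0, y₀)) := by
      have : ContMDiff 𝓘(ℝ, ℂ × EZ) 𝓘(ℝ, EZ) ∞ (fun r : ℂ × EZ => r.2) := contDiff_snd.contMDiff
      exact this.contMDiffAt.comp _ contMDiffAt_snd
    have f3 := ContMDiffAt.comp_of_eq h1 f2 rfl
    have f4 : ContMDiffAt (𝓘(ℝ, ℂ).prod 𝓘(ℝ, EZ)) 𝓘(ℝ, EZ) ∞
        (fun q : ℂ × Z => T.lift i q.1 q.2) (0, w₀) :=
      (T.lift_smooth i).contMDiffAt ((T.dom_open i).mem_nhds (T.dom_zero i w₀ hw))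
    exact ContMDiffAt.comp_of_eq f4 (f1.prodMk f3) (by simp [hyw])
  have hG0 : G (0, (0, y₀)) = w₀ := by simp only [hG, hyw, T.lift_zero i w₀ hw]
  have hQ : ContMDiffAt (𝓘(ℝ, ℝ).prod 𝓘(ℝ, ℂ × EZ)) 𝓘(ℝ, EZ) 2 Q (0, (0, y₀)) := by
    have h1 : ContMDiffAt 𝓘(ℝ, EZ) 𝓘(ℝ, EZ) ∞ (chartAt EZ w₀) w₀ :=
      contMDiffAt_of_mem_maximalAtlas (IsManifold.chart_mem_maximalAtlas w₀) (mem_chart_source EZ w₀)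
    exact (ContMDiffAt.comp_of_eq h1 hGs hG0).of_le two_le_infty
  obtain ⟨C, hC, ε₁, hε₁, h1⟩ := exists_slice_fderiv_bound hQ
  have g1 := h1.self_of_nhds
  have hsrc : ∀ᶠ r in 𝓝 (((0 : ℝ), ((0 : ℂ), y₀))), G r ∈ (chartAt EZ w₀).source := by
    refine hGs.continuousAt.eventually ((chartAt EZ w₀).open_source.mem_nhds ?_)
    rw [hG0]; exact mem_chart_source EZ w₀
  obtain ⟨ε₂, hε₂, h2⟩ := eventually_forall_ball
    (p := fun t x => G (t, x) ∈ (chartAt EZ w₀).source) hsrc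
  have g2 := h2.self_of_nhds
  refine ⟨C + 1, min ε₁ ε₂, by linarith, by positivity, fun lam hlam y hy => ?_⟩
  have mem : ∀ l : ℂ, ‖l‖ ≤ ‖lam‖ → (l, y) ∈ Metric.ball ((0 : ℂ), y₀) (min ε₁ ε₂) := by
    intro l hl
    rw [← ball_prod_same]
    exact ⟨by rw [mem_ball_zero_iff]; exact hl.trans_lt hlam, hy⟩
  have hr1 := Metric.ball_subset_ball (x := ((0 : ℂ), y₀)) (min_le_left ε₁ ε₂)
  have hr2 := Metric.ball_subset_ball (x := ((0 : ℂ), y₀)) (min_le_right ε₁ ε₂)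
  have hder : ∀ l : ℂ, ‖l‖ ≤ ‖lam‖ → HasFDerivAt (T.coordLift i w₀ l)
      ((fderiv ℝ (fun x => Q (0, x)) (l, y)).comp (ContinuousLinearMap.inr ℝ ℂ EZ)) y := by
    intro l hl
    have h3 := ((g1 _ (hr1 (mem l hl))).1.differentiableAt (by norm_num)).hasFDerivAt
    exact h3.comp y (hasFDerivAt_prodMk_right l y)
  have m1 := mem lam le_rfl
  have m0 := mem 0 (by simp)
  have d1 := hder lam le_rfl
  have d0 := hder 0 (by simp)
  obtain ⟨-, b1, b2⟩ := g1 _ (hr1 m1)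
  have hsub : ‖((lam, y) : ℂ × EZ) - (0, y)‖ ≤ ‖lam‖ := by
    rw [Prod.mk_sub_mk, sub_zero, sub_self]
    exact max_le le_rfl (by simp)
  have hinr : ∀ v : EZ, ‖((0 : ℂ), v)‖ ≤ ‖v‖ := fun v => max_le (by simp) le_rfl
  refine ⟨g2 _ (hr2 m1), d1.differentiableAt, ?_, ?_, ?_⟩
  · rw [d1.fderiv]
    refine ContinuousLinearMap.opNorm_le_bound _ (by linarith) fun v => ?_
    calc _ ≤ C * ‖((0 : ℂ), v)‖ := ContinuousLinearMap.le_of_opNorm_le _ b1 _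
      _ ≤ (C + 1) * ‖v‖ := by gcongr; linarith; exact hinr v
  · have h3 := (convex_ball ((0 : ℂ), y₀) ε₁).norm_image_sub_le_of_norm_fderiv_le
      (f := fun x => Q (0, x)) (fun y hy => (g1 y hy).1.differentiableAt (by norm_num))
      (fun y hy => (g1 y hy).2.1) (hr1 m0) (hr1 m1)
    refine h3.trans ?_
    gcongr
    linarith
  · rw [d1.fderiv, d0.fderiv]
    have h5 := b2 _ (hr1 m0)
    refine ContinuousLinearMap.opNorm_le_bound _ (by positivity) fun v => ?_
    calc _ = ‖(fderiv ℝ (fun x => Q (0, x)) (lam, y) - fderiv ℝ (fun x => Q (0, x)) (0, y))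
          ((0 : ℂ), v)‖ := rfl
      _ ≤ _ := ContinuousLinearMap.le_of_opNorm_le _ h5 _
      _ ≤ (C + 1) * ‖lam‖ * ‖v‖ := by
          gcongr
          · linarith
          · exact hinr v

end Lift

section RegularBound

variable {EZ : Type*} [NormedAddCommGroup EZ] [NormedSpace ℝ EZ] [FiniteDimensional ℝ EZ]
  {Z : Type*} [TopologicalSpace Z] [T2Space Z] [ChartedSpace EZ Z] [IsManifold 𝓘(ℝ, EZ) ∞ Z]
  {W : Type*} [NormedAddCommGroup W] [NormedSpace ℝ W] [FiniteDimensional ℝ W]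
  {EΘ : Type*} [NormedAddCommGroup EΘ] [NormedSpace ℝ EΘ] [FiniteDimensional ℝ EΘ]
  {Θ : Type*} [TopologicalSpace Θ] [ChartedSpace EΘ Θ] [IsManifold 𝓘(ℝ, EΘ) ∞ Θ]
  {EP : Type*} [NormedAddCommGroup EP] [NormedSpace ℝ EP] [FiniteDimensional ℝ EP]
  {P : Type*} [TopologicalSpace P] [ChartedSpace EP P] [IsManifold 𝓘(ℝ, EP) ∞ P]
  {EN : Type*} [NormedAddCommGroup EN] [NormedSpace ℝ EN] [FiniteDimensional ℝ EN]
  {N : Type*} [TopologicalSpace N] [ChartedSpace EN N] [IsManifold 𝓘(ℝ, EN) ∞ N]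
  {S : Type*} [TopologicalSpace S] [T2Space S] [ChartedSpace ℂ S] [IsManifold 𝓘(ℝ, ℂ) ∞ S]
  {ℓ : ℕ} {T : SumFibration EZ Z W EΘ Θ} {A : CompatiblePair T EP P}
  {D : CurveFamily S EN N A.jP ℓ}

/-- Bounds for the structures on the target, in the charts at `z₀` and `q₀`. -/
structure ChartBounds (A : CompatiblePair T EP P) (Nm : NormalSplitting T) (C ε : ℝ) (z₀ : Z)
    (q₀ : P) : Prop where
  J_le : ∀ y ∈ Metric.ball (chartAt EZ z₀ z₀) ε,
    ‖coordEnd A.J (chartAt EZ z₀).symm (chartAt EZ z₀) y‖ ≤ C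
  J_lip : ∀ y ∈ Metric.ball (chartAt EZ z₀ z₀) ε, ∀ y' ∈ Metric.ball (chartAt EZ z₀ z₀) ε,
    ‖coordEnd A.J (chartAt EZ z₀).symm (chartAt EZ z₀) y -
      coordEnd A.J (chartAt EZ z₀).symm (chartAt EZ z₀) y'‖ ≤ C * ‖y - y'‖
  proj_le : ∀ y ∈ Metric.ball (chartAt EZ z₀ z₀) ε,
    ‖coordEnd Nm.proj (chartAt EZ z₀).symm (chartAt EZ z₀) y‖ ≤ C
  ν_le : ∀ x ∈ Metric.ball (chartAt EZ z₀ z₀, chartAt EP q₀ q₀) ε,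
    ‖coordHom A.ν (chartAt EZ z₀).symm (chartAt EZ z₀) (chartAt EP q₀).symm x.1 x.2‖ ≤ C
  ν_lip : ∀ x ∈ Metric.ball (chartAt EZ z₀ z₀, chartAt EP q₀ q₀) ε,
    ∀ x' ∈ Metric.ball (chartAt EZ z₀ z₀, chartAt EP q₀ q₀) ε,
    ‖coordHom A.ν (chartAt EZ z₀).symm (chartAt EZ z₀) (chartAt EP q₀).symm x.1 x.2 -
      coordHom A.ν (chartAt EZ z₀).symm (chartAt EZ z₀) (chartAt EP q₀).symm x'.1 x'.2‖ ≤
      C * ‖x - x'‖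
  chart_P : ∀ q ∈ Metric.ball (chartAt EP q₀ q₀) ε,
    MDifferentiableAt 𝓘(ℝ, EP) 𝓘(ℝ, EP) (chartAt EP q₀).symm q
  metric : ∀ y ∈ Metric.ball (chartAt EZ z₀ z₀) ε, ∀ w : EZ,
      Real.sqrt (A.g ((chartAt EZ z₀).symm y) (mfderiv 𝓘(ℝ, EZ) 𝓘(ℝ, EZ) (chartAt EZ z₀).symm y w)
        (mfderiv 𝓘(ℝ, EZ) 𝓘(ℝ, EZ) (chartAt EZ z₀).symm y w)) ≤ C * ‖w‖
  chart : ∀ y ∈ Metric.ball (chartAt EZ z₀ z₀) ε,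
    MDifferentiableAt 𝓘(ℝ, EZ) 𝓘(ℝ, EZ) (chartAt EZ z₀).symm y ∧
    (∀ w : EZ, mfderiv 𝓘(ℝ, EZ) 𝓘(ℝ, EZ) (chartAt EZ z₀) ((chartAt EZ z₀).symm y)
      (mfderiv 𝓘(ℝ, EZ) 𝓘(ℝ, EZ) (chartAt EZ z₀).symm y w) = w) ∧
    (∀ u : EZ, (mfderiv 𝓘(ℝ, EZ) 𝓘(ℝ, EZ) (chartAt EZ z₀).symm y
      (mfderiv 𝓘(ℝ, EZ) 𝓘(ℝ, EZ) (chartAt EZ z₀) ((chartAt EZ z₀).symm y) u : EZ) : EZ) = u)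

theorem exists_chartBounds (A : CompatiblePair T EP P) (Nm : NormalSplitting T) (z₀ : Z) (q₀ : P) :
    ∃ C ε : ℝ, 1 ≤ C ∧ 0 < ε ∧ ChartBounds A Nm C ε z₀ q₀ := by
  have hc := isChartFamily_chartAt (EZ := EZ) z₀
  have hP : ContMDiffAt 𝓘(ℝ, EP) 𝓘(ℝ, EP) ∞ (chartAt EP q₀).symm (chartAt EP q₀ q₀) :=
    (contMDiffOn_chart_symm (I := 𝓘(ℝ, EP)) (n := ∞) (x := q₀)).contMDiffAt
      ((chartAt EP q₀).open_target.mem_nhds (mem_chart_target EP q₀))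
  obtain ⟨C₁, hC₁, ε₁, hε₁, h1⟩ := hc.exists_coordEnd_bound A.J (A.J_smooth.of_le two_le_infty)
  obtain ⟨C₂, hC₂, ε₂, hε₂, h2⟩ :=
    hc.exists_coordEnd_bound Nm.proj (Nm.proj_smooth.of_le two_le_infty)
  obtain ⟨C₃, hC₃, ε₃, hε₃, h3⟩ := hc.exists_coordHom_bound A.ν (A.ν_smooth.of_le two_le_infty)
    (chartAt EP q₀).symm (chartAt EP q₀ q₀) (hP.of_le three_le_infty)
  obtain ⟨C₄, hC₄, ε₄, hε₄, h4⟩ := hc.exists_metric_bound A.g (A.g_smooth.of_le two_le_infty)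
  obtain ⟨ε₅, hε₅, h5⟩ := hc.mfderiv_inv
  obtain ⟨ε₆, hε₆, h6⟩ := Metric.isOpen_iff.1 (chartAt EP q₀).open_target _ (mem_chart_target EP q₀)
  set ε := min (min (min ε₁ ε₂) (min ε₃ ε₄)) (min ε₅ ε₆) with hε
  have l1 : ε ≤ ε₁ := (min_le_left _ _).trans ((min_le_left _ _).trans (min_le_left _ _))
  have l2 : ε ≤ ε₂ := (min_le_left _ _).trans ((min_le_left _ _).trans (min_le_right _ _))
  have l3 : ε ≤ ε₃ := (min_le_left _ _).trans ((min_le_right _ _).trans (min_le_left _ _))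
  have l4 : ε ≤ ε₄ := (min_le_left _ _).trans ((min_le_right _ _).trans (min_le_right _ _))
  have l5 : ε ≤ ε₅ := (min_le_right _ _).trans (min_le_left _ _)
  have l6 : ε ≤ ε₆ := (min_le_right _ _).trans (min_le_right _ _)
  set C := 1 + C₁ + C₂ + C₃ + C₄ with hC
  have c1 : C₁ ≤ C := by linarith
  have c2 : C₂ ≤ C := by linarith
  have c3 : C₃ ≤ C := by linarith
  have c4 : C₄ ≤ C := by linarith
  have g1 := h1.self_of_nhds
  have g2 := h2.self_of_nhds
  have g3 := h3.self_of_nhds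
  have g4 := h4.self_of_nhds
  have g5 := h5.self_of_nhds
  refine ⟨C, ε, by linarith, by positivity, ?_, ?_, ?_, ?_, ?_, ?_, ?_, ?_⟩
  · exact fun y hy => (g1 y (Metric.ball_subset_ball l1 hy)).1.trans c1
  · exact fun y hy y' hy' => ((g1 y (Metric.ball_subset_ball l1 hy)).2 y'
      (Metric.ball_subset_ball l1 hy')).trans (by gcongr)
  · exact fun y hy => (g2 y (Metric.ball_subset_ball l2 hy)).1.trans c2
  · exact fun y hy => (g3 y (Metric.ball_subset_ball l3 hy)).1.trans c3
  · exact fun y hy y' hy' => ((g3 y (Metric.ball_subset_ball l3 hy)).2 y'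
      (Metric.ball_subset_ball l3 hy')).trans (by gcongr)
  · exact fun q hq => ((contMDiffOn_chart_symm (I := 𝓘(ℝ, EP)) (n := ∞) (x := q₀)).contMDiffAt
      ((chartAt EP q₀).open_target.mem_nhds (h6 (Metric.ball_subset_ball l6 hq)))).mdifferentiableAt
      (by simp)
  · exact fun y hy w => (g4 y (Metric.ball_subset_ball l4 hy) w).trans (by gcongr)
  · intro y hy
    obtain ⟨d1, -, -, d3, d4⟩ := g5 y (Metric.ball_subset_ball l5 hy)
    exact ⟨d1, d3, d4⟩

theorem CurveFamily.exists_coord_bound (D : CurveFamily S EN N A.jP ℓ) {p₀ : S}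
    (hp : ∀ i k, p₀ ≠ D.pt i k) :
    ∃ c > 0, ∀ᶠ p in 𝓝 p₀, ∀ i k, p ∈ (D.coord i k).source → c ≤ ‖D.coord i k p‖ := by
  have h1 : ∀ q : Fin 2 × Fin ℓ, ∃ c > 0, ∀ᶠ p in 𝓝 p₀, p ∈ (D.coord q.1 q.2).source →
      c ≤ ‖D.coord q.1 q.2 p‖ := by
    rintro ⟨i, k⟩
    by_cases h : p₀ ∈ (D.coord i k).source
    · have h0 : D.coord i k p₀ ≠ 0 := by
        intro h0
        refine hp i k ?_
        unfold CurveFamily.pt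
        rw [← h0, (D.coord i k).left_inv h]
      refine ⟨‖D.coord i k p₀‖ / 2, by positivity, ?_⟩
      have h2 := ((D.coord i k).continuousAt h).norm.eventually_const_lt
        (half_lt_self (norm_pos_iff.2 h0))
      exact h2.mono fun p hp _ => hp.le
    · refine ⟨1, one_pos, ?_⟩
      have h2 : p₀ ∉ (D.coord i k).symm '' Metric.closedBall 0 1 := by
        rintro ⟨z, hz, rfl⟩
        refine h ((D.coord i k).map_target ?_)
        rw [D.coord_target]
        exact Metric.closedBall_subset_ball (by norm_num) hz
      filter_upwards [(D.isClosed_disc i k (by norm_num)).isOpen_compl.mem_nhds h2] with p hp hs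
      by_contra hlt
      refine hp ⟨D.coord i k p, ?_, (D.coord i k).left_inv hs⟩
      rw [mem_closedBall_zero_iff]
      exact (not_le.1 hlt).le
  choose c hc h using h1
  obtain ⟨c₀, hc₀, hle⟩ : ∃ c₀ > 0, ∀ q, c₀ ≤ c q := by
    rcases isEmpty_or_nonempty (Fin 2 × Fin ℓ) with hE | hE
    · exact ⟨1, one_pos, fun q => (hE.false q).elim⟩
    · obtain ⟨q, hq⟩ := Finite.exists_min c
      exact ⟨c q, hc q, hq⟩
  refine ⟨c₀, hc₀, ?_⟩
  filter_upwards [eventually_all.2 h] with p hp i k hs using (hle (i, k)).trans (hp (i, k) hs)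

/-- A holomorphic curve solves the equation in coordinates. -/
theorem coordDbar_eq_zero {E : Type*} [NormedAddCommGroup E] [NormedSpace ℝ E]
    {e : OpenPartialHomeomorph S ℂ}
    (he : e ∈ IsManifold.maximalAtlas 𝓘(ℝ, ℂ) ∞ S) {z : ℂ} (hz : z ∈ e.target)
    {F : S → Z} {c : E → Z} {c' : Z → E} {F' : ℂ → E}
    (hF : ∀ᶠ x in 𝓝 z, F (e.symm x) = c (F' x))
    (hc : MDifferentiableAt 𝓘(ℝ, E) 𝓘(ℝ, EZ) c (F' z)) (hF' : DifferentiableAt ℝ F' z)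
    (hl : ∀ w : E, mfderiv 𝓘(ℝ, EZ) 𝓘(ℝ, E) c' (c (F' z))
      (mfderiv 𝓘(ℝ, E) 𝓘(ℝ, EZ) c (F' z) w) = w)
    (hr : ∀ u : EZ, (mfderiv 𝓘(ℝ, E) 𝓘(ℝ, EZ) c (F' z)
      (mfderiv 𝓘(ℝ, EZ) 𝓘(ℝ, E) c' (c (F' z)) u : E) : EZ) = u)
    {b : N} {μ : Fin ℓ → ℂ} {ψ : EP → P} {φ' : ℂ → EP}
    (hφ : ∀ᶠ x in 𝓝 z, D.φ b μ (e.symm x) = ψ (φ' x))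
    (hψ : MDifferentiableAt 𝓘(ℝ, EP) 𝓘(ℝ, EP) ψ (φ' z)) (hφ' : DifferentiableAt ℝ φ' z)
    (h0 : dbarSub A D b μ F (e.symm z) = 0) :
    coordDbar (coordEnd A.J c c') (coordHom A.ν c c' ψ) (coordJ (D.j b) e z) F' φ' z = 0 := by
  ext1 ζ
  have h1 := dbarSub_eq_coordDbar A D he hz hF hc hF' hr hφ hψ hφ' ζ
  have h2 : (dbarSub A D b μ F (e.symm z) (mfderiv 𝓘(ℝ, ℂ) 𝓘(ℝ, ℂ) e.symm z ζ) : EZ) = 0 := by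
    rw [h0]; rfl
  have h3 := h1.symm.trans h2
  rw [← hl (coordDbar _ _ _ _ _ _ ζ)]
  exact (congrArg (fun x : EZ => (mfderiv 𝓘(ℝ, EZ) 𝓘(ℝ, E) c' (c (F' z)) x : E)) h3).trans
    (map_zero _)

variable {s : Fin ℓ → ℕ} {β : ℝ → ℝ} {x : N × (S → Z)} {θ₀ : Fin ℓ → Θ}
    {u : ℕ → N × (S → Z)} {lam : ℕ → ℂ} {θ : ℕ → Fin ℓ → Θ} {a : ℕ → Fin 2 → Fin ℓ → ℂ}
    {μ : ℕ → Fin ℓ → ℂ} {F : ℕ → S → Z}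

theorem plumb_lt_of_lt {c m : ℝ} (hc : 0 < c) (hm : 0 ≤ m) (h : m < (c / 2) ^ (4 : ℝ)) :
    2 * m ^ (1 / 4 : ℝ) < c := by
  have h1 : m ^ (1 / 4 : ℝ) < ((c / 2) ^ (4 : ℝ)) ^ (1 / 4 : ℝ) :=
    Real.rpow_lt_rpow hm h (by norm_num)
  rw [← Real.rpow_mul (by positivity)] at h1
  norm_num at h1
  linarith

theorem CurveFamily.norm_coord_le_nodeRho {jP : ∀ q : P, TangentSpace 𝓘(ℝ, EP) q →L[ℝ] TangentSpace 𝓘(ℝ, EP) q}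
    (D : CurveFamily S EN N jP ℓ) (μ : Fin ℓ → ℂ)
    (i : Fin 2) (k : Fin ℓ) (p : S) : ‖D.coord i k p‖ ≤ D.nodeRho μ i k p :=
  Real.le_sqrt_of_sq_le (le_add_of_nonneg_right (by positivity))

/-- The approximate map near a point that is not a node. -/
theorem ApproxSeq.eventually_eq_lift (H : ApproxSeq A D s β x θ₀ u lam θ a μ F)
    (hs : ∀ k, 1 ≤ s k) {p₀ : S} (hp : ∀ i k, p₀ ≠ D.pt i k) :
    ∃ U ∈ 𝓝 p₀, ∀ᶠ n in atTop, ∀ p ∈ U,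
      F n p = T.lift (D.side p₀) (lam n) ((u n).2 p) ∧ D.side p = D.side p₀ := by
  obtain ⟨c, hc, h⟩ := D.exists_coord_bound hp
  have h2 : ∀ᶠ p in 𝓝 p₀, D.side p = D.side p₀ := (D.side_locConst.eventually_eq p₀)
  refine ⟨_, h.and h2, ?_⟩
  have hμ : ∀ᶠ n in atTop, ‖μ n‖ < (c / 2) ^ (4 : ℝ) := by
    have : Tendsto (fun n => ‖μ n‖) atTop (𝓝 0) := by simpa using (H.tendsto_μ hs).norm
    exact this.eventually_lt_const (by positivity)
  filter_upwards [hμ] with n hn p hp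
  refine ⟨?_, hp.2⟩
  rw [(H.approx n).outside p fun i k hpk => ?_, hp.2]
  refine (plumb_lt_of_lt hc (norm_nonneg _) ((norm_le_pi_norm (μ n) k).trans_lt hn)).trans_le ?_
  exact (hp.1 i k hpk).trans (D.norm_coord_le_nodeRho _ _ _ _)

set_option maxHeartbeats 800000 in
/-- The pointwise estimates near a point that is not a node. -/
theorem ApproxSeq.regular_bound (H : ApproxSeq A D s β x θ₀ u lam θ a μ F) (hs : ∀ k, 1 ≤ s k)
    (Nm : NormalSplitting T) {p₀ : S} (hp : ∀ i k, p₀ ≠ D.pt i k) :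
    ∃ K, 0 ≤ K ∧ ∃ U ∈ 𝓝 p₀, ∀ᶠ n in atTop, ∀ p ∈ U,
      ptNorm A D (u n).1 p (F n p) (dbarSub A D (u n).1 (μ n) (F n) p) ≤
        ENNReal.ofReal (K * glueRate s (lam n)) ∧
      ptNorm A D (u n).1 p (F n p)
        ((Nm.proj (F n p)).comp (dbarSub A D (u n).1 (μ n) (F n) p)) ≤
        ENNReal.ofReal (K * glueRate s (lam n)) := by
  obtain ⟨w₀, hw₀⟩ : ∃ w₀, x.2 p₀ = w₀ := ⟨_, rfl⟩
  obtain ⟨q₀, hq₀⟩ : ∃ q₀, D.φ x.1 0 p₀ = q₀ := ⟨_, rfl⟩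
  obtain ⟨i, hi⟩ : ∃ i, D.side p₀ = i := ⟨_, rfl⟩
  obtain ⟨z₀, hz₀⟩ : ∃ z₀, chartAt ℂ p₀ p₀ = z₀ := ⟨_, rfl⟩
  have hpz : (chartAt ℂ p₀).symm z₀ = p₀ := by
    rw [← hz₀, (chartAt ℂ p₀).left_inv (mem_chart_source ℂ p₀)]
  have hzt : z₀ ∈ (chartAt ℂ p₀).target := by rw [← hz₀]; exact mem_chart_target ℂ p₀
  have hsymm : Tendsto (chartAt ℂ p₀).symm (𝓝 z₀) (𝓝 p₀) := by
    have := (chartAt ℂ p₀).continuousAt_symm hzt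
    rwa [ContinuousAt, hpz] at this
  have hw : w₀ ∈ T.comp i \ (T.comp 0 ∩ T.comp 1) := by
    rw [← hw₀, ← hi]
    refine ⟨H.lim_mem.2.1 p₀, fun hV => ?_⟩
    obtain ⟨i, k, h⟩ := (H.lim_mem.2.2.1 p₀).1 hV
    exact hp i k h
  obtain ⟨C₁, hC₁, h1⟩ := H.gluing_bounds hs
  obtain ⟨C₂, ε, hC₂, hε, h2⟩ := exists_chartBounds A Nm w₀ q₀
  obtain ⟨C₃, r₃, hC₃, hr₃, h3⟩ := T.exists_lift_bound hw
  obtain ⟨⟨C₄, r₄, hr₄, h4⟩, hjt, B₀, hB₀, hsrc⟩ := H.tendsto.uniformlyCk (fun n => (H.mem n).1)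
    H.lim_mem.1 p₀ 1
  rw [hw₀, hz₀] at h4 hjt
  rw [hw₀] at hsrc
  obtain ⟨C₅, r₅, hC₅, hr₅, h5⟩ := D.exists_φ_bound x.1 hp hε
  simp only [hq₀, hz₀] at h5
  obtain ⟨B, r₆, hB, hr₆, h6⟩ := D.exists_metric_bound x.1 hp
  rw [hz₀] at h6
  obtain ⟨U₇, hU₇, h7⟩ := H.eventually_eq_lift hs hp
  rw [hi] at h7
  obtain ⟨r₈, hr₈, h8⟩ := hjt.eventually_ball
    (Metric.ball_mem_nhds _ (lt_min (half_pos hε) hr₃))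
  obtain ⟨r₉, hr₉, h9⟩ := Metric.mem_nhds_iff.1
    ((hsymm hB₀ : _ ∈ 𝓝 z₀))
  obtain ⟨r₁₀, hr₁₀, h10⟩ := Metric.mem_nhds_iff.1
    ((hsymm hU₇ : _ ∈ 𝓝 z₀))
  obtain ⟨C, hC⟩ : ∃ C, C = C₁ + C₂ + C₃ * (1 + |C₄|) + C₂ * (C₃ + C₅ * C₁) + C₅ + C₅ * C₁ +
    B ^ 2 := ⟨_, rfl⟩
  set r := min (min (min r₄ r₅) (min r₆ r₈)) (min r₉ r₁₀) with hr
  have hr0 : 0 < r := by positivity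
  have l4 : r ≤ r₄ := (min_le_left _ _).trans ((min_le_left _ _).trans (min_le_left _ _))
  have l5 : r ≤ r₅ := (min_le_left _ _).trans ((min_le_left _ _).trans (min_le_right _ _))
  have l6 : r ≤ r₆ := (min_le_left _ _).trans ((min_le_right _ _).trans (min_le_left _ _))
  have l8 : r ≤ r₈ := (min_le_left _ _).trans ((min_le_right _ _).trans (min_le_right _ _))
  have l9 : r ≤ r₉ := (min_le_right _ _).trans (min_le_left _ _)
  have l10 : r ≤ r₁₀ := (min_le_right _ _).trans (min_le_right _ _)
  have p3 : 0 ≤ C₃ * (1 + |C₄|) := by positivity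
  have p3' : C₃ * |C₄| ≤ C₃ * (1 + |C₄|) := by gcongr; linarith
  have p4 : 0 ≤ C₂ * (C₃ + C₅ * C₁) := by positivity
  have p5 : 0 ≤ C₅ * C₁ := by positivity
  have p6 : 0 ≤ B ^ 2 := by positivity
  have hC1 : 1 ≤ C := by linarith
  refine ⟨C * (4 * C ^ 3 * B) + C * (C * (4 * C ^ 3) * B), by positivity,
    (chartAt ℂ p₀).source ∩ chartAt ℂ p₀ ⁻¹' Metric.ball z₀ r, ?_, ?_⟩
  · refine inter_mem ((chartAt ℂ p₀).open_source.mem_nhds (mem_chart_source ℂ p₀)) ?_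
    refine (chartAt ℂ p₀).continuousAt (mem_chart_source ℂ p₀) ?_
    rw [hz₀]
    exact Metric.ball_mem_nhds _ hr0
  have hlam : ∀ᶠ n in atTop, ‖lam n‖ < min r₃ (ε / (2 * C₃)) := by
    have : Tendsto (fun n => ‖lam n‖) atTop (𝓝 0) := by simpa using H.tendsto_lam.norm
    exact this.eventually_lt_const (by positivity)
  have hμ : ∀ᶠ n in atTop, ‖μ n‖ < r₅ := by
    have : Tendsto (fun n => ‖μ n‖) atTop (𝓝 0) := by simpa using (H.tendsto_μ hs).norm
    exact this.eventually_lt_const hr₅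
  filter_upwards [h1, h4, hsrc, H.tendsto.1.eventually h5, H.tendsto.1.eventually h6, h7, h8, hlam,
    hμ] with n g1 g4 gsrc g5 g6 g7 g8 glam gμ
  rintro p ⟨hps, hpr⟩
  obtain ⟨z, hz⟩ : ∃ z, chartAt ℂ p₀ p = z := ⟨_, rfl⟩
  have hzp : (chartAt ℂ p₀).symm z = p := by rw [← hz, (chartAt ℂ p₀).left_inv hps]
  have hztar : z ∈ (chartAt ℂ p₀).target := by rw [← hz]; exact (chartAt ℂ p₀).map_source hps
  have hzr : z ∈ Metric.ball z₀ r := by rw [← hz]; exact hpr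
  rw [← hzp]
  clear hpr hps hz hzp p
  have hnear : ∀ᶠ y in 𝓝 z, y ∈ Metric.ball z₀ r := Metric.isOpen_ball.mem_nhds hzr
  set f := inCharts (E := EZ) (u n).2 p₀ w₀ with hf
  set G := fun y => T.coordLift i w₀ (lam n) (f y) with hG
  set ψ := fun (μ : Fin ℓ → ℂ) (z : ℂ) => chartAt EP q₀ (D.φ (u n).1 μ ((chartAt ℂ p₀).symm z))
    with hψ
  have gl1 : ‖lam n‖ < r₃ := glam.trans_le (min_le_left _ _)
  have gl2 : C₃ * ‖lam n‖ < ε / 2 := by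
    have := glam.trans_le (min_le_right _ _)
    rw [lt_div_iff₀ (by positivity)] at this
    linarith
  have hfs : ∀ y ∈ Metric.ball z₀ r, (u n).2 ((chartAt ℂ p₀).symm y) ∈ (chartAt EZ w₀).source :=
    fun y hy => gsrc (h9 (Metric.ball_subset_ball l9 hy))
  have hfc : ∀ y ∈ Metric.ball z₀ r, (u n).2 ((chartAt ℂ p₀).symm y) = (chartAt EZ w₀).symm (f y) :=
    fun y hy => ((chartAt EZ w₀).left_inv (hfs y hy)).symm
  have hfb : ∀ y ∈ Metric.ball z₀ r, f y ∈ Metric.ball (chartAt EZ w₀ w₀) (min (ε / 2) r₃) :=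
    fun y hy => g8 y (Metric.ball_subset_ball l8 hy)
  have hfb3 : ∀ y ∈ Metric.ball z₀ r, f y ∈ Metric.ball (chartAt EZ w₀ w₀) r₃ := fun y hy =>
    Metric.ball_subset_ball (min_le_right _ _) (hfb y hy)
  have hfL : ∀ y ∈ Metric.ball z₀ r, f y = T.coordLift i w₀ 0 (f y) := by
    intro y hy
    obtain ⟨-, hyn, -⟩ := g6 y (Metric.ball_subset_ball l6 hy)
    have hmem : (u n).2 ((chartAt ℂ p₀).symm y) ∈ T.comp i \ (T.comp 0 ∩ T.comp 1) := by
      have hside := (g7 _ (h10 (Metric.ball_subset_ball l10 hy))).2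
      refine ⟨?_, fun hV => ?_⟩
      · have := (H.mem n).2.1 ((chartAt ℂ p₀).symm y)
        rwa [hside] at this
      · obtain ⟨i, k, h⟩ := ((H.mem n).2.2.1 _).1 hV
        exact hyn i k h
    unfold SumFibration.coordLift
    rw [← hfc y hy, T.lift_zero i _ hmem]
    rfl
  have hFc : ∀ᶠ y in 𝓝 z, F n ((chartAt ℂ p₀).symm y) = (chartAt EZ w₀).symm (G y) := by
    filter_upwards [hnear] with y hy
    rw [(g7 _ (h10 (Metric.ball_subset_ball l10 hy))).1, hG]
    simp only
    unfold SumFibration.coordLift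
    rw [(chartAt EZ w₀).left_inv (h3 _ gl1 _ (hfb3 y hy)).1, hfc y hy]
  have hfe : ∀ᶠ y in 𝓝 z, (u n).2 ((chartAt ℂ p₀).symm y) = (chartAt EZ w₀).symm (f y) :=
    hnear.mono hfc
  obtain ⟨-, hLd, hLb, hLs, hLfs⟩ := h3 _ gl1 _ (hfb3 z hzr)
  obtain ⟨-, hLd0, -⟩ := h3 0 (by simpa using hr₃) _ (hfb3 z hzr)
  have hfd : DifferentiableAt ℝ f z := ((g4.1.contDiffAt
    (Metric.isOpen_ball.mem_nhds (Metric.ball_subset_ball l4 hzr))).differentiableAt (by simp))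
  have hfb4 : ‖fderiv ℝ f z‖ ≤ |C₄| := by
    have := g4.2 1 le_rfl z (Metric.ball_subset_ball l4 hzr)
    rw [norm_iteratedFDeriv_one] at this
    exact this.trans (le_abs_self _)
  have hGd : HasFDerivAt G ((fderiv ℝ (T.coordLift i w₀ (lam n)) (f z)).comp (fderiv ℝ f z)) z :=
    hLd.hasFDerivAt.comp z hfd.hasFDerivAt
  have hfd0 : HasFDerivAt f ((fderiv ℝ (T.coordLift i w₀ 0) (f z)).comp (fderiv ℝ f z)) z :=
    (hLd0.hasFDerivAt.comp z hfd.hasFDerivAt).congr_of_eventuallyEq (hnear.mono hfL)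
  have hκ := glueRate_nonneg s (lam n)
  obtain ⟨m1, m2, -⟩ := g1
  have hGf : ‖G z - f z‖ ≤ C₃ * ‖lam n‖ := by
    conv_lhs => rw [hfL z hzr]
    exact hLs
  have hfε2 : f z ∈ Metric.ball (chartAt EZ w₀ w₀) (ε / 2) :=
    Metric.ball_subset_ball (min_le_left _ _) (hfb z hzr)
  have hfε : f z ∈ Metric.ball (chartAt EZ w₀ w₀) ε :=
    Metric.ball_subset_ball (by linarith) hfε2
  have hGε : G z ∈ Metric.ball (chartAt EZ w₀ w₀) ε := by
    rw [mem_ball_iff_norm] at hfε2 ⊢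
    calc _ = ‖(G z - f z) + (f z - chartAt EZ w₀ w₀)‖ := by rw [sub_add_sub_cancel]
      _ ≤ _ := norm_add_le _ _
      _ < ε := by linarith
  obtain ⟨a1, a2, a3, a4, a5, a6⟩ := g5 (μ n) gμ z (Metric.ball_subset_ball l5 hzr)
  obtain ⟨b1, b2, -, -, -, b6⟩ := g5 0 (by simpa using hr₅) z (Metric.ball_subset_ball l5 hzr)
  obtain ⟨-, hzn, hmet⟩ := g6 z (Metric.ball_subset_ball l6 hzr)
  obtain ⟨c1, c2, c3⟩ := h2.chart _ hGε
  obtain ⟨d1, d2, d3⟩ := h2.chart _ hfε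
  have he := IsManifold.chart_mem_maximalAtlas (I := 𝓘(ℝ, ℂ)) (n := ∞) p₀
  have hgood := coordDbar_eq_zero (A := A) (D := D) he hztar hfe d1 hfd d2 d3 b6
    (h2.chart_P _ b1) b2 ((H.mem n).2.2.2.2.2 _)
  have hform := dbarSub_eq_coordDbar A D he hztar hFc c1 hGd.differentiableAt c3 a6
    (h2.chart_P _ a1) a2
  have hx1 : (G z, ψ (μ n) z) ∈ Metric.ball (chartAt EZ w₀ w₀, chartAt EP q₀ q₀) ε := by
    rw [← ball_prod_same]; exact ⟨hGε, a1⟩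
  have hx2 : (f z, ψ 0 z) ∈ Metric.ball (chartAt EZ w₀ w₀, chartAt EP q₀ q₀) ε := by
    rw [← ball_prod_same]; exact ⟨hfε, b1⟩
  have hCB : ∀ ζ, ‖coordDbar (coordEnd A.J (chartAt EZ w₀).symm (chartAt EZ w₀))
      (coordHom A.ν (chartAt EZ w₀).symm (chartAt EZ w₀) (chartAt EP q₀).symm)
      (coordJ (D.j (u n).1) (chartAt ℂ p₀) z) G (ψ (μ n)) z ζ‖ ≤
        4 * C ^ 3 * glueRate s (lam n) * ‖ζ‖ := by
    have hJ0 := (h2.J_le _ hfε).trans (show C₂ ≤ C by linarith)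
    have hν0 := (h2.ν_le _ hx2).trans (show C₂ ≤ C by linarith)
    intro ζ
    refine norm_coordDbar_le_of_close (f := f) (φ₀ := ψ 0) hC1 hκ hJ0 ?_ hν0
      ?_ ?_ ?_ ?_ ?_ ?_ hgood ζ
    · refine (h2.J_lip _ hGε _ hfε).trans ?_
      calc C₂ * ‖G z - f z‖ ≤ C₂ * ((C₃ + C₅ * C₁) * glueRate s (lam n)) := by
            gcongr
            refine hGf.trans ?_
            gcongr
            linarith
        _ = C₂ * (C₃ + C₅ * C₁) * glueRate s (lam n) := by ring
        _ ≤ _ := by gcongr; linarith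
    · refine (h2.ν_lip _ hx1 _ hx2).trans ?_
      have hm : ‖(G z, ψ (μ n) z) - (f z, ψ 0 z)‖ ≤ (C₃ + C₅ * C₁) * glueRate s (lam n) := by
        rw [Prod.mk_sub_mk]
        refine max_le ?_ ?_
        · refine hGf.trans ?_
          gcongr
          linarith
        · refine a4.trans ?_
          calc C₅ * ‖μ n‖ ≤ C₅ * (C₁ * glueRate s (lam n)) := by gcongr
            _ ≤ C₃ * glueRate s (lam n) + C₅ * (C₁ * glueRate s (lam n)) :=
                le_add_of_nonneg_left (by positivity)
            _ = _ := by ring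
      calc C₂ * _ ≤ C₂ * ((C₃ + C₅ * C₁) * glueRate s (lam n)) := by gcongr
        _ = C₂ * (C₃ + C₅ * C₁) * glueRate s (lam n) := by ring
        _ ≤ _ := by gcongr; linarith
    · refine fun ζ => (D.norm_coordJ_le hztar hzn hmet ζ).trans ?_
      gcongr
      linarith
    · intro ζ
      rw [hGd.fderiv]
      calc _ ≤ C₃ * (|C₄| * ‖ζ‖) := ContinuousLinearMap.le_of_opNorm_le_of_le _ hLb
              (ContinuousLinearMap.le_of_opNorm_le _ hfb4 _)
        _ = C₃ * |C₄| * ‖ζ‖ := by ring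
        _ ≤ _ := by gcongr; linarith
    · intro ζ
      have e0 : fderiv ℝ f z ζ = fderiv ℝ (T.coordLift i w₀ 0) (f z) (fderiv ℝ f z ζ) :=
        congrArg (fun L : ℂ →L[ℝ] EZ => L ζ) hfd0.fderiv
      have e1 : fderiv ℝ G z ζ = fderiv ℝ (T.coordLift i w₀ (lam n)) (f z) (fderiv ℝ f z ζ) :=
        congrArg (fun L : ℂ →L[ℝ] EZ => L ζ) hGd.fderiv
      calc _ = ‖(fderiv ℝ (T.coordLift i w₀ (lam n)) (f z) - fderiv ℝ (T.coordLift i w₀ 0) (f z))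
              (fderiv ℝ f z ζ)‖ := by rw [sub_apply, ← e0, e1]
        _ ≤ C₃ * ‖lam n‖ * (|C₄| * ‖ζ‖) := ContinuousLinearMap.le_of_opNorm_le_of_le _ hLfs
              (ContinuousLinearMap.le_of_opNorm_le _ hfb4 _)
        _ = C₃ * |C₄| * ‖lam n‖ * ‖ζ‖ := by ring
        _ ≤ _ := by gcongr; linarith
    · refine fun ζ => (a3 ζ).trans ?_
      gcongr
      linarith
    · refine fun ζ => (a5 ζ).trans ?_
      calc C₅ * ‖μ n‖ * ‖ζ‖ ≤ C₅ * (C₁ * glueRate s (lam n)) * ‖ζ‖ := by gcongr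
        _ = C₅ * C₁ * glueRate s (lam n) * ‖ζ‖ := by ring
        _ ≤ _ := by gcongr; linarith
  have hnorm : ∀ ζ : ℂ, D.h (u n).1 ((chartAt ℂ p₀).symm z)
      (mfderiv 𝓘(ℝ, ℂ) 𝓘(ℝ, ℂ) (chartAt ℂ p₀).symm z ζ)
      (mfderiv 𝓘(ℝ, ℂ) 𝓘(ℝ, ℂ) (chartAt ℂ p₀).symm z ζ) ≤ 1 → ‖ζ‖ ≤ B := by
    intro ζ hζ
    refine le_of_sq_le_sq ((hmet ζ).2.trans ?_) (by linarith)
    exact mul_le_of_le_one_right p6 hζ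
  have hFz := hFc.self_of_nhds
  have hgC : ∀ w : EZ, _ ≤ C * ‖w‖ := fun w => (h2.metric _ hGε w).trans (by gcongr; linarith)
  constructor
  · refine (ptNorm_le_of_coord A D he hztar hFz _ _ hform (by linarith) (by positivity) hgC hnorm
      hCB).trans (ENNReal.ofReal_le_ofReal ?_)
    calc C * (4 * C ^ 3 * glueRate s (lam n) * B) = C * (4 * C ^ 3 * B) * glueRate s (lam n) := by
          ring
      _ ≤ _ := by gcongr; exact le_add_of_nonneg_right (by positivity)
  · set Q := coordEnd Nm.proj (chartAt EZ w₀).symm (chartAt EZ w₀) (G z) with hQ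
    set η := coordDbar (coordEnd A.J (chartAt EZ w₀).symm (chartAt EZ w₀))
      (coordHom A.ν (chartAt EZ w₀).symm (chartAt EZ w₀) (chartAt EP q₀).symm)
      (coordJ (D.j (u n).1) (chartAt ℂ p₀) z) G (ψ (μ n)) z with hη
    refine (ptNorm_le_of_coord A D he hztar hFz _ (Q.comp η) ?_ (by linarith)
      (R := C * (4 * C ^ 3 * glueRate s (lam n))) (by positivity) hgC hnorm ?_).trans
      (ENNReal.ofReal_le_ofReal ?_)
    · intro ζ
      have key : ∀ w : Z, w = (chartAt EZ w₀).symm (G z) → ∀ v : EZ,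
          (Nm.proj w v : EZ) = Nm.proj ((chartAt EZ w₀).symm (G z)) v := by
        rintro _ rfl v; rfl
      refine (key _ hFz _).trans ?_
      refine (congrArg (fun v : EZ => (Nm.proj ((chartAt EZ w₀).symm (G z)) v : EZ))
        (hform ζ)).trans ?_
      exact (c3 _).symm
    · intro ζ
      calc ‖Q (η ζ)‖ ≤ C * (4 * C ^ 3 * glueRate s (lam n) * ‖ζ‖) :=
            ContinuousLinearMap.le_of_opNorm_le_of_le _
              ((h2.proj_le _ hGε).trans (by linarith)) (hCB ζ)
        _ = _ := by ring
    · calc C * (C * (4 * C ^ 3 * glueRate s (lam n)) * B) =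
          C * (C * (4 * C ^ 3) * B) * glueRate s (lam n) := by ring
        _ ≤ _ := by gcongr; exact le_add_of_nonneg_left (by positivity)

end RegularBound

theorem lintegral_ball_rpow_lt_top (y₀ : ℂ) (R : ℝ) {α : ℝ} (hα : α < 2) :
    ∫⁻ y in Metric.ball y₀ R, ENNReal.ofReal (‖y - y₀‖ ^ (-α)) < ⊤ := by
  have h1 : IntegrableOn (fun y : ℂ => ‖y‖ ^ (-α)) (Metric.ball 0 R) := by
    refine integrableOn_ball_of_norm_le_rpow (C := 1) (α := α) (by simp) (by simpa using hα) ?_ ?_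
    · refine ae_of_all _ fun y => ?_
      rw [Real.norm_of_nonneg (by positivity), one_mul]
    · exact (measurable_norm.pow_const _).aestronglyMeasurable
  have h2 := (measurePreserving_sub_right (volume : Measure ℂ) y₀).setLIntegral_comp_preimage_emb
    (MeasurableEquiv.subRight y₀).measurableEmbedding
    (fun y : ℂ => ENNReal.ofReal (‖y‖ ^ (-α))) (Metric.ball 0 R)
  have h3 : (fun y : ℂ => y - y₀) ⁻¹' Metric.ball 0 R = Metric.ball y₀ R := by
    ext y; simp [dist_eq_norm]
  rw [h3] at h2
  rw [h2]
  exact h1.setLIntegral_lt_top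

section AreaMeasure

variable {S : Type*} [TopologicalSpace S] [T2Space S] [ChartedSpace ℂ S] [IsManifold 𝓘(ℝ, ℂ) ∞ S]

theorem measurableSet_image_chart [MeasurableSpace S] [BorelSpace S] (e : OpenPartialHomeomorph S ℂ)
    {A : Set S} (hA : MeasurableSet A) (hAs : A ⊆ e.source) : MeasurableSet (e '' A) := by
  have h1 : Measurable (e.target.domRestrict e.symm) :=
    (continuousOn_iff_continuous_domRestrict.1 e.continuousOn_symm).measurable
  have h2 : e '' A = Subtype.val '' ((e.target.domRestrict e.symm) ⁻¹' A) := by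
    ext y
    constructor
    · rintro ⟨p, hp, rfl⟩
      refine ⟨⟨e p, e.map_source (hAs hp)⟩, ?_, rfl⟩
      change e.symm (e p) ∈ A
      rwa [e.left_inv (hAs hp)]
    · rintro ⟨⟨y, hy⟩, hyA, rfl⟩
      exact ⟨e.symm y, hyA, e.right_inv hy⟩
  rw [h2]
  exact e.open_target.measurableSet.subtype_image (h1 hA)

/-- The density of the area measure in the chart at `x`. -/
noncomputable def areaDensity
    (h : ∀ p : S, TangentSpace 𝓘(ℝ, ℂ) p →L[ℝ] TangentSpace 𝓘(ℝ, ℂ) p →L[ℝ] ℝ)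
    (x : S) (y : ℂ) : ℝ :=
  let p := (chartAt ℂ x).symm y
  let e₁ : TangentSpace 𝓘(ℝ, ℂ) p := mfderiv 𝓘(ℝ, ℂ) 𝓘(ℝ, ℂ) (chartAt ℂ x).symm y (1 : ℂ)
  let e₂ : TangentSpace 𝓘(ℝ, ℂ) p := mfderiv 𝓘(ℝ, ℂ) 𝓘(ℝ, ℂ) (chartAt ℂ x).symm y Complex.I
  Real.sqrt (h p e₁ e₁ * h p e₂ e₂ - h p e₁ e₂ ^ 2)

theorem areaDensity_le
    {h : ∀ p : S, TangentSpace 𝓘(ℝ, ℂ) p →L[ℝ] TangentSpace 𝓘(ℝ, ℂ) p →L[ℝ] ℝ}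
    {x : S} {y : ℂ} {M : ℝ} (hM : 0 ≤ M)
    (hb : ∀ ζ : ℂ, ‖ζ‖ = 1 → 0 ≤ h ((chartAt ℂ x).symm y)
        (mfderiv 𝓘(ℝ, ℂ) 𝓘(ℝ, ℂ) (chartAt ℂ x).symm y ζ)
        (mfderiv 𝓘(ℝ, ℂ) 𝓘(ℝ, ℂ) (chartAt ℂ x).symm y ζ) ∧
      h ((chartAt ℂ x).symm y)
        (mfderiv 𝓘(ℝ, ℂ) 𝓘(ℝ, ℂ) (chartAt ℂ x).symm y ζ)
        (mfderiv 𝓘(ℝ, ℂ) 𝓘(ℝ, ℂ) (chartAt ℂ x).symm y ζ) ≤ M) : areaDensity h x y ≤ M := by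
  obtain ⟨a1, a2⟩ := hb 1 (by simp)
  obtain ⟨b1, b2⟩ := hb Complex.I (by simp)
  refine Real.sqrt_le_iff.2 ⟨hM, ?_⟩
  refine (sub_le_self _ (sq_nonneg _)).trans ?_
  rw [sq]
  exact mul_le_mul a2 b2 b1 hM

theorem IsAreaMeasure.lintegral_le [MeasurableSpace S] [BorelSpace S]
    {h : ∀ p : S, TangentSpace 𝓘(ℝ, ℂ) p →L[ℝ] TangentSpace 𝓘(ℝ, ℂ) p →L[ℝ] ℝ} {m : Measure S}
    (hm : IsAreaMeasure h m) {x : S} {U : Set S} (hU : MeasurableSet U)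
    (hUs : U ⊆ (chartAt ℂ x).source) {G : ℂ → ℝ≥0∞} (hG : Measurable G)
    (hle : ∀ y ∈ chartAt ℂ x '' U, ENNReal.ofReal (areaDensity h x y) ≤ G y) (f : S → ℝ≥0∞) :
    ∫⁻ p in U, f p ∂m ≤ ∫⁻ y in chartAt ℂ x '' U, G y * f ((chartAt ℂ x).symm y) := by
  set e := chartAt ℂ x with he
  have hUm := measurableSet_image_chart e hU hUs
  have hUt : e '' U ⊆ e.target := by
    rintro _ ⟨p, hp, rfl⟩; exact e.map_source (hUs hp)
  set ν := (volume.restrict (e '' U)).withDensity G with hν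
  have hmeas : AEMeasurable e.symm ν :=
    ((e.continuousOn_symm.mono hUt).aemeasurable hUm).mono_ac (withDensity_absolutelyContinuous _ _)
  have hmle : m.restrict U ≤ Measure.map e.symm ν := by
    refine Measure.le_iff.2 fun A hA => ?_
    have hAU : A ∩ U ⊆ e.source := inter_subset_right.trans hUs
    have hAm := measurableSet_image_chart e (hA.inter hU) hAU
    rw [Measure.restrict_apply hA, Measure.map_apply_of_aemeasurable hmeas hA,
      hm x (A ∩ U) (hA.inter hU) hAU]
    calc _ ≤ ∫⁻ y in e '' (A ∩ U), G y :=
          setLIntegral_mono' hAm fun y hy => hle y (image_mono inter_subset_right hy)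
      _ = ∫⁻ y in e '' (A ∩ U), G y ∂(volume.restrict (e '' U)) := by
          rw [Measure.restrict_restrict_of_subset (image_mono inter_subset_right)]
      _ = ν (e '' (A ∩ U)) := (withDensity_apply _ hAm).symm
      _ ≤ _ := by
          refine measure_mono ?_
          rintro _ ⟨p, hp, rfl⟩
          change e.symm (e p) ∈ A
          rw [e.left_inv (hAU hp)]
          exact hp.1
  calc _ ≤ ∫⁻ p, f p ∂(Measure.map e.symm ν) := lintegral_mono' hmle le_rfl
    _ ≤ ∫⁻ y, f (e.symm y) ∂ν := lintegral_map_le _ _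
    _ ≤ _ := lintegral_withDensity_le_lintegral_mul _ hG _

end AreaMeasure

section Rho

variable {EP : Type*} [NormedAddCommGroup EP] [NormedSpace ℝ EP] [FiniteDimensional ℝ EP]
  {P : Type*} [TopologicalSpace P] [ChartedSpace EP P] [IsManifold 𝓘(ℝ, EP) ∞ P]
  {EN : Type*} [NormedAddCommGroup EN] [NormedSpace ℝ EN] [FiniteDimensional ℝ EN]
  {N : Type*} [TopologicalSpace N] [ChartedSpace EN N] [IsManifold 𝓘(ℝ, EN) ∞ N]
  {S : Type*} [TopologicalSpace S] [T2Space S] [ChartedSpace ℂ S] [IsManifold 𝓘(ℝ, ℂ) ∞ S]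
  {jP : ∀ q : P, TangentSpace 𝓘(ℝ, EP) q →L[ℝ] TangentSpace 𝓘(ℝ, EP) q}
  {ℓ : ℕ} (D : CurveFamily S EN N jP ℓ)

theorem CurveFamily.isClosed_curve (μ : Fin ℓ → ℂ) : IsClosed (D.curve μ) := by
  have h : D.curve μ = (⋃ i, ⋃ k, (D.coord i k).source ∩
      D.coord i k ⁻¹' Metric.ball 0 (Real.sqrt ‖μ k‖))ᶜ := by
    ext p
    simp [CurveFamily.curve]
  rw [h, isClosed_compl_iff]
  exact isOpen_iUnion fun i => isOpen_iUnion fun k =>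
    (D.coord i k).isOpen_inter_preimage Metric.isOpen_ball

theorem CurveFamily.nodeBall_subset_curve (μ : Fin ℓ → ℂ) (k : Fin ℓ) (r : ℝ) :
    D.nodeBall μ k r ⊆ D.curve μ := fun _ h => h.1

theorem CurveFamily.rho_eq {μ : Fin ℓ → ℂ} {p : S} {i : Fin 2} {k : Fin ℓ}
    (h : p ∈ (D.coord i k).source) : D.rho μ p = min 1 (D.nodeRho μ i k p) := by
  unfold CurveFamily.rho
  rw [Finset.prod_eq_single i, Finset.prod_eq_single k, if_pos h]
  · exact fun k' _ hk' => if_neg fun h' => hk' (D.eq_of_mem_source h h').2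
  · simp
  · exact fun i' _ hi' => Finset.prod_eq_one fun k' _ =>
      if_neg fun h' => hi' (D.eq_of_mem_source h h').1
  · simp

theorem CurveFamily.le_rho {μ : Fin ℓ → ℂ} {p : S} {c : ℝ} (hc : c ≤ 1)
    (h : ∀ i k, p ∈ (D.coord i k).source → c ≤ ‖D.coord i k p‖) : c ≤ D.rho μ p := by
  by_cases hp : ∃ i k, p ∈ (D.coord i k).source
  · obtain ⟨i, k, hk⟩ := hp
    rw [D.rho_eq hk]
    exact le_min hc ((h i k hk).trans (D.norm_coord_le_nodeRho _ _ _ _))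
  · push Not at hp
    unfold CurveFamily.rho
    rw [Finset.prod_eq_one fun i _ => Finset.prod_eq_one fun k _ => if_neg (hp i k)]
    exact hc

/-- Near a point that is not a node, the areas are uniformly bounded. -/
theorem CurveFamily.exists_area_bound [MeasurableSpace S] [BorelSpace S] {m : N → Measure S}
    (hm : ∀ b, IsAreaMeasure (D.h b) (m b)) (b₀ : N) {p₀ : S} (hp : ∀ i k, p₀ ≠ D.pt i k) :
    ∃ K : ℝ, ∃ U ∈ 𝓝 p₀, ∀ᶠ b in 𝓝 b₀, m b U ≤ ENNReal.ofReal K := by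
  obtain ⟨B, r, hB, hr, h⟩ := D.exists_metric_bound b₀ hp
  set U := (chartAt ℂ p₀).source ∩ chartAt ℂ p₀ ⁻¹' Metric.ball (chartAt ℂ p₀ p₀) r with hU
  have hUo : IsOpen U := (chartAt ℂ p₀).isOpen_inter_preimage Metric.isOpen_ball
  have himg : chartAt ℂ p₀ '' U ⊆ Metric.ball (chartAt ℂ p₀ p₀) r := by
    rintro _ ⟨p, hp, rfl⟩; exact hp.2
  refine ⟨(ENNReal.ofReal (B ^ 2) * volume (Metric.ball (chartAt ℂ p₀ p₀) r)).toReal, U,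
    hUo.mem_nhds ⟨mem_chart_source ℂ p₀, Metric.mem_ball_self hr⟩, ?_⟩
  filter_upwards [h] with b hb
  rw [ENNReal.ofReal_toReal (ENNReal.mul_ne_top ENNReal.ofReal_ne_top
    measure_ball_lt_top.ne)]
  have h1 := (hm b).lintegral_le (x := p₀) hUo.measurableSet inter_subset_left
    (G := fun _ => ENNReal.ofReal (B ^ 2)) measurable_const (fun y hy => by
      refine ENNReal.ofReal_le_ofReal (areaDensity_le (by positivity) fun ζ hζ => ?_)
      obtain ⟨-, -, h3⟩ := hb y (himg hy)
      obtain ⟨h4, h5⟩ := h3 ζ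
      rw [hζ] at h4 h5
      refine ⟨?_, h4.trans_eq (by ring)⟩
      have h6 : 0 < B ^ 2 := by positivity
      have h7 : 0 < B ^ 2 * D.coordMetric p₀ b y ζ := by linarith
      exact (pos_of_mul_pos_right h7 h6.le).le) (fun _ => 1)
  simp only [lintegral_const, one_mul, mul_one, Measure.restrict_apply MeasurableSet.univ,
    univ_inter] at h1
  exact h1.trans (by gcongr)

theorem contDiffAt_transition_symm {e : OpenPartialHomeomorph S ℂ}
    (he : e ∈ IsManifold.maximalAtlas 𝓘(ℝ, ℂ) ∞ S) {p : S} (hp : p ∈ e.source) :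
    ContDiffAt ℝ ∞ (fun y => e ((chartAt ℂ p).symm y)) (chartAt ℂ p p) := by
  rw [← contMDiffAt_iff_contDiffAt]
  have h1 : ContMDiffAt 𝓘(ℝ, ℂ) 𝓘(ℝ, ℂ) ∞ (chartAt ℂ p).symm (chartAt ℂ p p) :=
    (contMDiffOn_chart_symm (I := 𝓘(ℝ, ℂ)) (n := ∞) (x := p)).contMDiffAt
      ((chartAt ℂ p).open_target.mem_nhds (mem_chart_target ℂ p))
  have h2 : ContMDiffAt 𝓘(ℝ, ℂ) 𝓘(ℝ, ℂ) ∞ e p :=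
    (contMDiffOn_of_mem_maximalAtlas he).contMDiffAt (e.open_source.mem_nhds hp)
  exact ContMDiffAt.comp_of_eq h2 h1 ((chartAt ℂ p).left_inv (mem_chart_source ℂ p))

/-- Near a node, the function `|z| ^ (1/10)` is uniformly integrable for the cylindrical metrics. -/
theorem CurveFamily.exists_node_area_bound [MeasurableSpace S] [BorelSpace S] {m : N → Measure S}
    (hm : ∀ b, IsAreaMeasure (D.h b) (m b)) (i : Fin 2) (k : Fin ℓ) {r : ℝ} (hr : 0 < r) :
    ∃ K : ℝ, ∃ U ∈ 𝓝 (D.pt i k), IsOpen U ∧ U ⊆ (D.coord i k).source ∧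
      (∀ p ∈ U, ‖D.coord i k p‖ < r) ∧
      ∀ b, ∫⁻ p in U \ {D.pt i k}, ENNReal.ofReal (‖D.coord i k p‖ ^ (1 / 10 : ℝ)) ∂(m b) ≤
        ENNReal.ofReal K := by
  have h0t : (0 : ℂ) ∈ (D.coord i k).target := by
    rw [D.coord_target]; exact Metric.mem_ball_self two_pos
  obtain ⟨p₀, hp₀⟩ : ∃ p₀, D.pt i k = p₀ := ⟨_, rfl⟩
  have hps : p₀ ∈ (D.coord i k).source := by
    rw [← hp₀]; exact (D.coord i k).map_target h0t
  have hp0 : D.coord i k p₀ = 0 := by rw [← hp₀]; exact (D.coord i k).right_inv h0t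
  rw [hp₀]
  obtain ⟨y₀, hy₀⟩ : ∃ y₀, chartAt ℂ p₀ p₀ = y₀ := ⟨_, rfl⟩
  have hyp : (chartAt ℂ p₀).symm y₀ = p₀ := by
    rw [← hy₀, (chartAt ℂ p₀).left_inv (mem_chart_source ℂ p₀)]
  have hyt : y₀ ∈ (chartAt ℂ p₀).target := by rw [← hy₀]; exact mem_chart_target ℂ p₀
  set τ : ℂ → ℂ := fun y => D.coord i k ((chartAt ℂ p₀).symm y) with hτ
  set σ : ℂ → ℂ := fun z => chartAt ℂ p₀ ((D.coord i k).symm z) with hσ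
  have hτ0 : τ y₀ = 0 := by simp only [hτ, hyp, hp0]
  have hσ0 : σ 0 = y₀ := by
    simp only [hσ]
    rw [← hy₀]
    exact congrArg _ hp₀
  have hτs : ContDiffAt ℝ 1 τ y₀ := by
    rw [← hy₀]; exact (contDiffAt_transition_symm (D.coord_smooth i k) hps).of_le (by simp)
  have hσs : ContDiffAt ℝ 1 σ 0 := by
    rw [← hp0]; exact (contDiffAt_coord_transition (D.coord_smooth i k) hps).of_le (by simp)
  obtain ⟨L₁, t₁, ht₁, hL₁⟩ := hτs.exists_lipschitzOnWith
  obtain ⟨L₂, t₂, ht₂, hL₂⟩ := hσs.exists_lipschitzOnWith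
  have hτc : Tendsto τ (𝓝 y₀) (𝓝 0) := by
    have := hτs.continuousAt; rwa [ContinuousAt, hτ0] at this
  have hsc : Tendsto (chartAt ℂ p₀).symm (𝓝 y₀) (𝓝 p₀) := by
    have := (chartAt ℂ p₀).continuousAt_symm hyt
    rwa [ContinuousAt, hyp] at this
  have hall : ∀ᶠ y in 𝓝 y₀, t₁ ∈ 𝓝 y ∧ τ y ∈ t₂ ∧ τ y ∈ Metric.ball (0 : ℂ) (min r 1) ∧
      y ∈ (chartAt ℂ p₀).target ∧ (chartAt ℂ p₀).symm y ∈ (D.coord i k).source :=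
    (eventually_mem_nhds_iff.2 ht₁).and <| (hτc.eventually_mem ht₂).and <|
      (hτc.eventually_mem (Metric.ball_mem_nhds _ (lt_min hr one_pos))).and <|
      ((chartAt ℂ p₀).open_target.eventually_mem hyt).and
      (hsc.eventually_mem ((D.coord i k).open_source.mem_nhds hps))
  obtain ⟨R, hR, hball⟩ := Metric.eventually_nhds_iff_ball.1 hall
  set M : ℝ := (L₁ * L₂) ^ 2 * (L₁ : ℝ) ^ (1 / 10 : ℝ) with hM
  set U := (chartAt ℂ p₀).source ∩ chartAt ℂ p₀ ⁻¹' Metric.ball y₀ R with hU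
  have hUo : IsOpen U := (chartAt ℂ p₀).isOpen_inter_preimage Metric.isOpen_ball
  have hUp : ∀ p ∈ U, p ∈ (D.coord i k).source ∧ ‖D.coord i k p‖ < min r 1 := by
    rintro p ⟨hp1, hp2⟩
    obtain ⟨-, -, a1, -, a2⟩ := hball _ hp2
    simp only [hτ, (chartAt ℂ p₀).left_inv hp1, mem_ball_zero_iff] at a1 a2
    exact ⟨a2, a1⟩
  refine ⟨(∫⁻ y in Metric.ball y₀ R, ENNReal.ofReal M *
      ENNReal.ofReal (‖y - y₀‖ ^ (-(19 / 10) : ℝ))).toReal, U,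
    hUo.mem_nhds ⟨mem_chart_source ℂ p₀, by rw [mem_preimage, hy₀]; exact Metric.mem_ball_self hR⟩,
    hUo, fun p hp => (hUp p hp).1, fun p hp => (hUp p hp).2.trans_le (min_le_left _ _), fun b => ?_⟩
  rw [ENNReal.ofReal_toReal (by
    rw [lintegral_const_mul' _ _ ENNReal.ofReal_ne_top]
    exact ENNReal.mul_ne_top ENNReal.ofReal_ne_top
      (lintegral_ball_rpow_lt_top y₀ R (by norm_num)).ne)]
  have himg : chartAt ℂ p₀ '' (U \ {p₀}) ⊆ Metric.ball y₀ R \ {y₀} := by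
    rintro _ ⟨p, ⟨⟨hp1, hp2⟩, hp3⟩, rfl⟩
    refine ⟨hp2, fun h => hp3 ?_⟩
    have h' : chartAt ℂ p₀ p = y₀ := h
    rw [mem_singleton_iff, ← (chartAt ℂ p₀).left_inv hp1, h', hyp]
  have key : ∀ y ∈ Metric.ball y₀ R \ {y₀}, 0 < ‖y - y₀‖ ∧ 0 < ‖τ y‖ ∧
      ‖τ y‖ ≤ L₁ * ‖y - y₀‖ ∧ ‖y - y₀‖ ≤ L₂ * ‖τ y‖ := by
    rintro y ⟨hy1, hy2⟩
    obtain ⟨a1, a2, -, a4, a5⟩ := hball y hy1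
    have hn : 0 < ‖y - y₀‖ := norm_pos_iff.2 (sub_ne_zero.2 hy2)
    have e1 := hL₁.norm_sub_le (mem_of_mem_nhds a1) (mem_of_mem_nhds ht₁)
    rw [hτ0, sub_zero] at e1
    have e2 := hL₂.norm_sub_le a2 (mem_of_mem_nhds ht₂)
    have e3 : σ (τ y) = y := by
      simp only [hσ, hτ]
      rw [(D.coord i k).left_inv a5, (chartAt ℂ p₀).right_inv a4]
    rw [hσ0, e3, sub_zero] at e2
    refine ⟨hn, ?_, e1, e2⟩
    by_contra h
    have : ‖τ y‖ = 0 := le_antisymm (not_lt.1 h) (norm_nonneg _)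
    rw [this, mul_zero] at e2
    linarith
  have hmeasU : MeasurableSet (U \ {p₀}) := hUo.measurableSet.diff (measurableSet_singleton _)
  refine ((hm b).lintegral_le (x := p₀) hmeasU (sdiff_subset.trans inter_subset_left)
    (G := fun y => ENNReal.ofReal ((L₁ * L₂) ^ 2 * ‖y - y₀‖ ^ (-2 : ℝ))) (by fun_prop) ?_ _).trans ?_
  · intro y hy
    obtain ⟨k1, k2, k3, k4⟩ := key y (himg hy)
    obtain ⟨a1, -, a3, a4, a5⟩ := hball y (himg hy).1
    refine ENNReal.ofReal_le_ofReal (areaDensity_le (by positivity) fun ζ hζ => ?_)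
    have e1 := D.h_cylindrical i k b _ a5 k2
      ((mem_ball_zero_iff.1 a3).le.trans (min_le_right _ _))
      (mfderiv 𝓘(ℝ, ℂ) 𝓘(ℝ, ℂ) (chartAt ℂ p₀).symm y ζ)
    have hy3 : MDifferentiableAt 𝓘(ℝ, ℂ) 𝓘(ℝ, ℂ) (chartAt ℂ p₀).symm y :=
      mdifferentiableAt_symm_of_mem_maximalAtlas
        (IsManifold.chart_mem_maximalAtlas (I := 𝓘(ℝ, ℂ)) (n := ∞) p₀) a4
    have e2 : (mfderiv 𝓘(ℝ, ℂ) 𝓘(ℝ, ℂ) (D.coord i k) ((chartAt ℂ p₀).symm y)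
        (mfderiv 𝓘(ℝ, ℂ) 𝓘(ℝ, ℂ) (chartAt ℂ p₀).symm y ζ) : ℂ) = fderiv ℝ τ y ζ := by
      rw [← mfderiv_eq_fderiv]
      exact (mfderiv_comp_apply y
        (mdifferentiableAt_of_mem_maximalAtlas (D.coord_smooth i k) a5) hy3 ζ).symm
    have e3 : ‖toComplex (mfderiv 𝓘(ℝ, ℂ) 𝓘(ℝ, ℂ) (D.coord i k) ((chartAt ℂ p₀).symm y)
        (mfderiv 𝓘(ℝ, ℂ) 𝓘(ℝ, ℂ) (chartAt ℂ p₀).symm y ζ))‖ ≤ L₁ := by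
      refine (congrArg (fun w : ℂ => ‖w‖) e2).le.trans ?_
      have := ContinuousLinearMap.le_of_opNorm_le _ (norm_fderiv_le_of_lipschitzOn ℝ a1 hL₁) ζ
      rwa [hζ, mul_one] at this
    rw [e1]
    refine ⟨by positivity, ?_⟩
    rw [Real.rpow_neg k1.le, Real.rpow_two, mul_pow, ← div_eq_mul_inv, ← mul_pow, ← div_pow]
    have hL2 : 0 < (L₂ : ℝ) := by
      by_contra h
      have h2 : (L₂ : ℝ) = 0 := le_antisymm (not_lt.1 h) L₂.coe_nonneg
      rw [h2, zero_mul] at k4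
      linarith
    gcongr ?_ ^ 2
    rw [div_le_div_iff₀ k2 k1]
    calc _ ≤ (L₁ : ℝ) * (L₂ * ‖τ y‖) := by gcongr
      _ = _ := by ring
  · refine (setLIntegral_mono' (measurableSet_image_chart _ hmeasU
      (sdiff_subset.trans inter_subset_left)) (g := fun y => ENNReal.ofReal M *
        ENNReal.ofReal (‖y - y₀‖ ^ (-(19 / 10) : ℝ))) fun y hy => ?_).trans
      (lintegral_mono_set (himg.trans sdiff_subset))
    obtain ⟨k1, k2, k3, k4⟩ := key y (himg hy)
    rw [← ENNReal.ofReal_mul (by positivity), ← ENNReal.ofReal_mul (by positivity)]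
    refine ENNReal.ofReal_le_ofReal ?_
    calc (L₁ * L₂ : ℝ) ^ 2 * ‖y - y₀‖ ^ (-2 : ℝ) * ‖τ y‖ ^ (1 / 10 : ℝ)
        ≤ (L₁ * L₂ : ℝ) ^ 2 * ‖y - y₀‖ ^ (-2 : ℝ) * (L₁ * ‖y - y₀‖) ^ (1 / 10 : ℝ) := by gcongr
      _ = M * (‖y - y₀‖ ^ (-2 : ℝ) * ‖y - y₀‖ ^ (1 / 10 : ℝ)) := by
          rw [Real.mul_rpow L₁.coe_nonneg k1.le, hM]; ring
      _ = _ := by rw [← Real.rpow_add k1]; norm_num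

end Rho

theorem exists_lintegral_bound_of_local {S : Type*} [TopologicalSpace S] [CompactSpace S]
    [MeasurableSpace S] {m : ℕ → Measure S} {X : ℕ → Set S} {f : ℕ → S → ℝ≥0∞} {c : ℕ → ℝ}
    (hc : ∀ n, 0 ≤ c n)
    (h : ∀ p : S, ∃ U ∈ 𝓝 p, ∃ K : ℝ, 0 ≤ K ∧ ∀ᶠ n in atTop,
      ∫⁻ p in X n ∩ U, f n p ∂(m n) ≤ ENNReal.ofReal (K * c n)) :
    ∃ K : ℝ, 0 ≤ K ∧ ∀ᶠ n in atTop, ∫⁻ p in X n, f n p ∂(m n) ≤ ENNReal.ofReal (K * c n) := by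
  have key := isCompact_univ.induction_on (p := fun U : Set S => ∃ K : ℝ, 0 ≤ K ∧
      ∀ᶠ n in atTop, ∫⁻ p in X n ∩ U, f n p ∂(m n) ≤ ENNReal.ofReal (K * c n)) ?_ ?_ ?_ ?_
  · simpa only [inter_univ] using key
  · exact ⟨0, le_rfl, by simp⟩
  · rintro U U' hUU ⟨K, hK, hb⟩
    exact ⟨K, hK, hb.mono fun n hn => (lintegral_mono_set (by gcongr)).trans hn⟩
  · rintro U U' ⟨K, hK, hb⟩ ⟨K', hK', hb'⟩
    refine ⟨K + K', by positivity, ?_⟩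
    filter_upwards [hb, hb'] with n hn hn'
    rw [inter_union_distrib_left, add_mul,
      ENNReal.ofReal_add (mul_nonneg hK (hc n)) (mul_nonneg hK' (hc n))]
    exact (lintegral_union_le _ _ _).trans (add_le_add hn hn')
  · intro p _
    obtain ⟨U, hU, hK⟩ := h p
    exact ⟨U, mem_nhdsWithin_of_mem_nhds hU, hK⟩

theorem weight_le {E : ℝ≥0∞} {K κ t τ ρ δ q w : ℝ} (hK : 0 ≤ K) (hκ : 0 ≤ κ) (ht : 0 ≤ t)
    (hτ : 0 < τ) (hτρ : τ ≤ ρ) (hq : 0 ≤ q) (hδ : 0 ≤ δ)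
    (hE : E ≤ ENNReal.ofReal (K * κ * t)) (hw : t ^ q * τ ^ (-(δ * q / 2)) ≤ w) :
    (E ^ q + E ^ q) * ENNReal.ofReal (ρ ^ (-(δ * q / 2))) ≤
      ENNReal.ofReal (2 * K ^ q * κ ^ q) * ENNReal.ofReal w := by
  have h1 : E ^ q ≤ ENNReal.ofReal (K ^ q * κ ^ q * t ^ q) := by
    refine (ENNReal.rpow_le_rpow hE hq).trans_eq ?_
    rw [ENNReal.ofReal_rpow_of_nonneg (by positivity) hq, Real.mul_rpow (by positivity) ht,
      Real.mul_rpow hK hκ]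
  have h2 : ρ ^ (-(δ * q / 2)) ≤ τ ^ (-(δ * q / 2)) :=
    Real.rpow_le_rpow_of_nonpos hτ hτρ (by rw [Left.neg_nonpos_iff]; positivity)
  have hρ := hτ.trans_le hτρ
  calc _ ≤ (ENNReal.ofReal (K ^ q * κ ^ q * t ^ q) + ENNReal.ofReal (K ^ q * κ ^ q * t ^ q)) *
        ENNReal.ofReal (τ ^ (-(δ * q / 2))) := by gcongr
    _ = ENNReal.ofReal (2 * K ^ q * κ ^ q * (t ^ q * τ ^ (-(δ * q / 2)))) := by
        rw [← ENNReal.ofReal_add (by positivity) (by positivity),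
          ← ENNReal.ofReal_mul (by positivity)]
        congr 1
        ring
    _ ≤ ENNReal.ofReal (2 * K ^ q * κ ^ q * w) := by gcongr
    _ = _ := ENNReal.ofReal_mul (by positivity)

section Assembly

variable {EZ : Type*} [NormedAddCommGroup EZ] [NormedSpace ℝ EZ] [FiniteDimensional ℝ EZ]
  {Z : Type*} [TopologicalSpace Z] [T2Space Z] [ChartedSpace EZ Z] [IsManifold 𝓘(ℝ, EZ) ∞ Z]
  {W : Type*} [NormedAddCommGroup W] [NormedSpace ℝ W] [FiniteDimensional ℝ W]
  {EΘ : Type*} [NormedAddCommGroup EΘ] [NormedSpace ℝ EΘ] [FiniteDimensional ℝ EΘ]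
  {Θ : Type*} [TopologicalSpace Θ] [ChartedSpace EΘ Θ] [IsManifold 𝓘(ℝ, EΘ) ∞ Θ]
  {EP : Type*} [NormedAddCommGroup EP] [NormedSpace ℝ EP] [FiniteDimensional ℝ EP]
  {P : Type*} [TopologicalSpace P] [ChartedSpace EP P] [IsManifold 𝓘(ℝ, EP) ∞ P]
  {EN : Type*} [NormedAddCommGroup EN] [NormedSpace ℝ EN] [FiniteDimensional ℝ EN]
  {N : Type*} [TopologicalSpace N] [ChartedSpace EN N] [IsManifold 𝓘(ℝ, EN) ∞ N]
  {S : Type*} [TopologicalSpace S] [T2Space S] [ChartedSpace ℂ S] [IsManifold 𝓘(ℝ, ℂ) ∞ S]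
  {ℓ : ℕ} {T : SumFibration EZ Z W EΘ Θ} {A : CompatiblePair T EP P}
  {D : CurveFamily S EN N A.jP ℓ}


variable {s : Fin ℓ → ℕ} {β : ℝ → ℝ} {x : N × (S → Z)} {θ₀ : Fin ℓ → Θ}
    {u : ℕ → N × (S → Z)} {lam : ℕ → ℂ} {θ : ℕ → Fin ℓ → Θ} {a : ℕ → Fin 2 → Fin ℓ → ℂ}
    {μ : ℕ → Fin ℓ → ℂ} {F : ℕ → S → Z}


variable [MeasurableSpace S] [BorelSpace S] {m : N → Measure S}

/-- The integrand of the first part of the weighted norm. -/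
noncomputable def mainTerm (A : CompatiblePair T EP P) (D : CurveFamily S EN N A.jP ℓ) (δ q : ℝ)
    (b : N) (μ : Fin ℓ → ℂ) (F : S → Z) (p : S) : ℝ≥0∞ :=
  (ptNorm A D b p (F p) (dbarSub A D b μ F p) ^ q + ptNorm A D b p (F p) (dbarSub A D b μ F p) ^ q) *
      ENNReal.ofReal (D.rho μ p ^ (-(δ * q / 2)))

/-- The integrand of the second part of the weighted norm, for a node with contact of order `s`. -/
noncomputable def normalTerm (A : CompatiblePair T EP P) (D : CurveFamily S EN N A.jP ℓ)
    (Nm : NormalSplitting T) (s : ℕ) (δ q : ℝ) (b : N) (μ : Fin ℓ → ℂ) (F : S → Z) (p : S) : ℝ≥0∞ :=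
  ((ENNReal.ofReal (D.rho μ p ^ (1 - (s : ℝ))) *
          ptNorm A D b p (F p) ((Nm.proj (F p)).comp (dbarSub A D b μ F p))) ^ q +
        (ENNReal.ofReal (D.rho μ p ^ (1 - (s : ℝ))) *
          ptNorm A D b p (F p) ((Nm.proj (F p)).comp (dbarSub A D b μ F p))) ^ q) *
      ENNReal.ofReal (D.rho μ p ^ (-(δ * q / 2)))

theorem ApproxSeq.regular_local (H : ApproxSeq A D s β x θ₀ u lam θ a μ F) (hs : ∀ k, 1 ≤ s k)
    (hm : ∀ b, IsAreaMeasure (D.h b) (m b)) (Nm : NormalSplitting T) {δ q : ℝ} (hδ : 0 < δ)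
    (hq : 1 ≤ q) {p₀ : S} (hp : ∀ i k, p₀ ≠ D.pt i k) :
    ∃ U ∈ 𝓝 p₀, ∃ K : ℝ, 0 ≤ K ∧ ∀ᶠ n in atTop,
      (∫⁻ p in D.curve (μ n) ∩ U, mainTerm A D δ q (u n).1 (μ n) (F n) p ∂(m (u n).1) ≤
        ENNReal.ofReal (K * glueRate s (lam n) ^ q)) ∧
      ∀ k, ∫⁻ p in D.curve (μ n) ∩ U,
        normalTerm A D Nm (s k) δ q (u n).1 (μ n) (F n) p ∂(m (u n).1) ≤
        ENNReal.ofReal (K * glueRate s (lam n) ^ q) := by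
  obtain ⟨K₁, hK₁, U₁, hU₁, h1⟩ := H.regular_bound hs Nm hp
  obtain ⟨c₀, hc₀, h2⟩ := D.exists_coord_bound hp
  obtain ⟨K₃, U₃, hU₃, h3⟩ := D.exists_area_bound hm x.1 hp
  set c := min c₀ 1 with hc
  have hc0 : 0 < c := lt_min hc₀ one_pos
  set w := c ^ (-(δ * q / 2)) with hw
  set L := ∑ k, c ^ (1 - (s k : ℝ)) with hL
  have hLk : ∀ k, c ^ (1 - (s k : ℝ)) ≤ L := fun k =>
    Finset.single_le_sum (f := fun k => c ^ (1 - (s k : ℝ))) (fun k _ => by positivity)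
      (Finset.mem_univ k)
  have hL0 : 0 ≤ L := Finset.sum_nonneg fun k _ => by positivity
  set K := (L + 1) * K₁ with hK
  have hK0 : 0 ≤ K := by positivity
  refine ⟨U₁ ∩ ({p | ∀ i k, p ∈ (D.coord i k).source → c₀ ≤ ‖D.coord i k p‖} ∩ U₃),
    inter_mem hU₁ (inter_mem h2 hU₃), 2 * K ^ q * (w * |K₃|), by positivity, ?_⟩
  filter_upwards [h1, H.tendsto.1.eventually h3] with n g1 g3
  set κ := glueRate s (lam n) with hκ
  have hκ0 : 0 ≤ κ := glueRate_nonneg _ _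
  set V := D.curve (μ n) ∩
    (U₁ ∩ ({p | ∀ i k, p ∈ (D.coord i k).source → c₀ ≤ ‖D.coord i k p‖} ∩ U₃)) with hV
  have fin : ∀ f : S → ℝ≥0∞, (∀ p ∈ V, f p ≤
      ENNReal.ofReal (2 * K ^ q * κ ^ q) * ENNReal.ofReal w) →
      ∫⁻ p in V, f p ∂(m (u n).1) ≤ ENNReal.ofReal (2 * K ^ q * (w * |K₃|) * κ ^ q) := by
    intro f hf
    calc _ ≤ ∫⁻ p in V, ENNReal.ofReal (2 * K ^ q * κ ^ q) * ENNReal.ofReal w ∂(m (u n).1) :=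
          setLIntegral_mono measurable_const hf
      _ = ENNReal.ofReal (2 * K ^ q * κ ^ q) * ENNReal.ofReal w * m (u n).1 V :=
          setLIntegral_const _ _
      _ ≤ ENNReal.ofReal (2 * K ^ q * κ ^ q) * ENNReal.ofReal w * ENNReal.ofReal |K₃| := by
          gcongr
          exact (measure_mono (inter_subset_right.trans (inter_subset_right.trans
            inter_subset_right))).trans (g3.trans (ENNReal.ofReal_le_ofReal (le_abs_self _)))
      _ = _ := by
          rw [← ENNReal.ofReal_mul (by positivity), ← ENNReal.ofReal_mul (by positivity)]
          congr 1
          ring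
  have hρ : ∀ p ∈ V, c ≤ D.rho (μ n) p := fun p hp => D.le_rho (min_le_right _ _)
    fun i k hk => (min_le_left _ _).trans (hp.2.2.1 i k hk)
  have hw1 : (1 : ℝ) ^ q * c ^ (-(δ * q / 2)) ≤ w := by rw [Real.one_rpow, one_mul]
  constructor
  · refine fin _ fun p hp => ?_
    refine weight_le hK0 hκ0 zero_le_one hc0 (hρ p hp) (by linarith) hδ.le ?_ hw1
    refine (g1 p hp.2.1).1.trans (ENNReal.ofReal_le_ofReal ?_)
    rw [mul_one, hK]
    gcongr
    exact le_mul_of_one_le_left hK₁ (by linarith)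
  · intro k
    refine fin _ fun p hp => ?_
    refine weight_le hK0 hκ0 zero_le_one hc0 (hρ p hp) (by linarith) hδ.le ?_ hw1
    have hsk : (1 : ℝ) ≤ s k := by exact_mod_cast hs k
    calc _ ≤ ENNReal.ofReal L * ENNReal.ofReal (K₁ * κ) := by
          gcongr
          · exact (Real.rpow_le_rpow_of_nonpos hc0 (hρ p hp) (by linarith)).trans (hLk k)
          · exact (g1 p hp.2.1).2
      _ = ENNReal.ofReal (L * (K₁ * κ)) := (ENNReal.ofReal_mul hL0).symm
      _ ≤ _ := by
          refine ENNReal.ofReal_le_ofReal ?_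
          rw [mul_one, hK]
          calc L * (K₁ * κ) ≤ (L + 1) * (K₁ * κ) := by gcongr; linarith
            _ = _ := by ring

theorem ApproxSeq.node_local (H : ApproxSeq A D s β x θ₀ u lam θ a μ F) (hs : ∀ k, 1 ≤ s k)
    (hβ : IsCutoff β) (hm : ∀ b, IsAreaMeasure (D.h b) (m b)) (Nm : NormalSplitting T) {δ q : ℝ}
    (hδ : 0 < δ) (hδ' : δ < 1 / 6) (hq : 1 ≤ q) (i : Fin 2) (k : Fin ℓ) :
    ∃ U ∈ 𝓝 (D.pt i k), ∃ K : ℝ, 0 ≤ K ∧ ∀ᶠ n in atTop,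
      (∫⁻ p in D.curve (μ n) ∩ U, mainTerm A D δ q (u n).1 (μ n) (F n) p ∂(m (u n).1) ≤
        ENNReal.ofReal (K * glueRate s (lam n) ^ q)) ∧
      ∀ k', ∫⁻ p in D.nodeBall (μ n) k' 1 ∩ U,
        normalTerm A D Nm (s k') δ q (u n).1 (μ n) (F n) p ∂(m (u n).1) ≤
        ENNReal.ofReal (K * glueRate s (lam n) ^ q) := by
  obtain ⟨K, r, hK, hr, hr1, h1⟩ := H.node_bound hs hβ Nm i k
  obtain ⟨K₂, U, hU, hUo, hUs, hUr, h2⟩ := D.exists_node_area_bound hm i k hr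
  obtain ⟨C, -, h3⟩ := H.gluing_bounds hs
  refine ⟨U, hU, 2 * K ^ q * |K₂|, by positivity, ?_⟩
  filter_upwards [h1, h3] with n g1 g3
  have hμk := (g3.2.2 k).1
  set κ := glueRate s (lam n) with hκ
  have hκ0 : 0 ≤ κ := glueRate_nonneg _ _
  have hV : MeasurableSet (D.curve (μ n) ∩ U) :=
    (D.isClosed_curve (μ n)).measurableSet.inter hUo.measurableSet
  have hmem : ∀ p ∈ D.curve (μ n) ∩ U, Real.sqrt ‖μ n k‖ ≤ ‖D.coord i k p‖ ∧
      0 < ‖D.coord i k p‖ ∧ ‖D.coord i k p‖ < r ∧ (D.coord i k).symm (D.coord i k p) = p := by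
    intro p hp
    have h4 := hp.1 i k (hUs hp.2)
    exact ⟨h4, (Real.sqrt_pos.2 (norm_pos_iff.2 hμk)).trans_le h4, hUr p hp.2,
      (D.coord i k).left_inv (hUs hp.2)⟩
  have hsub : D.curve (μ n) ∩ U ⊆ U \ {D.pt i k} := by
    refine fun p hp => ⟨hp.2, fun h => ?_⟩
    have h5 := (hmem p hp).2.1
    rw [mem_singleton_iff.1 h, CurveFamily.pt, (D.coord i k).right_inv (by
      rw [D.coord_target]; exact Metric.mem_ball_self two_pos)] at h5
    simp at h5
  have fin : ∀ f : S → ℝ≥0∞, (∀ p ∈ D.curve (μ n) ∩ U, f p ≤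
      ENNReal.ofReal (2 * K ^ q * κ ^ q) * ENNReal.ofReal (‖D.coord i k p‖ ^ (1 / 10 : ℝ))) →
      ∫⁻ p in D.curve (μ n) ∩ U, f p ∂(m (u n).1) ≤
        ENNReal.ofReal (2 * K ^ q * |K₂| * κ ^ q) := by
    intro f hf
    calc _ ≤ ∫⁻ p in D.curve (μ n) ∩ U, ENNReal.ofReal (2 * K ^ q * κ ^ q) *
            ENNReal.ofReal (‖D.coord i k p‖ ^ (1 / 10 : ℝ)) ∂(m (u n).1) := setLIntegral_mono' hV hf
      _ ≤ ∫⁻ p in U \ {D.pt i k}, ENNReal.ofReal (2 * K ^ q * κ ^ q) *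
            ENNReal.ofReal (‖D.coord i k p‖ ^ (1 / 10 : ℝ)) ∂(m (u n).1) := lintegral_mono_set hsub
      _ = ENNReal.ofReal (2 * K ^ q * κ ^ q) * ∫⁻ p in U \ {D.pt i k},
            ENNReal.ofReal (‖D.coord i k p‖ ^ (1 / 10 : ℝ)) ∂(m (u n).1) :=
          lintegral_const_mul' _ _ ENNReal.ofReal_ne_top
      _ ≤ ENNReal.ofReal (2 * K ^ q * κ ^ q) * ENNReal.ofReal |K₂| := by
          gcongr
          exact (h2 _).trans (ENNReal.ofReal_le_ofReal (le_abs_self _))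
      _ = _ := by
          rw [← ENNReal.ofReal_mul (by positivity)]
          congr 1
          ring
  have hρ : ∀ p ∈ D.curve (μ n) ∩ U, ‖D.coord i k p‖ ≤ D.rho (μ n) p := by
    intro p hp
    refine D.le_rho ((hmem p hp).2.2.1.le.trans hr1) fun i' k' hk' => ?_
    obtain ⟨rfl, rfl⟩ := D.eq_of_mem_source (hUs hp.2) hk'
    exact le_rfl
  have hexp : ∀ p ∈ D.curve (μ n) ∩ U, (‖D.coord i k p‖ ^ (1 / 5 : ℝ)) ^ q *
      ‖D.coord i k p‖ ^ (-(δ * q / 2)) ≤ ‖D.coord i k p‖ ^ (1 / 10 : ℝ) := by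
    intro p hp
    obtain ⟨-, h4, h5, -⟩ := hmem p hp
    rw [← Real.rpow_mul h4.le, ← Real.rpow_add h4]
    refine Real.rpow_le_rpow_of_exponent_ge h4 (h5.le.trans hr1) ?_
    nlinarith
  constructor
  · refine fin _ fun p hp => ?_
    obtain ⟨h4, h5, h6, h7⟩ := hmem p hp
    have h8 := (g1 _ h6 h4).1
    rw [h7] at h8
    exact weight_le hK hκ0 (by positivity) h5 (hρ p hp) (by linarith) hδ.le h8 (hexp p hp)
  · intro k'
    by_cases hk : k' = k
    · subst hk
      refine (lintegral_mono_set (inter_subset_inter_left _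
        (D.nodeBall_subset_curve _ _ _))).trans (fin _ fun p hp => ?_)
      obtain ⟨h4, h5, h6, h7⟩ := hmem p hp
      have h8 := (g1 _ h6 h4).2
      rw [h7] at h8
      refine weight_le hK hκ0 (t := ‖D.coord i k' p‖ ^ (1 / 5 : ℝ)) (by positivity) h5 (hρ p hp)
        (by linarith) hδ.le ?_ (hexp p hp)
      have hsk : (1 : ℝ) ≤ s k' := by exact_mod_cast hs k'
      have h9 : D.rho (μ n) p ^ (1 - (s k' : ℝ)) ≤ ‖D.coord i k' p‖ ^ (1 - (s k' : ℝ)) :=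
        Real.rpow_le_rpow_of_nonpos h5 (hρ p hp) (by linarith)
      have h10 : ‖D.coord i k' p‖ ^ (1 - (s k' : ℝ)) * ‖D.coord i k' p‖ ^ (s k' - 1) = 1 := by
        rw [← Real.rpow_natCast, ← Real.rpow_add h5, Nat.cast_sub (hs k')]
        simp
      calc _ ≤ ENNReal.ofReal (‖D.coord i k' p‖ ^ (1 - (s k' : ℝ))) * ENNReal.ofReal
              (K * κ * ‖D.coord i k' p‖ ^ (1 / 5 : ℝ) * ‖D.coord i k' p‖ ^ (s k' - 1)) := by gcongr
        _ = ENNReal.ofReal (K * κ * ‖D.coord i k' p‖ ^ (1 / 5 : ℝ) *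
              (‖D.coord i k' p‖ ^ (1 - (s k' : ℝ)) * ‖D.coord i k' p‖ ^ (s k' - 1))) := by
            rw [← ENNReal.ofReal_mul (by positivity)]
            congr 1
            ring
        _ ≤ _ := by rw [h10, mul_one]
    · have hempty : D.nodeBall (μ n) k' 1 ∩ U = ∅ := by
        refine eq_empty_of_forall_notMem fun p hp => ?_
        obtain ⟨⟨-, i', hi', -⟩, hpU⟩ := hp
        exact hk (D.eq_of_mem_source (hUs hpU) hi').2
      rw [hempty]
      simp

/-- The estimate for a sequence of approximate maps. -/
theorem ApproxSeq.exists_weightedNorm_le [CompactSpace S]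
    (H : ApproxSeq A D s β x θ₀ u lam θ a μ F) (hs : ∀ k, 1 ≤ s k)
    (hβ : IsCutoff β) (hm : ∀ b, IsAreaMeasure (D.h b) (m b)) (Nm : NormalSplitting T) {δ q : ℝ}
    (hδ : 0 < δ) (hδ' : δ < 1 / 6) (hq : 1 ≤ q) :
    ∃ K : ℝ, 0 ≤ K ∧ ∀ᶠ n in atTop, weightedNorm A D Nm (m (u n).1) s δ q (u n).1 (μ n) (F n)
      (dbarSub A D (u n).1 (μ n) (F n)) ≤ ENNReal.ofReal (K * glueRate s (lam n)) := by
  have hloc : ∀ p₀ : S, ∃ U ∈ 𝓝 p₀, ∃ K : ℝ, 0 ≤ K ∧ ∀ᶠ n in atTop,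
      (∫⁻ p in D.curve (μ n) ∩ U, mainTerm A D δ q (u n).1 (μ n) (F n) p ∂(m (u n).1) ≤
        ENNReal.ofReal (K * glueRate s (lam n) ^ q)) ∧
      ∀ k, ∫⁻ p in D.nodeBall (μ n) k 1 ∩ U,
        normalTerm A D Nm (s k) δ q (u n).1 (μ n) (F n) p ∂(m (u n).1) ≤
        ENNReal.ofReal (K * glueRate s (lam n) ^ q) := by
    intro p₀
    by_cases hp : ∃ i k, p₀ = D.pt i k
    · obtain ⟨i, k, rfl⟩ := hp
      exact H.node_local hs hβ hm Nm hδ hδ' hq i k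
    · push Not at hp
      obtain ⟨U, hU, K, hK, h⟩ := H.regular_local hs hm Nm hδ hq hp
      refine ⟨U, hU, K, hK, h.mono fun n hn => ⟨hn.1, fun k => ?_⟩⟩
      exact (lintegral_mono_set (inter_subset_inter_left _
        (D.nodeBall_subset_curve _ _ _))).trans (hn.2 k)
  have hκ : ∀ n, 0 ≤ glueRate s (lam n) := fun n => glueRate_nonneg _ _
  have hκq : ∀ n, 0 ≤ glueRate s (lam n) ^ q := fun n => Real.rpow_nonneg (hκ n) q
  obtain ⟨K₁, hK₁, h1⟩ := exists_lintegral_bound_of_local (m := fun n => m (u n).1)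
    (X := fun n => D.curve (μ n)) (f := fun n => mainTerm A D δ q (u n).1 (μ n) (F n)) hκq
    fun p => by
      obtain ⟨U, hU, K, hK, h⟩ := hloc p
      exact ⟨U, hU, K, hK, h.mono fun n hn => hn.1⟩
  choose K₂ hK₂ h2 using fun k => exists_lintegral_bound_of_local (m := fun n => m (u n).1)
    (X := fun n => D.nodeBall (μ n) k 1)
    (f := fun n => normalTerm A D Nm (s k) δ q (u n).1 (μ n) (F n)) hκq
    fun p => by
      obtain ⟨U, hU, K, hK, h⟩ := hloc p
      exact ⟨U, hU, K, hK, h.mono fun n hn => hn.2 k⟩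
  have hsum : 0 ≤ ∑ k, K₂ k := Finset.sum_nonneg fun k _ => hK₂ k
  refine ⟨(K₁ + ∑ k, K₂ k) ^ (1 / q), by positivity, ?_⟩
  filter_upwards [h1, eventually_all.2 h2] with n g1 g2
  have htot : (∫⁻ p in D.curve (μ n), mainTerm A D δ q (u n).1 (μ n) (F n) p ∂(m (u n).1)) +
      ∑ k, ∫⁻ p in D.nodeBall (μ n) k 1,
        normalTerm A D Nm (s k) δ q (u n).1 (μ n) (F n) p ∂(m (u n).1) ≤
      ENNReal.ofReal ((K₁ + ∑ k, K₂ k) * glueRate s (lam n) ^ q) := by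
    rw [add_mul, Finset.sum_mul, ENNReal.ofReal_add (mul_nonneg hK₁ (hκq n))
      (Finset.sum_nonneg fun k _ => mul_nonneg (hK₂ k) (hκq n)),
      ENNReal.ofReal_sum_of_nonneg fun k _ => mul_nonneg (hK₂ k) (hκq n)]
    exact add_le_add g1 (Finset.sum_le_sum fun k _ => g2 k)
  have hq0 : 0 < q := by linarith
  refine (ENNReal.rpow_le_rpow htot (by positivity : 0 ≤ 1 / q)).trans_eq ?_
  rw [ENNReal.ofReal_rpow_of_nonneg (mul_nonneg (by positivity) (hκq n)) (by positivity),
    Real.mul_rpow (by positivity) (hκq n), ← Real.rpow_mul (hκ n), mul_one_div_cancel hq0.ne',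
    Real.rpow_one]

variable (EΘ) in
theorem firstCountableTopology_of_chartedSpace (Θ : Type*) [TopologicalSpace Θ]
    [ChartedSpace EΘ Θ] : FirstCountableTopology Θ := by
  refine ⟨fun θ => ?_⟩
  have h := (chartAt EΘ θ).symm.map_nhds_eq (mem_chart_target EΘ θ)
  rw [(chartAt EΘ θ).left_inv (mem_chart_source EΘ θ)] at h
  rw [← h]
  infer_instance

theorem SmoothlyTendsto.comp_strictMono {u : ℕ → N × (S → Z)} {x : N × (S → Z)}
    (h : SmoothlyTendsto EZ u x) {τ : ℕ → ℕ} (hτ : StrictMono τ) :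
    SmoothlyTendsto EZ (u ∘ τ) x := by
  have ht := hτ.tendsto_atTop
  refine ⟨h.1.comp ht, fun p => ?_⟩
  obtain ⟨B, hB, hBs, hBx, hBu, hlim⟩ := h.2 p
  refine ⟨B, hB, hBs, hBx, ht.eventually hBu, fun d V hV => ht.eventually (hlim d V hV)⟩

end Assembly

end SymplecticSum

open SymplecticSum in
theorem lemma6p9
    {EZ : Type*} [NormedAddCommGroup EZ] [NormedSpace ℝ EZ] [FiniteDimensional ℝ EZ]
    {Z : Type*} [TopologicalSpace Z] [T2Space Z] [ChartedSpace EZ Z]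
    [IsManifold 𝓘(ℝ, EZ) ∞ Z]
    {W : Type*} [NormedAddCommGroup W] [NormedSpace ℝ W] [FiniteDimensional ℝ W]
    {EΘ : Type*} [NormedAddCommGroup EΘ] [NormedSpace ℝ EΘ] [FiniteDimensional ℝ EΘ]
    {Θ : Type*} [TopologicalSpace Θ] [T2Space Θ] [CompactSpace Θ] [ChartedSpace EΘ Θ]
    [IsManifold 𝓘(ℝ, EΘ) ∞ Θ]
    {EP : Type*} [NormedAddCommGroup EP] [NormedSpace ℝ EP] [FiniteDimensional ℝ EP]
    {P : Type*} [TopologicalSpace P] [T2Space P] [ChartedSpace EP P]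
    [IsManifold 𝓘(ℝ, EP) ∞ P]
    {EN : Type*} [NormedAddCommGroup EN] [NormedSpace ℝ EN] [FiniteDimensional ℝ EN]
    {N : Type*} [TopologicalSpace N] [T2Space N] [ChartedSpace EN N]
    [IsManifold 𝓘(ℝ, EN) ∞ N]
    {S : Type*} [TopologicalSpace S] [T2Space S] [CompactSpace S] [ChartedSpace ℂ S]
    [IsManifold 𝓘(ℝ, ℂ) ∞ S]
    [MeasurableSpace S] [BorelSpace S]
    {ℓ : ℕ}
    (T : SumFibration EZ Z W EΘ Θ) (A : CompatiblePair T EP P) (Nm : NormalSplitting T)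
    (D : CurveFamily S EN N A.jP ℓ)
    (m : N → Measure S) (hm : ∀ b, IsAreaMeasure (D.h b) (m b))
    (β : ℝ → ℝ) (hβ : IsCutoff β)
    (δ : ℝ) (hδ : 0 < δ) (hδ' : δ < 1 / 6)
    (q : ℝ) (hq : 1 ≤ q)
    (s : Fin ℓ → ℕ) (hs : ∀ k, 1 ≤ s k)
    (K : Set (N × (S → Z))) (hK : K ⊆ moduli A D s) (hKc : IsSmoothlyCompact EZ K) :
    ∃ c > 0, ∃ lambda₀ > 0, ∀ b f, (b, f) ∈ K →
      ∀ lambda : ℂ, lambda ≠ 0 → ‖lambda‖ ≤ lambda₀ →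
      ∀ (θ : Fin ℓ → Θ) (a : Fin 2 → Fin ℓ → ℂ) (μ : Fin ℓ → ℂ) (F : S → Z),
        IsApproxMap A D s β f lambda θ a μ F →
        weightedNorm A D Nm (m b) s δ q b μ F (dbarSub A D b μ F) ≤
          ENNReal.ofReal (c * ‖lambda‖ ^ (1 / (5 * ((∏ k, s k : ℕ) : ℝ)))) := by
  classical
  by_contra hcon
  push Not at hcon
  have hex : ∀ n : ℕ, ∃ (u : N × (S → Z)) (lam : ℂ) (θ : Fin ℓ → Θ) (a : Fin 2 → Fin ℓ → ℂ)
      (μ : Fin ℓ → ℂ) (F : S → Z), u ∈ K ∧ lam ≠ 0 ∧ ‖lam‖ ≤ 1 / ((n : ℝ) + 1) ∧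
      IsApproxMap A D s β u.2 lam θ a μ F ∧ ENNReal.ofReal (((n : ℝ) + 1) * glueRate s lam) <
        weightedNorm A D Nm (m u.1) s δ q u.1 μ F (dbarSub A D u.1 μ F) := by
    intro n
    obtain ⟨b, f, hbf, lam, h1, h2, θ, a, μ, F, h3, h4⟩ :=
      hcon ((n : ℝ) + 1) (by positivity) (1 / ((n : ℝ) + 1)) (by positivity)
    exact ⟨(b, f), lam, θ, a, μ, F, hbf, h1, h2, h3, h4⟩
  choose u lam θ a μ F hu hlam hlam' hF hlt using hex
  obtain ⟨x, hx, τ, hτ, hlim⟩ := hKc u hu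
  have := firstCountableTopology_of_chartedSpace EΘ Θ
  obtain ⟨θ₀, σ, hσ, hθ⟩ := CompactSpace.tendsto_subseq (fun n => θ (τ n))
  have hρ : StrictMono (τ ∘ σ) := hτ.comp hσ
  have hlam0 : Tendsto lam atTop (𝓝 0) :=
    squeeze_zero_norm hlam' tendsto_one_div_add_atTop_nhds_zero_nat
  have H : ApproxSeq A D s β x θ₀ (fun n => u (τ (σ n))) (fun n => lam (τ (σ n)))
      (fun n => θ (τ (σ n))) (fun n => a (τ (σ n))) (fun n => μ (τ (σ n)))
      (fun n => F (τ (σ n))) :=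
    { lim_mem := hK hx
      mem := fun n => hK (hu _)
      tendsto := hlim.comp_strictMono hσ
      tendsto_θ := tendsto_pi_nhds.1 hθ
      lam_ne := fun n => hlam _
      tendsto_lam := hlam0.comp hρ.tendsto_atTop
      approx := fun n => hF _ }
  obtain ⟨C, hC, hev⟩ := H.exists_weightedNorm_le hs hβ hm Nm hδ hδ' hq
  obtain ⟨n₀, hn₀⟩ := exists_nat_ge C
  obtain ⟨n, hn, hn'⟩ := (hev.and (eventually_ge_atTop n₀)).exists
  refine absurd ((hlt (τ (σ n))).trans_le hn) (not_lt.2 (ENNReal.ofReal_le_ofReal ?_))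
  refine mul_le_mul_of_nonneg_right ?_ (glueRate_nonneg _ _)
  have h1 : (n₀ : ℝ) ≤ (τ (σ n) : ℝ) := by
    exact_mod_cast hn'.trans (hρ.id_le n)
  linarith
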